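/- Throughout, $\lambda$ is the security parameter, $s,\mu,N,\ell$ are polynomials in $\lambda$ with coefficients in $\mathbb N$ and $s\neq 0$, and QPT means computable by a polynomial-time uniform family of quantum circuits (over a fixed finite universal gate set). "Adversary" means a pair $(\mathcal A_1,\mathcal A_2)$ with $\mathcal A_1$ QPT (with several stages that share a quantum internal state, finally handed to $\mathcal A_2$) and $\mathcal A_2$ computationally unbounded. **Function class.** Let $U=(U_\lambda)$ be a polynomial-time uniform family of Boolean circuits with $N$ gates, taking a function description $f\in\{0,1\}^{s}$ and a plaintext $m\in\{0,1\}^{\mu}$ to $f(m):=U_\lambda(f,m)\in\{0,1\}^{\ell}$. (With $U$ a universal circuit for the circuits of a given polynomial size this is FE for $\mathsf{P/poly}$.) **Building blocks.** (a) A garbling scheme $\mathsf{GC}.(\mathsf{Setup},\mathsf{Garble},\mathsf{Eval},\mathsf{Del},\mathsf{Vrfy})$ of QPT algorithms for Boolean circuits with $s$ input bits, $N$ gates (constant wires allowed) and $\ell$ output bits, with labels in $\mathcal L=\{0,1\}^{p(\lambda)}$, quantum garbled circuits, classical verification keys and classical deletion certificates. It is *selectively certified everlasting secure* if there is a QPT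 simulator $\mathsf{GC.Sim}$ such that for every adversary the probabilities that the following experiment outputs $1$ for $b=0$ and $b=1$ differ negligibly: $\mathcal A_1$ chooses a circuit $C$ and an input $x$; $\{L_{i,\alpha}\}\leftarrow\mathsf{Setup}(1^\lambda)$; $\mathcal A_1$ gets $\{L_{i,x_i}\}_i$ and $\widetilde C$, where $(\widetilde C,\mathsf{vk})\leftarrow\mathsf{Garble}(1^\lambda,C,\{L_{i,\alpha}\})$ if $b=0$ and $(\widetilde C,\mathsf{vk})\leftarrow\mathsf{GC.Sim}(1^\lambda,1^{|C|},C(x),\{L_{i,x_i}\}_i)$ if $b=1$; $\mathcal A_1$ outputs a certificate; if $\mathsf{Vrfy}(\mathsf{vk},\mathsf{cert})=\top$ the output is the bit $b'$ that $\mathcal A_2$ outputs, and otherwise it is $\bot$. (b) A public key encryption scheme $\mathsf{PKE}.(\mathsf{KeyGen},\mathsf{Enc},\mathsf{Dec},\mathsf{Del},\mathsf{Vrfy})$ of QPT algorithms with plaintext space $\mathcal L$, quantum ciphertexts, classical verification keys and classical deletion certificates. It is *certified everlasting IND-CPA secure* if for every adversary the probabilities that the following experiment outputs $1$ for $b=0$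 and $b=1$ differ negligibly: $(\mathsf{pk},\mathsf{sk})\leftarrow\mathsf{KeyGen}(1^\lambda)$; $\mathcal A_1(\mathsf{pk})$ chooses $m_0,m_1$; it gets $\mathsf{ct}$, where $(\mathsf{vk},\mathsf{ct})\leftarrow\mathsf{Enc}(\mathsf{pk},m_b)$, and outputs a certificate; if $\mathsf{Vrfy}(\mathsf{vk},\mathsf{cert})=\top$, then $\mathcal A_2$ is given $\mathsf{sk}$ and the output is its output bit $b'$; otherwise the output is $\bot$. **Construction $\Sigma_{\mathsf{cefe}}$.** - $\mathsf{Setup}$: run $(\mathsf{pk}_{i,\alpha},\mathsf{sk}_{i,\alpha})\leftarrow\mathsf{PKE.KeyGen}(1^\lambda)$ for $i\in[s]$, $\alpha\in\{0,1\}$; output $\mathsf{MPK}=\{\mathsf{pk}_{i,\alpha}\}$, $\mathsf{MSK}=\{\mathsf{sk}_{i,\alpha}\}$. - $\mathsf{KeyGen}(\mathsf{MSK},f)$: output $\mathsf{sk}_f=(f,\{\mathsf{sk}_{i,f[i]}\}_i)$. - $\mathsf{Enc}(\mathsf{MPK},m)$: sample $\{L_{i,\alpha}\}\leftarrow\mathsf{GC.Setup}(1^\lambda)$,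 $(\widetilde U,\mathsf{gc.vk})\leftarrow\mathsf{GC.Garble}(1^\lambda,U_\lambda(\cdot,m),\{L_{i,\alpha}\})$ and $(\mathsf{vk}_{i,\alpha},\mathsf{ct}_{i,\alpha})\leftarrow\mathsf{PKE.Enc}(\mathsf{pk}_{i,\alpha},L_{i,\alpha})$; output $\mathsf{vk}=(\mathsf{gc.vk},\{\mathsf{vk}_{i,\alpha}\})$ and $\mathsf{ct}=(\widetilde U,\{\mathsf{ct}_{i,\alpha}\})$. - $\mathsf{Dec}(\mathsf{sk}_f,\mathsf{ct})$: decrypt the $\mathsf{ct}_{i,f[i]}$ to labels $L_i$ and output $\mathsf{GC.Eval}(\widetilde U,\{L_i\}_i)$ ($\bot$ if a decryption fails). - $\mathsf{Del}$ applies $\mathsf{GC.Del}$ and $\mathsf{PKE.Del}$ to every component; $\mathsf{Vrfy}$ accepts iff $\mathsf{GC.Vrfy}$ and all $\mathsf{PKE.Vrfy}$ accept. **Theorem.** If $\mathsf{GC}$ is selectively certified everlasting secure and $\mathsf{PKE}$ is certified everlasting IND-CPA secure, then $\Sigma_{\mathsf{cefe}}$ is $1$-bounded non-adaptive certified everlasting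 simulation-secure. That is, there is a QPT simulator $\mathsf{Sim}$ such that for every adversary the probabilities that the following experiment outputs $1$ for $b=0$ and $b=1$ differ negligibly: $(\mathsf{MPK},\mathsf{MSK})\leftarrow\mathsf{Setup}(1^\lambda)$; $\mathcal A_1(\mathsf{MPK})$ makes at most one key query $f$, answered by $\mathsf{sk}_f\leftarrow\mathsf{KeyGen}(\mathsf{MSK},f)$, and then chooses a plaintext $m$; let $\mathcal V=(f(m),f,\mathsf{sk}_f)$, or $\mathcal V=\emptyset$ if there was no query; $\mathcal A_1$ gets $\mathsf{ct}$, where $(\mathsf{vk},\mathsf{ct})\leftarrow\mathsf{Enc}(\mathsf{MPK},m)$ if $b=0$ and $(\mathsf{vk},\mathsf{ct})\leftarrow\mathsf{Sim}(\mathsf{MPK},\mathcal V,1^{|m|})$ if $b=1$; $\mathcal A_1$ outputs a certificate; if $\mathsf{Vrfy}(\mathsf{vk},\mathsf{cert})=\top$, then $\mathcal A_2$ is given $\mathsf{MSK}$ and the output is its output bit $b'$; otherwise the output is $\bot$. -/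

import Mathlib

open scoped Kronecker ComplexOrder

noncomputable section

namespace CertFE

/-! ## Bit strings and bit representations -/

/-- The set `{0,1}^n`. -/
abbrev BV (n : ℕ) := Fin n → Bool

/-- A fixed-length, injective binary encoding of a finite type: `code x i` is the `i`-th bit of
the encoding of `x`, for `i < len`. -/
class BitRep (X : Type) where
  len : ℕ
  code : X → ℕ → Bool
  inj : ∀ x y, (∀ i, i < len → code x i = code y i) → x = y

instance instBitRepUnit : BitRep Unit where
  len := 0
  code _ _ := false
  inj _ _ _ := rfl

instance instBitRepBool : BitRep Bool where
  len := 1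
  code b _ := b
  inj _ _ h := h 0 Nat.one_pos

/-- One-hot encoding of an index. -/
instance instBitRepFin (n : ℕ) : BitRep (Fin n) where
  len := n
  code x i := decide (i = x.val)
  inj x y h := by
    have := h x.val x.isLt
    simpa [Fin.ext_iff] using this

/-- A pair is encoded by concatenation. -/
instance instBitRepProd {X Y : Type} [BitRep X] [BitRep Y] : BitRep (X × Y) where
  len := BitRep.len X + BitRep.len Y
  code p i := if i < BitRep.len X then BitRep.code p.1 i else BitRep.code p.2 (i - BitRep.len X)
  inj p q h := by
    refine Prod.ext (BitRep.inj _ _ fun i hi => ?_) (BitRep.inj _ _ fun i hi => ?_)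
    · simpa [hi] using h i (by omega)
    · simpa using h (BitRep.len X + i) (by omega)

/-- A tag bit, followed by room for both alternatives. -/
instance instBitRepSum {X Y : Type} [BitRep X] [BitRep Y] : BitRep (X ⊕ Y) where
  len := 1 + BitRep.len X + BitRep.len Y
  code s i := match s with
    | .inl x => if i = 0 then false else
        if i - 1 < BitRep.len X then BitRep.code x (i - 1) else false
    | .inr y => if i = 0 then true else
        if i - 1 < BitRep.len X then false else BitRep.code y (i - 1 - BitRep.len X)
  inj s t h := by
    have h0 := h 0 (by omega)
    rcases s with x | x <;> rcases t with y | y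
    · congr 1
      refine BitRep.inj _ _ fun i hi => ?_
      simpa [hi] using h (i + 1) (by omega)
    · simp at h0
    · simp at h0
    · congr 1
      refine BitRep.inj _ _ fun i hi => ?_
      have h1 := h (BitRep.len X + i + 1) (by omega)
      simpa using h1

/-- A presence bit, followed by the encoding of the value (zeros if absent). -/
instance instBitRepOption {X : Type} [BitRep X] : BitRep (Option X) where
  len := 1 + BitRep.len X
  code s i := match s with
    | none => false
    | some x => if i = 0 then true else BitRep.code x (i - 1)
  inj s t h := by
    have h0 := h 0 (by omega)
    rcases s with _ | x <;> rcases t with _ | y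
    · rfl
    · simp at h0
    · simp at h0
    · congr 1
      refine BitRep.inj _ _ fun i hi => ?_
      simpa using h (i + 1) (by omega)

/-- A finite sequence is encoded by concatenation. -/
instance instBitRepFinPi {n : ℕ} {X : Type} [BitRep X] : BitRep (Fin n → X) where
  len := n * BitRep.len X
  code f i := if h : i / BitRep.len X < n then
    BitRep.code (f ⟨i / BitRep.len X, h⟩) (i % BitRep.len X) else false
  inj f g h := by
    funext k
    refine BitRep.inj _ _ fun i hi => ?_
    have hpos : 0 < BitRep.len X := by omega
    have hlt : k.val * BitRep.len X + i < n * BitRep.len X := by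
      have := Nat.mul_le_mul_right (BitRep.len X) (Nat.succ_le_of_lt k.isLt)
      rw [Nat.succ_mul] at this
      omega
    have h1 := h _ hlt
    have hd : (k.val * BitRep.len X + i) / BitRep.len X = k.val := by
      rw [Nat.mul_comm, Nat.mul_add_div hpos, Nat.div_eq_of_lt hi, Nat.add_zero]
    have hm : (k.val * BitRep.len X + i) % BitRep.len X = i := by
      rw [Nat.mul_comm, Nat.mul_add_mod, Nat.mod_eq_of_lt hi]
    simpa [hd, hm, k.isLt] using h1

instance instBitRepBoolPi {X : Type} [BitRep X] : BitRep (Bool → X) where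
  len := BitRep.len X + BitRep.len X
  code f i := if i < BitRep.len X then BitRep.code (f false) i
    else BitRep.code (f true) (i - BitRep.len X)
  inj f g h := by
    funext b
    cases b
    · refine BitRep.inj _ _ fun i hi => ?_
      simpa [hi] using h i (by omega)
    · refine BitRep.inj _ _ fun i hi => ?_
      simpa using h (BitRep.len X + i) (by omega)

/-! ## Boolean circuits -/

/-- What an incoming wire of a gate may be attached to: an input of the circuit (indexed by `ι`),
the outgoing wire of one of the `N` gates, or a constant. -/
abbrev Src (ι : Type) (N : ℕ) := ι ⊕ (Fin N ⊕ Bool)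

/-- Boolean circuits with inputs indexed by `ι`, with `N` gates of fan-in two (listed in
topological order, each computing an arbitrary function `{0,1}² → {0,1}`), and `l` outputs. -/
@[ext] structure BCircuit (ι : Type) (N l : ℕ) where
  op : Fin N → Bool → Bool → Bool
  lhs : Fin N → Src ι N
  rhs : Fin N → Src ι N
  out : Fin l → Src ι N
  lhs_lt : ∀ k j, lhs k = Sum.inr (Sum.inl j) → j < k
  rhs_lt : ∀ k j, rhs k = Sum.inr (Sum.inl j) → j < k

namespace BCircuit

variable {ι κ : Type} {N l : ℕ}

/-- The value on the outgoing wire of gate `k` when the input is `x`. -/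
def gateVal (C : BCircuit ι N l) (x : ι → Bool) (k : Fin N) : Bool :=
  C.op k
    (match h : C.lhs k with
      | Sum.inl i => x i
      | Sum.inr (Sum.inl j) =>
          have : j < k := C.lhs_lt k j h
          gateVal C x j
      | Sum.inr (Sum.inr b) => b)
    (match h : C.rhs k with
      | Sum.inl i => x i
      | Sum.inr (Sum.inl j) =>
          have : j < k := C.rhs_lt k j h
          gateVal C x j
      | Sum.inr (Sum.inr b) => b)
termination_by k.val

/-- The output `C(x)`. -/
def eval (C : BCircuit ι N l) (x : ι → Bool) : BV l := fun o =>
  match C.out o with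
  | Sum.inl i => x i
  | Sum.inr (Sum.inl j) => C.gateVal x j
  | Sum.inr (Sum.inr b) => b

/-- Replace the inputs indexed by `κ` by the constants `m`. -/
def hardSrc (m : κ → Bool) : Src (ι ⊕ κ) N → Src ι N
  | Sum.inl (Sum.inl i) => Sum.inl i
  | Sum.inl (Sum.inr j) => Sum.inr (Sum.inr (m j))
  | Sum.inr s => Sum.inr s

theorem of_hardSrc {m : κ → Bool} {s : Src (ι ⊕ κ) N} {j : Fin N}
    (h : hardSrc (ι := ι) m s = Sum.inr (Sum.inl j)) : s = Sum.inr (Sum.inl j) := by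
  rcases s with (i | i) | s
  · simp [hardSrc] at h
  · simp [hardSrc] at h
  · simpa [hardSrc] using h

/-- The circuit `U(·, m)`, obtained from `U` by hard-wiring its second argument to `m`. -/
def hardwire (U : BCircuit (ι ⊕ κ) N l) (m : κ → Bool) : BCircuit ι N l where
  op := U.op
  lhs k := hardSrc m (U.lhs k)
  rhs k := hardSrc m (U.rhs k)
  out o := hardSrc m (U.out o)
  lhs_lt k j h := U.lhs_lt k j (of_hardSrc h)
  rhs_lt k j h := U.rhs_lt k j (of_hardSrc h)

/-- The data of a circuit, as a tuple. -/
def toTuple (C : BCircuit ι N l) :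
    (Fin N → Bool → Bool → Bool) × (Fin N → Src ι N) × (Fin N → Src ι N) × (Fin l → Src ι N) :=
  (C.op, C.lhs, C.rhs, C.out)

theorem toTuple_injective : Function.Injective (toTuple (ι := ι) (N := N) (l := l)) := by
  intro C D h
  simp only [toTuple, Prod.mk.injEq] at h
  exact BCircuit.ext h.1 h.2.1 h.2.2.1 h.2.2.2

instance [Fintype ι] : Fintype (BCircuit ι N l) := by
  classical exact Fintype.ofInjective toTuple toTuple_injective

instance [BitRep ι] : BitRep (BCircuit ι N l) where
  len := BitRep.len ((Fin N → Bool → Bool → Bool) × (Fin N → Src ι N) × (Fin N → Src ι N) ×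
    (Fin l → Src ι N))
  code C := BitRep.code C.toTuple
  inj _ _ h := toTuple_injective (BitRep.inj _ _ h)

end BCircuit

/-! ## Classical polynomial time -/

/-- Arithmetic instructions. -/
inductive ArithOp
  | add | sub | mul | div | mod | lt | eq

def ArithOp.eval : ArithOp → ℕ → ℕ → ℕ
  | add, a, b => a + b
  | sub, a, b => a - b
  | mul, a, b => a * b
  | div, a, b => a / b
  | mod, a, b => a % b
  | lt, a, b => if a < b then 1 else 0
  | eq, a, b => if a = b then 1 else 0

/-- Classical programs with `k` integer arguments: constants, arguments, arithmetic, branching,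
procedure calls and loops. In `loop n init body` the accumulator starts as `init` and is updated
`n` times by `body`, which sees the loop counter and the accumulator as arguments `0` and `1`, and
then the surrounding arguments. -/
inductive Prog : ℕ → Type
  | num {k : ℕ} (c : ℕ) : Prog k
  | var {k : ℕ} (i : Fin k) : Prog k
  | arith {k : ℕ} (o : ArithOp) (a b : Prog k) : Prog k
  | cond {k : ℕ} (c a b : Prog k) : Prog k
  | call {k m : ℕ} (f : Prog m) (args : Fin m → Prog k) : Prog k
  | loop {k : ℕ} (n init : Prog k) (body : Prog (k + 2)) : Prog k

/-- The value computed by a program. -/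
def Prog.eval : {k : ℕ} → Prog k → (Fin k → ℕ) → ℕ
  | _, .num c, _ => c
  | _, .var i, v => v i
  | _, .arith o a b, v => o.eval (a.eval v) (b.eval v)
  | _, .cond c a b, v => if c.eval v ≠ 0 then a.eval v else b.eval v
  | _, .call f args, v => f.eval fun j => (args j).eval v
  | _, .loop n init body, v =>
      Nat.rec (init.eval v) (fun t acc => body.eval (Fin.cons t (Fin.cons acc v))) (n.eval v)

/-- The running time of a program, in bit operations: reading a number costs its bit length, and
an arithmetic instruction costs the product of the bit lengths of its operands. -/
def Prog.cost : {k : ℕ} → Prog k → (Fin k → ℕ) → ℕ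
  | _, .num c, _ => Nat.size c + 1
  | _, .var i, v => Nat.size (v i) + 1
  | _, .arith _ a b, v =>
      a.cost v + b.cost v + (Nat.size (a.eval v) + 1) * (Nat.size (b.eval v) + 1)
  | _, .cond c a b, v => c.cost v + 1 + if c.eval v ≠ 0 then a.cost v else b.cost v
  | _, .call f args, v => (∑ j, (args j).cost v) + 1 + f.cost fun j => (args j).eval v
  | _, .loop n init body, v =>
      n.cost v + init.cost v + 1 + ∑ t ∈ Finset.range (n.eval v),
        (1 + body.cost (Fin.cons t (Fin.cons
          (Nat.rec (init.eval v) (fun t acc => body.eval (Fin.cons t (Fin.cons acc v))) t : ℕ) v)))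

/-- The program runs in polynomial time on the unary inputs `(1^n, 1^i)`. -/
def Prog.PolyTime (P : Prog 2) : Prop :=
  ∃ p : Polynomial ℕ, ∀ n i, P.cost ![n, i] ≤ p.eval (n + i)

/-- A sequence of objects `x_n` whose encodings can be computed in polynomial time: on input
`(1^n, 1^i)` a polynomial-time program outputs the `i`-th bit of the encoding of `x_n`. -/
def UniformSeq {X : ℕ → Type} [∀ n, BitRep (X n)] (x : ∀ n, X n) : Prop :=
  ∃ P : Prog 2, P.PolyTime ∧
    ∀ n i, i < BitRep.len (X n) → P.eval ![n, i] = (BitRep.code (x n) i).toNat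

/-! ## Quantum polynomial time -/

/-- Elementary gates on wires numbered by `ℕ`: Hadamard, `T = diag(1, e^{iπ/4})`, `X`, CNOT and
Toffoli (the last wire is the target), and the identity. -/
inductive Gate
  | skip
  | had (a : ℕ)
  | tee (a : ℕ)
  | not (a : ℕ)
  | cnot (a b : ℕ)
  | toff (a b c : ℕ)

/-- The gate with a given numerical description. -/
def Gate.ofNat (kind a b c : ℕ) : Gate :=
  match kind with
  | 1 => .had a
  | 2 => .tee a
  | 3 => .not a
  | 4 => .cnot a b
  | 5 => .toff a b c
  | _ => .skip

/-- The bit on wire `a` (zero if there is no such wire). -/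
def getBit {W : ℕ} (z : BV W) (a : ℕ) : Bool := if h : a < W then z ⟨a, h⟩ else false

def setBit {W : ℕ} (z : BV W) (a : ℕ) (v : Bool) : BV W := fun i => if i.val = a then v else z i

def flipIf {W : ℕ} (z : BV W) (a : ℕ) (v : Bool) : BV W :=
  fun i => if i.val = a then xor (z i) v else z i

/-- The unitary action of a gate on amplitude vectors of `W` qubits. Gates that refer to
non-existing wires, and controlled gates whose target is also a control, act trivially. -/
def Gate.act {W : ℕ} (g : Gate) (ψ : BV W → ℂ) : BV W → ℂ :=
  match g with
  | .skip => ψ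
  | .had a => fun z =>
      if a < W then
        (ψ (setBit z a false) + (if getBit z a then -1 else 1) * ψ (setBit z a true)) /
          (Real.sqrt 2 : ℂ)
      else ψ z
  | .tee a => fun z =>
      (if getBit z a then Complex.exp (Complex.I * (Real.pi / 4 : ℝ)) else 1) * ψ z
  | .not a => fun z => ψ (flipIf z a true)
  | .cnot a b => fun z => if a = b then ψ z else ψ (flipIf z b (getBit z a))
  | .toff a b c => fun z =>
      if a = c ∨ b = c then ψ z else ψ (flipIf z c (getBit z a && getBit z b))

/-- The matrix entry `⟨z| G_t ⋯ G_1 |w⟩` of the circuit with gates `G_1, …, G_t`. -/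
def amplitude {W : ℕ} (gs : List Gate) (w z : BV W) : ℂ :=
  gs.foldl (fun ψ g => g.act ψ) (Pi.single w 1) z

/-- The basis state of `W` wires whose first wires hold the encoding of `x`, and whose other wires
are as in `e`. -/
def place {X : Type} [BitRep X] {W : ℕ} (x : X) (e : BV W) : BV W :=
  fun i => if i.val < BitRep.len X then BitRep.code x i.val else e i

/-- Operators on the Hilbert space with orthonormal basis `A`; a register of `n` qubits has
`A = BV n`. -/
abbrev Op (A : Type) := Matrix A A ℂ

/-- (Possibly probabilistic) classical algorithms: `K x y` is the probability of output `y` on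
input `x`. -/
abbrev Kernel (X Y : Type) := X → Y → ℝ

/-- Algorithms with classical input in `X`, classical output in `Y` and a quantum output in the
register `B`: `S x y` is the final state of `B`, conditioned on the classical output `y` and
scaled by the probability of `y`. -/
abbrev Prep (X Y B : Type) := X → Y → Op B

/-- Algorithms with classical and quantum input and output: on classical input `x` and input state
`ρ`, the state of `B` given the classical output `y`, scaled by the probability of `y`, is
`Φ x y ρ`. -/
abbrev Instr (X A Y B : Type) := X → Y → Op A → Op B

/-- A polynomial-time uniform family of quantum circuits: on `(1^n, 1^i)` a polynomial-time
classical program outputs the description of the `i`-th gate of the `n`-th circuit. -/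
structure UCircuit where
  kind : Prog 2
  fst : Prog 2
  snd : Prog 2
  trd : Prog 2
  kind_poly : kind.PolyTime
  fst_poly : fst.PolyTime
  snd_poly : snd.PolyTime
  trd_poly : trd.PolyTime
  size : Polynomial ℕ
  width : Polynomial ℕ

namespace UCircuit

def gates (C : UCircuit) (n : ℕ) : List Gate :=
  (List.range (C.size.eval n)).map fun i =>
    Gate.ofNat (C.kind.eval ![n, i]) (C.fst.eval ![n, i]) (C.snd.eval ![n, i])
      (C.trd.eval ![n, i])

/-- What the `n`-th circuit does: the first wires are initialised to the classical input and the
quantum input, the other wires to zero; the gates are applied; the first wires are then read out as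
the classical output (measured) and the quantum output, and the other wires are traced out. -/
def instr (C : UCircuit) (n : ℕ) {X A Y B : Type} [BitRep X] [BitRep A] [BitRep Y] [BitRep B]
    [Fintype A] : Instr X A Y B := fun x y ρ =>
  Matrix.of fun b b' =>
    ∑ e : BV (C.width.eval n) with ∀ i, i.val < BitRep.len (Y × B) → e i = false,
      ∑ a : A, ∑ a' : A,
        amplitude (C.gates n) (place (x, a) fun _ => false) (place (y, b) e) * ρ a a' *
          star (amplitude (C.gates n) (place (x, a') fun _ => false) (place (y, b') e))

end UCircuit

section QPT

variable {X A Y B : ℕ → Type}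
variable [∀ n, BitRep (X n)] [∀ n, BitRep (A n)] [∀ n, BitRep (Y n)] [∀ n, BitRep (B n)]
variable [∀ n, Fintype (A n)] [∀ n, Fintype (Y n)] [∀ n, Fintype (B n)]

/-- Quantum polynomial time: the family is implemented by a polynomial-time uniform family of
quantum circuits, whose classical outputs are always encodings of elements of `Y n`. -/
def QPT (Φ : ∀ n, Instr (X n) (A n) (Y n) (B n)) : Prop :=
  ∃ C : UCircuit, ∀ n,
    BitRep.len (X n × A n) ≤ C.width.eval n ∧
    BitRep.len (Y n × B n) ≤ C.width.eval n ∧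
    (∀ x y ρ, Φ n x y ρ = C.instr n x y ρ) ∧
    (∀ x ρ, ∑ y, (Φ n x y ρ).trace = ρ.trace)

/-- Quantum polynomial time for algorithms without quantum input. -/
def QPTPrep (S : ∀ n, Prep (X n) (Y n) (B n)) : Prop :=
  QPT (X := X) (A := fun _ => Unit) (Y := Y) (B := B) fun n x y ρ => ρ () () • S n x y

/-- Quantum polynomial time for algorithms with classical input and output. -/
def QPTKernel (K : ∀ n, Kernel (X n) (Y n)) : Prop :=
  QPTPrep (X := X) (Y := Y) (B := fun _ => Unit) fun n x y => (K n x y : ℂ) • (1 : Op Unit)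

end QPT

/-! ## Negligible functions and unbounded adversaries -/

/-- Negligible functions: eventually smaller in absolute value than every `n^{-c}`. -/
def Negligible (f : ℕ → ℝ) : Prop :=
  ∀ c : ℕ, ∃ n₀ : ℕ, ∀ n, n₀ < n → |f n| < ((n : ℝ) ^ c)⁻¹

/-- The effect `E` with which an unbounded algorithm outputs `1`, on a quantum register: the output
is `1` with probability `Tr(E ρ)`, where `0 ≤ E ≤ 1`. -/
def IsEffect {A : Type} [Fintype A] [DecidableEq A] (E : Op A) : Prop :=
  E.PosSemidef ∧ (1 - E).PosSemidef

/-! ## Public key encryption with certified everlasting deletion -/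

/-- A PKE scheme with certified everlasting deletion and plaintext space `{0,1}^μ`, with quantum
ciphertexts and classical deletion certificates. In `dec`, `none` stands for `⊥`; in `vrfy`, `true`
stands for `⊤`. -/
structure PKE (μ : Polynomial ℕ) where
  pkLen : Polynomial ℕ
  skLen : Polynomial ℕ
  ctLen : Polynomial ℕ
  vkLen : Polynomial ℕ
  certLen : Polynomial ℕ
  keyGen : ∀ n, Kernel Unit (BV (pkLen.eval n) × BV (skLen.eval n))
  enc : ∀ n, Prep (BV (pkLen.eval n) × BV (μ.eval n)) (BV (vkLen.eval n)) (BV (ctLen.eval n))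
  dec : ∀ n, Instr (BV (skLen.eval n)) (BV (ctLen.eval n)) (Option (BV (μ.eval n))) Unit
  del : ∀ n, Instr Unit (BV (ctLen.eval n)) (BV (certLen.eval n)) Unit
  vrfy : ∀ n, Kernel (BV (vkLen.eval n) × BV (certLen.eval n)) Bool
  keyGen_qpt : QPTKernel keyGen
  enc_qpt : QPTPrep enc
  dec_qpt : QPT dec
  del_qpt : QPT del
  vrfy_qpt : QPTKernel vrfy

namespace PKE

variable {μ : Polynomial ℕ}

/-- QPT adversaries `A₁` in the certified everlasting IND-CPA experiment: `choose` is given the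
public key and outputs two plaintexts; `delete` is given the ciphertext and outputs a certificate.
Each stage hands its internal quantum state on, the last one to the unbounded adversary. -/
structure Adversary (P : PKE μ) where
  r₁ : Polynomial ℕ
  r₂ : Polynomial ℕ
  choose : ∀ n, Instr (BV (P.pkLen.eval n)) Unit (BV (μ.eval n) × BV (μ.eval n)) (BV (r₁.eval n))
  delete : ∀ n, Instr Unit (BV (r₁.eval n) × BV (P.ctLen.eval n)) (BV (P.certLen.eval n))
    (BV (r₂.eval n))
  choose_qpt : QPT choose
  delete_qpt : QPT delete

/-- The probability that the certified everlasting IND-CPA experiment with challenge bit `b`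
outputs `1`. The unbounded adversary is given the secret key and outputs `1` by the effect `E`. -/
def exp (P : PKE μ) (A : P.Adversary)
    (E : ∀ n, BV (P.skLen.eval n) → Op (BV (A.r₂.eval n))) (b : Bool) (n : ℕ) : ℝ :=
  ∑ pk, ∑ sk, ∑ m₀, ∑ m₁, ∑ vk, ∑ cert,
    P.keyGen n () (pk, sk) * P.vrfy n (vk, cert) true *
      (E n sk * A.delete n () cert
        (A.choose n pk (m₀, m₁) 1 ⊗ₖ P.enc n (pk, if b then m₁ else m₀) vk)).trace.re

/-- Certified everlasting IND-CPA security. -/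
def CertEverINDCPA (P : PKE μ) : Prop :=
  ∀ (A : P.Adversary) (E : ∀ n, BV (P.skLen.eval n) → Op (BV (A.r₂.eval n))),
    (∀ n sk, IsEffect (E n sk)) → Negligible fun n => |P.exp A E false n - P.exp A E true n|

end PKE

/-! ## Garbling with certified everlasting deletion -/

/-- A garbling scheme with certified everlasting deletion for the Boolean circuits with `s`
inputs, `N` gates and `l` outputs (all polynomials in the security parameter). The label space is
`{0,1}^labLen`. -/
structure Garbling (s N l : Polynomial ℕ) where
  labLen : Polynomial ℕ
  gcLen : Polynomial ℕ
  vkLen : Polynomial ℕ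
  certLen : Polynomial ℕ
  setup : ∀ n, Kernel Unit (Fin (s.eval n) → Bool → BV (labLen.eval n))
  garble : ∀ n, Prep
    (BCircuit (Fin (s.eval n)) (N.eval n) (l.eval n) × (Fin (s.eval n) → Bool → BV (labLen.eval n)))
    (BV (vkLen.eval n)) (BV (gcLen.eval n))
  gceval : ∀ n, Instr (Fin (s.eval n) → BV (labLen.eval n)) (BV (gcLen.eval n))
    (Option (BV (l.eval n))) Unit
  del : ∀ n, Instr Unit (BV (gcLen.eval n)) (BV (certLen.eval n)) Unit
  vrfy : ∀ n, Kernel (BV (vkLen.eval n) × BV (certLen.eval n)) Bool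
  setup_qpt : QPTKernel setup
  garble_qpt : QPTPrep garble
  gceval_qpt : QPT gceval
  del_qpt : QPT del
  vrfy_qpt : QPTKernel vrfy

namespace Garbling

variable {s N l : Polynomial ℕ}

/-- QPT adversaries `A₁` in the selective certified everlasting security experiment: `choose`
outputs a circuit and an input; `delete` is given the garbled circuit and the labels of the input
and outputs a certificate. -/
structure Adversary (G : Garbling s N l) where
  r₁ : Polynomial ℕ
  r₂ : Polynomial ℕ
  choose : ∀ n, Instr Unit Unit
    (BCircuit (Fin (s.eval n)) (N.eval n) (l.eval n) × BV (s.eval n)) (BV (r₁.eval n))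
  delete : ∀ n, Instr (Fin (s.eval n) → BV (G.labLen.eval n))
    (BV (r₁.eval n) × BV (G.gcLen.eval n)) (BV (G.certLen.eval n)) (BV (r₂.eval n))
  choose_qpt : QPT choose
  delete_qpt : QPT delete

/-- Simulators, which are given `C(x)` and the labels of `x` (and `1^λ`, `1^{|C|}`, where `|C|` is
a function of the security parameter here). -/
abbrev Simulator (G : Garbling s N l) :=
  ∀ n, Prep (BV (l.eval n) × (Fin (s.eval n) → BV (G.labLen.eval n)))
    (BV (G.vkLen.eval n)) (BV (G.gcLen.eval n))

/-- The probability that the selective certified everlasting security experiment outputs `1`; the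
garbled circuit is `G̃ n C x L vk`. -/
def exp (G : Garbling s N l) (A : G.Adversary) (E : ∀ n, Op (BV (A.r₂.eval n)))
    (G' : ∀ n, BCircuit (Fin (s.eval n)) (N.eval n) (l.eval n) → BV (s.eval n) →
      (Fin (s.eval n) → Bool → BV (G.labLen.eval n)) → BV (G.vkLen.eval n) →
      Op (BV (G.gcLen.eval n))) (n : ℕ) : ℝ :=
  ∑ C, ∑ x, ∑ L, ∑ vk, ∑ cert,
    G.setup n () L * G.vrfy n (vk, cert) true *
      (E n * A.delete n (fun i => L i (x i)) cert
        (A.choose n () (C, x) 1 ⊗ₖ G' n C x L vk)).trace.re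

/-- The experiment with the real garbled circuit. -/
def expReal (G : Garbling s N l) (A : G.Adversary) (E : ∀ n, Op (BV (A.r₂.eval n))) : ℕ → ℝ :=
  G.exp A E fun n C _ L vk => G.garble n (C, L) vk

/-- The experiment with the simulated garbled circuit. -/
def expSim (G : Garbling s N l) (S : G.Simulator) (A : G.Adversary)
    (E : ∀ n, Op (BV (A.r₂.eval n))) : ℕ → ℝ :=
  G.exp A E fun n C x L vk => S n (C.eval x, fun i => L i (x i)) vk

/-- Selective certified everlasting security. -/
def SelCertEver (G : Garbling s N l) : Prop :=
  ∃ S : G.Simulator, QPTPrep S ∧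
    ∀ (A : G.Adversary) (E : ∀ n, Op (BV (A.r₂.eval n))), (∀ n, IsEffect (E n)) →
      Negligible fun n => |G.expReal A E n - G.expSim S A E n|

end Garbling

/-! ## Functional encryption with certified everlasting deletion -/

/-- The algorithms of an FE scheme with certified everlasting deletion for functions with
descriptions in `{0,1}^s`, plaintexts in `{0,1}^μ` and values in `{0,1}^l`; the function with
description `f` maps `m` to `fn n f m`. -/
structure FE (s μ l : Polynomial ℕ) (MPK MSK SK VK Cert CT : ℕ → Type) where
  fn : ∀ n, BV (s.eval n) → BV (μ.eval n) → BV (l.eval n)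
  setup : ∀ n, Kernel Unit (MPK n × MSK n)
  keyGen : ∀ n, Kernel (MSK n × BV (s.eval n)) (SK n)
  enc : ∀ n, Prep (MPK n × BV (μ.eval n)) (VK n) (CT n)
  dec : ∀ n, Instr (SK n) (CT n) (Option (BV (l.eval n))) Unit
  del : ∀ n, Instr Unit (CT n) (Cert n) Unit
  vrfy : ∀ n, Kernel (VK n × Cert n) Bool

namespace FE

variable {s μ l : Polynomial ℕ} {MPK MSK SK VK Cert CT : ℕ → Type}
variable [∀ n, Fintype (MPK n)] [∀ n, Fintype (MSK n)] [∀ n, Fintype (SK n)]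
variable [∀ n, Fintype (VK n)] [∀ n, Fintype (Cert n)] [∀ n, Fintype (CT n)]
variable [∀ n, BitRep (MPK n)] [∀ n, BitRep (MSK n)] [∀ n, BitRep (SK n)]
variable [∀ n, BitRep (VK n)] [∀ n, BitRep (Cert n)] [∀ n, BitRep (CT n)]

/-- QPT adversaries `A₁` in the `1`-bounded non-adaptive experiment. `query` is given the master
public key and outputs a bit `q` and a string `f`: if `q` is true, a key for `f` is requested, and
if it is false, no key is requested (and `f` is ignored). `choose` is given the key (`none` if none
was requested) and outputs a plaintext. `delete` is given the ciphertext and outputs a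
certificate. -/
structure Adversary (F : FE s μ l MPK MSK SK VK Cert CT) where
  r₁ : Polynomial ℕ
  r₂ : Polynomial ℕ
  r₃ : Polynomial ℕ
  query : ∀ n, Instr (MPK n) Unit (Bool × BV (s.eval n)) (BV (r₁.eval n))
  choose : ∀ n, Instr (Option (SK n)) (BV (r₁.eval n)) (BV (μ.eval n)) (BV (r₂.eval n))
  delete : ∀ n, Instr Unit (BV (r₂.eval n) × CT n) (Cert n) (BV (r₃.eval n))
  query_qpt : QPT query
  choose_qpt : QPT choose
  delete_qpt : QPT delete

/-- Simulators, which are given the master public key and `V`, which is either empty or consists of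
`f(m)`, `f` and the key for `f` (and `1^λ`, `1^{|m|}`, where `|m|` is a function of the security
parameter), and output a verification key and a ciphertext. -/
abbrev Simulator (_F : FE s μ l MPK MSK SK VK Cert CT) :=
  ∀ n, Prep (MPK n × Option (BV (l.eval n) × BV (s.eval n) × SK n)) (VK n) (CT n)

/-- The probability of the answer `a` to the (possible) key query. -/
def answer (F : FE s μ l MPK MSK SK VK Cert CT) (n : ℕ) (msk : MSK n) (q : Bool)
    (f : BV (s.eval n)) (a : Option (SK n)) : ℝ :=
  match q, a with
  | true, some sk => F.keyGen n (msk, f) sk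
  | false, none => 1
  | _, _ => 0

/-- The probability that the `1`-bounded non-adaptive certified everlasting simulation experiment
outputs `1`; verification key and ciphertext are `enc' n mpk f a m`, where `a` is the answer to the
(possible) key query `f`. The unbounded adversary is given the master secret key and outputs `1` by
the effect `E`. -/
def exp (F : FE s μ l MPK MSK SK VK Cert CT) (A : F.Adversary)
    (E : ∀ n, MSK n → Op (BV (A.r₃.eval n)))
    (enc' : ∀ n, MPK n → BV (s.eval n) → Option (SK n) → BV (μ.eval n) → VK n → Op (CT n))
    (n : ℕ) : ℝ :=
  ∑ mpk, ∑ msk, ∑ q, ∑ f, ∑ a, ∑ m, ∑ vk, ∑ cert,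
    F.setup n () (mpk, msk) * F.answer n msk q f a * F.vrfy n (vk, cert) true *
      (E n msk * A.delete n () cert
        (A.choose n a m (A.query n mpk (q, f) 1) ⊗ₖ enc' n mpk f a m vk)).trace.re

/-- The real experiment. -/
def expReal (F : FE s μ l MPK MSK SK VK Cert CT) (A : F.Adversary)
    (E : ∀ n, MSK n → Op (BV (A.r₃.eval n))) : ℕ → ℝ :=
  F.exp A E fun n mpk _ _ m vk => F.enc n (mpk, m) vk

/-- The simulated experiment. -/
def expSim (F : FE s μ l MPK MSK SK VK Cert CT) (S : F.Simulator) (A : F.Adversary)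
    (E : ∀ n, MSK n → Op (BV (A.r₃.eval n))) : ℕ → ℝ :=
  F.exp A E fun n mpk f a m vk => S n (mpk, a.map fun sk => (F.fn n f m, f, sk)) vk

/-- `1`-bounded non-adaptive certified everlasting simulation-security. -/
def NonAdaptiveCertEverSim (F : FE s μ l MPK MSK SK VK Cert CT) : Prop :=
  ∃ S : F.Simulator, QPTPrep S ∧
    ∀ (A : F.Adversary) (E : ∀ n, MSK n → Op (BV (A.r₃.eval n))), (∀ n msk, IsEffect (E n msk)) →
      Negligible fun n => |F.expReal A E n - F.expSim S A E n|

end FE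

/-! ## The construction -/

/-- The tensor product of a family of states. -/
def tensorFam {s : ℕ} {B : Type} (ρ : Fin s → Bool → Op B) : Op (Fin s → Bool → B) :=
  Matrix.of fun x y => ∏ i, ∏ α, ρ i α (x i α) (y i α)

section Construction

variable {s μ N l : Polynomial ℕ}

/-- The FE scheme built from the garbling scheme `G`, the PKE scheme `P`, whose plaintexts are the
labels of `G`, and the circuits `U n`, which take a function description `f` and a plaintext `m` to
`f(m)`. -/
def cefe (G : Garbling s N l) (P : PKE G.labLen)
    (U : ∀ n, BCircuit (Fin (s.eval n) ⊕ Fin (μ.eval n)) (N.eval n) (l.eval n)) :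
    FE s μ l
      (fun n => Fin (s.eval n) → Bool → BV (P.pkLen.eval n))
      (fun n => Fin (s.eval n) → Bool → BV (P.skLen.eval n))
      (fun n => BV (s.eval n) × (Fin (s.eval n) → BV (P.skLen.eval n)))
      (fun n => BV (G.vkLen.eval n) × (Fin (s.eval n) → Bool → BV (P.vkLen.eval n)))
      (fun n => BV (G.certLen.eval n) × (Fin (s.eval n) → Bool → BV (P.certLen.eval n)))
      (fun n => BV (G.gcLen.eval n) × (Fin (s.eval n) → Bool → BV (P.ctLen.eval n))) where
  fn n f m := (U n).eval (Sum.elim f m)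
  setup n _ k := ∏ i, ∏ α, P.keyGen n () (k.1 i α, k.2 i α)
  keyGen n k sk := if sk = (k.2, fun i => k.1 i (k.2 i)) then 1 else 0
  enc n k vk :=
    ∑ L, (G.setup n () L : ℂ) • (G.garble n ((U n).hardwire k.2, L) vk.1 ⊗ₖ
      tensorFam fun i α => P.enc n (k.1 i α, L i α) (vk.2 i α))
  dec n sk y ρ :=
    -- On `|a⟩⟨a'|`: decrypt the ciphertexts `(i, f[i])`, with results `L`, discard the other
    -- ciphertexts, and evaluate the garbled circuit if no decryption failed.
    (∑ a, ∑ a', ∑ L : Fin (s.eval n) → Option (BV (G.labLen.eval n)),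
      ρ a a' *
      (∏ i, P.dec n (sk.2 i) (L i) (Matrix.single (a.2 i (sk.1 i)) (a'.2 i (sk.1 i)) 1) () ()) *
      (∏ i, if a.2 i (!sk.1 i) = a'.2 i (!sk.1 i) then 1 else 0) *
      (if ∀ i, (L i).isSome then
        G.gceval n (fun i => (L i).getD fun _ => false) y (Matrix.single a.1 a'.1 1) () ()
      else if y = none ∧ a.1 = a'.1 then 1 else 0)) • (1 : Op Unit)
  del n _ cert ρ :=
    (∑ a, ∑ a', ρ a a' * G.del n () cert.1 (Matrix.single a.1 a'.1 1) () () *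
      ∏ i, ∏ α, P.del n () (cert.2 i α) (Matrix.single (a.2 i α) (a'.2 i α) 1) () ()) •
        (1 : Op Unit)
  vrfy n k r :=
    let accept : ℝ := G.vrfy n (k.1.1, k.2.1) true *
      ∏ i, ∏ α, P.vrfy n (k.1.2 i α, k.2.2 i α) true
    if r then accept else 1 - accept

end Construction

end CertFE

end

noncomputable section

set_option linter.unusedSectionVars false
set_option synthInstance.maxSize 100000

namespace CertFE

/-! ## Polynomial-time computable functions of numbers in unary -/

/-! The real experiment is carried to the simulated one by two replacements. Both are changes inside
`hyb`, the experiment in which keys, key query and plaintext are followed by a garbled circuit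
prepared by `T` and by encryptions of the labels given by `Λ`.

The first replacement concerns the labels. A key for `f` contains only the secret keys of the slots
`(i, f[i])`, so in every other slot the label may be replaced by zeros (`PKE.hyb_negligible`). This
is a hybrid argument over the `2s` slots. Which slots stay closed is known only after the public
keys have been handed out, so the reduction guesses a slot, plants the challenge key and ciphertext
there, and counts for nothing if the slot turns out to be opened; in that case the two neighbouring
hybrids coincide anyway (`partLabels_succ`). The guess comes from coin flips and hits every slot
with the same probability `p ≥ 1/(4s)`, so the reduction's advantage is exactly `p` times the
telescoping sum of the hybrid differences. The secret key released after deletion completes the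
master secret key, and the verification of all other components is a number in `[0,1]` that is
multiplied into the effect of the unbounded adversary.

The second replacement concerns the garbled circuit (`hyb_simGarble_negligible`). Now only the
labels of a single input occur, as selective security requires, so if a key was requested, the
garbling of `U(·,m)` becomes a simulation from `f(m)`. If no key was requested, the simulator of the
theorem honestly garbles `U(·,0)`. The passage from `U(·,m)` to `U(·,0)` uses a circuit of the same
size in which the ones of `m` are attached to the first input: it agrees with `U(·,m)` on the
all-one input and with `U(·,0)` on the all-zero input. Without a key no label is encrypted, so the
input submitted to the garbling game is free, and four applications of its security connect the two
ends. The first input exists because `s` does not vanish.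

Most of the work lies in showing that the reductions and the simulator are quantum polynomial time
in the concrete circuit model. Algorithms are exchanged with isometric dilations
(`QPT.exists_dilation`, `QPT.of_dilation`), which uniform circuits implement exactly on encodings
(`EI`). Classical steps are broken into functions whose bits are quadratic polynomials over the
field with two elements (`BQ`, `Quad`), computable by NOT, CNOT and Toffoli gates. A map with a left
inverse leaves no garbage if both are quadratic (`EIf.of_leftInverse`); functions of classical data
may leave garbage (`Easy`), which joins the environment of the dilation. -/

theorem polynomial_eval_mono (p : Polynomial ℕ) {a b : ℕ} (h : a ≤ b) : p.eval a ≤ p.eval b := by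
  rw [Polynomial.eval_eq_sum, Polynomial.eval_eq_sum]
  exact Finset.sum_le_sum fun i _ => Nat.mul_le_mul_left _ (Nat.pow_le_pow_left h i)

/-- Functions of two numbers that are bounded by a polynomial. -/
def PolyBdd (f : ℕ × ℕ → ℕ) : Prop := ∃ p : Polynomial ℕ, ∀ x, f x ≤ p.eval (x.1 + x.2)

namespace PolyBdd

theorem mono {f g : ℕ × ℕ → ℕ} (hg : PolyBdd g) (h : ∀ x, f x ≤ g x) : PolyBdd f := by
  obtain ⟨p, hp⟩ := hg
  exact ⟨p, fun x => (h x).trans (hp x)⟩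

theorem const (c : ℕ) : PolyBdd fun _ => c := ⟨Polynomial.C c, fun _ => by simp⟩

theorem fst : PolyBdd fun x => x.1 := ⟨Polynomial.X, fun _ => by simp⟩

theorem snd : PolyBdd fun x => x.2 := ⟨Polynomial.X, fun _ => by simp⟩

theorem add {f g : ℕ × ℕ → ℕ} (hf : PolyBdd f) (hg : PolyBdd g) : PolyBdd fun x => f x + g x := by
  obtain ⟨p, hp⟩ := hf
  obtain ⟨q, hq⟩ := hg
  exact ⟨p + q, fun x => by simpa using Nat.add_le_add (hp x) (hq x)⟩

theorem mul {f g : ℕ × ℕ → ℕ} (hf : PolyBdd f) (hg : PolyBdd g) : PolyBdd fun x => f x * g x := by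
  obtain ⟨p, hp⟩ := hf
  obtain ⟨q, hq⟩ := hg
  exact ⟨p * q, fun x => by simpa using Nat.mul_le_mul (hp x) (hq x)⟩

theorem comp {F f g : ℕ × ℕ → ℕ} (hF : PolyBdd F) (hf : PolyBdd f) (hg : PolyBdd g) :
    PolyBdd fun x => F (f x, g x) := by
  obtain ⟨r, hr⟩ := hF
  obtain ⟨p, hp⟩ := hf
  obtain ⟨q, hq⟩ := hg
  refine ⟨r.comp (p + q), fun x => (hr _).trans ?_⟩
  rw [Polynomial.eval_comp]
  exact polynomial_eval_mono r (by simpa using Nat.add_le_add (hp x) (hq x))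

end PolyBdd

/-- Polynomially bounded functions that are computed by a program in polynomial time. -/
@[fun_prop]
def PT (f : ℕ × ℕ → ℕ) : Prop :=
  ∃ P : Prog 2, (∀ x : ℕ × ℕ, P.eval ![x.1, x.2] = f x) ∧
    PolyBdd (fun x => P.cost ![x.1, x.2]) ∧ PolyBdd f

theorem nat_size_le (x : ℕ) : Nat.size x ≤ x := Nat.size_le.2 Nat.lt_two_pow_self

namespace PT

theorem bdd {f : ℕ × ℕ → ℕ} (h : PT f) : PolyBdd f := let ⟨_, _, _, h⟩ := h; h

@[fun_prop]
theorem const (c : ℕ) : PT fun _ => c :=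
  ⟨.num c, fun _ => rfl, PolyBdd.const (Nat.size c + 1), PolyBdd.const c⟩

@[fun_prop]
theorem fst : PT fun x => x.1 :=
  ⟨.var 0, fun _ => rfl, (PolyBdd.fst.add (PolyBdd.const 1)).mono fun x =>
    Nat.succ_le_succ (nat_size_le x.1), PolyBdd.fst⟩

@[fun_prop]
theorem snd : PT fun x => x.2 :=
  ⟨.var 1, fun _ => rfl, (PolyBdd.snd.add (PolyBdd.const 1)).mono fun x =>
    Nat.succ_le_succ (nat_size_le x.2), PolyBdd.snd⟩

theorem arith_eval_le (o : ArithOp) (a b : ℕ) : o.eval a b ≤ a * b + a + b + 1 := by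
  cases o <;> simp only [ArithOp.eval]
  · nlinarith [Nat.zero_le (a * b)]
  · exact (Nat.sub_le a b).trans (by nlinarith [Nat.zero_le (a * b)])
  · omega
  · exact (Nat.div_le_self a b).trans (by nlinarith [Nat.zero_le (a * b)])
  · exact (Nat.mod_le a b).trans (by nlinarith [Nat.zero_le (a * b)])
  · split_ifs <;> omega
  · split_ifs <;> omega

theorem arith (o : ArithOp) {f g : ℕ × ℕ → ℕ} (hf : PT f) (hg : PT g) :
    PT fun x => o.eval (f x) (g x) := by
  obtain ⟨P, hP, hPc, hPb⟩ := hf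
  obtain ⟨Q, hQ, hQc, hQb⟩ := hg
  refine ⟨.arith o P Q, fun x => by simp [Prog.eval, hP, hQ], ?_, ?_⟩
  · refine ((hPc.add hQc).add ((hPb.add (.const 1)).mul (hQb.add (.const 1)))).mono fun x => ?_
    simp only [Prog.cost, hP, hQ]
    gcongr <;> exact nat_size_le _
  · exact (((hPb.mul hQb).add hPb).add hQb |>.add (.const 1)).mono fun x => arith_eval_le o _ _

@[fun_prop]
theorem add {f g : ℕ × ℕ → ℕ} (hf : PT f) (hg : PT g) : PT fun x => f x + g x := arith .add hf hg

@[fun_prop]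
theorem sub {f g : ℕ × ℕ → ℕ} (hf : PT f) (hg : PT g) : PT fun x => f x - g x := arith .sub hf hg

@[fun_prop]
theorem mul {f g : ℕ × ℕ → ℕ} (hf : PT f) (hg : PT g) : PT fun x => f x * g x := arith .mul hf hg

@[fun_prop]
theorem div {f g : ℕ × ℕ → ℕ} (hf : PT f) (hg : PT g) : PT fun x => f x / g x := arith .div hf hg

@[fun_prop]
theorem mod {f g : ℕ × ℕ → ℕ} (hf : PT f) (hg : PT g) : PT fun x => f x % g x := arith .mod hf hg

theorem prog_cond {f g c : ℕ × ℕ → ℕ} (hc : PT c) (hf : PT f) (hg : PT g) :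
    PT fun x => if c x ≠ 0 then f x else g x := by
  obtain ⟨R, hR, hRc, hRb⟩ := hc
  obtain ⟨P, hP, hPc, hPb⟩ := hf
  obtain ⟨Q, hQ, hQc, hQb⟩ := hg
  refine ⟨.cond R P Q, fun x => by simp only [Prog.eval, hP, hQ, hR], ?_, ?_⟩
  · refine ((hRc.add (.const 1)).add (hPc.add hQc)).mono fun x => ?_
    simp only [Prog.cost]
    gcongr
    split_ifs <;> omega
  · exact (hPb.add hQb).mono fun x => by split_ifs <;> omega

/-- Running times are polynomial in unary arguments, so the inner values must be polynomially
bounded themselves. This is why `PT` includes a bound on the values and not only on the cost. -/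
theorem comp {F f g : ℕ × ℕ → ℕ} (hF : PT F) (hf : PT f) (hg : PT g) :
    PT fun x => F (f x, g x) := by
  obtain ⟨R, hR, hRc, hRb⟩ := hF
  obtain ⟨P, hP, hPc, hPb⟩ := hf
  obtain ⟨Q, hQ, hQc, hQb⟩ := hg
  have key : ∀ x : ℕ × ℕ, (fun j => (![P, Q] j).eval ![x.1, x.2]) = ![f x, g x] := by
    intro x
    funext j
    fin_cases j <;> simp [hP, hQ]
  refine ⟨.call R ![P, Q], fun x => ?_, ?_, hRb.comp hPb hQb⟩
  · rw [Prog.eval, key]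
    exact hR (f x, g x)
  · refine (((hPc.add hQc).add (.const 1)).add (hRc.comp hPb hQb)).mono fun x => ?_
    rw [Prog.cost, key]
    simp [Fin.sum_univ_two]

@[fun_prop]
theorem pow {f : ℕ × ℕ → ℕ} (hf : PT f) (k : ℕ) : PT fun x => f x ^ k := by
  induction k with
  | zero => simpa using const 1
  | succ k ih => simpa [pow_succ] using ih.mul hf

@[fun_prop]
theorem polynomial (p : Polynomial ℕ) {f : ℕ × ℕ → ℕ} (hf : PT f) :
    PT fun x => p.eval (f x) := by
  induction p using Polynomial.induction_on' with
  | add p q hp hq => simpa using hp.add hq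
  | monomial n a => simpa using (const a).mul (hf.pow n)

end PT

open Classical in
/-- Conditions decided in polynomial time. -/
@[fun_prop]
def PTd (c : ℕ × ℕ → Prop) : Prop := PT fun x => if c x then 1 else 0

@[fun_prop]
theorem PT.ite {c : ℕ × ℕ → Prop} [∀ x, Decidable (c x)] {f g : ℕ × ℕ → ℕ} (hc : PTd c)
    (hf : PT f) (hg : PT g) : PT fun x => if c x then f x else g x := by
  have hc' : PT fun x => if c x then 1 else 0 := by
    unfold PTd at hc
    convert hc
  have h := PT.prog_cond hc' hf hg
  refine (congrArg PT ?_).mp h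
  funext x
  by_cases h : c x <;> simp [h]

namespace PTd

variable {f g : ℕ × ℕ → ℕ} {c d : ℕ × ℕ → Prop}

@[fun_prop]
theorem const (p : Prop) : PTd fun _ => p := PT.const _

@[fun_prop]
theorem lt (hf : PT f) (hg : PT g) : PTd fun x => f x < g x := by
  have h := PT.arith .lt hf hg
  simp only [ArithOp.eval] at h
  unfold PTd
  convert h

@[fun_prop]
theorem eq (hf : PT f) (hg : PT g) : PTd fun x => f x = g x := by
  have h := PT.arith .eq hf hg
  simp only [ArithOp.eval] at h
  unfold PTd
  convert h

@[fun_prop]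
theorem not (hc : PTd c) : PTd fun x => ¬ c x := by
  classical
  have h : PT fun x => 1 - if c x then 1 else 0 := by
    have hc' : PT fun x => if c x then 1 else 0 := by unfold PTd at hc; convert hc
    fun_prop
  unfold PTd
  refine (congrArg PT ?_).mp h
  funext x
  by_cases hx : c x <;> simp [hx]

@[fun_prop]
theorem and (hc : PTd c) (hd : PTd d) : PTd fun x => c x ∧ d x := by
  classical
  have h : PT fun x => if c x then (if d x then 1 else 0) else 0 := by fun_prop
  unfold PTd
  refine (congrArg PT ?_).mp h
  funext x
  by_cases hx : c x <;> simp [hx]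

@[fun_prop]
theorem or (hc : PTd c) (hd : PTd d) : PTd fun x => c x ∨ d x := by
  classical
  have h : PT fun x => if c x then 1 else (if d x then 1 else 0) := by fun_prop
  unfold PTd
  refine (congrArg PT ?_).mp h
  funext x
  by_cases hx : c x <;> simp [hx]

@[fun_prop]
theorem le (hf : PT f) (hg : PT g) : PTd fun x => f x ≤ g x := by
  simpa only [not_lt] using (lt hg hf).not

end PTd

@[fun_prop]
theorem PT.natMin {f g : ℕ × ℕ → ℕ} (hf : PT f) (hg : PT g) : PT fun x => min (f x) (g x) := by
  simp only [Nat.min_def]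
  fun_prop

/-! ### Bit lengths, and programs with large values -/

theorem nat_size_mono {a b : ℕ} (h : a ≤ b) : Nat.size a ≤ Nat.size b := Nat.size_le_size h

theorem nat_size_mul_le (a b : ℕ) : Nat.size (a * b) ≤ Nat.size a + Nat.size b := by
  rw [Nat.size_le, pow_add]
  exact Nat.mul_lt_mul'' (Nat.lt_size_self a) (Nat.lt_size_self b)

theorem nat_size_add_le (a b : ℕ) : Nat.size (a + b) ≤ Nat.size a + Nat.size b + 1 := by
  rw [Nat.size_le, pow_succ, pow_add]
  have ha := Nat.lt_size_self a
  have hb := Nat.lt_size_self b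
  nlinarith

theorem ArithOp.size_eval_le (o : ArithOp) (a b : ℕ) :
    Nat.size (o.eval a b) ≤ (Nat.size a + 1) * (Nat.size b + 1) := by
  have h1 : Nat.size 1 = 1 := by decide
  have h0 : Nat.size 0 = 0 := by decide
  cases o <;> simp only [ArithOp.eval]
  · exact (nat_size_add_le a b).trans (by nlinarith [Nat.zero_le (Nat.size a * Nat.size b)])
  · exact (nat_size_mono (Nat.sub_le a b)).trans (by nlinarith)
  · exact (nat_size_mul_le a b).trans (by nlinarith)
  · exact (nat_size_mono (Nat.div_le_self a b)).trans (by nlinarith)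
  · exact (nat_size_mono (Nat.mod_le a b)).trans (by nlinarith)
  · split_ifs <;> simp only [h1, h0] <;> nlinarith
  · split_ifs <;> simp only [h1, h0] <;> nlinarith

/-- Every instruction is charged at least the bit length of its result, by induction on the program;
for a loop the last iteration already pays for the result. -/
theorem Prog.size_eval_le_cost : {k : ℕ} → (P : Prog k) → (v : Fin k → ℕ) →
    Nat.size (P.eval v) ≤ P.cost v
  | _, .num c, v => by simp [Prog.eval, Prog.cost]
  | _, .var i, v => by simp [Prog.eval, Prog.cost]
  | _, .arith o a b, v => by
      simp only [Prog.eval, Prog.cost]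
      exact (o.size_eval_le _ _).trans (by omega)
  | _, .cond c a b, v => by
      simp only [Prog.eval, Prog.cost]
      have ha := a.size_eval_le_cost v
      have hb := b.size_eval_le_cost v
      split_ifs <;> omega
  | _, .call f args, v => by
      simp only [Prog.eval, Prog.cost]
      exact (f.size_eval_le_cost _).trans (by omega)
  | _, .loop n init body, v => by
      simp only [Prog.eval, Prog.cost]
      rcases n.eval v with _ | t
      · exact (init.size_eval_le_cost v).trans (by omega)
      · rw [Finset.sum_range_succ]
        have := body.size_eval_le_cost (Fin.cons t (Fin.cons
          (Nat.rec (init.eval v) (fun t acc => body.eval (Fin.cons t (Fin.cons acc v))) t : ℕ) v))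
        simp only
        omega

theorem PT.of_min_polyTime {P : Prog 2} (hP : P.PolyTime) {g : ℕ × ℕ → ℕ} (hg : PT g) :
    PT fun x => min (P.eval ![x.1, x.2]) (g x) := by
  obtain ⟨p, hp⟩ := hP
  obtain ⟨Q, hQ, hQc, hQb⟩ := hg
  have hPc : PolyBdd fun x => P.cost ![x.1, x.2] := ⟨p, fun x => hp _ _⟩
  refine ⟨.cond (.arith .lt P Q) P Q, fun x => ?_, ?_, hQb.mono fun x => min_le_right _ _⟩
  · simp only [Prog.eval, ArithOp.eval, hQ]
    by_cases h : P.eval ![x.1, x.2] < g x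
    · simp [h, h.le]
    · simp [h, not_lt.1 h]
  · refine ((((hPc.add hQc).add ((hPc.add (.const 1)).mul (hQb.add (.const 1)))).add
      (.const 1)).add (hPc.add hQc)).mono fun x => ?_
    simp only [Prog.cost, hQ]
    gcongr
    · exact P.size_eval_le_cost _
    · exact nat_size_le _
    · split_ifs <;> omega

/-- Bundled polynomial-time functions of two numbers. -/
structure PF where
  toFun : ℕ → ℕ → ℕ
  pt : PT fun x => toFun x.1 x.2

/-- Application of a bundled polynomial-time function. -/
def PF.ev (σ : PF) (n i : ℕ) : ℕ := σ.toFun n i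

@[simp]
theorem PF.ev_mk (f : ℕ → ℕ → ℕ) (h : PT fun x => f x.1 x.2) (n i : ℕ) :
    PF.ev ⟨f, h⟩ n i = f n i := rfl

-- The purpose of bundling: a bundled function carries its own proof, so `fun_prop` can treat its
-- applications without looking for hypotheses.
@[fun_prop]
theorem PF.pt_ev (σ : PF) {f g : ℕ × ℕ → ℕ} (hf : PT f) (hg : PT g) :
    PT fun x => σ.ev (f x) (g x) := σ.pt.comp hf hg

/-- Bundled polynomial-time functions of one number. -/
structure PF1 where
  toFun : ℕ → ℕ
  pt : PT fun x => toFun x.1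

/-- Application of a bundled polynomial-time function. -/
def PF1.ev (σ : PF1) (n : ℕ) : ℕ := σ.toFun n

@[simp]
theorem PF1.ev_mk (f : ℕ → ℕ) (h : PT fun x => f x.1) (n : ℕ) : PF1.ev ⟨f, h⟩ n = f n := rfl

@[fun_prop]
theorem PF1.pt_ev (σ : PF1) {f : ℕ × ℕ → ℕ} (hf : PT f) : PT fun x => σ.ev (f x) :=
  σ.pt.comp hf (PT.const 0)

/-- Needed because the size and width of a `UCircuit` are polynomials, whereas a function in `PF1`
is only bounded by one. -/
theorem PF1.exists_polynomial (σ : PF1) : ∃ p : Polynomial ℕ, ∀ n, σ.ev n ≤ p.eval n := by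
  obtain ⟨p, hp⟩ := σ.pt.bdd
  exact ⟨p, fun n => by simpa [ev] using hp (n, 0)⟩

/-- `t ↦ ⌊t / 2^b⌋`. -/
def halve (t b : ℕ) : ℕ := t / 2 ^ b

theorem halve_succ (t b : ℕ) : halve t (b + 1) = halve t b / 2 := by
  rw [halve, halve, Nat.div_div_eq_div_mul, pow_succ]

-- The power `2 ^ b` is not polynomially bounded and must not be computed. Halving `b` times keeps
-- all intermediate values below the argument.
@[fun_prop]
theorem PT.halve {f g : ℕ × ℕ → ℕ} (hf : PT f) (hg : PT g) :
    PT fun x => halve (f x) (g x) := by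
  suffices h : PT fun x => CertFE.halve x.1 x.2 from h.comp hf hg
  have hv : ∀ x : ℕ × ℕ, ∀ b : ℕ, (Nat.rec (x.1 : ℕ) (fun _ acc => acc / 2) b : ℕ) =
      CertFE.halve x.1 b := by
    intro x b
    induction b with
    | zero => simp [CertFE.halve]
    | succ b ih => rw [halve_succ, ← ih]
  have hle : ∀ t b, CertFE.halve t b ≤ t := fun t b => Nat.div_le_self _ _
  refine ⟨.loop (.var 1) (.var 0) (.arith .div (.var 1) (.num 2)), fun x => ?_, ?_,
    PolyBdd.fst.mono fun x => hle _ _⟩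
  · simpa [Prog.eval, ArithOp.eval] using hv x x.2
  · refine (((PolyBdd.snd.add (.const 1)).add (PolyBdd.fst.add (.const 1))).add (.const 1) |>.add
      (PolyBdd.snd.mul ((PolyBdd.const 1).add (((PolyBdd.fst.add (.const 1)).add (.const 3)).add
        ((PolyBdd.fst.add (.const 1)).mul (.const 3)))))).mono fun x => ?_
    simp only [Prog.cost, Prog.eval, ArithOp.eval]
    have h2 : Nat.size 2 = 2 := by decide
    gcongr
    · exact nat_size_le _
    · exact nat_size_le _
    · refine (Finset.sum_le_card_nsmul _ _ (1 + (x.1 + 1 + 3 + (x.1 + 1) * 3)) fun b _ => ?_).trans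
        (by simp)
      have hb : Nat.size (CertFE.halve x.1 b) ≤ x.1 := (nat_size_le _).trans (hle _ _)
      have hv' := hv x b
      simp only [Matrix.cons_val_zero, Fin.cons_one, Fin.cons_zero, h2] at hv' ⊢
      rw [hv']
      gcongr

/-! ## Action of gate lists -/

/-- The action of a gate as a linear map. -/
def Gate.lin {W : ℕ} (g : Gate) : (BV W → ℂ) →ₗ[ℂ] (BV W → ℂ) where
  toFun := g.act
  map_add' φ ψ := by
    cases g <;> funext z <;> simp only [Gate.act, Pi.add_apply] <;> split_ifs <;> ring
  map_smul' c φ := by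
    cases g <;> funext z <;> simp only [Gate.act, Pi.smul_apply, smul_eq_mul, RingHom.id_apply] <;>
      split_ifs <;> ring

/-- The action of a list of gates. -/
def run {W : ℕ} (gs : List Gate) (ψ : BV W → ℂ) : BV W → ℂ := gs.foldl (fun ψ g => g.act ψ) ψ

@[simp] theorem run_nil {W : ℕ} (ψ : BV W → ℂ) : run [] ψ = ψ := rfl

@[simp] theorem run_cons {W : ℕ} (g : Gate) (gs : List Gate) (ψ : BV W → ℂ) :
    run (g :: gs) ψ = run gs (g.act ψ) := rfl

theorem run_append {W : ℕ} (gs hs : List Gate) (ψ : BV W → ℂ) :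
    run (gs ++ hs) ψ = run hs (run gs ψ) := List.foldl_append

theorem run_sum {W : ℕ} {ι : Type*} (gs : List Gate) (s : Finset ι) (c : ι → ℂ)
    (ψ : ι → BV W → ℂ) : run gs (∑ i ∈ s, c i • ψ i) = ∑ i ∈ s, c i • run gs (ψ i) := by
  induction gs generalizing ψ with
  | nil => rfl
  | cons g gs ih =>
    have h : g.act (∑ i ∈ s, c i • ψ i) = ∑ i ∈ s, c i • g.act (ψ i) := by
      have h1 := map_sum (g.lin (W := W)) (fun i => c i • ψ i) s
      simp only [map_smul] at h1
      exact h1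
    simp only [run_cons, h, ih]

/-! ### Unitarity -/

theorem flipIf_flipIf {W : ℕ} (z : BV W) (a : ℕ) (v : Bool) : flipIf (flipIf z a v) a v = z := by
  funext i
  simp only [flipIf]
  split_ifs <;> cases z i <;> cases v <;> rfl

theorem getBit_flipIf {W : ℕ} (z : BV W) {a b : ℕ} (v : Bool) (h : b ≠ a) :
    getBit (flipIf z a v) b = getBit z b := by
  simp only [getBit, flipIf]
  split_ifs <;> rfl

theorem involutive_cnot {W : ℕ} {a b : ℕ} (h : a ≠ b) :
    Function.Involutive fun z : BV W => flipIf z b (getBit z a) := fun z => by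
  simp only [getBit_flipIf _ _ h, flipIf_flipIf]

theorem involutive_toff {W : ℕ} {a b c : ℕ} (ha : a ≠ c) (hb : b ≠ c) :
    Function.Involutive fun z : BV W => flipIf z c (getBit z a && getBit z b) := fun z => by
  simp only [getBit_flipIf _ _ ha, getBit_flipIf _ _ hb, flipIf_flipIf]

theorem setBit_flipIf {W : ℕ} (z : BV W) (a : ℕ) (u v : Bool) :
    setBit (flipIf z a u) a v = setBit z a v := by
  funext i
  simp only [setBit, flipIf]
  split_ifs <;> rfl

theorem setBit_getBit {W : ℕ} (z : BV W) (a : ℕ) : setBit z a (getBit z a) = z := by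
  funext i
  simp only [setBit, getBit]
  split_ifs with h h' <;> first | rfl | (exfalso; omega) | (subst h; rfl)

theorem flipIf_true {W : ℕ} (z : BV W) {a : ℕ} (h : a < W) :
    flipIf z a true = setBit z a (!getBit z a) := by
  funext i
  simp only [setBit, getBit, flipIf, h, dite_true]
  split_ifs with h' <;> first | rfl | (subst h'; simp)

theorem getBit_flipIf_true {W : ℕ} (z : BV W) {a : ℕ} (h : a < W) :
    getBit (flipIf z a true) a = !getBit z a := by
  simp [getBit, flipIf, h]

/-- NOT, CNOT and Toffoli permute the basis by involutions, which only reindexes the sum. The gate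
`T` multiplies by phases. Only the Hadamard gate mixes basis states, and it does so in pairs. -/
theorem Gate.act_inner {W : ℕ} (g : Gate) (φ ψ : BV W → ℂ) :
    ∑ z, star (g.act φ z) * g.act ψ z = ∑ z, star (φ z) * ψ z := by
  have key : ∀ F : BV W → BV W, Function.Involutive F →
      ∑ z, star (φ (F z)) * ψ (F z) = ∑ z, star (φ z) * ψ z := fun F hF =>
    Equiv.sum_comp hF.toPerm fun z => star (φ z) * ψ z
  cases g with
  | skip => rfl
  | had a =>
    by_cases ha : a < W
    · simp only [Gate.act, ha, if_true]
      have hF : Function.Involutive fun z : BV W => flipIf z a true := fun z => flipIf_flipIf z a _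
      -- Both sums are doubled and one copy is reindexed by flipping wire `a`. Each summand then
      -- contains the two basis states that the gate mixes, and the identity holds summand by
      -- summand.
      refine mul_left_cancel₀ (two_ne_zero' ℂ) ?_
      rw [two_mul, two_mul]
      conv_lhs => arg 2; rw [← Equiv.sum_comp hF.toPerm]
      conv_rhs => arg 2; rw [← Equiv.sum_comp hF.toPerm]
      rw [← Finset.sum_add_distrib, ← Finset.sum_add_distrib]
      refine Finset.sum_congr rfl fun z _ => ?_
      simp only [Function.Involutive.coe_toPerm, setBit_flipIf, getBit_flipIf_true z ha]
      rw [flipIf_true z ha]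
      have h2 : (Real.sqrt 2 : ℂ) * (Real.sqrt 2 : ℂ) = 2 := by
        rw [← Complex.ofReal_mul, Real.mul_self_sqrt (by norm_num)]; norm_num
      have h0 : (Real.sqrt 2 : ℂ) ≠ 0 := by
        intro h; rw [h] at h2; norm_num at h2
      have hz : star (φ z) * ψ z =
          star (φ (setBit z a (getBit z a))) * ψ (setBit z a (getBit z a)) := by
        rw [setBit_getBit]
      rw [hz]
      cases hb : getBit z a <;>
        simp only [Bool.not_false, Bool.not_true, Bool.false_eq_true, if_true, if_false,
          star_div₀, star_add, star_neg, Complex.star_def,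
          Complex.conj_ofReal, one_mul, neg_mul] <;> field_simp <;> rw [sq, h2] <;> ring
    · simp only [Gate.act, ha, if_false]
  | tee a =>
    refine Finset.sum_congr rfl fun z _ => ?_
    simp only [Gate.act]
    have h : star (Complex.exp (Complex.I * (Real.pi / 4 : ℝ))) *
        Complex.exp (Complex.I * (Real.pi / 4 : ℝ)) = 1 := by
      rw [Complex.star_def, ← Complex.exp_conj, ← Complex.exp_add, map_mul, Complex.conj_I,
        Complex.conj_ofReal]
      simp
    split_ifs
    · rw [star_mul]
      linear_combination (star (φ z) * ψ z) * h
    · simp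
  | not a => exact key _ fun z => flipIf_flipIf z a _
  | cnot a b =>
    by_cases h : a = b
    · simp only [Gate.act, h, if_true]
    · simp only [Gate.act, h, if_false]
      exact key _ (involutive_cnot h)
  | toff a b c =>
    by_cases h : a = c ∨ b = c
    · simp only [Gate.act, h, if_true]
    · simp only [Gate.act, h, if_false]
      push Not at h
      exact key _ (involutive_toff h.1 h.2)

theorem run_inner {W : ℕ} (gs : List Gate) (φ ψ : BV W → ℂ) :
    ∑ z, star (run gs φ z) * run gs ψ z = ∑ z, star (φ z) * ψ z := by
  induction gs generalizing φ ψ with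
  | nil => rfl
  | cons g gs ih => rw [run_cons, run_cons, ih, g.act_inner]

/-! ### Basis states -/

/-- The first `W` bits of an infinite bit string. -/
def trunc (W : ℕ) (Z : ℕ → Bool) : BV W := fun i => Z i

/-- The basis state given by the first `W` bits of an infinite bit string. -/
def ket (W : ℕ) (Z : ℕ → Bool) : BV W → ℂ := Pi.single (trunc W Z) 1

theorem ket_apply (W : ℕ) (Z : ℕ → Bool) (z : BV W) :
    ket W Z z = if z = trunc W Z then 1 else 0 := by
  rw [ket, Pi.single_apply]

theorem ket_congr {W : ℕ} {Z Z' : ℕ → Bool} (h : ∀ i, i < W → Z i = Z' i) : ket W Z = ket W Z' := by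
  have : trunc W Z = trunc W Z' := funext fun i => h i i.isLt
  rw [ket, ket, this]

theorem getBit_trunc {W a : ℕ} (Z : ℕ → Bool) (h : a < W) : getBit (trunc W Z) a = Z a := by
  simp [getBit, trunc, h]

/-- Flip the bit at position `a` if `v` is true. -/
def flipAt (Z : ℕ → Bool) (a : ℕ) (v : Bool) : ℕ → Bool :=
  fun i => if i = a then xor (Z i) v else Z i

theorem single_comp_involutive {α : Type*} [DecidableEq α] {F : α → α}
    (hF : Function.Involutive F) (a : α) :
    (fun z => (Pi.single a (1 : ℂ) : α → ℂ) (F z)) = Pi.single (F a) 1 := by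
  funext z
  simp only [Pi.single_apply, hF.eq_iff]

/-- A gate which adds to the target `c` the constant `1` (`k = 1`), the bit `a` (`k = 2`), or the
product of the bits `a` and `b` (`k ≥ 3`). -/
def termGate (k a b c : ℕ) : Gate :=
  if k = 0 then .skip else if k = 1 then .not c else if k = 2 then .cnot a c else .toff a b c

/-- The bit added by `termGate`. -/
def termVal (k a b : ℕ) (Z : ℕ → Bool) : Bool :=
  if k = 0 then false else if k = 1 then true else if k = 2 then Z a else Z a && Z b

theorem termGate_act {W k a b c : ℕ} (Z : ℕ → Bool) (ha : 2 ≤ k → a < W ∧ a ≠ c)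
    (hb : 3 ≤ k → b < W ∧ b ≠ c) :
    (termGate k a b c).act (ket W Z) = ket W (flipAt Z c (termVal k a b Z)) := by
  unfold termGate termVal
  split_ifs with h0 h1 h2
  · refine ket_congr fun i _ => ?_
    simp [flipAt]
  · exact single_comp_involutive (fun z => flipIf_flipIf z c true) (trunc W Z)
  · obtain ⟨ha, hac⟩ := ha (by omega)
    simp only [Gate.act, hac, if_false]
    rw [← getBit_trunc Z ha]
    exact single_comp_involutive (involutive_cnot hac) (trunc W Z)
  · obtain ⟨ha, hac⟩ := ha (by omega)
    obtain ⟨hb, hbc⟩ := hb (by omega)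
    simp only [Gate.act, hac, hbc, or_self, if_false]
    rw [← getBit_trunc Z ha, ← getBit_trunc Z hb]
    exact single_comp_involutive (involutive_toff hac hbc) (trunc W Z)

/-! ### Acting on a block of wires -/

/-- The gate that acts like `g` on the `w` wires from wire `o` on. -/
def Gate.shift (o w : ℕ) : Gate → Gate
  | .skip => .skip
  | .had a => if a < w then .had (o + a) else .skip
  | .tee a => if a < w then .tee (o + a) else .skip
  | .not a => if a < w then .not (o + a) else .skip
  | .cnot a b => if a < w ∧ b < w then .cnot (o + a) (o + b) else .skip
  | .toff a b c => if a < w ∧ b < w ∧ c < w then .toff (o + a) (o + b) (o + c) else .skip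

/-- The part of a bit string in a block. -/
def block {W : ℕ} (o w : ℕ) (z : BV W) : BV w := fun i => getBit z (o + i)

/-- The state which is `φ` on a block, and as in `Z` elsewhere. -/
def lift {w : ℕ} (W o : ℕ) (Z : ℕ → Bool) (φ : BV w → ℂ) : BV W → ℂ := fun z =>
  if ∀ i : Fin W, ¬ (o ≤ i.val ∧ i.val < o + w) → z i = Z i then φ (block o w z) else 0

section lift

variable {W o w : ℕ}

theorem getBit_block (z : BV W) {a : ℕ} (h : a < w) :
    getBit (block o w z) a = getBit z (o + a) := by
  simp [getBit, block, h]

theorem block_setBit (hW : o + w ≤ W) (z : BV W) {a : ℕ} (v : Bool) :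
    block o w (setBit z (o + a) v) = setBit (block o w z) a v := by
  funext i
  have := i.isLt
  have h : o + i.val < W := by omega
  simp [block, setBit, getBit, h]

theorem block_flipIf (hW : o + w ≤ W) (z : BV W) {a : ℕ} (v : Bool) :
    block o w (flipIf z (o + a) v) = flipIf (block o w z) a v := by
  funext i
  have := i.isLt
  have h : o + i.val < W := by omega
  simp [block, flipIf, getBit, h]

theorem agree_setBit (z : BV W) (Z : ℕ → Bool) {a : ℕ} (ha : a < w) (v : Bool) :
    (∀ i : Fin W, ¬ (o ≤ i.val ∧ i.val < o + w) → setBit z (o + a) v i = Z i) ↔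
      ∀ i : Fin W, ¬ (o ≤ i.val ∧ i.val < o + w) → z i = Z i := by
  refine forall_congr' fun i => imp_congr_right fun hi => ?_
  have : i.val ≠ o + a := by omega
  simp [setBit, this]

theorem agree_flipIf (z : BV W) (Z : ℕ → Bool) {a : ℕ} (ha : a < w) (v : Bool) :
    (∀ i : Fin W, ¬ (o ≤ i.val ∧ i.val < o + w) → flipIf z (o + a) v i = Z i) ↔
      ∀ i : Fin W, ¬ (o ≤ i.val ∧ i.val < o + w) → z i = Z i := by
  refine forall_congr' fun i => imp_congr_right fun hi => ?_
  have : i.val ≠ o + a := by omega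
  simp [flipIf, this]

theorem flipIf_of_le (z : BV W) {a : ℕ} (h : W ≤ a) (v : Bool) : flipIf z a v = z := by
  funext i
  have : i.val ≠ a := by omega
  simp [flipIf, this]

theorem getBit_of_le (z : BV W) {a : ℕ} (h : W ≤ a) : getBit z a = false := by
  simp [getBit, not_lt.2 h]

theorem flipIf_false (z : BV W) (a : ℕ) : flipIf z a false = z := by
  funext i
  simp [flipIf]

/-- On `w` wires a gate that names a missing wire is trivial: a missing control reads zero and a
missing target cannot be flipped. On the larger register the same wire number would hit a
neighbouring block; this is why `Gate.shift` turns such gates into `skip`, and why no assumption on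
the gate is needed. -/
theorem Gate.act_lift (hW : o + w ≤ W) (g : Gate) (Z : ℕ → Bool) (φ : BV w → ℂ) :
    (g.shift o w).act (lift W o Z φ) = lift W o Z (g.act φ) := by
  funext z
  cases g with
  | skip => rfl
  | had a =>
    by_cases ha : a < w
    · have ha' : o + a < W := by omega
      simp only [Gate.shift, ha, if_true, Gate.act, ha', lift, agree_setBit z Z ha,
        block_setBit hW, getBit_block z ha]
      split_ifs <;> simp
    · simp only [Gate.shift, ha, if_false, Gate.act]
  | tee a =>
    by_cases ha : a < w
    · simp only [Gate.shift, ha, if_true, Gate.act, lift, getBit_block z ha]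
      split_ifs <;> simp
    · simp only [Gate.shift, ha, if_false, Gate.act]
      simp [getBit_of_le _ (not_lt.1 ha)]
  | not a =>
    by_cases ha : a < w
    · simp only [Gate.shift, ha, if_true, Gate.act, lift, agree_flipIf z Z ha, block_flipIf hW]
    · simp only [Gate.shift, ha, if_false, Gate.act]
      simp only [flipIf_of_le _ (not_lt.1 ha)]
  | cnot a b =>
    by_cases h : a < w ∧ b < w
    · simp only [Gate.shift, h, and_self, if_true, Gate.act, lift, agree_flipIf z Z h.2,
        block_flipIf hW, getBit_block z h.1, add_right_inj]
      split_ifs <;> rfl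
    · simp only [Gate.shift, h, if_false, Gate.act]
      by_cases ha : a < w
      · simp only [flipIf_of_le _ (not_lt.1 fun hb => h ⟨ha, hb⟩), ite_self]
      · simp only [getBit_of_le _ (not_lt.1 ha), flipIf_false, ite_self]
  | toff a b c =>
    by_cases h : a < w ∧ b < w ∧ c < w
    · simp only [Gate.shift, h, and_self, if_true, Gate.act, lift, agree_flipIf z Z h.2.2,
        block_flipIf hW, getBit_block z h.1, getBit_block z h.2.1, add_right_inj]
      split_ifs <;> rfl
    · simp only [Gate.shift, h, if_false, Gate.act]
      by_cases ha : a < w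
      · by_cases hb : b < w
        · simp only [flipIf_of_le _ (not_lt.1 fun hc => h ⟨ha, hb, hc⟩), ite_self]
        · simp only [getBit_of_le _ (not_lt.1 hb), Bool.and_false, flipIf_false, ite_self]
      · simp only [getBit_of_le _ (not_lt.1 ha), Bool.false_and, flipIf_false, ite_self]

theorem run_lift (hW : o + w ≤ W) (gs : List Gate) (Z : ℕ → Bool) (φ : BV w → ℂ) :
    run (gs.map (Gate.shift o w)) (lift W o Z φ) = lift W o Z (run gs φ) := by
  induction gs generalizing φ with
  | nil => rfl
  | cons g gs ih => rw [List.map_cons, run_cons, g.act_lift hW, ih, run_cons]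

/-- Overwrite a block of a bit string. -/
def overwr (o w : ℕ) (Z v : ℕ → Bool) : ℕ → Bool :=
  fun i => if o ≤ i ∧ i < o + w then v (i - o) else Z i

theorem lift_ket (hW : o + w ≤ W) (Z v : ℕ → Bool) :
    lift W o Z (ket w v) = ket W (overwr o w Z v) := by
  funext z
  simp only [lift, ket_apply]
  rw [← ite_and]
  congr 1
  simp only [eq_iff_iff]
  constructor
  · rintro ⟨h1, h2⟩
    funext i
    by_cases hi : o ≤ i.val ∧ i.val < o + w
    · have h3 := congrFun h2 ⟨i.val - o, by omega⟩
      have h4 : o + (i.val - o) = i.val := by omega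
      simp only [block, trunc, getBit, h4, i.isLt, dite_true] at h3
      simp only [trunc, overwr, hi, and_self, if_true]
      exact h3
    · simp only [trunc, overwr, hi, if_false]
      exact h1 i hi
  · rintro rfl
    constructor
    · intro i hi
      simp only [trunc, overwr, hi, if_false]
    · funext i
      have := i.isLt
      have h : o + i.val < W := by omega
      simp [block, trunc, getBit, overwr, h]

theorem lift_sum {ι : Type*} (s : Finset ι) (Z : ℕ → Bool) (c : ι → ℂ) (φ : ι → BV w → ℂ) :
    lift W o Z (∑ i ∈ s, c i • φ i) = ∑ i ∈ s, c i • lift W o Z (φ i) := by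
  funext z
  simp only [lift, Finset.sum_apply, Pi.smul_apply]
  split_ifs <;> simp

/-- Shifting by zero only discards references to wires that do not exist. It normalises the gates of
an arbitrary circuit so that their descriptions become polynomially bounded. -/
theorem Gate.act_shift_zero (g : Gate) (ψ : BV W → ℂ) : (g.shift 0 W).act ψ = g.act ψ := by
  have h : ∀ φ : BV W → ℂ, lift W 0 (fun _ => false) φ = φ := by
    intro φ
    funext z
    have : block 0 W z = z := by
      funext i
      simp [block, getBit]
    simp [lift, this]
  have := Gate.act_lift (o := 0) (w := W) (W := W) (by simp) g (fun _ => false) ψ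
  rwa [h, h] at this

end lift

/-! ## Uniform families of gates -/

/-- Families of gates described by polynomial-time functions. -/
@[fun_prop]
def UG (g : ℕ × ℕ → Gate) : Prop :=
  ∃ k a b c : ℕ × ℕ → ℕ, PT k ∧ PT a ∧ PT b ∧ PT c ∧
    ∀ x, g x = Gate.ofNat (k x) (a x) (b x) (c x)

namespace UG

theorem comp {g : ℕ × ℕ → Gate} {f h : ℕ × ℕ → ℕ} (hg : UG g) (hf : PT f) (hh : PT h) :
    UG fun x => g (f x, h x) := by
  obtain ⟨k, a, b, c, hk, ha, hb, hc, H⟩ := hg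
  exact ⟨_, _, _, _, hk.comp hf hh, ha.comp hf hh, hb.comp hf hh, hc.comp hf hh, fun x => H _⟩

theorem ite {g g' : ℕ × ℕ → Gate} {p : ℕ × ℕ → Prop} [∀ x, Decidable (p x)] (hp : PTd p)
    (hg : UG g) (hg' : UG g') : UG fun x => if p x then g x else g' x := by
  obtain ⟨k, a, b, c, hk, ha, hb, hc, H⟩ := hg
  obtain ⟨k', a', b', c', hk', ha', hb', hc', H'⟩ := hg'
  refine ⟨_, _, _, _, .ite hp hk hk', .ite hp ha ha', .ite hp hb hb', .ite hp hc hc', fun x => ?_⟩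
  by_cases hx : p x <;> simp [hx, H, H']

theorem skip : UG fun _ => Gate.skip :=
  ⟨_, _, _, _, .const 0, .const 0, .const 0, .const 0, fun _ => rfl⟩

theorem had {a : ℕ × ℕ → ℕ} (ha : PT a) : UG fun x => Gate.had (a x) :=
  ⟨_, _, _, _, .const 1, ha, .const 0, .const 0, fun _ => rfl⟩

theorem termGate {k a b c : ℕ × ℕ → ℕ} (hk : PT k) (ha : PT a) (hb : PT b) (hc : PT c) :
    UG fun x => termGate (k x) (a x) (b x) (c x) := by
  refine ⟨fun x => if k x = 0 then 0 else if k x = 1 then 3 else if k x = 2 then 4 else 5,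
    fun x => if k x = 1 then c x else a x, fun x => if k x = 2 then c x else b x, c,
    by fun_prop, by fun_prop, by fun_prop, hc, fun x => ?_⟩
  simp only [CertFE.termGate]
  split_ifs <;> rfl

/-- The numbers describing a gate may be huge, but the shifted gate depends only on their
truncations: all kinds from 6 on are `skip`, and a relevant wire number that reaches `w` makes the
gate trivial. -/
theorem shift_of_min {k a b c o w : ℕ × ℕ → ℕ} (hk : PT fun x => min (k x) 6)
    (ha : PT fun x => min (a x) (w x)) (hb : PT fun x => min (b x) (w x))
    (hc : PT fun x => min (c x) (w x)) (ho : PT o) (hw : PT w) :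
    UG fun x => (Gate.ofNat (k x) (a x) (b x) (c x)).shift (o x) (w x) := by
  refine ⟨fun x => if (min (k x) 6 ≤ 3 ∧ min (a x) (w x) < w x) ∨
      (min (k x) 6 = 4 ∧ min (a x) (w x) < w x ∧ min (b x) (w x) < w x) ∨
      (min (k x) 6 = 5 ∧ min (a x) (w x) < w x ∧ min (b x) (w x) < w x ∧ min (c x) (w x) < w x)
      then min (k x) 6 else 0, fun x => o x + min (a x) (w x), fun x => o x + min (b x) (w x),
      fun x => o x + min (c x) (w x), by fun_prop, by fun_prop, by fun_prop, by fun_prop,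
      fun x => ?_⟩
  have hlt : ∀ a w : ℕ, min a w < w ↔ a < w := fun a w => by simp
  have hm : ∀ a w : ℕ, a < w → min a w = a := fun a w h => min_eq_left h.le
  simp only [hlt]
  by_cases h6 : 6 ≤ k x
  · have h0 : Gate.ofNat (k x) (a x) (b x) (c x) = .skip := by
      obtain ⟨t, ht⟩ := Nat.exists_eq_add_of_le h6
      rw [ht, add_comm]; rfl
    rw [h0, min_eq_right h6]
    simp [Gate.shift, Gate.ofNat]
  · rw [min_eq_left (by omega)]
    generalize hk : k x = K at *
    have h6' : K < 6 := by omega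
    interval_cases K <;> simp only [Gate.ofNat, Gate.shift] <;>
      simp (config := { decide := true }) only [false_and, true_and, false_or, or_false] <;>
      split_ifs with h
    all_goals first | rfl | simp [hm _ _ h] | simp [hm _ _ h.1, hm _ _ h.2] |
        simp [hm _ _ h.1, hm _ _ h.2.1, hm _ _ h.2.2]

theorem shift {g : ℕ × ℕ → Gate} (hg : UG g) {o w : ℕ × ℕ → ℕ} (ho : PT o) (hw : PT w) :
    UG fun x => (g x).shift (o x) (w x) := by
  obtain ⟨k, a, b, c, hk, ha, hb, hc, H⟩ := hg
  simp only [H]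
  exact shift_of_min (by fun_prop) (by fun_prop) (by fun_prop) (by fun_prop) ho hw

end UG

/-- The list of the first `m` gates of the `n`-th member of a family. -/
def circ (g : ℕ × ℕ → Gate) (m n : ℕ) : List Gate := (List.range m).map fun i => g (n, i)

theorem circ_add (g : ℕ × ℕ → Gate) (m k n : ℕ) :
    circ g (m + k) n = circ g m n ++ (List.range k).map fun i => g (n, m + i) := by
  simp [circ, List.range_add]

theorem circ_congr {g g' : ℕ × ℕ → Gate} {m n : ℕ} (h : ∀ i, i < m → g (n, i) = g' (n, i)) :
    circ g m n = circ g' m n :=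
  List.map_congr_left fun i hi => h i (List.mem_range.1 hi)

/-! ## Encodings as infinite bit strings -/

/-- The length of the encodings. -/
def ln (X : ℕ → Type) [∀ n, BitRep (X n)] (n : ℕ) : ℕ := BitRep.len (X n)

/-- The length of the encodings is a polynomial-time function of the parameter. -/
class PTLen (X : ℕ → Type) [∀ n, BitRep (X n)] : Prop where
  pt : PT fun x => ln X x.1

@[fun_prop]
theorem PT.ln {X : ℕ → Type} [∀ n, BitRep (X n)] [h : PTLen X] {f : ℕ × ℕ → ℕ} (hf : PT f) :
    PT fun x => ln X (f x) := h.pt.comp hf (.const 0)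

/-- An encoding, followed by zeros. -/
def pad {X : Type} [BitRep X] (x : X) : ℕ → Bool :=
  fun i => if i < BitRep.len X then BitRep.code x i else false

theorem pad_of_le {X : Type} [BitRep X] (x : X) {i : ℕ} (h : BitRep.len X ≤ i) :
    pad x i = false := by simp [pad, not_lt.2 h]

theorem pad_injective {X : Type} [BitRep X] : Function.Injective (pad : X → ℕ → Bool) :=
  fun x y h => BitRep.inj x y fun i hi => by simpa [pad, hi] using congrFun h i

theorem pad_prod {X Y : Type} [BitRep X] [BitRep Y] (p : X × Y) (i : ℕ) :
    pad p i = if i < BitRep.len X then pad p.1 i else pad p.2 (i - BitRep.len X) := by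
  simp only [pad, BitRep.len, BitRep.code]
  split_ifs <;> first | rfl | omega

section PTLen

variable {X Y : ℕ → Type} [∀ n, BitRep (X n)] [∀ n, BitRep (Y n)]

instance : PTLen fun _ => Unit := ⟨PT.const 0⟩

instance : PTLen fun _ => Bool := ⟨PT.const 1⟩

instance [PTLen X] [PTLen Y] : PTLen fun n => X n × Y n := ⟨by
  have : PT fun x => ln X x.1 + ln Y x.1 := by fun_prop
  exact this⟩

instance [PTLen X] [PTLen Y] : PTLen fun n => X n ⊕ Y n := ⟨by
  have : PT fun x => 1 + ln X x.1 + ln Y x.1 := by fun_prop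
  exact this⟩

instance [PTLen X] : PTLen fun n => Option (X n) := ⟨by
  have : PT fun x => 1 + ln X x.1 := by fun_prop
  exact this⟩

instance [PTLen X] : PTLen fun n => Bool → X n := ⟨by
  have : PT fun x => ln X x.1 + ln X x.1 := by fun_prop
  exact this⟩

instance [PTLen X] (p : Polynomial ℕ) : PTLen fun n => Fin (p.eval n) → X n := ⟨by
  have : PT fun x => p.eval x.1 * ln X x.1 := by fun_prop
  exact this⟩

instance [PTLen X] (p : PF1) : PTLen fun n => Fin (p.ev n) → X n := ⟨by
  have : PT fun x => p.ev x.1 * ln X x.1 := by fun_prop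
  exact this⟩

instance (p : Polynomial ℕ) : PTLen fun n => Fin (p.eval n) := ⟨by
  have : PT fun x => p.eval x.1 := by fun_prop
  exact this⟩

end PTLen

/-! ## Exactly implementable families of matrices -/

section EI

variable {R S T S' T' : ℕ → Type} [∀ n, BitRep (R n)] [∀ n, BitRep (S n)] [∀ n, BitRep (T n)]
  [∀ n, BitRep (S' n)] [∀ n, BitRep (T' n)]

/-- The matrices are implemented, without any leftover, by a uniform family of circuits: the
encoding of `s` is taken to the superposition of the encodings of all `t`, with amplitudes
`V n t s`. -/
def EI [∀ n, Fintype (T n)] (V : ∀ n, T n → S n → ℂ) : Prop :=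
  ∃ (g : ℕ × ℕ → Gate) (m w : PF1), UG g ∧ ∀ n, ln S n ≤ w.ev n ∧ ln T n ≤ w.ev n ∧
    ∀ s, run (circ g (m.ev n) n) (ket (w.ev n) (pad s)) = ∑ t, V n t s • ket (w.ev n) (pad t)

open Classical in
/-- The matrix of a function. -/
def fmat {S T : Type} (v : S → T) (t : T) (s : S) : ℂ := if t = v s then 1 else 0

/-- The function on basis states is implemented by a uniform family of circuits. -/
def EIf (v : ∀ n, S n → T n) : Prop :=
  ∃ (g : ℕ × ℕ → Gate) (m w : PF1), UG g ∧ ∀ n, ln S n ≤ w.ev n ∧ ln T n ≤ w.ev n ∧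
    ∀ s, run (circ g (m.ev n) n) (ket (w.ev n) (pad s)) = ket (w.ev n) (pad (v n s))

theorem EI.intro [∀ n, Fintype (T n)] {V : ∀ n, T n → S n → ℂ} (g : ℕ × ℕ → Gate) (m w : ℕ → ℕ)
    (hg : UG g) (hm : PT fun x => m x.1) (hw : PT fun x => w x.1)
    (h : ∀ n, ln S n ≤ w n ∧ ln T n ≤ w n ∧
      ∀ s, run (circ g (m n) n) (ket (w n) (pad s)) = ∑ t, V n t s • ket (w n) (pad t)) : EI V :=
  ⟨g, ⟨m, hm⟩, ⟨w, hw⟩, hg, h⟩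

theorem EIf.intro {v : ∀ n, S n → T n} (g : ℕ × ℕ → Gate) (m w : ℕ → ℕ)
    (hg : UG g) (hm : PT fun x => m x.1) (hw : PT fun x => w x.1)
    (h : ∀ n, ln S n ≤ w n ∧ ln T n ≤ w n ∧
      ∀ s, run (circ g (m n) n) (ket (w n) (pad s)) = ket (w n) (pad (v n s))) : EIf v :=
  ⟨g, ⟨m, hm⟩, ⟨w, hw⟩, hg, h⟩

theorem sum_fmat {S T : Type} [Fintype T] {M : Type*} [AddCommMonoid M] [Module ℂ M]
    (v : S → T) (s : S) (F : T → M) : ∑ t, fmat v t s • F t = F (v s) := by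
  classical
  rw [Finset.sum_eq_single (v s)]
  · simp [fmat]
  · intro t _ h
    simp [fmat, h]
  · simp

theorem eif_iff [∀ n, Fintype (T n)] {v : ∀ n, S n → T n} : EIf v ↔ EI fun n => fmat (v n) := by
  simp only [EIf, EI, sum_fmat]

/-- A bit string that agrees with an encoding on a block is that encoding lifted to the block, and
`lift` is linear. The wires outside the block are arbitrary, so this serves sequential composition,
framing and tensor powers alike. -/
theorem EI.run_shift_aux {W o w : ℕ} {gs : List Gate} {S T : Type} [BitRep S] [BitRep T]
    [Fintype T] {c : T → ℂ} {s : S} (hW : o + w ≤ W) {Z : ℕ → Bool}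
    (hZ : ∀ i, i < w → Z (o + i) = pad s i)
    (h : run gs (ket w (pad s)) = ∑ t, c t • ket w (pad t)) :
    run (gs.map (Gate.shift o w)) (ket W Z) = ∑ t, c t • ket W (overwr o w Z (pad t)) := by
  have h1 : ket W Z = lift W o Z (ket w (pad s)) := by
    rw [lift_ket hW]
    refine ket_congr fun i _ => ?_
    simp only [overwr]
    split_ifs with hi
    · rw [← hZ _ (by omega)]
      congr 1
      omega
    · rfl
  rw [h1, run_lift hW, h, lift_sum]
  simp only [lift_ket hW]

/-- Encodings are followed by zeros, so a circuit narrower than the register but wide enough for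
both encodings replaces one padded encoding by the other. -/
theorem overwr_zero_pad {w : ℕ} {S T : Type} [BitRep S] [BitRep T] (s : S) (t : T)
    (hS : BitRep.len S ≤ w) (hT : BitRep.len T ≤ w) : overwr 0 w (pad s) (pad t) = pad t := by
  funext i
  simp only [overwr, Nat.zero_le, true_and, zero_add, Nat.sub_zero]
  split_ifs with h
  · rfl
  · rw [pad_of_le _ (by omega), pad_of_le _ (by omega)]

theorem overwr_pad_prod {R S T : Type} [BitRep R] [BitRep S] [BitRep T] {w : ℕ} (r : R) (s : S)
    (t : T) (hS : BitRep.len S ≤ w) (hT : BitRep.len T ≤ w) :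
    overwr (BitRep.len R) w (pad (r, s)) (pad t) = pad (r, t) := by
  funext i
  simp only [overwr, pad_prod]
  split_ifs <;> first | rfl | omega | (rw [pad_of_le _ (by omega), pad_of_le _ (by omega)])

/-- Concatenation works because nothing is left over: all wires beyond the intermediate encoding
have returned to zero, which is the form of input that the second circuit expects. The two circuits
may have different widths and are run side by side from wire zero. -/
theorem EI.comp [∀ n, Fintype (S n)] [∀ n, Fintype (T n)] {V : ∀ n, S n → R n → ℂ}
    {V' : ∀ n, T n → S n → ℂ} (hV : EI V) (hV' : EI V') :
    EI fun n t r => ∑ s, V' n t s * V n s r := by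
  obtain ⟨g, m, w, hg, H⟩ := hV
  obtain ⟨g', m', w', hg', H'⟩ := hV'
  refine EI.intro (fun x => if x.2 < m.ev x.1 then (g x).shift 0 (w.ev x.1) else
      (g' (x.1, x.2 - m.ev x.1)).shift 0 (w'.ev x.1)) (fun n => m.ev n + m'.ev n)
    (fun n => w.ev n + w'.ev n) ?_ (by fun_prop) (by fun_prop) fun n => ?_
  · exact UG.ite (by fun_prop) (hg.shift (by fun_prop) (by fun_prop))
      ((hg'.comp (by fun_prop) (by fun_prop)).shift (by fun_prop) (by fun_prop))
  · obtain ⟨h1, h2, h3⟩ := H n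
    obtain ⟨h1', h2', h3'⟩ := H' n
    refine ⟨by omega, by omega, fun r => ?_⟩
    have e1 : circ (fun x => if x.2 < m.ev x.1 then (g x).shift 0 (w.ev x.1) else
        (g' (x.1, x.2 - m.ev x.1)).shift 0 (w'.ev x.1)) (m.ev n + m'.ev n) n =
        (circ g (m.ev n) n).map (Gate.shift 0 (w.ev n)) ++
          (circ g' (m'.ev n) n).map (Gate.shift 0 (w'.ev n)) := by
      rw [circ_add]
      congr 1
      · rw [circ, circ, List.map_map]
        refine List.map_congr_left fun i hi => ?_
        simp [List.mem_range.1 hi]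
      · rw [circ, List.map_map]
        refine List.map_congr_left fun i hi => ?_
        simp
    rw [e1, run_append, EI.run_shift_aux (by omega) (fun i _ => by rw [zero_add]) (h3 r), run_sum]
    have e2 : ∀ s, overwr 0 (w.ev n) (pad r) (pad s) = pad s := fun s =>
      overwr_zero_pad r s h1 h2
    have e3 : ∀ (s : S n) (t : T n), overwr 0 (w'.ev n) (pad s) (pad t) = pad t := fun s t =>
      overwr_zero_pad s t h1' h2'
    simp only [e2]
    have e4 : ∀ s : S n, run ((circ g' (m'.ev n) n).map (Gate.shift 0 (w'.ev n)))
        (ket (w.ev n + w'.ev n) (pad s)) =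
        ∑ t, V' n t s • ket (w.ev n + w'.ev n) (pad t) := by
      intro s
      rw [EI.run_shift_aux (by omega) (fun i _ => by rw [zero_add]) (h3' s)]
      simp only [e3]
    simp only [e4, Finset.smul_sum, smul_smul]
    rw [Finset.sum_comm]
    simp only [Finset.sum_smul, mul_comm]

open Classical in
theorem EI.frame [PTLen R] [∀ n, Fintype (R n)] [∀ n, Fintype (T n)] {V : ∀ n, T n → S n → ℂ}
    (hV : EI V) : EI (S := fun n => R n × S n) (T := fun n => R n × T n) fun n p q =>
      if p.1 = q.1 then V n p.2 q.2 else 0 := by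
  obtain ⟨g, m, w, hg, H⟩ := hV
  refine EI.intro (fun x => (g x).shift (ln R x.1) (w.ev x.1)) m.ev (fun n => ln R n + w.ev n)
    (hg.shift (by fun_prop) (by fun_prop)) (by fun_prop) (by fun_prop) fun n => ?_
  obtain ⟨h1, h2, h3⟩ := H n
  refine ⟨Nat.add_le_add_left h1 _, Nat.add_le_add_left h2 _, fun ⟨r, s⟩ => ?_⟩
  have e1 : circ (fun x => (g x).shift (ln R x.1) (w.ev x.1)) (m.ev n) n =
      (circ g (m.ev n) n).map (Gate.shift (ln R n) (w.ev n)) := by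
    rw [circ, circ, List.map_map]
    rfl
  rw [e1, EI.run_shift_aux (by rfl) (fun i _ => ?_) (h3 s)]
  · have e2 : ∀ t, overwr (ln R n) (w.ev n) (pad (r, s)) (pad t) = pad (r, t) := fun t =>
      overwr_pad_prod r s t h1 h2
    simp only [e2, Fintype.sum_prod_type, ite_smul, zero_smul]
    rw [Finset.sum_eq_single r]
    · simp
    · intro r' _ h
      simp [h]
    · simp
  · rw [pad_prod]
    simp [ln]

theorem EI.pre [∀ n, Fintype (S n)] [∀ n, Fintype (T n)] {V : ∀ n, T n → S n → ℂ}
    {v : ∀ n, R n → S n} (hV : EI V) (hv : EIf v) : EI fun n t r => V n t (v n r) := by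
  have h := (eif_iff.1 hv).comp hV
  have e : ∀ n t r, ∑ s, V n t s * fmat (v n) s r = V n t (v n r) := fun n t r => by
    simpa [mul_comm] using sum_fmat (v n) r fun s => V n t s
  simpa only [e] using h

theorem EIf.comp {u : ∀ n, R n → S n} {v : ∀ n, S n → T n} (hv : EIf v) (hu : EIf u)
    [∀ n, Fintype (S n)] [∀ n, Fintype (T n)] : EIf fun n r => v n (u n r) := by
  rw [eif_iff] at hv ⊢
  exact hv.pre hu

theorem EI.post [∀ n, Fintype (S n)] [∀ n, Fintype (T n)] {V : ∀ n, S n → R n → ℂ}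
    {v : ∀ n, S n → T n} (hV : EI V) (hv : EIf v) (u : ∀ n, T n → S n)
    (h1 : ∀ n s, u n (v n s) = s) (h2 : ∀ n t, v n (u n t) = t) :
    EI fun n t r => V n (u n t) r := by
  have h := hV.comp (eif_iff.1 hv)
  have e : ∀ n t r, ∑ s, fmat (v n) t s * V n s r = V n (u n t) r := fun n t r => by
    rw [Finset.sum_eq_single (u n t)]
    · simp [fmat, h2]
    · intro s _ hs
      have : t ≠ v n s := fun h => hs (by rw [h, h1])
      simp [fmat, this]
    · simp
  simpa only [e] using h

/-- Gates preserve inner products and distinct encodings are orthogonal, so the columns of the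
matrix are orthonormal. This later supplies the trace condition in `QPT`. -/
theorem EI.isometry [∀ n, Fintype (T n)] {V : ∀ n, T n → S n → ℂ} (hV : EI V) (n : ℕ) (s s' : S n) :
    ∑ t, star (V n t s) * V n t s' = open Classical in if s = s' then 1 else 0 := by
  classical
  obtain ⟨g, m, w, hg, H⟩ := hV
  obtain ⟨h1, h2, h3⟩ := H n
  have inj : ∀ {X : Type} [BitRep X], BitRep.len X ≤ w.ev n → ∀ x y : X,
      trunc (w.ev n) (pad x) = trunc (w.ev n) (pad y) ↔ x = y := by
    intro X _ hX x y
    refine ⟨fun h => BitRep.inj x y fun i hi => ?_, fun h => by rw [h]⟩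
    have := congrFun h ⟨i, by omega⟩
    simpa [trunc, pad, hi] using this
  have h4 := run_inner (circ g (m.ev n) n) (ket (w.ev n) (pad s)) (ket (w.ev n) (pad s'))
  have e1 : ∀ (c : T n → ℂ) (t : T n),
      (∑ t', c t' • ket (w.ev n) (pad t')) (trunc (w.ev n) (pad t)) = c t := by
    intro c t
    simp [Finset.sum_apply, ket_apply, inj h2]
  have e2 : ∀ (c : T n → ℂ) (f : BV (w.ev n) → ℂ),
      ∑ z, f z * (∑ t', c t' • ket (w.ev n) (pad t')) z = ∑ t, f (trunc _ (pad t)) * c t := by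
    intro c f
    simp only [Finset.sum_apply, Pi.smul_apply, smul_eq_mul, Finset.mul_sum, ket_apply]
    rw [Finset.sum_comm]
    simp
  rw [h3, h3, e2] at h4
  simp only [e1] at h4
  rw [h4]
  simp only [ket_apply]
  simp [inj h1, eq_comm]

end EI

/-! ## Quadratic Boolean functions -/

/-- The exclusive or of `f 0, …, f (T - 1)`. -/
def bigXor (T : ℕ) (f : ℕ → Bool) : Bool :=
  Nat.rec false (fun t acc => xor acc (f t)) T

@[simp] theorem bigXor_zero (f : ℕ → Bool) : bigXor 0 f = false := rfl

theorem bigXor_succ (T : ℕ) (f : ℕ → Bool) : bigXor (T + 1) f = xor (bigXor T f) (f T) := rfl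

theorem bigXor_congr {T : ℕ} {f g : ℕ → Bool} (h : ∀ t, t < T → f t = g t) :
    bigXor T f = bigXor T g := by
  induction T with
  | zero => rfl
  | succ T ih => rw [bigXor_succ, bigXor_succ, ih fun t ht => h t (by omega), h T (by omega)]

@[simp] theorem bigXor_false (T : ℕ) : bigXor T (fun _ => false) = false := by
  induction T with
  | zero => rfl
  | succ T ih => rw [bigXor_succ, ih]; rfl

theorem bigXor_eq_single {T : ℕ} {f : ℕ → Bool} (t₀ : ℕ) (ht : t₀ < T)
    (h : ∀ t, t < T → t ≠ t₀ → f t = false) : bigXor T f = f t₀ := by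
  induction T with
  | zero => omega
  | succ T ih =>
    rw [bigXor_succ]
    by_cases hT : t₀ = T
    · subst hT
      rw [bigXor_congr (g := fun _ => false) fun t ht' => h t (by omega) (by omega)]
      simp
    · rw [ih (by omega) fun t ht' => h t (by omega), h T (by omega) (Ne.symm hT)]
      simp

theorem bigXor_add (T U : ℕ) (f : ℕ → Bool) :
    bigXor (T + U) f = xor (bigXor T f) (bigXor U fun u => f (T + u)) := by
  induction U with
  | zero => simp
  | succ U ih => rw [← add_assoc, bigXor_succ, ih, bigXor_succ, Bool.xor_assoc]

theorem bigXor_mul (M T : ℕ) (f : ℕ → Bool) :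
    bigXor (M * T) f = bigXor M fun t => bigXor T fun u => f (t * T + u) := by
  induction M with
  | zero => simp
  | succ M ih => rw [Nat.succ_mul, bigXor_add, ih, bigXor_succ]

theorem termVal_congr {k a b : ℕ} {Z Z' : ℕ → Bool} (ha : 2 ≤ k → Z a = Z' a)
    (hb : 3 ≤ k → Z b = Z' b) : termVal k a b Z = termVal k a b Z' := by
  unfold termVal
  split_ifs with h0 h1 h2
  · rfl
  · rfl
  · exact ha (by omega)
  · rw [ha (by omega), hb (by omega)]

/-- A list of `termGate`s, `T` of them for each of the consecutive targets `c, …, c + m - 1`. -/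
def termList (m T : ℕ) (k a b : ℕ → ℕ) (c : ℕ) : List Gate :=
  (List.range (m * T)).map fun i => termGate (k i) (a i) (b i) (c + i / T)

/-- A list of `termGate`s whose controls are never targets of the same or a later gate takes a
basis state to the one that satisfies the equations given by the gates. -/
theorem run_termList {W m T c : ℕ} {k a b : ℕ → ℕ} {Z F : ℕ → Bool}
    (ha : ∀ o t, o < m → t < T → 2 ≤ k (o * T + t) →
      a (o * T + t) < W ∧ (a (o * T + t) < c + o ∨ c + m ≤ a (o * T + t)))
    (hb : ∀ o t, o < m → t < T → 3 ≤ k (o * T + t) →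
      b (o * T + t) < W ∧ (b (o * T + t) < c + o ∨ c + m ≤ b (o * T + t)))
    (hoff : ∀ j, j < c ∨ c + m ≤ j → F j = Z j)
    (hon : ∀ o, o < m → F (c + o) = xor (Z (c + o)) (bigXor T fun t =>
      termVal (k (o * T + t)) (a (o * T + t)) (b (o * T + t)) F)) :
    run (termList m T k a b c) (ket W Z) = ket W F := by
  -- Invariant over the targets: those from `c + o` on still hold their old values, and everything
  -- else already agrees with the final string `F`.
  suffices H : ∀ o, o ≤ m → run ((List.range (o * T)).map fun i =>
      termGate (k i) (a i) (b i) (c + i / T)) (ket W Z) =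
      ket W (fun j => if c + o ≤ j ∧ j < c + m then Z j else F j) by
    rw [termList, H m le_rfl]
    refine ket_congr fun j _ => ?_
    split_ifs <;> first | omega | rfl
  intro o
  induction o with
  | zero =>
    intro _
    simp only [zero_mul, List.range_zero, List.map_nil, run_nil, add_zero]
    refine ket_congr fun j _ => ?_
    split_ifs with h
    · rfl
    · exact (hoff j (by omega)).symm
  | succ o ih =>
    intro ho
    rw [Nat.succ_mul, List.range_add, List.map_append, run_append, ih (by omega), List.map_map]
    set Y : ℕ → Bool := fun j => if c + o ≤ j ∧ j < c + m then Z j else F j with hY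
    have hYF : ∀ p, (p < c + o ∨ c + m ≤ p) → Y p = F p := by
      intro p hp
      simp only [hY]
      split_ifs <;> first | omega | rfl
    have inner : ∀ t, t ≤ T → run ((List.range t).map ((fun i =>
        termGate (k i) (a i) (b i) (c + i / T)) ∘ fun x => o * T + x)) (ket W Y) =
        ket W (flipAt Y (c + o) (bigXor t fun t =>
          termVal (k (o * T + t)) (a (o * T + t)) (b (o * T + t)) F)) := by
      intro t
      induction t with
      | zero =>
        intro _
        refine ket_congr fun j _ => ?_
        simp [flipAt]
      | succ t iht =>
        intro ht
        rw [List.range_succ, List.map_append, run_append, iht (by omega), List.map_singleton,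
          run_cons, run_nil]
        have hdiv : (o * T + t) / T = o := by
          rw [mul_comm, Nat.mul_add_div (by omega), Nat.div_eq_of_lt (by omega), add_zero]
        simp only [Function.comp_apply, hdiv]
        have hA := ha o t (by omega) (by omega)
        have hB := hb o t (by omega) (by omega)
        rw [termGate_act _ (fun h => ⟨(hA h).1, by have := (hA h).2; omega⟩)
          (fun h => ⟨(hB h).1, by have := (hB h).2; omega⟩)]
        refine ket_congr fun j _ => ?_
        -- The controls avoid both the current target and all later ones, so reading them in the
        -- present state gives their values in `F`.
        have hv : ∀ v, termVal (k (o * T + t)) (a (o * T + t)) (b (o * T + t))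
            (flipAt Y (c + o) v) =
            termVal (k (o * T + t)) (a (o * T + t)) (b (o * T + t)) F := by
          intro v
          refine termVal_congr (fun h => ?_) (fun h => ?_)
          · have := hA h
            rw [flipAt, if_neg (by omega), hYF _ this.2]
          · have := hB h
            rw [flipAt, if_neg (by omega), hYF _ this.2]
        rw [hv, bigXor_succ]
        simp only [flipAt]
        split_ifs
        · rw [Bool.xor_assoc]
        · rfl
    rw [inner T le_rfl]
    refine ket_congr fun j _ => ?_
    simp only [flipAt, hY]
    by_cases hj : j = c + o
    · subst hj
      rw [if_pos rfl, if_pos (by omega), if_neg (by omega), hon o (by omega)]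
    · rw [if_neg hj]
      split_ifs <;> first | omega | rfl

/-- Uniform families of lists of gates. -/
def UL (gs : ℕ → List Gate) : Prop :=
  ∃ (g : ℕ × ℕ → Gate) (m : PF1), UG g ∧ ∀ n, gs n = circ g (m.ev n) n

theorem UL.append {gs hs : ℕ → List Gate} (hg : UL gs) (hh : UL hs) :
    UL fun n => gs n ++ hs n := by
  obtain ⟨g, m, hg, Hg⟩ := hg
  obtain ⟨h, k, hh, Hh⟩ := hh
  refine ⟨fun x => if x.2 < m.ev x.1 then g x else h (x.1, x.2 - m.ev x.1),
    ⟨fun n => m.ev n + k.ev n, by fun_prop⟩,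
    UG.ite (by fun_prop) hg (hh.comp (by fun_prop) (by fun_prop)), fun n => ?_⟩
  change gs n ++ hs n = circ _ (m.ev n + k.ev n) n
  rw [Hg, Hh, circ_add]
  congr 1
  · exact circ_congr fun i hi => by simp [hi]
  · simp [circ]

theorem UL.termList {m T c : ℕ → ℕ} {k a b : ℕ → ℕ → ℕ} (hm : PT fun x => m x.1)
    (hT : PT fun x => T x.1) (hc : PT fun x => c x.1) (hk : PT fun x => k x.1 x.2)
    (ha : PT fun x => a x.1 x.2) (hb : PT fun x => b x.1 x.2) :
    UL fun n => termList (m n) (T n) (k n) (a n) (b n) (c n) :=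
  let T' : PF1 := ⟨T, hT⟩
  let c' : PF1 := ⟨c, hc⟩
  ⟨fun x => termGate (k x.1 x.2) (a x.1 x.2) (b x.1 x.2) (c'.ev x.1 + x.2 / T'.ev x.1),
    ⟨fun n => m n * T'.ev n, PT.mul hm (by fun_prop)⟩, UG.termGate hk ha hb (by fun_prop),
    fun n => rfl⟩

section Quad

variable {R S T : ℕ → Type} [∀ n, BitRep (R n)] [∀ n, BitRep (S n)] [∀ n, BitRep (T n)]

theorem EIf.of_UL {v : ∀ n, S n → T n} (gs : ℕ → List Gate) (w : ℕ → ℕ) (hg : UL gs)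
    (hw : PT fun x => w x.1) (h : ∀ n, ln S n ≤ w n ∧ ln T n ≤ w n ∧
      ∀ s, run (gs n) (ket (w n) (pad s)) = ket (w n) (pad (v n s))) : EIf v := by
  obtain ⟨g, m, hg, H⟩ := hg
  exact EIf.intro g m.ev w hg (by fun_prop) hw fun n => by rw [← H]; exact h n

/-- The data of a uniform family of quadratic polynomials over `𝔽₂`, as sums of monomials. -/
structure QData where
  T : PF1
  k : PF
  a : PF
  b : PF

/-- The value of the `i`-th polynomial. -/
def QData.val (q : QData) (n i : ℕ) (Z : ℕ → Bool) : Bool :=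
  bigXor (q.T.ev n) fun t => termVal (q.k.ev n (i * q.T.ev n + t)) (q.a.ev n (i * q.T.ev n + t))
    (q.b.ev n (i * q.T.ev n + t)) Z

/-- Uniform families of quadratic functions of the bits of the encoding. -/
def BQ (β : ∀ n, ℕ → S n → Bool) : Prop :=
  ∃ q : QData, (∀ n j, 2 ≤ q.k.ev n j → q.a.ev n j < ln S n) ∧
    (∀ n j, 3 ≤ q.k.ev n j → q.b.ev n j < ln S n) ∧ ∀ n i s, β n i s = q.val n i (pad s)

/-- The circuits append the bits `f n s`, each of which is a quadratic function of `s` and the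
preceding bits. -/
theorem EIf.append_of_slp [PTLen S] [PTLen T] {f : ∀ n, S n → T n} (q : QData)
    (ha : ∀ n o t, o < ln T n → t < q.T.ev n → 2 ≤ q.k.ev n (o * q.T.ev n + t) →
      q.a.ev n (o * q.T.ev n + t) < ln S n + o)
    (hb : ∀ n o t, o < ln T n → t < q.T.ev n → 3 ≤ q.k.ev n (o * q.T.ev n + t) →
      q.b.ev n (o * q.T.ev n + t) < ln S n + o)
    (h : ∀ n o s, o < ln T n → pad (f n s) o = q.val n o (pad (s, f n s))) :
    EIf (S := S) (T := fun n => S n × T n) fun n s => (s, f n s) := by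
  refine EIf.of_UL (fun n => CertFE.termList (ln T n) (q.T.ev n) (q.k.ev n) (q.a.ev n) (q.b.ev n)
    (ln S n)) (fun n => ln S n + ln T n) (UL.termList (by fun_prop) (by fun_prop) (by fun_prop)
    (by fun_prop) (by fun_prop) (by fun_prop)) (by fun_prop) fun n =>
    ⟨Nat.le_add_right _ _, le_rfl, fun s => ?_⟩
  have hp : ∀ j, ln S n ≤ j → pad s j = false := fun j hj => pad_of_le s hj
  refine run_termList (fun o t ho ht hk => ?_) (fun o t ho ht hk => ?_) (fun j hj => ?_)
    (fun o ho => ?_)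
  · have := ha n o t ho ht hk
    omega
  · have := hb n o t ho ht hk
    omega
  · rw [pad_prod]
    split_ifs with h1
    · rfl
    · have h2 : ln S n = BitRep.len (S n) := rfl
      have h3 : ln T n = BitRep.len (T n) := rfl
      rw [pad_of_le _ (by omega), pad_of_le s (by omega)]
  · rw [hp _ (by omega), Bool.false_xor]
    refine Eq.trans ?_ (h n o s ho)
    rw [pad_prod, if_neg (by simp [ln])]
    simp [ln]

/-- All bits of the values are quadratic functions of the argument. -/
def Quad (v : ∀ n, S n → T n) : Prop := BQ fun n i s => pad (v n s) i

theorem EIf.append [PTLen S] [PTLen T] {f : ∀ n, S n → T n} (hf : Quad f) :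
    EIf (S := S) (T := fun n => S n × T n) fun n s => (s, f n s) := by
  obtain ⟨q, ha, hb, h⟩ := hf
  beta_reduce at h
  refine EIf.append_of_slp q (fun n o t _ _ hk => (ha n _ hk).trans_le (Nat.le_add_right _ _))
    (fun n o t _ _ hk => (hb n _ hk).trans_le (Nat.le_add_right _ _)) fun n o s _ => ?_
  rw [h]
  have hp : ∀ j, j < ln S n → pad s j = pad (s, f n s) j := fun j hj => by
    rw [pad_prod]
    exact (if_pos hj).symm
  exact bigXor_congr fun t _ => termVal_congr (fun hk => hp _ (ha n _ hk))
    (fun hk => hp _ (hb n _ hk))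

/-- A map with a left inverse is implemented without leftover if both are quadratic. -/
theorem EIf.of_leftInverse [PTLen S] [PTLen T] {v : ∀ n, S n → T n} {u : ∀ n, T n → S n}
    (hv : Quad v) (hu : Quad u) (h : ∀ n s, u n (v n s) = s) : EIf v := by
  obtain ⟨q, qa, qb, hq⟩ := hv
  obtain ⟨r, ra, rb, hr⟩ := hu
  beta_reduce at hq hr
  have e : ∀ n, ln S n = BitRep.len (S n) := fun _ => rfl
  have e' : ∀ n, ln T n = BitRep.len (T n) := fun _ => rfl
  -- Four passes: write `v s` into fresh wires behind position `ln S + ln T`, erase `s` by adding `u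
  -- (v s)` to it, copy the result to the front, and erase the rear copy by adding the front one.
  refine EIf.of_UL (fun n =>
    (termList (ln T n) (q.T.ev n) (q.k.ev n) (q.a.ev n) (q.b.ev n) (ln S n + ln T n) ++
     termList (ln S n) (r.T.ev n) (r.k.ev n) (fun i => ln S n + ln T n + r.a.ev n i)
      (fun i => ln S n + ln T n + r.b.ev n i) 0) ++
    (termList (ln T n) 1 (fun _ => 2) (fun i => ln S n + ln T n + i) (fun _ => 0) 0 ++
     termList (ln T n) 1 (fun _ => 2) (fun i => i) (fun _ => 0) (ln S n + ln T n)))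
    (fun n => ln S n + ln T n + ln T n) ?_ (by fun_prop) fun n => ⟨by omega, by omega, fun s => ?_⟩
  · refine .append (.append ?_ ?_) (.append ?_ ?_) <;> apply UL.termList <;> fun_prop
  set p := ln S n + ln T n with hp
  set t := v n s with ht
  have z0 : ∀ j, ln S n ≤ j → pad s j = false := fun j hj => pad_of_le s hj
  have z1 : ∀ j, ln T n ≤ j → pad t j = false := fun j hj => pad_of_le t hj
  have s1 : run (termList (ln T n) (q.T.ev n) (q.k.ev n) (q.a.ev n) (q.b.ev n) p)
      (ket (p + ln T n) (pad s)) =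
      ket (p + ln T n) (fun j => if j < p then pad s j else pad t (j - p)) := by
    refine run_termList (fun o i _ _ hk => ?_) (fun o i _ _ hk => ?_) (fun j hj => ?_)
      (fun o ho => ?_)
    · have := qa n _ hk; omega
    · have := qb n _ hk; omega
    · split_ifs with h1
      · rfl
      · rw [z1 _ (by omega), z0 _ (by omega)]
    · rw [if_neg (by omega), z0 _ (by omega), Bool.false_xor, Nat.add_sub_cancel_left, hq]
      exact bigXor_congr fun i _ => termVal_congr
        (fun hk => by have := qa n _ hk; rw [if_pos (by omega)])
        (fun hk => by have := qb n _ hk; rw [if_pos (by omega)])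
  have s2 : run (termList (ln S n) (r.T.ev n) (r.k.ev n) (fun i => p + r.a.ev n i)
      (fun i => p + r.b.ev n i) 0)
      (ket (p + ln T n) (fun j => if j < p then pad s j else pad t (j - p))) =
      ket (p + ln T n) (fun j => if j < p then false else pad t (j - p)) := by
    refine run_termList (fun o i _ _ hk => ?_) (fun o i _ _ hk => ?_) (fun j hj => ?_)
      (fun o ho => ?_)
    · have := ra n _ hk; omega
    · have := rb n _ hk; omega
    · split_ifs with h1
      · exact (z0 _ (by omega)).symm
      · rfl
    · rw [zero_add, if_pos (by omega), if_pos (by omega)]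
      have h1 : pad s o = r.val n o (pad t) := by rw [← hr, ht, h]
      rw [h1, eq_comm]
      simp only [bne_eq_false_iff_eq]
      refine bigXor_congr fun i _ => ?_
      simp only [termVal, not_lt.2 (Nat.le_add_right _ _), if_false, Nat.add_sub_cancel_left]
  have s3 : run (termList (ln T n) 1 (fun _ => 2) (fun i => p + i) (fun _ => 0) 0)
      (ket (p + ln T n) (fun j => if j < p then false else pad t (j - p))) =
      ket (p + ln T n) (fun j => if j < p then pad t j else pad t (j - p)) := by
    refine run_termList (fun o i ho hi _ => ?_) (fun o i _ _ hk => by omega)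
      (fun j hj => ?_) (fun o ho => ?_)
    · omega
    · split_ifs with h1
      · exact z1 _ (by omega)
      · rfl
    · rw [zero_add, if_pos (by omega), if_pos (by omega)]
      simp [bigXor, termVal]
  have s4 : run (termList (ln T n) 1 (fun _ => 2) (fun i => i) (fun _ => 0) p)
      (ket (p + ln T n) (fun j => if j < p then pad t j else pad t (j - p))) =
      ket (p + ln T n) (pad t) := by
    refine run_termList (fun o i ho hi _ => ?_) (fun o i _ _ hk => by omega)
      (fun j hj => ?_) (fun o ho => ?_)
    · omega
    · split_ifs with h1
      · rfl
      · rw [z1 _ (by omega), z1 _ (by omega)]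
    · rw [if_neg (by omega), z1 _ (by omega), Nat.add_sub_cancel_left]
      simp [bigXor, termVal]
  rw [run_append, run_append, run_append, s1, s2, s3, s4]

end Quad

theorem PTd.comp {c : ℕ × ℕ → Prop} {f g : ℕ × ℕ → ℕ} (hc : PTd c) (hf : PT f) (hg : PT g) :
    PTd fun x => c (f x, g x) := by
  unfold PTd at *
  exact PT.comp hc hf hg

/-! ### Closure properties of quadratic families -/

section BQ

variable {R S T : ℕ → Type} [∀ n, BitRep (R n)] [∀ n, BitRep (S n)] [∀ n, BitRep (T n)]

theorem BQ.intro {β : ∀ n, ℕ → S n → Bool} (U : ℕ → ℕ) (k a b : ℕ → ℕ → ℕ)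
    (hU : PT fun x => U x.1) (hk : PT fun x => k x.1 x.2) (ha : PT fun x => a x.1 x.2)
    (hb : PT fun x => b x.1 x.2) (ha' : ∀ n j, 2 ≤ k n j → a n j < ln S n)
    (hb' : ∀ n j, 3 ≤ k n j → b n j < ln S n)
    (h : ∀ n i s, β n i s = bigXor (U n) fun t =>
      termVal (k n (i * U n + t)) (a n (i * U n + t)) (b n (i * U n + t)) (pad s)) : BQ β :=
  ⟨⟨⟨U, hU⟩, ⟨k, hk⟩, ⟨a, ha⟩, ⟨b, hb⟩⟩, ha', hb', h⟩

theorem BQ.congr {β γ : ∀ n, ℕ → S n → Bool} (hβ : BQ β) (h : ∀ n i s, γ n i s = β n i s) :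
    BQ γ := by
  have : γ = β := by
    funext n i s
    exact h n i s
  rwa [this]

theorem BQ.wire [PTLen S] {σ : ℕ → ℕ → ℕ} (hσ : PT fun x => σ x.1 x.2) :
    BQ (S := S) fun n i s => pad s (σ n i) := by
  let σ' : PF := ⟨σ, hσ⟩
  refine BQ.intro (fun _ => 1) (fun n i => if σ'.ev n i < ln S n then 2 else 0) σ'.ev
    (fun _ _ => 0) (by fun_prop) (by fun_prop) (by fun_prop) (by fun_prop) (fun n j h => ?_)
    (fun n j h => ?_) fun n i s => ?_
  · beta_reduce at h
    split_ifs at h <;> omega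
  · beta_reduce at h
    split_ifs at h <;> omega
  · simp only [bigXor_succ, bigXor_zero, mul_one, add_zero, Bool.false_xor, termVal]
    change pad s (σ'.ev n i) = _
    by_cases h : σ'.ev n i < ln S n
    · simp [h]
    · simp [h, pad_of_le s (not_lt.1 h)]

theorem BQ.and_wire [PTLen S] {σ τ : ℕ → ℕ → ℕ} (hσ : PT fun x => σ x.1 x.2)
    (hτ : PT fun x => τ x.1 x.2) :
    BQ (S := S) fun n i s => pad s (σ n i) && pad s (τ n i) := by
  let σ' : PF := ⟨σ, hσ⟩
  let τ' : PF := ⟨τ, hτ⟩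
  refine BQ.intro (fun _ => 1) (fun n i => if σ'.ev n i < ln S n ∧ τ'.ev n i < ln S n then 3 else 0)
    σ'.ev τ'.ev (by fun_prop) (by fun_prop) (by fun_prop) (by fun_prop) (fun n j h => ?_)
    (fun n j h => ?_) fun n i s => ?_
  · beta_reduce at h
    split_ifs at h <;> omega
  · beta_reduce at h
    split_ifs at h <;> omega
  · simp only [bigXor_succ, bigXor_zero, mul_one, add_zero, Bool.false_xor, termVal]
    change (pad s (σ'.ev n i) && pad s (τ'.ev n i)) = _
    by_cases h : σ'.ev n i < ln S n
    · by_cases h' : τ'.ev n i < ln S n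
      · simp [h, h']
      · simp [h, h', pad_of_le s (not_lt.1 h')]
    · simp [h, pad_of_le s (not_lt.1 h)]

theorem BQ.cond {c : ℕ → ℕ → Prop} [∀ n i, Decidable (c n i)] (hc : PTd fun x => c x.1 x.2) :
    BQ (S := S) fun n i _ => decide (c n i) := by
  refine BQ.intro (fun _ => 1) (fun n i => if c n i then 1 else 0) (fun _ _ => 0)
    (fun _ _ => 0) (by fun_prop) (by fun_prop) (by fun_prop) (by fun_prop) (fun n j h => ?_)
    (fun n j h => ?_) fun n i s => ?_
  · beta_reduce at h
    split_ifs at h <;> omega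
  · beta_reduce at h
    split_ifs at h <;> omega
  · simp only [bigXor_succ, bigXor_zero, mul_one, add_zero, Bool.false_xor, termVal]
    by_cases h : c n i <;> simp [h]

theorem BQ.xor {β γ : ∀ n, ℕ → S n → Bool} (hβ : BQ β) (hγ : BQ γ) :
    BQ fun n i s => Bool.xor (β n i s) (γ n i s) := by
  obtain ⟨q, qa, qb, hq⟩ := hβ
  obtain ⟨r, ra, rb, hr⟩ := hγ
  -- Term `j` of the combined family belongs to polynomial `I` and has position `J` in it: the terms
  -- of `β` come first, those of `γ` after them.
  let I : ℕ × ℕ → ℕ := fun x => x.2 / (q.T.ev x.1 + r.T.ev x.1)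
  let J : ℕ × ℕ → ℕ := fun x => x.2 % (q.T.ev x.1 + r.T.ev x.1)
  have hI : PT I := by fun_prop
  have hJ : PT J := by fun_prop
  let sel : (q r : PF) → ℕ → ℕ → ℕ := fun u v n j =>
    if J (n, j) < q.T.ev n then u.ev n (I (n, j) * q.T.ev n + J (n, j))
    else v.ev n (I (n, j) * r.T.ev n + (J (n, j) - q.T.ev n))
  have hsel : ∀ u v, PT fun x => sel u v x.1 x.2 := by
    intro u v
    have : PT fun x => if J x < q.T.ev x.1 then u.ev x.1 (I x * q.T.ev x.1 + J x)
        else v.ev x.1 (I x * r.T.ev x.1 + (J x - q.T.ev x.1)) := by fun_prop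
    exact this
  refine BQ.intro (fun n => q.T.ev n + r.T.ev n) (sel q.k r.k) (sel q.a r.a) (sel q.b r.b)
    (by fun_prop) (hsel _ _) (hsel _ _) (hsel _ _) (fun n j h => ?_) (fun n j h => ?_)
    fun n i s => ?_
  · simp only [sel] at h ⊢
    split_ifs at h ⊢
    · exact qa _ _ h
    · exact ra _ _ h
  · simp only [sel] at h ⊢
    split_ifs at h ⊢
    · exact qb _ _ h
    · exact rb _ _ h
  · rw [hq, hr, bigXor_add]
    have key : ∀ t, t < q.T.ev n + r.T.ev n → I (n, i * (q.T.ev n + r.T.ev n) + t) = i ∧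
        J (n, i * (q.T.ev n + r.T.ev n) + t) = t := by
      intro t ht
      simp only [I, J]
      rw [mul_comm, Nat.mul_add_div (by omega), Nat.div_eq_of_lt ht, Nat.mul_add_mod,
        Nat.mod_eq_of_lt ht]
      simp
    congr 1
    · refine bigXor_congr fun t ht => ?_
      obtain ⟨h1, h2⟩ := key t (by omega)
      simp only [sel, h1, h2, ht, if_true]
    · refine bigXor_congr fun t ht => ?_
      obtain ⟨h1, h2⟩ := key (q.T.ev n + t) (by omega)
      have h3 : ¬ q.T.ev n + t < q.T.ev n := by omega
      simp only [sel, h1, h2, h3, if_false, Nat.add_sub_cancel_left]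

theorem BQ.mask {β : ∀ n, ℕ → S n → Bool} {c : ℕ → ℕ → Prop} [∀ n i, Decidable (c n i)]
    (hc : PTd fun x => c x.1 x.2) (hβ : BQ β) :
    BQ fun n i s => decide (c n i) && β n i s := by
  obtain ⟨q, qa, qb, hq⟩ := hβ
  have hc' : PTd fun x => c x.1 (x.2 / q.T.ev x.1) :=
    PTd.comp (c := fun x => c x.1 x.2) (f := fun x => x.1) (g := fun x => x.2 / q.T.ev x.1) hc
      (by fun_prop) (by fun_prop)
  refine BQ.intro q.T.ev (fun n j => if c n (j / q.T.ev n) then q.k.ev n j else 0) q.a.ev q.b.ev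
    (by fun_prop) (PT.ite (f := fun x => q.k.ev x.1 x.2) (g := fun _ => 0) hc' (by fun_prop) (by fun_prop)) (by fun_prop) (by fun_prop)
    (fun n j h => ?_)
    (fun n j h => ?_) fun n i s => ?_
  · beta_reduce at h
    split_ifs at h
    · exact qa _ _ h
    · omega
  · beta_reduce at h
    split_ifs at h
    · exact qb _ _ h
    · omega
  · have key : ∀ t, t < q.T.ev n → (i * q.T.ev n + t) / q.T.ev n = i := by
      intro t ht
      rw [mul_comm, Nat.mul_add_div (by omega), Nat.div_eq_of_lt ht, add_zero]
    rw [hq]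
    by_cases h : c n i
    · simp only [h, decide_true, Bool.true_and]
      refine bigXor_congr fun t ht => ?_
      simp only [key t ht, h, if_true]
    · simp only [h, decide_false, Bool.false_and]
      rw [bigXor_congr (g := fun _ => false), bigXor_false]
      intro t ht
      simp only [key t ht, h, if_false]
      simp [termVal]

theorem BQ.ite {β γ : ∀ n, ℕ → S n → Bool} {c : ℕ → ℕ → Prop} [∀ n i, Decidable (c n i)]
    (hc : PTd fun x => c x.1 x.2) (hβ : BQ β) (hγ : BQ γ) :
    BQ fun n i s => if c n i then β n i s else γ n i s := by
  have hc' : PTd fun x => ¬ c x.1 x.2 := by fun_prop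
  refine ((hβ.mask hc).xor (hγ.mask (c := fun n i => ¬ c n i) hc')).congr fun n i s => ?_
  by_cases h : c n i <;> simp [h]

theorem BQ.zero : BQ (S := S) fun _ _ _ => false :=
  (BQ.cond (c := fun _ _ => False) (.const _)).congr fun _ _ _ => by simp

theorem BQ.reindex {β : ∀ n, ℕ → S n → Bool} (hβ : BQ β) {σ : ℕ → ℕ → ℕ}
    (hσ : PT fun x => σ x.1 x.2) : BQ fun n i s => β n (σ n i) s := by
  obtain ⟨q, qa, qb, hq⟩ := hβ
  let σ' : PF := ⟨σ, hσ⟩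
  let K : ℕ → ℕ → ℕ := fun n j => σ'.ev n (j / q.T.ev n) * q.T.ev n + j % q.T.ev n
  have hK : PT fun x => K x.1 x.2 := by
    simp only [K]
    fun_prop
  let K' : PF := ⟨K, hK⟩
  refine BQ.intro q.T.ev (fun n j => q.k.ev n (K'.ev n j)) (fun n j => q.a.ev n (K'.ev n j))
    (fun n j => q.b.ev n (K'.ev n j))
    (by fun_prop) (by fun_prop) (by fun_prop) (by fun_prop) (fun n j h => qa _ _ h)
    (fun n j h => qb _ _ h) fun n i s => ?_
  rw [hq]
  refine bigXor_congr fun t ht => ?_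
  have h1 : K'.ev n (i * q.T.ev n + t) = σ n i * q.T.ev n + t := by
    change σ n ((i * q.T.ev n + t) / q.T.ev n) * q.T.ev n + (i * q.T.ev n + t) % q.T.ev n = _
    rw [mul_comm i, Nat.mul_add_div (by omega), Nat.div_eq_of_lt ht, Nat.mul_add_mod,
      Nat.mod_eq_of_lt ht, add_zero]
  rw [h1]

/-- The terms of `M` consecutive polynomials are already stored consecutively, so only the number of
terms per polynomial changes. -/
theorem BQ.sum {β : ∀ n, ℕ → S n → Bool} (hβ : BQ β) {M : ℕ → ℕ} (hM : PT fun x => M x.1) :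
    BQ fun n i s => bigXor (M n) fun t => β n (i * M n + t) s := by
  obtain ⟨q, qa, qb, hq⟩ := hβ
  let M' : PF1 := ⟨M, hM⟩
  refine BQ.intro (fun n => M'.ev n * q.T.ev n) q.k.ev q.a.ev q.b.ev
    (by fun_prop) (by fun_prop) (by fun_prop) (by fun_prop) qa qb fun n i s => ?_
  rw [bigXor_mul]
  change (bigXor (M'.ev n) fun t => β n (i * M'.ev n + t) s) = _
  refine bigXor_congr fun t _ => ?_
  rw [hq]
  refine bigXor_congr fun u _ => ?_
  have : (i * M'.ev n + t) * q.T.ev n + u = i * (M'.ev n * q.T.ev n) + (t * q.T.ev n + u) := by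
    ring
  rw [this]

/-! ### Rearrangements of bits -/

/-- Every bit of the value is one of the bits of the argument, or zero. -/
def Wire (v : ∀ n, S n → T n) : Prop :=
  ∃ σ : PF, ∀ n i s, pad (v n s) i = pad s (σ.ev n i)

/-- Substituting single bits or zero for the variables does not raise the degree. A term in which
some variable becomes zero is switched off by giving it kind 0, which also keeps all wire numbers in
range. -/
theorem BQ.pullback [PTLen S] {β : ∀ n, ℕ → T n → Bool} (hβ : BQ β) {v : ∀ n, S n → T n}
    (hv : Wire v) : BQ fun n i s => β n i (v n s) := by
  obtain ⟨q, qa, qb, hq⟩ := hβ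
  obtain ⟨σ, hσ⟩ := hv
  refine BQ.intro q.T.ev (fun n j => if q.k.ev n j = 2 then
      (if σ.ev n (q.a.ev n j) < ln S n then 2 else 0) else if 3 ≤ q.k.ev n j then
      (if σ.ev n (q.a.ev n j) < ln S n ∧ σ.ev n (q.b.ev n j) < ln S n then 3 else 0)
      else q.k.ev n j) (fun n j => σ.ev n (q.a.ev n j)) (fun n j => σ.ev n (q.b.ev n j))
    (by fun_prop) (by fun_prop) (by fun_prop) (by fun_prop) (fun n j h => ?_) (fun n j h => ?_)
    fun n i s => ?_
  · beta_reduce at h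
    split_ifs at h <;> omega
  · beta_reduce at h
    split_ifs at h <;> omega
  · rw [hq]
    refine bigXor_congr fun t _ => ?_
    generalize i * q.T.ev n + t = j
    have hz : ∀ p, ¬ p < ln S n → pad s p = false := fun p hp => pad_of_le s (not_lt.1 hp)
    simp only [termVal, hσ]
    rcases h : q.k.ev n j with _ | _ | _ | K
    · simp
    · simp
    · by_cases h1 : σ.ev n (q.a.ev n j) < ln S n
      · simp [h1]
      · simp [h1, hz _ h1]
    · by_cases h1 : σ.ev n (q.a.ev n j) < ln S n
      · by_cases h2 : σ.ev n (q.b.ev n j) < ln S n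
        · simp [h1, h2]
        · simp [h1, h2, hz _ h2]
      · simp [h1, hz _ h1]

theorem Wire.quad [PTLen S] {v : ∀ n, S n → T n} (hv : Wire v) : Quad v := by
  obtain ⟨σ, hσ⟩ := hv
  exact (BQ.wire (σ := σ.ev) (by fun_prop)).congr hσ

theorem Wire.intro {v : ∀ n, S n → T n} (σ : ℕ → ℕ → ℕ) (hσ : PT fun x => σ x.1 x.2)
    (h : ∀ n i s, pad (v n s) i = pad s (σ n i)) : Wire v := ⟨⟨σ, hσ⟩, h⟩

theorem Wire.of_pad_eq {v : ∀ n, S n → T n} (h : ∀ n s, pad (v n s) = pad s) : Wire v :=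
  .intro (fun _ i => i) (by fun_prop) fun n i s => by rw [h]

theorem Wire.id : Wire fun n (s : S n) => s := .of_pad_eq fun _ _ => rfl

theorem Wire.comp {v : ∀ n, S n → T n} {u : ∀ n, R n → S n} (hv : Wire v) (hu : Wire u) :
    Wire fun n r => v n (u n r) := by
  obtain ⟨σ, hσ⟩ := hv
  obtain ⟨τ, hτ⟩ := hu
  exact .intro (fun n i => τ.ev n (σ.ev n i)) (by fun_prop) fun n i s => by rw [hσ, hτ]

theorem Wire.unit [PTLen S] : Wire fun n (_ : S n) => () :=
  .intro (fun n _ => ln S n) (by fun_prop) fun n i s => (pad_of_le s le_rfl).symm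

theorem Wire.fst' [PTLen R] [PTLen S] : Wire fun n (p : R n × S n) => p.1 :=
  .intro (fun n i => if i < ln R n then i else ln R n + ln S n) (by fun_prop) fun n i s => by
    split_ifs with h
    · rw [pad_prod]
      exact (if_pos h).symm
    · rw [pad_of_le _ (not_lt.1 h)]
      exact (pad_of_le s le_rfl).symm

theorem Wire.snd' [PTLen R] : Wire fun n (p : R n × S n) => p.2 :=
  .intro (fun n i => ln R n + i) (by fun_prop) fun n i s => by
    rw [pad_prod]
    simp [ln]

theorem Wire.pair [PTLen S] {v : ∀ n, R n → S n} {u : ∀ n, R n → T n} (hv : Wire v)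
    (hu : Wire u) : Wire fun n r => (v n r, u n r) := by
  obtain ⟨σ, hσ⟩ := hv
  obtain ⟨τ, hτ⟩ := hu
  -- The first component occupies the first `ln S n` bits, so the index of the second one restarts
  -- after them.
  refine .intro (fun n i => if i < ln S n then σ.ev n i else τ.ev n (i - ln S n)) (by fun_prop)
    fun n i s => ?_
  rw [pad_prod, hσ, hτ]
  exact (apply_ite (pad s) _ _ _).symm

theorem Wire.fst [PTLen S] [PTLen T] {v : ∀ n, R n → S n × T n} (hv : Wire v) :
    Wire fun n r => (v n r).1 := Wire.fst'.comp hv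

theorem Wire.snd [PTLen S] {v : ∀ n, R n → S n × T n} (hv : Wire v) :
    Wire fun n r => (v n r).2 := Wire.snd'.comp hv

theorem Quad.pair [PTLen S] {v : ∀ n, R n → S n} {u : ∀ n, R n → T n} (hv : Quad v)
    (hu : Quad u) : Quad fun n r => (v n r, u n r) := by
  refine (BQ.ite (c := fun n i => i < ln S n) (by fun_prop) hv (hu.reindex
    (σ := fun n i => i - ln S n) (by fun_prop))).congr fun n i s => ?_
  rw [pad_prod]
  rfl

theorem Quad.comp_wire [PTLen R] {v : ∀ n, S n → T n} (hv : Quad v) {u : ∀ n, R n → S n}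
    (hu : Wire u) : Quad fun n r => v n (u n r) := BQ.pullback hv hu

end BQ

/-! ## Dilations of quantum polynomial time algorithms -/

/-- `V` is an isometric dilation of `Φ`, with environment `G`. -/
def IsDil {X A Y B G : Type} [Fintype A] [Fintype G] (V : (Y × B) × G → X × A → ℂ)
    (Φ : Instr X A Y B) : Prop :=
  ∀ x y ρ b b', Φ x y ρ b b' =
    ∑ g, ∑ a, ∑ a', V ((y, b), g) (x, a) * ρ a a' * star (V ((y, b'), g) (x, a'))

theorem pad_bv {k : ℕ} (e : BV k) (i : ℕ) : pad e i = getBit e i := by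
  have h1 : BitRep.len (BV k) = k := Nat.mul_one k
  simp only [pad, h1, getBit]
  split_ifs with h
  · simp only [BitRep.code, Nat.div_one, BitRep.len, h, dite_true]
  · rfl

theorem trunc_pad_injective {X : Type} [BitRep X] {W : ℕ} (hX : BitRep.len X ≤ W) :
    Function.Injective fun x : X => trunc W (pad x) := fun x y h =>
  BitRep.inj x y fun i hi => by
    have := congrFun h ⟨i, by omega⟩
    simpa [trunc, pad, hi] using this

theorem ln_bv (k : ℕ) : BitRep.len (BV k) = k := Nat.mul_one k

/-- The sum over the discarded wires runs over strings that vanish on the output wires. Dropping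
these positions turns the discarded wires into an honest register of fixed length, which serves as
the environment. -/
theorem sum_place {Q : Type} [BitRep Q] {W : ℕ} (q : Q) (F : BV W → ℂ) :
    (∑ e : BV W with ∀ i, i.val < BitRep.len Q → e i = false, F (place q e)) =
      ∑ e : BV (W - BitRep.len Q), F (trunc W (pad (q, e))) := by
  refine Finset.sum_bij' (fun e _ => fun j => getBit e (BitRep.len Q + j))
    (fun e _ => fun i => if i.val < BitRep.len Q then false else getBit e (i - BitRep.len Q))
    (fun _ _ => Finset.mem_univ _) (fun e _ => ?_) (fun e he => ?_) (fun e _ => ?_) (fun e _ => ?_)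
  · simp only [Finset.mem_filter, Finset.mem_univ, true_and]
    intro i hi
    simp [hi]
  · simp only [Finset.mem_filter, Finset.mem_univ, true_and] at he
    funext i
    have := i.isLt
    split_ifs with hi
    · rw [he i hi]
    · have h1 : i.val - BitRep.len Q < W - BitRep.len Q := by omega
      have h2 : BitRep.len Q + (i.val - BitRep.len Q) = i.val := by omega
      simp [getBit, h1, h2]
  · funext j
    have := j.isLt
    have h1 : BitRep.len Q + j.val < W := by omega
    simp [getBit, h1]
  · congr 1
    funext i
    have := i.isLt
    simp only [place, trunc, pad_prod, pad_bv]
    split_ifs with hi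
    · simp [pad, hi]
    · have h1 : i.val - BitRep.len Q < W - BitRep.len Q := by omega
      have h2 : BitRep.len Q + (i.val - BitRep.len Q) = i.val := by omega
      simp [getBit, h1, h2]

theorem place_eq_overwrite {Q : Type} [BitRep Q] {W : ℕ} (q q' : Q) (e : BV W) :
    place q e = fun i => if i.val < BitRep.len Q then BitRep.code q i.val else place q' e i := by
  funext i
  simp only [place]
  split_ifs <;> rfl

theorem overwrite_trunc_pad {Q E : Type} [BitRep Q] [BitRep E] {W : ℕ} (q q' : Q) (e : E) :
    (fun i : Fin W => if i.val < BitRep.len Q then BitRep.code q i.val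
      else trunc W (pad (q', e)) i) = trunc W (pad (q, e)) := by
  funext i
  simp only [trunc, pad_prod (X := Q)]
  split_ifs with hi
  · rw [pad, if_pos hi]
  · rfl

/-- A unit vector all of whose norm comes from encodings is a combination of encodings. -/
theorem eq_sum_ket {T : Type} [BitRep T] [Fintype T] {W : ℕ} (hT : BitRep.len T ≤ W)
    {ψ : BV W → ℂ} (norm1 : ∑ z, star (ψ z) * ψ z = 1)
    (norm2 : ∑ t : T, star (ψ (trunc W (pad t))) * ψ (trunc W (pad t)) = 1) :
    ψ = ∑ t : T, ψ (trunc W (pad t)) • ket W (pad t) := by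
  classical
  set P : T → BV W := fun t => trunc _ (pad t) with hP
  have hPinj : Function.Injective P := trunc_pad_injective hT
  have hz : ∀ z, (∀ t, P t ≠ z) → ψ z = 0 := by
    have hsub : ∑ z ∈ Finset.univ.image P, star (ψ z) * ψ z = 1 := by
      rw [Finset.sum_image fun t _ t' _ h => hPinj h, norm2]
    rw [← Finset.sum_add_sum_compl (Finset.univ.image P), hsub, add_eq_left] at norm1
    have nn : ∀ z, star (ψ z) * ψ z = ((Complex.normSq (ψ z) : ℝ) : ℂ) := fun z => by
      rw [Complex.normSq_eq_conj_mul_self]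
      rfl
    simp only [nn] at norm1
    rw [← Complex.ofReal_sum, Complex.ofReal_eq_zero,
      Finset.sum_eq_zero_iff_of_nonneg fun z _ => Complex.normSq_nonneg _] at norm1
    intro z hz
    refine Complex.normSq_eq_zero.1 (norm1 z ?_)
    simp only [Finset.mem_compl, Finset.mem_image, Finset.mem_univ, true_and, not_exists]
    exact hz
  funext z
  simp only [Finset.sum_apply, Pi.smul_apply, smul_eq_mul]
  have hk : ∀ t, ket W (pad t) z = if z = P t then 1 else 0 := fun t => ket_apply _ _ _
  simp only [hk]
  by_cases hzP : ∃ t, P t = z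
  · obtain ⟨t, rfl⟩ := hzP
    rw [Finset.sum_eq_single t (by
      intro t' _ ht
      simp [hPinj.eq_iff, Ne.symm ht]) (by simp)]
    simp only [if_true, mul_one]
    rfl
  · push Not at hzP
    rw [hz z hzP, Finset.sum_eq_zero]
    intro t _
    simp [Ne.symm (hzP t)]

theorem run_map_skip {W : ℕ} (l : List ℕ) (ψ : BV W → ℂ) :
    run (l.map fun _ => Gate.skip) ψ = ψ := by
  induction l with
  | nil => rfl
  | cons _ _ ih => exact ih

section

variable {X A Y B G : ℕ → Type}
variable [∀ n, BitRep (X n)] [∀ n, BitRep (A n)] [∀ n, BitRep (Y n)] [∀ n, BitRep (B n)]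
  [∀ n, BitRep (G n)]
variable [∀ n, Fintype (A n)] [∀ n, Fintype (Y n)] [∀ n, Fintype (B n)] [∀ n, Fintype (G n)]

/-- The describing programs may name astronomically large wires; restriction to the width makes the
description admissible for `UG`. -/
theorem UG.of_ucircuit (C : UCircuit) : UG fun x => (Gate.ofNat (C.kind.eval ![x.1, x.2])
    (C.fst.eval ![x.1, x.2]) (C.snd.eval ![x.1, x.2]) (C.trd.eval ![x.1, x.2])).shift 0
      (C.width.eval x.1) :=
  UG.shift_of_min (.of_min_polyTime C.kind_poly (.const 6))
    (.of_min_polyTime C.fst_poly (by fun_prop)) (.of_min_polyTime C.snd_poly (by fun_prop))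
    (.of_min_polyTime C.trd_poly (by fun_prop)) (.const 0) (by fun_prop)

theorem run_map_shift_zero {W : ℕ} (gs : List Gate) (ψ : BV W → ℂ) :
    run (gs.map (Gate.shift 0 W)) ψ = run gs ψ := by
  induction gs generalizing ψ with
  | nil => rfl
  | cons g gs ih => rw [List.map_cons, run_cons, run_cons, g.act_shift_zero, ih]

theorem trace_single_diag {A : Type} [Fintype A] [DecidableEq A] (a : A) :
    (Matrix.single a a (1 : ℂ)).trace = 1 := by
  simp

/-- The circuit is its own dilation, with the non-output wires as environment. What needs an
argument is that the final state involves only valid encodings of outputs, since the readout simply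
ignores other strings. The trace condition in `QPT` provides it: all of the norm lies on valid
encodings, so the other amplitudes vanish. -/
theorem QPT.exists_dilation [PTLen Y] [PTLen B] {Φ : ∀ n, Instr (X n) (A n) (Y n) (B n)}
    (h : QPT Φ) : ∃ (w : PF1) (V : ∀ n, (Y n × B n) × BV (w.ev n) → X n × A n → ℂ),
      EI V ∧ ∀ n, IsDil (V n) (Φ n) := by
  classical
  obtain ⟨C, hC⟩ := h
  refine ⟨⟨fun n => C.width.eval n - ln (fun n => Y n × B n) n, by fun_prop⟩, fun n t s =>
    amplitude (C.gates n) (place s fun _ => false) (trunc (C.width.eval n) (pad t)), ?_,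
    fun n x y ρ b b' => ?_⟩
  · refine EI.intro _ C.size.eval C.width.eval (.of_ucircuit C) (by fun_prop) (by fun_prop)
      fun n => ?_
    obtain ⟨h1, h2, h3, h4⟩ := hC n
    have hlen : ln (fun n => (Y n × B n) × BV (C.width.eval n - ln (fun n => Y n × B n) n)) n =
        C.width.eval n := by
      change BitRep.len (Y n × B n) + BitRep.len (BV _) = _
      rw [ln_bv]
      exact Nat.add_sub_cancel' h2
    refine ⟨h1, hlen.le, fun s => ?_⟩
    have e1 : circ (fun x => (Gate.ofNat (C.kind.eval ![x.1, x.2]) (C.fst.eval ![x.1, x.2])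
        (C.snd.eval ![x.1, x.2]) (C.trd.eval ![x.1, x.2])).shift 0 (C.width.eval x.1))
        (C.size.eval n) n = (C.gates n).map (Gate.shift 0 (C.width.eval n)) := by
      rw [circ, UCircuit.gates, List.map_map]
      rfl
    rw [e1, run_map_shift_zero]
    refine eq_sum_ket hlen.le ?_ ?_
    · rw [run_inner]
      simp [ket_apply]
    · obtain ⟨x, a⟩ := s
      -- The trace condition is applied to the pure input `|a⟩⟨a|`; the total trace of the outputs
      -- is then the norm carried by valid encodings.
      rw [← trace_single_diag a, ← h4 x]
      simp only [Matrix.trace, Matrix.diag_apply, h3, UCircuit.instr, Matrix.of_apply]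
      rw [Fintype.sum_prod_type, Fintype.sum_prod_type]
      refine Finset.sum_congr rfl fun y _ => Finset.sum_congr rfl fun b _ => ?_
      rw [sum_place (Q := Y n × B n) (y, b) (F := fun z => ∑ a₁, ∑ a₂,
        amplitude (C.gates n) (place (x, a₁) fun _ => false) z * Matrix.single a a 1 a₁ a₂ *
          star (amplitude (C.gates n) (place (x, a₂) fun _ => false) z))]
      refine Finset.sum_congr rfl fun e _ => ?_
      rw [Finset.sum_eq_single a (by
        intro a₁ _ ha
        simp [Ne.symm ha]) (by simp),
        Finset.sum_eq_single a (by
        intro a₁ _ ha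
        simp [Ne.symm ha]) (by simp)]
      simp only [Matrix.single_apply, and_self, if_true, mul_one]
      rw [mul_comm]
      rfl
  · obtain ⟨h1, h2, h3, h4⟩ := hC n
    rw [h3]
    simp only [UCircuit.instr, Matrix.of_apply]
    -- Row and column have different output values but share the discarded wires. Expressing the row
    -- state through the column state makes the summand a function of one string, as `sum_place`
    -- requires.
    simp only [place_eq_overwrite (q := (y, b)) (q' := (y, b'))]
    rw [sum_place (Q := Y n × B n) (y, b') (F := fun z => ∑ a₁, ∑ a₂,
      amplitude (C.gates n) (place (x, a₁) fun _ => false) (fun i => if i.val <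
        BitRep.len (Y n × B n) then BitRep.code (y, b) i.val else z i) * ρ a₁ a₂ *
        star (amplitude (C.gates n) (place (x, a₂) fun _ => false) z))]
    simp only [overwrite_trunc_pad]
    rfl

/-! ### From exact implementations back to quantum polynomial time -/

theorem PT.exists_prog {f : ℕ × ℕ → ℕ} (h : PT f) :
    ∃ P : Prog 2, P.PolyTime ∧ ∀ n i, P.eval ![n, i] = f (n, i) := by
  obtain ⟨P, hP, ⟨p, hp⟩, _⟩ := h
  exact ⟨P, ⟨p, fun n i => hp (n, i)⟩, fun n i => hP (n, i)⟩

theorem UG.exists_ucircuit {g : ℕ × ℕ → Gate} (hg : UG g) (m w : Polynomial ℕ) :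
    ∃ C : UCircuit, C.width = w ∧ ∀ n, C.gates n = circ g (m.eval n) n := by
  obtain ⟨k, a, b, c, hk, ha, hb, hc, H⟩ := hg
  obtain ⟨k', hk', Hk⟩ := hk.exists_prog
  obtain ⟨a', ha', Ha⟩ := ha.exists_prog
  obtain ⟨b', hb', Hb⟩ := hb.exists_prog
  obtain ⟨c', hc', Hc⟩ := hc.exists_prog
  refine ⟨⟨k', a', b', c', hk', ha', hb', hc', m, w⟩, rfl, fun n => ?_⟩
  simp only [UCircuit.gates, circ, Hk, Ha, Hb, Hc, H]

/-- Size and width of a `UCircuit` must be polynomials exactly. The given circuit is filled up with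
`skip` gates and idle wires until both equal polynomial upper bounds. -/
theorem EI.exists_ucircuit {S T : ℕ → Type} [∀ n, BitRep (S n)] [∀ n, BitRep (T n)]
    [∀ n, Fintype (T n)] {V : ∀ n, T n → S n → ℂ} (hV : EI V) :
    ∃ C : UCircuit, ∀ n, ln S n ≤ C.width.eval n ∧ ln T n ≤ C.width.eval n ∧ ∀ s,
      run (C.gates n) (ket (C.width.eval n) (pad s)) =
        ∑ t, V n t s • ket (C.width.eval n) (pad t) := by
  obtain ⟨g, m, w, hg, H⟩ := hV
  obtain ⟨p, hp⟩ := m.exists_polynomial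
  obtain ⟨q, hq⟩ := w.exists_polynomial
  obtain ⟨C, hCw, hC⟩ := UG.exists_ucircuit (g := fun x => if x.2 < m.ev x.1 then
    (g x).shift 0 (w.ev x.1) else .skip)
    (UG.ite (by fun_prop) (hg.shift (.const 0) (by fun_prop)) .skip) p q
  refine ⟨C, fun n => ?_⟩
  obtain ⟨h1, h2, h3⟩ := H n
  rw [hCw]
  refine ⟨h1.trans (hq n), h2.trans (hq n), fun s => ?_⟩
  obtain ⟨d, hd⟩ := Nat.exists_eq_add_of_le (hp n)
  rw [hC, hd, circ_add, run_append]
  have e1 : circ (fun x => if x.2 < m.ev x.1 then (g x).shift 0 (w.ev x.1) else .skip)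
      (m.ev n) n = (circ g (m.ev n) n).map (Gate.shift 0 (w.ev n)) := by
    rw [circ, circ, List.map_map]
    refine List.map_congr_left fun i hi => ?_
    simp [List.mem_range.1 hi]
  have e2 : ∀ ψ : BV (q.eval n) → ℂ, run ((List.range d).map fun i =>
      (fun x : ℕ × ℕ => if x.2 < m.ev x.1 then (g x).shift 0 (w.ev x.1) else .skip)
        (n, m.ev n + i)) ψ = ψ := by
    intro ψ
    simp only [not_lt.2 (Nat.le_add_right _ _), if_false]
    exact run_map_skip _ ψ
  rw [e1, e2, EI.run_shift_aux (by simpa using hq n) (fun i _ => by rw [zero_add]) (h3 s)]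
  have e3 : ∀ t, overwr 0 (w.ev n) (pad s) (pad t) = pad t := fun t => overwr_zero_pad s t h1 h2
  simp only [e3]

-- The converse of `QPT.exists_dilation`. Agreement with the circuit is a computation of amplitudes,
-- and the trace condition follows from the orthonormality of the columns, `EI.isometry`.
open Classical in
theorem QPT.of_dilation [∀ n, Fintype (X n)] {V : ∀ n, (Y n × B n) × G n → X n × A n → ℂ}
    (hV : EI V) {Φ : ∀ n, Instr (X n) (A n) (Y n) (B n)} (h : ∀ n, IsDil (V n) (Φ n)) :
    QPT Φ := by
  obtain ⟨C, hC⟩ := hV.exists_ucircuit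
  refine ⟨C, fun n => ?_⟩
  obtain ⟨h1, h2, h3⟩ := hC n
  have h2' : BitRep.len (Y n × B n) + BitRep.len (G n) ≤ C.width.eval n := h2
  refine ⟨h1, by omega, fun x y ρ => ?_, fun x ρ => ?_⟩
  · have hinj : Function.Injective fun t : (Y n × B n) × G n => trunc (C.width.eval n) (pad t) :=
      trunc_pad_injective h2
    have hGinj : Function.Injective fun g : G n =>
        trunc (C.width.eval n - BitRep.len (Y n × B n)) (pad g) := trunc_pad_injective (by omega)
    have key : ∀ (p q : Y n × B n) (g : G n) (e : BV (C.width.eval n - BitRep.len (Y n × B n))),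
        trunc (C.width.eval n) (pad (p, e)) = trunc (C.width.eval n) (pad (q, g)) ↔
        p = q ∧ e = trunc _ (pad g) := by
      intro p q g e
      constructor
      · intro hh
        constructor
        · refine BitRep.inj p q fun i hi => ?_
          have := congrFun hh ⟨i, by omega⟩
          simp only [trunc, pad_prod (X := Y n × B n), hi, if_true] at this
          simpa [pad, hi] using this
        · funext j
          have hj := j.isLt
          have := congrFun hh ⟨BitRep.len (Y n × B n) + j, by omega⟩
          have hlt : ¬ BitRep.len (Y n × B n) + j.val < BitRep.len (Y n × B n) := by omega
          simp only [trunc, pad_prod (X := Y n × B n), hlt, if_false, Nat.add_sub_cancel_left,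
            pad_bv] at this
          simpa [trunc, getBit] using this
      · rintro ⟨rfl, rfl⟩
        funext i
        simp only [trunc, pad_prod (X := Y n × B n)]
        split_ifs with hi
        · rfl
        · have := i.isLt
          have h1 : i.val - BitRep.len (Y n × B n) <
            C.width.eval n - BitRep.len (Y n × B n) := by omega
          simp [pad_bv, getBit, h1, trunc]
    have amp : ∀ s b (e : BV (C.width.eval n - BitRep.len (Y n × B n))),
        amplitude (C.gates n) (place s fun _ => false) (trunc (C.width.eval n) (pad ((y, b), e))) =
        ∑ g : G n, V n ((y, b), g) s * if e = trunc _ (pad g) then 1 else 0 := by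
      intro s b e
      have h4 := congrFun (h3 s) (trunc (C.width.eval n) (pad ((y, b), e)))
      refine Eq.trans h4 ?_
      simp only [Finset.sum_apply, Pi.smul_apply, smul_eq_mul, ket_apply]
      rw [Fintype.sum_prod_type, Finset.sum_eq_single (y, b)]
      · refine Finset.sum_congr rfl fun g _ => ?_
        congr 1
        refine if_congr ?_ rfl rfl
        rw [key]
        simp
      · intro p _ hp
        refine Finset.sum_eq_zero fun g _ => ?_
        rw [if_neg, mul_zero]
        intro hh
        rw [key] at hh
        exact hp hh.1.symm
      · simp
    ext b b'
    rw [h]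
    simp only [UCircuit.instr, Matrix.of_apply]
    simp only [place_eq_overwrite (q := (y, b)) (q' := (y, b'))]
    rw [sum_place (Q := Y n × B n) (y, b') (F := fun z => ∑ a₁, ∑ a₂,
      amplitude (C.gates n) (place (x, a₁) fun _ => false) (fun i => if i.val <
        BitRep.len (Y n × B n) then BitRep.code (y, b) i.val else z i) * ρ a₁ a₂ *
        star (amplitude (C.gates n) (place (x, a₂) fun _ => false) z))]
    simp only [overwrite_trunc_pad, amp]
    -- The circuit traces out all strings on the remaining wires, but only encodings of environment
    -- states, padded with zeros, have nonzero amplitude.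
    rw [← Finset.sum_subset (Finset.subset_univ (Finset.univ.image fun g : G n =>
      trunc (C.width.eval n - BitRep.len (Y n × B n)) (pad g)))]
    · rw [Finset.sum_image fun g _ g' _ hh => hGinj hh]
      simp [hGinj.eq_iff]
    · intro e _ he
      simp only [Finset.mem_image, Finset.mem_univ, true_and, not_exists] at he
      simp [fun g => Ne.symm (he g)]
  · simp only [Matrix.trace, Matrix.diag_apply, h n x _ ρ]
    calc _ = ∑ t : (Y n × B n) × G n, ∑ a, ∑ a', V n t (x, a) * ρ a a' * star (V n t (x, a')) := by
          simp only [Fintype.sum_prod_type]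
      _ = ∑ a, ∑ a', ρ a a' * ∑ t, star (V n t (x, a')) * V n t (x, a) := by
          rw [Finset.sum_comm]
          refine Finset.sum_congr rfl fun a _ => ?_
          rw [Finset.sum_comm]
          refine Finset.sum_congr rfl fun a' _ => ?_
          rw [Finset.mul_sum]
          refine Finset.sum_congr rfl fun t _ => ?_
          ring
      _ = ∑ a, ρ a a := by
          have iso : ∀ a a', ∑ t, star (V n t (x, a')) * V n t (x, a) =
              if a' = a then 1 else 0 := by
            intro a a'
            rw [hV.isometry]
            simp
          simp only [iso]
          simp

end

/-! ## Tensor powers -/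

theorem pad_pi {k : ℕ} {X : Type} [BitRep X] (f : Fin k → X) (i : ℕ) :
    pad f i = if h : i / BitRep.len X < k then pad (f ⟨i / BitRep.len X, h⟩) (i % BitRep.len X)
      else false := by
  change (if i < k * BitRep.len X then (if h : i / BitRep.len X < k then
    BitRep.code (f ⟨i / BitRep.len X, h⟩) (i % BitRep.len X) else false) else false) = _
  simp only [pad]
  rcases Nat.eq_zero_or_pos (BitRep.len X) with h0 | h0
  · simp [h0]
  · simp only [Nat.mod_lt _ h0, if_true, Nat.div_lt_iff_lt_mul h0]
    split_ifs <;> rfl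

theorem pad_boolPi {X : Type} [BitRep X] (f : Bool → X) (i : ℕ) :
    pad f i = if i < BitRep.len X then pad (f false) i else pad (f true) (i - BitRep.len X) := by
  change (if i < BitRep.len X + BitRep.len X then (if i < BitRep.len X then
    BitRep.code (f false) i else BitRep.code (f true) (i - BitRep.len X)) else false) = _
  simp only [pad]
  split_ifs <;> first | rfl | omega

theorem pad_pi_bool {k : ℕ} {X : Type} [BitRep X] (f : Fin k → Bool → X) (i : ℕ) :
    pad f i = if h : i / BitRep.len X / 2 < k then
      pad (f ⟨i / BitRep.len X / 2, h⟩ (decide (i / BitRep.len X % 2 = 1))) (i % BitRep.len X)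
      else false := by
  rw [pad_pi]
  have hl : BitRep.len (Bool → X) = BitRep.len X * 2 := by
    rw [mul_two]; rfl
  simp only [hl, Nat.div_div_eq_div_mul]
  split_ifs with h
  · rw [pad_boolPi]
    rcases Nat.eq_zero_or_pos (BitRep.len X) with h0 | h0
    · simp [pad, h0]
    · rw [Nat.mod_mul]
      have h1 := Nat.mod_lt i h0
      rcases Nat.mod_two_eq_zero_or_one (i / BitRep.len X) with h2 | h2
      · simp [h2, h1]
      · simp [h2]
  · rfl

/-- A type with one element, encoded by `c` zeros. -/
def Blank (_c : ℕ) : Type := Unit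

instance (c : ℕ) : BitRep (Blank c) where
  len := c
  code _ _ := false
  inj _ _ _ := rfl

instance (c : ℕ) : Fintype (Blank c) := inferInstanceAs (Fintype Unit)

/-- The element of `Blank c`. -/
def blank (c : ℕ) : Blank c := ()

theorem pad_blank {c : ℕ} (b : Blank c) : pad b = fun _ => false := by
  funext i
  simp only [pad]
  split_ifs <;> rfl

theorem sum_blank {c : ℕ} {M : Type*} [AddCommMonoid M] (F : Blank c → M) :
    ∑ b, F b = F (blank c) := by
  rw [Finset.sum_eq_single (blank c)]
  · intro b _ h
    exact absurd rfl h
  · simp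

instance (p : PF1) : PTLen fun n => Blank (p.ev n) := ⟨by
  have : PT fun x => p.ev x.1 := by fun_prop
  exact this⟩

theorem pad_prod_blank {X : Type} [BitRep X] {c : ℕ} (x : X) (b : Blank c) :
    pad (x, b) = pad x := by
  funext i
  rw [pad_prod]
  split_ifs with h
  · rfl
  · rw [pad_blank, pad_of_le x (not_lt.1 h)]

/-- Induction on the number of blocks: each copy of the circuit acts on its own `w` wires and leaves
the others alone, so the amplitudes multiply. Positive `w` is needed to recover the block of a wire
by division. -/
theorem run_blocks {W w : ℕ} {S T : Type} [BitRep S] [BitRep T] [Fintype T] {gs : List Gate}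
    {V : T → S → ℂ} (hw : 0 < w)
    (h : ∀ s, run gs (ket w (pad s)) = ∑ t, V t s • ket w (pad t)) (K : ℕ) (hW : K * w ≤ W)
    (s : Fin K → S) (Z : ℕ → Bool) (hZ : ∀ (j : Fin K) r, r < w → Z (j * w + r) = pad (s j) r) :
    run ((List.range K).flatMap fun j => gs.map (Gate.shift (j * w) w)) (ket W Z) =
      ∑ t : Fin K → T, (∏ j, V (t j) (s j)) • ket W (fun i =>
        if h : i / w < K then pad (t ⟨i / w, h⟩) (i % w) else Z i) := by
  induction K with
  | zero => simp
  | succ K ih =>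
    have hKw : (K + 1) * w = K * w + w := Nat.succ_mul K w
    rw [List.range_succ, List.flatMap_append, run_append,
      ih (by omega) (fun j => s j.castSucc) (fun j r hr => by simpa using hZ j.castSucc r hr),
      run_sum, ← (Fin.snocEquiv fun _ : Fin (K + 1) => T).sum_comp, Fintype.sum_prod_type_right]
    refine Finset.sum_congr rfl fun t _ => ?_
    rw [List.flatMap_singleton, EI.run_shift_aux (by omega) (fun r hr => ?_) (h (s (Fin.last K))),
      Finset.smul_sum]
    · refine Finset.sum_congr rfl fun t' _ => ?_
      rw [smul_smul, Fin.prod_univ_castSucc]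
      simp only [Fin.snocEquiv_apply, Fin.snoc_castSucc, Fin.snoc_last]
      congr 1
      refine ket_congr fun i _ => ?_
      simp only [overwr]
      have hi := Nat.div_add_mod i w
      have hm := Nat.mod_lt i hw
      rw [mul_comm] at hi
      by_cases h1 : K * w ≤ i ∧ i < K * w + w
      · have h2 : i / w = K := by
          rw [Nat.div_eq_iff hw]
          omega
        rw [if_pos h1, dif_pos (by omega)]
        have h3 : (⟨i / w, by omega⟩ : Fin (K + 1)) = Fin.last K := Fin.ext h2
        rw [h3, Fin.snoc_last]
        congr 1
        rw [h2] at hi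
        omega
      · rw [if_neg h1]
        by_cases h2 : i / w < K
        · rw [dif_pos h2, dif_pos (by omega)]
          have h3 : (⟨i / w, by omega⟩ : Fin (K + 1)) = (⟨i / w, h2⟩ : Fin K).castSucc := rfl
          rw [h3, Fin.snoc_castSucc]
        · have h3 : i / w ≠ K := by
            intro h4
            rw [h4] at hi
            omega
          rw [dif_neg h2, dif_neg (by omega)]
    · have h2 : (K * w + r) / w = K := by
        rw [mul_comm, Nat.mul_add_div hw, Nat.div_eq_of_lt hr, add_zero]
      simp only [h2, lt_irrefl, dite_false]
      simpa using hZ (Fin.last K) r hr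

/-- Functions on pairs of an index and a bit, as functions on twice as many indices. -/
def pairIdx {k : ℕ} (j : Fin (k * 2)) : Fin k × Bool :=
  (⟨j / 2, by omega⟩, decide (j.val % 2 = 1))

theorem pairIdx_bijective (k : ℕ) : Function.Bijective (pairIdx (k := k)) := by
  constructor
  · intro a b h
    simp only [pairIdx, Prod.mk.injEq, Fin.mk.injEq, decide_eq_decide] at h
    ext
    omega
  · rintro ⟨i, b⟩
    have := i.isLt
    cases b
    · refine ⟨⟨2 * i, by omega⟩, ?_⟩
      simp [pairIdx]
    · refine ⟨⟨2 * i + 1, by omega⟩, ?_⟩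
      simp only [pairIdx, Prod.mk.injEq, decide_eq_true_eq]
      exact ⟨Fin.ext (by simp only; omega), by omega⟩

/-- The equivalence given by `pairIdx`. -/
def pairEquiv (k : ℕ) (X : Type) : (Fin (k * 2) → X) ≃ (Fin k → Bool → X) :=
  ((Equiv.arrowCongr (Equiv.ofBijective _ (pairIdx_bijective k)) (Equiv.refl X))).trans
    (Equiv.curry _ _ _)

theorem pairEquiv_symm_apply {k : ℕ} {X : Type} (f : Fin k → Bool → X) (j : Fin (k * 2)) :
    (pairEquiv k X).symm f j = f (pairIdx j).1 (pairIdx j).2 := rfl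

theorem prod_pairIdx {M : Type*} [CommMonoid M] {k : ℕ} (F : Fin k → Bool → M) :
    ∏ j : Fin (k * 2), F (pairIdx j).1 (pairIdx j).2 = ∏ i, ∏ α, F i α := by
  rw [← Fintype.prod_prod_type', ← (Equiv.ofBijective _ (pairIdx_bijective k)).prod_comp]
  rfl

section

variable {S T : ℕ → Type} [∀ n, BitRep (S n)] [∀ n, BitRep (T n)]

/-- A copy of the circuit may need more wires than the encodings of its input and output occupy. The
blanks pad both to one common length per slot, so that consecutive slots are consecutive blocks. The
common length is `w + 1` and not `w`, since blocks must be nonempty. -/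
theorem EI.pow_blank [PTLen S] [PTLen T] [∀ n, Fintype (T n)] {V : ∀ n, T n → S n → ℂ} (hV : EI V)
    (p : Polynomial ℕ) : ∃ c d : PF1,
      EI (S := fun n => Fin (p.eval n) → Bool → S n × Blank (c.ev n))
        (T := fun n => Fin (p.eval n) → Bool → T n × Blank (d.ev n))
        fun n t s => ∏ i, ∏ α, V n (t i α).1 (s i α).1 := by
  obtain ⟨g, m, w, hg, H⟩ := hV
  obtain ⟨c, hc⟩ : ∃ c : PF1, ∀ n, ln S n + c.ev n = w.ev n + 1 :=
    ⟨⟨fun n => w.ev n + 1 - ln S n, by fun_prop⟩, fun n => by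
      have := (H n).1
      simp only [PF1.ev_mk]
      omega⟩
  obtain ⟨d, hd⟩ : ∃ d : PF1, ∀ n, ln T n + d.ev n = w.ev n + 1 :=
    ⟨⟨fun n => w.ev n + 1 - ln T n, by fun_prop⟩, fun n => by
      have := (H n).2.1
      simp only [PF1.ev_mk]
      omega⟩
  refine ⟨c, d, ?_⟩
  refine EI.intro (fun x => ((g (x.1, x.2 % m.ev x.1)).shift 0 (w.ev x.1)).shift
      (x.2 / m.ev x.1 * (w.ev x.1 + 1)) (w.ev x.1 + 1))
    (fun n => p.eval n * 2 * m.ev n) (fun n => p.eval n * 2 * (w.ev n + 1))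
    (((hg.comp (by fun_prop) (by fun_prop)).shift (by fun_prop) (by fun_prop)).shift (by fun_prop)
      (by fun_prop)) (by fun_prop) (by fun_prop) fun n => ?_
  obtain ⟨h1, h2, h3⟩ := H n
  have hS : BitRep.len (S n × Blank (c.ev n)) = w.ev n + 1 := hc n
  have hT : BitRep.len (T n × Blank (d.ev n)) = w.ev n + 1 := hd n
  have hS' : BitRep.len (Fin (p.eval n) → Bool → S n × Blank (c.ev n)) =
      p.eval n * 2 * (w.ev n + 1) := by
    change p.eval n * (BitRep.len (S n × Blank _) + BitRep.len (S n × Blank _)) = _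
    rw [hS]
    ring
  have hT' : BitRep.len (Fin (p.eval n) → Bool → T n × Blank (d.ev n)) =
      p.eval n * 2 * (w.ev n + 1) := by
    change p.eval n * (BitRep.len (T n × Blank _) + BitRep.len (T n × Blank _)) = _
    rw [hT]
    ring
  refine ⟨hS'.le, hT'.le, fun s => ?_⟩
  have e1 : circ (fun x => ((g (x.1, x.2 % m.ev x.1)).shift 0 (w.ev x.1)).shift
      (x.2 / m.ev x.1 * (w.ev x.1 + 1)) (w.ev x.1 + 1)) (p.eval n * 2 * m.ev n) n =
      (List.range (p.eval n * 2)).flatMap fun j =>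
        ((circ g (m.ev n) n).map (Gate.shift 0 (w.ev n))).map
          (Gate.shift (j * (w.ev n + 1)) (w.ev n + 1)) := by
    generalize p.eval n * 2 = K
    induction K with
    | zero => simp [circ]
    | succ K ih =>
      rw [Nat.succ_mul, circ_add, ih, List.range_succ, List.flatMap_append, List.flatMap_singleton]
      congr 1
      rw [circ, List.map_map, List.map_map]
      refine List.map_congr_left fun i hi => ?_
      have hi := List.mem_range.1 hi
      simp only [Function.comp_apply]
      have h5 : (K * m.ev n + i) % m.ev n = i := by
        rw [mul_comm, Nat.mul_add_mod, Nat.mod_eq_of_lt hi]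
      have h6 : (K * m.ev n + i) / m.ev n = K := by
        rw [mul_comm, Nat.mul_add_div (by omega), Nat.div_eq_of_lt hi, add_zero]
      rw [h5, h6]
  have h4 : ∀ s : S n × Blank (c.ev n),
      run ((circ g (m.ev n) n).map (Gate.shift 0 (w.ev n))) (ket (w.ev n + 1) (pad s)) =
      ∑ t : T n × Blank (d.ev n), V n t.1 s.1 • ket (w.ev n + 1) (pad t) := by
    rintro ⟨s, b⟩
    rw [EI.run_shift_aux (by omega) (fun i _ => by rw [zero_add, pad_prod_blank]) (h3 s)]
    simp only [Fintype.sum_prod_type, sum_blank, pad_prod_blank]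
    simp only [fun t => overwr_zero_pad s t h1 h2]
  rw [e1, run_blocks (Nat.succ_pos _) h4 _ le_rfl ((pairEquiv _ _).symm s),
    ← (pairEquiv _ _).symm.sum_comp]
  · refine Finset.sum_congr rfl fun t _ => ?_
    simp only [pairEquiv_symm_apply]
    rw [prod_pairIdx fun i α => V n (t i α).1 (s i α).1]
    congr 1
    refine ket_congr fun i hi => ?_
    have h5 : i / (w.ev n + 1) < p.eval n * 2 := by
      rw [Nat.div_lt_iff_lt_mul (Nat.succ_pos _)]
      exact hi
    rw [dif_pos h5, pad_pi_bool, hT, dif_pos (by omega)]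
    rfl
  · intro j r hr
    have hj := j.isLt
    have h6 : (j.val * (w.ev n + 1) + r) / (w.ev n + 1) = j := by
      rw [mul_comm, Nat.mul_add_div (by omega), Nat.div_eq_of_lt hr, add_zero]
    have h7 : (j.val * (w.ev n + 1) + r) % (w.ev n + 1) = r := by
      rw [mul_comm, Nat.mul_add_mod, Nat.mod_eq_of_lt hr]
    rw [pad_pi_bool, hS]
    simp only [h6, h7]
    rw [dif_pos (by omega)]
    rfl

/-- Applying a rearrangement of bits to every component. -/
theorem Wire.map [PTLen S] [PTLen T] {v : ∀ n, S n → T n} (hv : Wire v) (p : Polynomial ℕ) :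
    Wire (S := fun n => Fin (p.eval n) → Bool → S n) (T := fun n => Fin (p.eval n) → Bool → T n)
      fun n s i α => v n (s i α) := by
  obtain ⟨σ, hσ⟩ := hv
  -- In a single slot `σ` may point past the encoding in order to read a zero; in the array that
  -- position would belong to the next slot. Such references are redirected to `p * 2 * ln S`, the
  -- first position behind the whole array, where a zero is guaranteed.
  refine .intro (fun n i => if σ.ev n (i % ln T n) < ln S n ∧ i / ln T n / 2 < p.eval n then
      i / ln T n * ln S n + σ.ev n (i % ln T n) else p.eval n * 2 * ln S n) (by fun_prop)
    fun n i s => ?_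
  have key : ∀ {X : ℕ → Type} [∀ n, BitRep (X n)] (f : Fin (p.eval n) → Bool → X n) (i : ℕ),
      pad f i = if h : i / ln X n / 2 < p.eval n then
        pad (f ⟨i / ln X n / 2, h⟩ (decide (i / ln X n % 2 = 1))) (i % ln X n) else false :=
    fun f i => pad_pi_bool f i
  rw [key, key]
  rcases Nat.eq_zero_or_pos (ln S n) with h0 | h0
  · have hz : ∀ (x : S n) i, pad x i = false := fun x i => pad_of_le x (by
      change ln S n ≤ i
      omega)
    simp only [hσ, hz, dite_eq_ite, ite_self]
  · by_cases h1 : i / ln T n / 2 < p.eval n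
    · rw [dif_pos h1, hσ]
      by_cases h2 : σ.ev n (i % ln T n) < ln S n
      · have h3 : (i / ln T n * ln S n + σ.ev n (i % ln T n)) / ln S n = i / ln T n := by
          rw [mul_comm, Nat.mul_add_div h0, Nat.div_eq_of_lt h2, add_zero]
        have h4 : (i / ln T n * ln S n + σ.ev n (i % ln T n)) % ln S n = σ.ev n (i % ln T n) := by
          rw [mul_comm, Nat.mul_add_mod, Nat.mod_eq_of_lt h2]
        simp only [h1, h2, and_self, if_true, h3, h4, dite_true]
      · simp only [h2, false_and, if_false]
        rw [dif_neg (by rw [Nat.mul_div_cancel _ h0]; omega)]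
        exact pad_of_le _ (not_lt.1 h2)
    · simp only [h1, and_false, if_false, dite_false]
      rw [dif_neg (by rw [Nat.mul_div_cancel _ h0]; omega)]

/-- The blanks of `EI.pow_blank` are inserted before and removed after the circuits. Both are
rearrangements of bits with inverse rearrangements, hence implementable without leftover. -/
theorem EI.pow [PTLen S] [PTLen T] [∀ n, Fintype (S n)] [∀ n, Fintype (T n)]
    {V : ∀ n, T n → S n → ℂ} (hV : EI V) (p : Polynomial ℕ) :
    EI (S := fun n => Fin (p.eval n) → Bool → S n) (T := fun n => Fin (p.eval n) → Bool → T n)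
        fun n t s => ∏ i, ∏ α, V n (t i α) (s i α) := by
  obtain ⟨c, d, h⟩ := hV.pow_blank p
  have in1 : Wire fun n (s : S n) => (s, blank (c.ev n)) := .of_pad_eq fun n s => pad_prod_blank _ _
  have out1 : Wire fun n (s : S n × Blank (c.ev n)) => s.1 :=
    .of_pad_eq fun n s => (pad_prod_blank s.1 s.2).symm
  have in2 : Wire fun n (s : T n) => (s, blank (d.ev n)) := .of_pad_eq fun n s => pad_prod_blank _ _
  have out2 : Wire fun n (s : T n × Blank (d.ev n)) => s.1 :=
    .of_pad_eq fun n s => (pad_prod_blank s.1 s.2).symm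
  have h1 := EIf.of_leftInverse (in1.map p).quad (out1.map p).quad fun n s => rfl
  have h2 := EIf.of_leftInverse (out2.map p).quad (in2.map p).quad fun n s => rfl
  exact (h.pre h1).post h2 (fun n t i α => (t i α, blank (d.ev n))) (fun _ _ => rfl)
    fun _ _ => rfl

end

/-! ## Coins -/

theorem UG.hadZero : UG fun _ => Gate.had 0 := UG.had (.const 0)

theorem EI.coin : EI (S := fun _ => Unit × Unit) (T := fun _ => (Bool × Unit) × Unit)
    fun _ _ _ => (Real.sqrt 2 : ℂ)⁻¹ := by
  refine EI.intro (fun _ => .had 0) (fun _ => 1) (fun _ => 1) UG.hadZero (by fun_prop)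
    (by fun_prop) fun n => ⟨Nat.zero_le _, le_rfl, fun s => ?_⟩
  funext z
  have h1 : ∀ t : (Bool × Unit) × Unit, pad t = fun i => if i < 1 then t.1.1 else false := by
    intro t
    funext i
    rw [pad_prod (X := Bool × Unit), pad_prod]
    simp only [BitRep.len, BitRep.code, pad]
    split_ifs <;> rfl
  have h2 : pad s = fun _ => false := funext fun i => pad_of_le s (Nat.zero_le i)
  change Gate.act (.had 0) (ket 1 (pad s)) z = _
  simp only [Gate.act, ket_apply, h1, h2, Finset.sum_apply, Pi.smul_apply, smul_eq_mul,
    Fintype.sum_prod_type, Fintype.sum_bool, Finset.univ_unique, Finset.sum_singleton]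
  have h3 : ∀ v : Bool, setBit z 0 v = fun _ => v := by
    intro v
    funext i
    simp [setBit]
  have h4 : ∀ v : Bool, z = trunc 1 (fun i => if i < 1 then v else false) ↔ z 0 = v := by
    intro v
    constructor
    · intro h
      rw [h]
      simp [trunc]
    · intro h
      funext i
      have : i = 0 := Subsingleton.elim _ _
      simp [trunc, this, h]
  have h5 : ∀ v : Bool, (fun _ : Fin 1 => v) = trunc 1 (fun _ => false) ↔ v = false := by
    intro v
    constructor
    · intro h
      exact congrFun h 0
    · rintro rfl
      rfl
  simp only [h3, h4, h5]
  cases z 0 <;> simp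

theorem coin_qpt : QPTKernel (X := fun _ => Unit) (Y := fun _ => Bool)
    fun _ _ _ => (1 / 2 : ℝ) := by
  refine QPT.of_dilation EI.coin fun n x y ρ b b' => ?_
  have h : (Real.sqrt 2 : ℂ)⁻¹ * (Real.sqrt 2 : ℂ)⁻¹ = 1 / 2 := by
    rw [← mul_inv, ← Complex.ofReal_mul, Real.mul_self_sqrt (by norm_num)]
    norm_num
  have h' : star (Real.sqrt 2 : ℂ)⁻¹ = (Real.sqrt 2 : ℂ)⁻¹ := by
    rw [star_inv₀]
    congr 1
    exact Complex.conj_ofReal _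
  simp only [Finset.univ_unique, Finset.sum_singleton, Matrix.smul_apply, h', mul_right_comm _ (ρ _ _), h]
  simp [mul_comm]

section

variable {R S T S' T' : ℕ → Type} [∀ n, BitRep (R n)] [∀ n, BitRep (S n)] [∀ n, BitRep (T n)]
  [∀ n, BitRep (S' n)] [∀ n, BitRep (T' n)]

/-! ## Functions computed with leftover -/

/-- The function is implemented, with a classical leftover. -/
def Easy (g : ∀ n, S n → T n) : Prop :=
  ∃ (w : PF1) (γ : ∀ n, S n → BV (w.ev n)), EIf fun n s => (γ n s, g n s)

/-- The encoding of `x`, filled up with zeros. -/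
def packTo {X : Type} [BitRep X] (k : ℕ) (x : X) : BV k := fun i => pad x i

theorem pad_packTo {X : Type} [BitRep X] {k : ℕ} (h : BitRep.len X ≤ k) (x : X) :
    pad (packTo k x) = pad x := by
  funext i
  rw [pad_bv, getBit]
  split_ifs with hi
  · rfl
  · exact (pad_of_le x (by omega)).symm

theorem EIf.congr_pad {v : ∀ n, S n → T n} {v' : ∀ n, S n → T' n} (hv : EIf v)
    (hl : ∀ n, ln T' n ≤ ln T n) (h : ∀ n s, pad (v' n s) = pad (v n s)) : EIf v' := by
  obtain ⟨g, m, w, hg, H⟩ := hv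
  exact ⟨g, m, w, hg, fun n => ⟨(H n).1, (hl n).trans (H n).2.1, fun s => by rw [h, (H n).2.2]⟩⟩

theorem Easy.intro {Γ : ℕ → Type} [∀ n, BitRep (Γ n)] [PTLen Γ] {g : ∀ n, S n → T n}
    {γ : ∀ n, S n → Γ n} (h : EIf fun n s => (γ n s, g n s)) : Easy g := by
  obtain ⟨w, hw⟩ : ∃ w : PF1, ∀ n, w.ev n = ln Γ n := ⟨⟨fun n => ln Γ n, by fun_prop⟩, fun n => rfl⟩
  have hl : ∀ n, BitRep.len (BV (w.ev n)) = BitRep.len (Γ n) := fun n => (ln_bv _).trans (hw n)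
  refine ⟨w, fun n s => packTo _ (γ n s), h.congr_pad (fun n => ?_) fun n s => ?_⟩
  · change BitRep.len (BV (w.ev n)) + BitRep.len (T n) ≤ BitRep.len (Γ n) + BitRep.len (T n)
    rw [hl]
  · funext i
    rw [pad_prod, pad_prod, hl, pad_packTo (hw n).ge]

theorem EIf.frame [PTLen R] [∀ n, Fintype (R n)] [∀ n, Fintype (T n)] {v : ∀ n, S n → T n}
    (hv : EIf v) : EIf (S := fun n => R n × S n) (T := fun n => R n × T n)
      fun n p => (p.1, v n p.2) := by
  rw [eif_iff] at hv ⊢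
  have h := hv.frame (R := R)
  have e : ∀ n (p : R n × T n) (q : R n × S n), open Classical in
      (if p.1 = q.1 then fmat (v n) p.2 q.2 else 0) =
      fmat (fun p : R n × S n => (p.1, v n p.2)) p q := fun n p q => by
    obtain ⟨p1, p2⟩ := p
    simp only [fmat]
    split_ifs <;> simp_all
  simpa only [e] using h

theorem EIf.of_wire [PTLen S] [PTLen T] {v : ∀ n, S n → T n} {u : ∀ n, T n → S n}
    (hv : Wire v) (hu : Wire u) (h : ∀ n s, u n (v n s) = s) : EIf v :=
  .of_leftInverse hv.quad hu.quad h

variable [PTLen R] [PTLen S] [PTLen T] [PTLen S'] [PTLen T']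

theorem Quad.easy {g : ∀ n, S n → T n} (hg : Quad g) : Easy g := .intro (EIf.append hg)

theorem Wire.easy {g : ∀ n, S n → T n} (hg : Wire g) : Easy g := hg.quad.easy

variable [∀ n, Fintype (R n)] [∀ n, Fintype (S n)] [∀ n, Fintype (T n)]
  [∀ n, Fintype (S' n)] [∀ n, Fintype (T' n)]

/-- Leftovers are never uncomputed but simply accumulate. In this way compositions of quadratic
functions, which are no longer quadratic, remain available. -/
theorem Easy.comp {g : ∀ n, S n → T n} {f : ∀ n, R n → S n} (hg : Easy g) (hf : Easy f) :
    Easy fun n r => g n (f n r) := by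
  obtain ⟨w, γ, h⟩ := hg
  obtain ⟨w', γ', h'⟩ := hf
  have h1 := (h.frame (R := fun n => BV (w'.ev n))).comp h'
  refine .intro (Γ := fun n => BV (w'.ev n) × BV (w.ev n))
    (γ := fun n r => (γ' n r, γ n (f n r))) (EIf.comp (EIf.of_wire (v := fun n
      (p : BV (w'.ev n) × BV (w.ev n) × T n) => ((p.1, p.2.1), p.2.2)) (u := fun n p =>
      (p.1.1, p.1.2, p.2)) ?_ ?_ fun _ _ => rfl) h1)
  · exact .pair (.pair Wire.id.fst Wire.id.snd.fst) Wire.id.snd.snd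
  · exact .pair Wire.id.fst.fst (.pair Wire.id.fst.snd Wire.id.snd)

theorem Easy.pair {g : ∀ n, R n → S n} {f : ∀ n, R n → T n} (hg : Easy g) (hf : Easy f) :
    Easy fun n r => (g n r, f n r) := by
  obtain ⟨w, γ, h⟩ := hg
  obtain ⟨w', γ', h'⟩ := hf
  have h0 : EIf fun n (r : R n) => (r, r) :=
    .of_wire (u := fun n p => p.1) (.pair Wire.id Wire.id) Wire.id.fst fun _ _ => rfl
  have h1 := (h.frame (R := R)).comp h0
  have h2 : EIf fun n (p : R n × BV (w.ev n) × S n) => (p.2, p.1) :=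
    .of_wire (u := fun n p => (p.2, p.1)) (.pair Wire.id.snd Wire.id.fst)
      (.pair Wire.id.snd Wire.id.fst) fun _ _ => rfl
  have h3 := (h'.frame (R := fun n => BV (w.ev n) × S n)).comp (h2.comp h1)
  refine .intro (Γ := fun n => BV (w.ev n) × BV (w'.ev n))
    (γ := fun n r => (γ n r, γ' n r)) (EIf.comp (EIf.of_wire (v := fun n
      (p : (BV (w.ev n) × S n) × BV (w'.ev n) × T n) => ((p.1.1, p.2.1), (p.1.2, p.2.2)))
      (u := fun n p => ((p.1.1, p.2.1), (p.1.2, p.2.2))) ?_ ?_ fun _ _ => rfl) h3)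
  · exact .pair (.pair Wire.id.fst.fst Wire.id.snd.fst) (.pair Wire.id.fst.snd Wire.id.snd.snd)
  · exact .pair (.pair Wire.id.fst.fst Wire.id.snd.fst) (.pair Wire.id.fst.snd Wire.id.snd.snd)

theorem Easy.fst {g : ∀ n, R n → S n × T n} (hg : Easy g) : Easy fun n r => (g n r).1 :=
  Wire.id.fst.easy.comp hg

theorem Easy.snd {g : ∀ n, R n → S n × T n} (hg : Easy g) : Easy fun n r => (g n r).2 :=
  Wire.id.snd.easy.comp hg

theorem Easy.id : Easy fun n (s : S n) => s := Wire.id.easy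

theorem Easy.eif {g : ∀ n, S n → T n} (hg : Easy g) : ∃ (w : PF1) (γ : ∀ n, S n → BV (w.ev n)),
    EIf fun n s => (s, γ n s, g n s) := by
  obtain ⟨w, γ, h⟩ := hg
  have h0 : EIf fun n (r : S n) => (r, r) :=
    .of_wire (u := fun n p => p.1) (.pair Wire.id Wire.id) Wire.id.fst fun _ _ => rfl
  exact ⟨w, γ, (h.frame (R := S)).comp h0⟩

end

section

variable {X A Y B G Z D A' B' R : ℕ → Type}
variable [∀ n, BitRep (X n)] [∀ n, BitRep (A n)] [∀ n, BitRep (Y n)] [∀ n, BitRep (B n)]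
  [∀ n, BitRep (G n)] [∀ n, BitRep (Z n)] [∀ n, BitRep (D n)] [∀ n, BitRep (A' n)]
  [∀ n, BitRep (B' n)] [∀ n, BitRep (R n)]
variable [∀ n, Fintype (X n)] [∀ n, Fintype (A n)] [∀ n, Fintype (Y n)] [∀ n, Fintype (B n)]
  [∀ n, Fintype (G n)] [∀ n, Fintype (Z n)] [∀ n, Fintype (D n)] [∀ n, Fintype (A' n)]
  [∀ n, Fintype (B' n)] [∀ n, Fintype (R n)]
variable [PTLen X] [PTLen A] [PTLen Y] [PTLen B] [PTLen G] [PTLen Z] [PTLen D] [PTLen A']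
  [PTLen B'] [PTLen R]

open Classical in
/-- Keeping a copy of the classical input. -/
theorem EI.keep {V : ∀ n, Y n → X n × A n → ℂ} (hV : EI V) :
    EI (S := fun n => X n × A n) (T := fun n => X n × Y n) fun n p q =>
      if p.1 = q.1 then V n p.2 q else 0 := by
  have h0 : EIf fun n (r : X n × A n) => (r.1, r) :=
    .of_wire (u := fun n p => p.2) (.pair Wire.id.fst Wire.id) Wire.id.snd fun _ _ => rfl
  exact (hV.frame (R := X)).pre h0

open Classical in
/-- Applying an easy function to a part of the output, keeping everything. -/
theorem EI.easy_post {V : ∀ n, R n × X n → A n → ℂ} (hV : EI V) {g : ∀ n, X n → Z n}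
    (hg : Easy g) : ∃ (w : PF1) (γ : ∀ n, X n → BV (w.ev n)),
    EI (S := A) (T := fun n => R n × (X n × (BV (w.ev n) × Z n))) fun n t a =>
      if t.2.2 = (γ n t.2.1, g n t.2.1) then V n (t.1, t.2.1) a else 0 := by
  obtain ⟨w, γ, h⟩ := hg.eif
  refine ⟨w, γ, ?_⟩
  have h1 := hV.comp (eif_iff.1 (h.frame (R := R)))
  have e : ∀ n (t : R n × (X n × (BV (w.ev n) × Z n))) (a : A n),
      (∑ s, fmat (fun p : R n × X n => (p.1, p.2, γ n p.2, g n p.2)) t s * V n s a) =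
      if t.2.2 = (γ n t.2.1, g n t.2.1) then V n (t.1, t.2.1) a else 0 := by
    rintro n ⟨r, x, c⟩ a
    rw [Finset.sum_eq_single (r, x)]
    · simp [fmat]
    · rintro ⟨r', x'⟩ _ hne
      rw [fmat, if_neg, zero_mul]
      intro hh
      simp only [Prod.mk.injEq] at hh
      exact hne (by rw [hh.1, hh.2.1])
    · simp
  simpa only [e] using h1

/-! ## Closure properties of quantum polynomial time -/

/-- The leftover of `g` depends only on the classical input. Moved to the environment, it takes a
single value for each input, so exactly one term of the enlarged Kraus sum survives. -/
theorem QPT.precomp {Φ : ∀ n, Instr (X n) (A n) (Y n) (B n)} (hΦ : QPT Φ) {g : ∀ n, Z n → X n}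
    (hg : Easy g) : QPT fun n z => Φ n (g n z) := by
  classical
  obtain ⟨w, V, hV, hD⟩ := hΦ.exists_dilation
  obtain ⟨w', γ, h⟩ := hg
  have h1 : EIf fun n (p : Z n × A n) => (p.2, p.1) :=
    .of_wire (u := fun n p => (p.2, p.1)) (.pair Wire.id.snd Wire.id.fst)
      (.pair Wire.id.snd Wire.id.fst) fun _ _ => rfl
  have h2 : EIf fun n (p : A n × BV (w'.ev n) × X n) => (p.2.1, (p.2.2, p.1)) :=
    .of_wire (u := fun n p => (p.2.2, p.1, p.2.1))
      (.pair Wire.id.snd.fst (.pair Wire.id.snd.snd Wire.id.fst))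
      (.pair Wire.id.snd.snd (.pair Wire.id.fst Wire.id.snd.fst)) fun _ _ => rfl
  have h3 := (hV.frame (R := fun n => BV (w'.ev n))).pre (h2.comp ((h.frame (R := A)).comp h1))
  have h4 : EIf fun n (p : BV (w'.ev n) × (Y n × B n) × BV (w.ev n)) => (p.2.1, (p.1, p.2.2)) :=
    .of_wire (u := fun n p => (p.2.1, p.1, p.2.2))
      (.pair Wire.id.snd.fst (.pair Wire.id.fst Wire.id.snd.snd))
      (.pair Wire.id.snd.fst (.pair Wire.id.fst Wire.id.snd.snd)) fun _ _ => rfl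
  have h5 := h3.post h4 (fun n p => (p.2.1, p.1, p.2.2)) (fun _ _ => rfl) fun _ _ => rfl
  refine QPT.of_dilation h5 fun n z y ρ b b' => ?_
  rw [hD]
  simp [Fintype.sum_prod_type]

/-- The Kraus form of a composition: products of the Kraus operators of both algorithms, indexed by
both environments. -/
theorem sum_sandwich {B A G G' : Type} [Fintype B] [Fintype A] [Fintype G] [Fintype G']
    (W : G' → B → ℂ) (W' : G' → B → ℂ) (V : B → G → A → ℂ) (V' : B → G → A → ℂ) (ρ : Op A) :
    ∑ g', ∑ b, ∑ b', W g' b * (∑ g, ∑ a, ∑ a', V b g a * ρ a a' * star (V' b' g a')) *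
      star (W' g' b') = ∑ g, ∑ g', ∑ a, ∑ a', (∑ b, W g' b * V b g a) * ρ a a' *
        star (∑ b', W' g' b' * V' b' g a') := by
  simp only [Finset.mul_sum, Finset.sum_mul, star_sum, star_mul']
  simp only [← Fintype.sum_prod_type']
  refine Fintype.sum_equiv ⟨fun p => (p.2.2.2.1, p.1, p.2.2.2.2.1, p.2.2.2.2.2, p.2.2.1, p.2.1),
    fun q => (q.2.1, q.2.2.2.2.2, q.2.2.2.2.1, q.1, q.2.2.1, q.2.2.2.1), fun _ => rfl,
    fun _ => rfl⟩ _ _ fun p => ?_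
  simp only [Equiv.coe_fn_mk]
  ring

/-- Running two algorithms one after the other. -/
def Instr.bind {X A Y B Z D : Type} (Φ : Instr X A Y B) (Ψ : Instr (X × Y) B Z D) :
    Instr X A (Y × Z) D := fun x p ρ => Ψ (x, p.1) p.2 (Φ x p.1 ρ)

theorem IsDil.eq_sum {X A Y B G : Type} [Fintype A] [Fintype G] {V : (Y × B) × G → X × A → ℂ}
    {Φ : Instr X A Y B} (h : IsDil V Φ) (x : X) (y : Y) (ρ : Op A) (b b' : B) : Φ x y ρ b b' =
      ∑ g, ∑ a, ∑ a', V ((y, b), g) (x, a) * ρ a a' * star (V ((y, b'), g) (x, a')) := h ..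

/-- The first dilation keeps the classical input, and the second reads it together with the first
output and keeps both. Afterwards both classical outputs are measured, and the input joins the two
environments, where it has only one possible value. -/
theorem QPT.bind {Φ : ∀ n, Instr (X n) (A n) (Y n) (B n)} (hΦ : QPT Φ)
    {Ψ : ∀ n, Instr (X n × Y n) (B n) (Z n) (D n)} (hΨ : QPT Ψ) :
    QPT fun n => (Φ n).bind (Ψ n) := by
  classical
  obtain ⟨w, V, hV, hD⟩ := hΦ.exists_dilation
  obtain ⟨w', W, hW, hE⟩ := hΨ.exists_dilation
  have h1 := hV.keep
  have h2 : EIf fun n (p : X n × (Y n × B n) × BV (w.ev n)) =>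
      (p.2.2, ((p.1, p.2.1.1), p.2.1.2)) :=
    .of_wire (u := fun n p => (p.2.1.1, (p.2.1.2, p.2.2), p.1))
      (.pair Wire.id.snd.snd (.pair (.pair Wire.id.fst Wire.id.snd.fst.fst) Wire.id.snd.fst.snd))
      (.pair Wire.id.snd.fst.fst (.pair (.pair Wire.id.snd.fst.snd Wire.id.snd.snd) Wire.id.fst))
      fun _ _ => rfl
  have h3 := h1.post h2 (fun n p => (p.2.1.1, (p.2.1.2, p.2.2), p.1)) (fun _ _ => rfl)
    fun _ _ => rfl
  have h4 := h3.comp (hW.keep.frame (R := fun n => BV (w.ev n)))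
  have h5 : EIf fun n (p : BV (w.ev n) × (X n × Y n) × (Z n × D n) × BV (w'.ev n)) =>
      (((p.2.1.2, p.2.2.1.1), p.2.2.1.2), ((p.1, p.2.2.2), p.2.1.1)) :=
    .of_wire (u := fun n p => (p.2.1.1, (p.2.2, p.1.1.1), (p.1.1.2, p.1.2), p.2.1.2))
      (.pair (.pair (.pair Wire.id.snd.fst.snd Wire.id.snd.snd.fst.fst) Wire.id.snd.snd.fst.snd)
        (.pair (.pair Wire.id.fst Wire.id.snd.snd.snd) Wire.id.snd.fst.fst))
      (.pair Wire.id.snd.fst.fst (.pair (.pair Wire.id.snd.snd Wire.id.fst.fst.fst)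
        (.pair (.pair Wire.id.fst.fst.snd Wire.id.fst.snd) Wire.id.snd.fst.snd)))
      fun _ _ => rfl
  have h6 := h4.post h5 (fun n p => (p.2.1.1, (p.2.2, p.1.1.1), (p.1.1.2, p.1.2), p.2.1.2))
    (fun _ _ => rfl) fun _ _ => rfl
  refine QPT.of_dilation h6 fun n x p ρ d d' => ?_
  obtain ⟨y, z⟩ := p
  simp only [Instr.bind]
  rw [hE]
  have key : ∀ (z : Z n) (d : D n) (g : BV (w.ev n)) (g' : BV (w'.ev n)) (x' : X n) (a : A n),
      (∑ s : BV (w.ev n) × (X n × Y n) × B n, (if g = s.1 then if (x', y) = s.2.1 then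
        W n ((z, d), g') s.2 else 0 else 0) *
          if s.2.1.1 = x then V n ((s.2.1.2, s.2.2), s.1) (x, a) else 0) =
      if x' = x then ∑ b, W n ((z, d), g') ((x, y), b) * V n ((y, b), g) (x, a) else 0 := by
    intro z d g g' x' a
    rw [Fintype.sum_prod_type, Finset.sum_eq_single g (by
      intro g₁ _ h
      simp [Ne.symm h]) (by simp), Fintype.sum_prod_type, Finset.sum_eq_single (x', y) (by
      intro g₁ _ h
      simp [Ne.symm h]) (by simp)]
    simp only [if_true]
    split_ifs with h
    · rw [h]
    · simp
  simp only [key, Fintype.sum_prod_type (α₂ := X n), Fintype.sum_prod_type (α₂ := BV (w'.ev n))]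
  simp only [hD n x y ρ]
  have key2 : ∀ (x' : X n) (a a' : A n) (u v : ℂ),
      (if x' = x then u else 0) * ρ a a' * star (if x' = x then v else 0) =
      if x' = x then u * ρ a a' * star v else 0 := by
    intro x' a a' u v
    split_ifs <;> simp
  simp only [key2, Finset.sum_ite_irrel, Finset.sum_const_zero, Finset.sum_ite_eq',
    Finset.mem_univ, if_true]
  exact sum_sandwich (fun g' b => W n ((z, d), g') ((x, y), b))
    (fun g' b => W n ((z, d'), g') ((x, y), b)) (fun b g a => V n ((y, b), g) (x, a))
    (fun b g a => V n ((y, b), g) (x, a)) ρ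

/-- A function of the classical input and output as the new classical output. -/
theorem QPT.marginal {Φ : ∀ n, Instr (X n) (A n) (Y n) (B n)} (hΦ : QPT Φ)
    {g : ∀ n, X n × Y n → Z n} (hg : Easy g) : QPT fun n x z ρ =>
      ∑ y, open Classical in if g n (x, y) = z then Φ n x y ρ else 0 := by
  classical
  obtain ⟨w, V, hV, hD⟩ := hΦ.exists_dilation
  have h2 : EIf fun n (p : X n × (Y n × B n) × BV (w.ev n)) =>
      ((p.2.2, p.2.1.2), (p.1, p.2.1.1)) :=
    .of_wire (u := fun n p => (p.2.1, (p.2.2, p.1.2), p.1.1))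
      (.pair (.pair Wire.id.snd.snd Wire.id.snd.fst.snd) (.pair Wire.id.fst Wire.id.snd.fst.fst))
      (.pair Wire.id.snd.fst (.pair (.pair Wire.id.snd.snd Wire.id.fst.snd) Wire.id.fst.fst))
      fun _ _ => rfl
  have h3 := hV.keep.post h2 (fun n p => (p.2.1, (p.2.2, p.1.2), p.1.1)) (fun _ _ => rfl)
    fun _ _ => rfl
  obtain ⟨w', γ, h4⟩ := h3.easy_post hg
  have h5 : EIf fun n (p : (BV (w.ev n) × B n) × ((X n × Y n) × (BV (w'.ev n) × Z n))) =>
      ((p.2.2.2, p.1.2), ((p.1.1, p.2.2.1), p.2.1)) :=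
    .of_wire (u := fun n p => ((p.2.1.1, p.1.2), (p.2.2, (p.2.1.2, p.1.1))))
      (.pair (.pair Wire.id.snd.snd.snd Wire.id.fst.snd) (.pair (.pair Wire.id.fst.fst
        Wire.id.snd.snd.fst) Wire.id.snd.fst))
      (.pair (.pair Wire.id.snd.fst.fst Wire.id.fst.snd) (.pair Wire.id.snd.snd
        (.pair Wire.id.snd.fst.snd Wire.id.fst.fst)))
      fun _ _ => rfl
  have h6 := h4.post h5 (fun n p => ((p.2.1.1, p.1.2), (p.2.2, (p.2.1.2, p.1.1))))
    (fun _ _ => rfl) fun _ _ => rfl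
  refine QPT.of_dilation h6 fun n x z ρ b b' => ?_
  have key : ∀ (g₁ : BV (w.ev n)) (c : BV (w'.ev n)) (x' : X n) (y : Y n) (b b' : B n),
      (∑ a, ∑ a', (if (c, z) = (γ n (x', y), g n (x', y)) then
        if x' = x then V n ((y, b), g₁) (x, a) else 0 else 0) * ρ a a' *
        star (if (c, z) = (γ n (x', y), g n (x', y)) then
        if x' = x then V n ((y, b'), g₁) (x, a') else 0 else 0)) =
      if c = γ n (x', y) then if x' = x then if g n (x, y) = z then
        ∑ a, ∑ a', V n ((y, b), g₁) (x, a) * ρ a a' * star (V n ((y, b'), g₁) (x, a'))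
        else 0 else 0 else 0 := by
    intro g₁ c x' y b b'
    split_ifs with h₁ h₂ h₃ h₄ <;> simp_all
  simp only [Fintype.sum_prod_type (α₂ := X n × Y n), Fintype.sum_prod_type (α₁ := X n),
    Fintype.sum_prod_type (α₂ := BV (w'.ev n)), key]
  rw [Matrix.sum_apply]
  have e1 : ∀ y, (if g n (x, y) = z then Φ n x y ρ else 0) b b' =
      ∑ g₁, if g n (x, y) = z then ∑ a, ∑ a', V n ((y, b), g₁) (x, a) * ρ a a' *
        star (V n ((y, b'), g₁) (x, a')) else 0 := by
    intro y
    split_ifs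
    · exact hD ..
    · simp
  simp only [e1]
  rw [Finset.sum_comm]
  refine Finset.sum_congr rfl fun g₁ _ => ?_
  have e2 : ∀ (F : Y n → ℂ), (∑ c : BV (w'.ev n), ∑ x', ∑ y, if c = γ n (x', y) then
      if x' = x then F y else 0 else 0) = ∑ y, F y := by
    intro F
    rw [Finset.sum_comm]
    simp only [Finset.sum_comm (s := (Finset.univ : Finset (BV (w'.ev n)))), Finset.sum_ite_eq',
      Finset.mem_univ, if_true, Finset.sum_ite_irrel, Finset.sum_const_zero]
  rw [e2]

/-- A copy of the classical output is left in the quantum register. -/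
theorem QPT.dup {Φ : ∀ n, Instr (X n) (A n) (Y n) (B n)} (hΦ : QPT Φ) :
    QPT (B := fun n => Y n × B n) fun n x y ρ => Matrix.of fun p q =>
      open Classical in if p.1 = y ∧ q.1 = y then Φ n x y ρ p.2 q.2 else 0 := by
  classical
  obtain ⟨w, V, hV, hD⟩ := hΦ.exists_dilation
  have h2 : EIf fun n (p : (Y n × B n) × BV (w.ev n)) => ((p.1.1, (p.1.1, p.1.2)), p.2) :=
    .of_wire (u := fun n p => ((p.1.1, p.1.2.2), p.2))
      (.pair (.pair Wire.id.fst.fst (.pair Wire.id.fst.fst Wire.id.fst.snd)) Wire.id.snd)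
      (.pair (.pair Wire.id.fst.fst Wire.id.fst.snd.snd) Wire.id.snd)
      fun _ _ => rfl
  have h3 := hV.comp (eif_iff.1 h2)
  have e : ∀ n (t : (Y n × (Y n × B n)) × BV (w.ev n)) (s : X n × A n),
      (∑ r, fmat (fun p : (Y n × B n) × BV (w.ev n) => ((p.1.1, (p.1.1, p.1.2)), p.2)) t r *
        V n r s) = if t.1.2.1 = t.1.1 then V n ((t.1.1, t.1.2.2), t.2) s else 0 := by
    rintro n ⟨⟨y, y', b⟩, g⟩ s
    rw [Finset.sum_eq_single ((y, b), g)]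
    · simp [fmat]
    · rintro ⟨⟨y₁, b₁⟩, g₁⟩ _ hne
      rw [fmat, if_neg, zero_mul]
      intro hh
      simp only [Prod.mk.injEq] at hh
      exact hne (by rw [hh.1.1, hh.1.2.2, hh.2])
    · simp
  simp only [e] at h3
  refine QPT.of_dilation h3 fun n x y ρ p q => ?_
  simp only [Matrix.of_apply]
  by_cases h : p.1 = y ∧ q.1 = y
  · simp only [h, and_self, if_true]
    exact hD ..
  · rw [if_neg h]
    rcases not_and_or.1 h with h | h <;> simp [h]

open Classical in
/-- Storing the classical output in the quantum register. -/
def Instr.store {X A Y B Z : Type} (Φ : Instr X A Y B) (g : X × Y → Z) :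
    Instr X A Z (Y × B) := fun x z ρ => Matrix.of fun p q =>
      if p.1 = q.1 ∧ g (x, p.1) = z then Φ x p.1 ρ p.2 q.2 else 0

/-- The classical output is duplicated into the quantum register, and the measured copy is then
coarsened to `g`. Reductions remember their whole history between the stages of an experiment in
this way. -/
theorem QPT.store {Φ : ∀ n, Instr (X n) (A n) (Y n) (B n)} (hΦ : QPT Φ)
    {g : ∀ n, X n × Y n → Z n} (hg : Easy g) : QPT fun n => (Φ n).store (g n) := by
  classical
  convert hΦ.dup.marginal hg using 5 with n x z ρ
  ext p q
  rw [Matrix.sum_apply, Finset.sum_eq_single p.1]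
  · simp only [Instr.store, Matrix.of_apply]
    rcases eq_or_ne p.1 q.1 with h1 | h1
    · rw [← h1]
      split_ifs <;> simp_all
    · rw [if_neg fun h => h1 h.1]
      split_ifs <;> simp [h1.symm]
  · intro y _ hy
    split_ifs
    · simp [Ne.symm hy]
    · rfl
  · simp

/-- An algorithm acting on a part of a register. -/
def Instr.frame {X A Y B : Type} (R : Type) (Φ : Instr X A Y B) : Instr X (R × A) Y (R × B) :=
  fun x y ρ => Matrix.of fun p q => Φ x y (Matrix.of fun a a' => ρ (p.1, a) (q.1, a')) p.2 q.2

theorem QPT.frame {Φ : ∀ n, Instr (X n) (A n) (Y n) (B n)} (hΦ : QPT Φ) :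
    QPT fun n => (Φ n).frame (R n) := by
  classical
  obtain ⟨w, V, hV, hD⟩ := hΦ.exists_dilation
  have h1 : EIf fun n (p : X n × R n × A n) => (p.2.1, p.1, p.2.2) :=
    .of_wire (u := fun n p => (p.2.1, p.1, p.2.2))
      (.pair Wire.id.snd.fst (.pair Wire.id.fst Wire.id.snd.snd))
      (.pair Wire.id.snd.fst (.pair Wire.id.fst Wire.id.snd.snd)) fun _ _ => rfl
  have h2 : EIf fun n (p : R n × (Y n × B n) × BV (w.ev n)) => ((p.2.1.1, (p.1, p.2.1.2)), p.2.2) :=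
    .of_wire (u := fun n p => (p.1.2.1, (p.1.1, p.1.2.2), p.2))
      (.pair (.pair Wire.id.snd.fst.fst (.pair Wire.id.fst Wire.id.snd.fst.snd)) Wire.id.snd.snd)
      (.pair Wire.id.fst.snd.fst (.pair (.pair Wire.id.fst.fst Wire.id.fst.snd.snd) Wire.id.snd))
      fun _ _ => rfl
  have h3 := ((hV.frame (R := R)).pre h1).post h2 (fun n p => (p.1.2.1, (p.1.1, p.1.2.2), p.2))
    (fun _ _ => rfl) fun _ _ => rfl
  refine QPT.of_dilation h3 fun n x y ρ p q => ?_
  simp only [Instr.frame, Matrix.of_apply]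
  rw [hD]
  refine Finset.sum_congr rfl fun g _ => ?_
  rw [Fintype.sum_prod_type, Finset.sum_eq_single p.1 (by
    intro r _ hr
    simp [Ne.symm hr]) (by simp)]
  refine Finset.sum_congr rfl fun a _ => ?_
  rw [Fintype.sum_prod_type, Finset.sum_eq_single q.1 (by
    intro r _ hr
    simp [Ne.symm hr]) (by simp)]
  simp

/-- Renaming the basis states of the quantum input. -/
theorem QPT.pre {Φ : ∀ n, Instr (X n) (A n) (Y n) (B n)} (hΦ : QPT Φ)
    (e : ∀ n, A' n ≃ A n) (he : EIf fun n => e n) :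
    QPT fun n x y (ρ : Op (A' n)) => Φ n x y (ρ.submatrix (e n).symm (e n).symm) := by
  classical
  obtain ⟨w, V, hV, hD⟩ := hΦ.exists_dilation
  refine QPT.of_dilation (hV.pre (he.frame (R := X))) fun n x y ρ b b' => ?_
  rw [hD]
  refine Finset.sum_congr rfl fun g _ => ?_
  rw [← (e n).sum_comp]
  refine Finset.sum_congr rfl fun a _ => ?_
  rw [← (e n).sum_comp]
  simp

/-- Renaming the basis states of the quantum output. -/
theorem QPT.post {Φ : ∀ n, Instr (X n) (A n) (Y n) (B n)} (hΦ : QPT Φ)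
    (f : ∀ n, B n ≃ B' n) (hf : EIf fun n => f n) :
    QPT fun n x y (ρ : Op (A n)) => (Φ n x y ρ).submatrix (f n).symm (f n).symm := by
  classical
  obtain ⟨w, V, hV, hD⟩ := hΦ.exists_dilation
  have h1 : EIf fun n (p : (Y n × B n) × BV (w.ev n)) => ((p.1.1, p.2), p.1.2) :=
    .of_wire (u := fun n p => ((p.1.1, p.2), p.1.2))
      (.pair (.pair Wire.id.fst.fst Wire.id.snd) Wire.id.fst.snd)
      (.pair (.pair Wire.id.fst.fst Wire.id.snd) Wire.id.fst.snd) fun _ _ => rfl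
  have h2 : EIf fun n (p : (Y n × BV (w.ev n)) × B' n) => ((p.1.1, p.2), p.1.2) :=
    .of_wire (u := fun n p => ((p.1.1, p.2), p.1.2))
      (.pair (.pair Wire.id.fst.fst Wire.id.snd) Wire.id.fst.snd)
      (.pair (.pair Wire.id.fst.fst Wire.id.snd) Wire.id.fst.snd) fun _ _ => rfl
  have h3 := hV.post (h2.comp ((hf.frame (R := fun n => Y n × BV (w.ev n))).comp h1))
    (fun n p => ((p.1.1, (f n).symm p.1.2), p.2)) (fun n p => by simp) (fun n p => by simp)
  refine QPT.of_dilation h3 fun n x y ρ b b' => ?_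
  rw [Matrix.submatrix_apply, hD]

/-- Renaming the basis states, controlled by the classical input, measuring some of the result and
discarding some of it. -/
theorem QPT.of_equiv (e : ∀ n, X n → A n ≃ (Y n × B n) × G n)
    (he : EIf fun n (p : X n × A n) => (p.1, e n p.1 p.2)) :
    QPT fun n x y (ρ : Op (A n)) => Matrix.of fun b b' =>
      ∑ g, ρ ((e n x).symm ((y, b), g)) ((e n x).symm ((y, b'), g)) := by
  classical
  have h1 : EIf fun n (p : X n × (Y n × B n) × G n) => (p.2.1, (p.2.2, p.1)) :=
    .of_wire (u := fun n p => (p.2.2, (p.1, p.2.1)))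
      (.pair Wire.id.snd.fst (.pair Wire.id.snd.snd Wire.id.fst))
      (.pair Wire.id.snd.snd (.pair Wire.id.fst Wire.id.snd.fst)) fun _ _ => rfl
  refine QPT.of_dilation (eif_iff.1 (h1.comp he)) fun n x y ρ b b' => ?_
  have key : ∀ g x' a b, fmat (fun p : X n × A n => ((e n p.1 p.2).1, (e n p.1 p.2).2, p.1))
      ((y, b), (g, x')) (x, a) = if x' = x then if a = (e n x).symm ((y, b), g) then 1 else 0
        else 0 := by
    intro g x' a b
    rw [fmat, Equiv.eq_symm_apply]
    split_ifs with h₁ h₂ h₃ h₃ h₂ <;> simp_all [Prod.ext_iff]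
  simp only [Fintype.sum_prod_type (α₂ := X n), key, Matrix.of_apply]
  refine Finset.sum_congr rfl fun g _ => ?_
  rw [Finset.sum_eq_single x (by
    intro r _ hr
    simp [hr]) (by simp)]
  simp

end

section

variable {X A Y B G Z D C A' B' R : ℕ → Type}
variable [∀ n, BitRep (X n)] [∀ n, BitRep (A n)] [∀ n, BitRep (Y n)] [∀ n, BitRep (B n)]
  [∀ n, BitRep (G n)] [∀ n, BitRep (Z n)] [∀ n, BitRep (D n)] [∀ n, BitRep (C n)]
variable [∀ n, Fintype (X n)] [∀ n, Fintype (A n)] [∀ n, Fintype (Y n)] [∀ n, Fintype (B n)]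
  [∀ n, Fintype (G n)] [∀ n, Fintype (Z n)] [∀ n, Fintype (D n)] [∀ n, Fintype (C n)]
variable [PTLen X] [PTLen A] [PTLen Y] [PTLen B] [PTLen G] [PTLen Z] [PTLen D] [PTLen C]

/-! ## Extending algorithms step by step -/

theorem QPT.congr {Φ Φ' : ∀ n, Instr (X n) (A n) (Y n) (B n)} (h : QPT Φ)
    (e : ∀ n x y ρ, Φ' n x y ρ = Φ n x y ρ) : QPT Φ' := by
  have : Φ' = Φ := by
    funext n x y ρ
    exact e n x y ρ
  rwa [this]

theorem QPTPrep.congr {S S' : ∀ n, Prep (X n) (Y n) (B n)} (h : QPTPrep S)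
    (e : ∀ n x y, S' n x y = S n x y) : QPTPrep S' :=
  QPT.congr h fun n x y ρ => by rw [e]

theorem QPT.prep {Φ : ∀ n, Instr (X n) Unit (Y n) (B n)} (h : QPT Φ)
    {S : ∀ n, Prep (X n) (Y n) (B n)} (e : ∀ n x y ρ, Φ n x y ρ = ρ () () • S n x y) :
    QPTPrep S := QPT.congr h fun n x y ρ => (e n x y ρ).symm

theorem EIf.of_wire_equiv {e : ∀ n, A n ≃ B n} (h : Wire fun n a => e n a)
    (h' : Wire fun n b => (e n).symm b) : EIf fun n => e n :=
  .of_wire (u := fun n b => (e n).symm b) h h' fun n a => (e n).symm_apply_apply a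

theorem QPTPrep.tensor_right {S : ∀ n, Prep (X n) (Y n) (C n)} (hS : QPTPrep S) :
    QPT (A := B) (B := fun n => B n × C n) fun n x y ρ => ρ ⊗ₖ S n x y := by
  have h1 := (QPT.frame (R := B) hS).pre (fun n => (Equiv.prodPUnit (B n)).symm)
    (.of_wire_equiv (.pair Wire.id Wire.unit) Wire.id.fst)
  convert h1 using 4 with n x y ρ
  ext p q
  simp [Instr.frame, Matrix.kroneckerMap_apply]

theorem QPTKernel.smul {K : ∀ n, Kernel (X n) (Y n)} (hK : QPTKernel K) :
    QPT (A := B) (B := B) fun n x y ρ => (K n x y : ℂ) • ρ := by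
  have h1 := (QPTPrep.tensor_right (B := B) hK).post (fun n => Equiv.prodPUnit (B n))
    (.of_wire_equiv Wire.id.fst (.pair Wire.id Wire.unit))
  convert h1 using 4 with n x y ρ
  ext p q
  simp [Matrix.kroneckerMap_apply, mul_comm]

/-- Classical outputs accumulate in a tuple, and `g` reads the input of the next algorithm off
everything known so far. Reductions with many steps are chains of this lemma and the two after it.
-/
theorem QPT.andPrep {Φ : ∀ n, Instr (X n) (A n) (Y n) (B n)} (hΦ : QPT Φ)
    {S : ∀ n, Prep (D n) (Z n) (C n)} (hS : QPTPrep S) {g : ∀ n, X n × Y n → D n} (hg : Easy g) :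
    QPT (Y := fun n => Y n × Z n) (B := fun n => B n × C n) fun n x p ρ =>
      Φ n x p.1 ρ ⊗ₖ S n (g n (x, p.1)) p.2 :=
  hΦ.bind (hS.tensor_right.precomp hg)

theorem QPT.andKernel {Φ : ∀ n, Instr (X n) (A n) (Y n) (B n)} (hΦ : QPT Φ)
    {K : ∀ n, Kernel (D n) (Z n)} (hK : QPTKernel K) {g : ∀ n, X n × Y n → D n} (hg : Easy g) :
    QPT (Y := fun n => Y n × Z n) fun n x p ρ => (K n (g n (x, p.1)) p.2 : ℂ) • Φ n x p.1 ρ :=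
  hΦ.bind (hK.smul.precomp hg)

theorem QPT.andThen {Φ : ∀ n, Instr (X n) (A n) (Y n) (B n)} (hΦ : QPT Φ)
    {Ψ : ∀ n, Instr (D n) (B n) (Z n) (C n)} (hΨ : QPT Ψ) {g : ∀ n, X n × Y n → D n}
    (hg : Easy g) :
    QPT (Y := fun n => Y n × Z n) fun n x p ρ => Ψ n (g n (x, p.1)) p.2 (Φ n x p.1 ρ) :=
  hΦ.bind (hΨ.precomp hg)

/-! ## Algorithms without quantum input -/

theorem QPTPrep.precomp {S : ∀ n, Prep (X n) (Y n) (B n)} (hS : QPTPrep S) {g : ∀ n, Z n → X n}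
    (hg : Easy g) : QPTPrep fun n z => S n (g n z) :=
  QPT.precomp (Φ := fun n x y ρ => ρ () () • S n x y) hS hg

theorem QPTPrep.andPrep {S : ∀ n, Prep (X n) (Y n) (B n)} (hS : QPTPrep S)
    {S' : ∀ n, Prep (D n) (Z n) (C n)} (hS' : QPTPrep S') {g : ∀ n, X n × Y n → D n}
    (hg : Easy g) : QPTPrep (Y := fun n => Y n × Z n) (B := fun n => B n × C n) fun n x p =>
      S n x p.1 ⊗ₖ S' n (g n (x, p.1)) p.2 := by
  have h := QPT.andPrep (Φ := fun n x y ρ => ρ () () • S n x y) hS hS' hg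
  simp only [Matrix.smul_kronecker] at h
  exact h

theorem QPTPrep.marginal {S : ∀ n, Prep (X n) (Y n) (B n)} (hS : QPTPrep S)
    {g : ∀ n, X n × Y n → Z n} (hg : Easy g) : QPTPrep fun n x z =>
      ∑ y, open Classical in if g n (x, y) = z then S n x y else 0 := by
  classical
  have h := QPT.marginal (Φ := fun n x y ρ => ρ () () • S n x y) hS hg
  refine QPT.prep h fun n x z ρ => ?_
  rw [Finset.smul_sum]
  simp only [smul_ite, smul_zero]

theorem QPTPrep.post {S : ∀ n, Prep (X n) (Y n) (B n)} (hS : QPTPrep S) (f : ∀ n, B n ≃ D n)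
    (hf : EIf fun n => f n) : QPTPrep fun n x y => (S n x y).submatrix (f n).symm (f n).symm :=
  QPT.post (Φ := fun n x y ρ => ρ () () • S n x y) hS f hf

theorem QPTKernel.andPrep {K : ∀ n, Kernel (X n) (Y n)} (hK : QPTKernel K)
    {S' : ∀ n, Prep (D n) (Z n) (C n)} (hS' : QPTPrep S') {g : ∀ n, X n × Y n → D n}
    (hg : Easy g) : QPTPrep (Y := fun n => Y n × Z n) fun n x p =>
      (K n x p.1 : ℂ) • S' n (g n (x, p.1)) p.2 := by
  have h := (QPTPrep.andPrep hK hS' hg).post (fun n => Equiv.punitProd (C n))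
    (.of_wire_equiv Wire.id.snd (.pair Wire.unit Wire.id))
  convert h using 4 with n x p
  ext b b'
  simp [Matrix.kroneckerMap_apply]

theorem QPTKernel.marginal {K : ∀ n, Kernel (X n) (Y n)} (hK : QPTKernel K)
    {g : ∀ n, X n × Y n → Z n} (hg : Easy g) : QPTKernel fun n x z =>
      ∑ y, open Classical in if g n (x, y) = z then K n x y else 0 := by
  classical
  have h := QPTPrep.marginal hK hg
  refine QPTPrep.congr h fun n x z => ?_
  push_cast
  rw [Finset.sum_smul]
  exact Finset.sum_congr rfl fun y _ => by split_ifs <;> simp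

end

section

variable {X A Y B G Z D C R S T : ℕ → Type}
variable [∀ n, BitRep (X n)] [∀ n, BitRep (A n)] [∀ n, BitRep (Y n)] [∀ n, BitRep (B n)]
  [∀ n, BitRep (G n)] [∀ n, BitRep (Z n)] [∀ n, BitRep (D n)] [∀ n, BitRep (C n)]
  [∀ n, BitRep (R n)] [∀ n, BitRep (S n)] [∀ n, BitRep (T n)]
variable [∀ n, Fintype (X n)] [∀ n, Fintype (A n)] [∀ n, Fintype (Y n)] [∀ n, Fintype (B n)]
  [∀ n, Fintype (G n)] [∀ n, Fintype (Z n)] [∀ n, Fintype (D n)] [∀ n, Fintype (C n)]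
  [∀ n, Fintype (R n)] [∀ n, Fintype (S n)] [∀ n, Fintype (T n)]
variable [PTLen X] [PTLen A] [PTLen Y] [PTLen B] [PTLen G] [PTLen Z] [PTLen D] [PTLen C]
  [PTLen R] [PTLen S] [PTLen T]

/-! ## Multiplexing -/

theorem pad_bool (b : Bool) : pad b = fun i => if i < 1 then b else false := rfl

theorem BQ.bit_and {c : ∀ n, S n → Bool} (hc : Wire c) {b : ∀ n, S n → T n} (hb : Wire b) :
    BQ fun n i s => c n s && pad (b n s) i := by
  obtain ⟨σ, hσ⟩ := hc
  obtain ⟨τ, hτ⟩ := hb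
  refine (BQ.and_wire (σ := fun n _ => σ.ev n 0) (τ := τ.ev) (by fun_prop) (by fun_prop)).congr
    fun n i s => ?_
  rw [← hσ, ← hτ]
  rfl

theorem BQ.bit {c : ∀ n, S n → Bool} (hc : Wire c) : BQ fun n _ s => c n s :=
  (BQ.reindex hc.quad (σ := fun _ _ => 0) (by fun_prop)).congr fun _ _ _ => rfl

/-- Over the field with two elements the choice is `b' + c·b + c·b'`, which is quadratic when `c`,
`b` and `b'` are single bits of the argument. -/
theorem Quad.mux {c : ∀ n, S n → Bool} (hc : Wire c) {b b' : ∀ n, S n → T n} (hb : Wire b)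
    (hb' : Wire b') : Quad fun n s => if c n s then b n s else b' n s :=
  (hb'.quad.xor ((BQ.bit_and hc hb).xor (BQ.bit_and hc hb'))).congr fun n i s => by
    cases h : c n s
    · simp [h]
    · simp only [h, if_true, Bool.true_and]
      cases pad (b n s) i <;> cases pad (b' n s) i <;> rfl

theorem QPTPrep.sum_trace {S : ∀ n, Prep (X n) (Y n) (B n)} (hS : QPTPrep S) (n : ℕ) (x : X n) :
    ∑ y, (S n x y).trace = 1 := by
  obtain ⟨C, hC⟩ := hS
  have h := (hC n).2.2.2 x (1 : Op Unit)
  simpa using h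

/-- Running one of two algorithms. -/
theorem QPTPrep.cond {S₀ S₁ : ∀ n, Prep (X n) (Y n) (B n)} (h₀ : QPTPrep S₀) (h₁ : QPTPrep S₁)
    {c : ∀ n, X n → Bool} (hc : Easy c) :
    QPTPrep fun n x y => if c n x then S₁ n x y else S₀ n x y := by
  classical
  -- Both algorithms are run. The condition then decides which of the two registers is put in the
  -- output position, and the other one is discarded.
  let e : ∀ n, Bool → B n × B n ≃ (Unit × B n) × B n := fun n c =>
    ⟨fun p => (((), if c then p.2 else p.1), if c then p.1 else p.2),
      fun q => (if c then q.2 else q.1.2, if c then q.1.2 else q.2), fun p => by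
        cases c <;> rfl, fun q => by cases c <;> rfl⟩
  have q1 : Quad fun n (p : Bool × B n × B n) => (p.1, e n p.1 p.2) :=
    .pair Wire.id.fst.quad (.pair (.pair Wire.unit.quad (.mux Wire.id.fst Wire.id.snd.snd
      Wire.id.snd.fst)) (.mux Wire.id.fst Wire.id.snd.fst Wire.id.snd.snd))
  have q2 : Quad fun n (p : Bool × (Unit × B n) × B n) => (p.1, (e n p.1).symm p.2) :=
    .pair Wire.id.fst.quad (.pair (.mux Wire.id.fst Wire.id.snd.snd Wire.id.snd.fst.snd)
      (.mux Wire.id.fst Wire.id.snd.fst.snd Wire.id.snd.snd))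
  have he := QPT.of_equiv (X := fun _ => Bool) e (EIf.of_leftInverse q1 q2 fun n p => by simp)
  have h2 := (QPTPrep.andPrep h₀ h₁ Easy.id.fst).andThen he (hc.comp Easy.id.fst)
  have q3 : Quad fun n (p : Bool × Y n × Y n) => if p.1 then p.2.2 else p.2.1 :=
    .mux Wire.id.fst Wire.id.snd.snd Wire.id.snd.fst
  have h3 := h2.marginal (g := fun n p => if c n p.1 then p.2.1.2 else p.2.1.1)
    (q3.easy.comp (.pair (hc.comp Easy.id.fst) Easy.id.snd.fst))
  refine QPT.prep h3 fun n x y ρ => ?_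
  rw [Fintype.sum_prod_type, Fintype.sum_prod_type]
  simp only [Finset.univ_unique, Finset.sum_singleton]
  ext b b'
  simp only [Matrix.sum_apply, Matrix.smul_apply]
  cases hcx : c n x
  · rw [Finset.sum_eq_single y (by
      intro y' _ hy
      simp [hy]) (by simp)]
    simp only [if_true, Bool.false_eq_true, if_false, Matrix.of_apply, e, Equiv.coe_fn_symm_mk,
      Matrix.kroneckerMap_apply, smul_eq_mul, ← Finset.mul_sum]
    -- The discarded algorithm has total trace one over all its classical outputs, so it leaves no
    -- factor behind.
    have := h₁.sum_trace n x
    simp only [Matrix.trace, Matrix.diag_apply] at this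
    rw [this, mul_one]
  · simp only [if_true]
    rw [Finset.sum_comm, Finset.sum_eq_single y (by
      intro y' _ hy
      simp [hy]) (by simp)]
    simp only [if_true, Matrix.of_apply, e, Equiv.coe_fn_symm_mk, Matrix.kroneckerMap_apply,
      smul_eq_mul, ← Finset.mul_sum, ← Finset.sum_mul]
    have := h₀.sum_trace n x
    simp only [Matrix.trace, Matrix.diag_apply] at this
    rw [this, one_mul]

/-! ## Tensor powers of algorithms -/

theorem Wire.zip {p : Polynomial ℕ} {v : ∀ n, R n → Fin (p.eval n) → Bool → S n}
    {u : ∀ n, R n → Fin (p.eval n) → Bool → T n} (hv : Wire v) (hu : Wire u) :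
    Wire (T := fun n => Fin (p.eval n) → Bool → S n × T n) fun n r i α => (v n r i α, u n r i α) := by
  obtain ⟨σ, hσ⟩ := hv
  obtain ⟨τ, hτ⟩ := hu
  refine .intro (fun n i => if i / (ln S n + ln T n) / 2 < p.eval n then
      if i % (ln S n + ln T n) < ln S n then
        σ.ev n (i / (ln S n + ln T n) * ln S n + i % (ln S n + ln T n))
      else if i % (ln S n + ln T n) - ln S n < ln T n then
        τ.ev n (i / (ln S n + ln T n) * ln T n + (i % (ln S n + ln T n) - ln S n))
      else ln R n else ln R n) (by fun_prop) fun n i r => ?_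
  have key : ∀ {X : ℕ → Type} [∀ n, BitRep (X n)] (f : Fin (p.eval n) → Bool → X n) (i : ℕ),
      pad f i = if h : i / ln X n / 2 < p.eval n then
        pad (f ⟨i / ln X n / 2, h⟩ (decide (i / ln X n % 2 = 1))) (i % ln X n) else false :=
    fun f i => pad_pi_bool f i
  have key2 : ∀ {X : ℕ → Type} [∀ n, BitRep (X n)] (f : Fin (p.eval n) → Bool → X n) (K m : ℕ)
      (h : K / 2 < p.eval n), m < ln X n → pad f (K * ln X n + m) =
        pad (f ⟨K / 2, h⟩ (decide (K % 2 = 1))) m := by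
    intro X _ f K m h hm
    have h1 : (K * ln X n + m) / ln X n = K := by
      rw [mul_comm, Nat.mul_add_div (by omega), Nat.div_eq_of_lt hm, add_zero]
    have h2 : (K * ln X n + m) % ln X n = m := by
      rw [mul_comm, Nat.mul_add_mod, Nat.mod_eq_of_lt hm]
    rw [key]
    simp only [h1, h2]
    rw [dif_pos h]
  have hr : false = pad r (ln R n) := (pad_of_le r le_rfl).symm
  rw [key (X := fun n => S n × T n)]
  have hl : ln (fun n => S n × T n) n = ln S n + ln T n := rfl
  simp only [hl]
  by_cases hK : i / (ln S n + ln T n) / 2 < p.eval n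
  · rw [dif_pos hK, if_pos hK, pad_prod]
    by_cases h1 : i % (ln S n + ln T n) < ln S n
    · rw [if_pos h1, ← hσ, key2 _ _ _ hK h1]
      exact if_pos h1
    · rw [if_neg h1]
      refine (if_neg h1).trans ?_
      by_cases h2 : i % (ln S n + ln T n) - ln S n < ln T n
      · rw [if_pos h2, ← hτ, key2 _ _ _ hK h2]
        rfl
      · rw [if_neg h2, ← hr]
        exact pad_of_le _ (not_lt.1 h2)
  · rw [dif_neg hK, if_neg hK, hr]

theorem prod_prod_sum {M : Type*} [CommSemiring M] {k : ℕ} {G : Type} [Fintype G]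
    (F : Fin k → Bool → G → M) :
    ∏ i, ∏ α, ∑ g, F i α g = ∑ g : Fin k → Bool → G, ∏ i, ∏ α, F i α (g i α) := by
  classical
  simp only [Finset.prod_univ_sum, Fintype.piFinset_univ]

/-- A product of Kraus sums is a sum over families of environment values. The tensor power of a
dilation is therefore a dilation of the tensor power. -/
theorem QPTPrep.tensorFam {S : ∀ n, Prep (X n) (Y n) (B n)} (hS : QPTPrep S) (p : Polynomial ℕ) :
    QPTPrep (X := fun n => Fin (p.eval n) → Bool → X n) (Y := fun n => Fin (p.eval n) → Bool → Y n)
      (B := fun n => Fin (p.eval n) → Bool → B n) fun n x y =>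
      CertFE.tensorFam fun i α => S n (x i α) (y i α) := by
  classical
  obtain ⟨w, V, hV, hD⟩ := QPT.exists_dilation hS
  have h1 : EIf fun n (a : (Fin (p.eval n) → Bool → X n) × Unit) (i : Fin (p.eval n)) (α : Bool) =>
      (a.1 i α, ()) :=
    .of_wire (u := fun n q => (fun i α => (q i α).1, ()))
      (.zip Wire.id.fst (Wire.comp (Wire.map (S := X) Wire.unit p) Wire.id.fst))
      (.pair (Wire.map (S := fun n => X n × Unit) Wire.id.fst p) Wire.unit) fun _ _ => rfl
  have h2 : EIf fun n (t : Fin (p.eval n) → Bool → (Y n × B n) × BV (w.ev n)) =>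
      ((((fun i α => (t i α).1.1), fun i α => (t i α).1.2), fun i α => (t i α).2) :
      ((Fin (p.eval n) → Bool → Y n) × (Fin (p.eval n) → Bool → B n)) ×
        (Fin (p.eval n) → Bool → BV (w.ev n))) :=
    .of_wire (u := fun n q i α => ((q.1.1 i α, q.1.2 i α), q.2 i α))
      (.pair (.pair (Wire.map (S := fun n => (Y n × B n) × BV (w.ev n)) Wire.id.fst.fst p)
        (Wire.map (S := fun n => (Y n × B n) × BV (w.ev n)) Wire.id.fst.snd p))
        (Wire.map (S := fun n => (Y n × B n) × BV (w.ev n)) Wire.id.snd p))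
      (.zip (.zip Wire.id.fst.fst Wire.id.fst.snd) Wire.id.snd) fun _ _ => rfl
  have h3 := ((hV.pow p).pre h1).post h2 (fun n q i α => ((q.1.1 i α, q.1.2 i α), q.2 i α))
    (fun _ _ => rfl) fun _ _ => rfl
  refine QPT.of_dilation h3 fun n x y ρ b b' => ?_
  have e : ∀ i α, S n (x i α) (y i α) (b i α) (b' i α) =
      ∑ g, V n ((y i α, b i α), g) (x i α, ()) * star (V n ((y i α, b' i α), g) (x i α, ())) := by
    intro i α
    have := hD n (x i α) (y i α) 1 (b i α) (b' i α)
    simpa using this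
  simp only [Matrix.smul_apply, CertFE.tensorFam, Matrix.of_apply, e, prod_prod_sum,
    Finset.univ_unique, Finset.sum_singleton, smul_eq_mul, Finset.mul_sum]
  refine Finset.sum_congr rfl fun g _ => ?_
  simp only [Finset.prod_mul_distrib, star_prod, PUnit.default_eq_unit]
  ring

theorem QPTKernel.tensorFam {K : ∀ n, Kernel (X n) (Y n)} (hK : QPTKernel K) (p : Polynomial ℕ) :
    QPTKernel (X := fun n => Fin (p.eval n) → Bool → X n)
      (Y := fun n => Fin (p.eval n) → Bool → Y n) fun n x y => ∏ i, ∏ α, K n (x i α) (y i α) := by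
  classical
  let f : ∀ n, (Fin (p.eval n) → Bool → Unit) ≃ Unit := fun n =>
    ⟨fun _ => (), fun _ _ _ => (), fun _ => rfl, fun _ => rfl⟩
  have h := (QPTPrep.tensorFam hK p).post f (.of_wire_equiv Wire.unit
    (.of_pad_eq fun n s => by
      funext i
      rw [pad_pi_bool]
      split_ifs <;> rfl))
  refine QPTPrep.congr h fun n x y => ?_
  ext b b'
  simp [CertFE.tensorFam]

end

/-! ## Encodings onto all bit strings -/

/-- Every bit string of the right length is an encoding. -/
class FullRep (X : Type) [BitRep X] : Prop where
  surj : ∀ Z : ℕ → Bool, ∃ x : X, ∀ i, i < BitRep.len X → pad x i = Z i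

instance : FullRep Bool := ⟨fun Z => ⟨Z 0, fun i hi => by
  obtain rfl : i = 0 := Nat.lt_one_iff.1 hi
  rfl⟩⟩

instance {X Y : Type} [BitRep X] [BitRep Y] [FullRep X] [FullRep Y] : FullRep (X × Y) := ⟨fun Z => by
  obtain ⟨x, hx⟩ := FullRep.surj (X := X) Z
  obtain ⟨y, hy⟩ := FullRep.surj (X := Y) fun i => Z (BitRep.len X + i)
  refine ⟨(x, y), fun i hi => ?_⟩
  have hi : i < BitRep.len X + BitRep.len Y := hi
  rw [pad_prod]
  split_ifs with h
  · exact hx i h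
  · rw [hy _ (by omega)]
    congr 1
    omega⟩

instance {X : Type} [BitRep X] [FullRep X] : FullRep (Bool → X) := ⟨fun Z => by
  obtain ⟨x, hx⟩ := FullRep.surj (X := X) Z
  obtain ⟨y, hy⟩ := FullRep.surj (X := X) fun i => Z (BitRep.len X + i)
  refine ⟨fun b => if b then y else x, fun i hi => ?_⟩
  have hi : i < BitRep.len X + BitRep.len X := hi
  rw [pad_boolPi]
  split_ifs with h h'
  · cases h'
  · exact hx i h
  · rw [hy _ (by omega)]
    congr 1
    omega
  · exact absurd rfl ‹_›⟩

instance {k : ℕ} {X : Type} [BitRep X] [FullRep X] : FullRep (Fin k → X) := ⟨fun Z => by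
  choose x hx using fun j : Fin k => FullRep.surj (X := X) fun i => Z (j * BitRep.len X + i)
  refine ⟨x, fun i hi => ?_⟩
  have hi : i < k * BitRep.len X := hi
  have hpos : 0 < BitRep.len X := by
    rcases Nat.eq_zero_or_pos (BitRep.len X) with h | h
    · simp [h] at hi
    · exact h
  rw [pad_pi, dif_pos ((Nat.div_lt_iff_lt_mul hpos).2 hi), hx _ _ (Nat.mod_lt _ hpos)]
  congr 1
  rw [mul_comm]
  exact Nat.div_add_mod _ _⟩

/-- The length of the encodings is a polynomial. -/
class PolyLen (X : ℕ → Type) [∀ n, BitRep (X n)] : Prop where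
  poly : ∃ p : Polynomial ℕ, ∀ n, p.eval n = ln X n

section

variable {X Y : ℕ → Type} [∀ n, BitRep (X n)] [∀ n, BitRep (Y n)]

instance : PolyLen fun _ => Bool := ⟨⟨1, fun _ => by simp [ln, BitRep.len]⟩⟩

instance [hX : PolyLen X] [hY : PolyLen Y] : PolyLen fun n => X n × Y n := ⟨by
  obtain ⟨p, hp⟩ := hX.poly
  obtain ⟨q, hq⟩ := hY.poly
  refine ⟨p + q, fun n => ?_⟩
  rw [Polynomial.eval_add, hp, hq]
  rfl⟩

instance [hX : PolyLen X] : PolyLen fun n => Bool → X n := ⟨by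
  obtain ⟨p, hp⟩ := hX.poly
  refine ⟨p + p, fun n => ?_⟩
  rw [Polynomial.eval_add, hp]
  rfl⟩

instance [hX : PolyLen X] (q : Polynomial ℕ) : PolyLen fun n => Fin (q.eval n) → X n := ⟨by
  obtain ⟨p, hp⟩ := hX.poly
  refine ⟨q * p, fun n => ?_⟩
  rw [Polynomial.eval_mul, hp]
  rfl⟩

theorem packTo_bijective {X : Type} [BitRep X] [FullRep X] {k : ℕ} (h : k = BitRep.len X) :
    Function.Bijective (packTo (X := X) k) := by
  constructor
  · intro x y hxy
    refine pad_injective ?_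
    rw [← pad_packTo h.ge, hxy, pad_packTo h.ge]
  · intro b
    obtain ⟨x, hx⟩ := FullRep.surj (X := X) (getBit b)
    refine ⟨x, ?_⟩
    funext i
    have := hx i (by omega)
    simpa [packTo, getBit] using this

/-- The security definitions allow adversaries whose registers are bit strings of polynomial length,
whereas the reductions use structured registers. When every bit string of the right length is an
encoding, the encoding is a bijection that moves no wire, and the registers can be renamed. -/
theorem FullRep.exists_equiv [∀ n, FullRep (X n)] [hX : PolyLen X] :
    ∃ (p : Polynomial ℕ) (e : ∀ n, X n ≃ BV (p.eval n)),
      (Wire fun n x => e n x) ∧ Wire fun n b => (e n).symm b := by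
  obtain ⟨p, hp⟩ := hX.poly
  refine ⟨p, fun n => Equiv.ofBijective _ (packTo_bijective (hp n)), ?_, ?_⟩
  · exact .of_pad_eq fun n x => pad_packTo (hp n).ge x
  · refine .of_pad_eq fun n b => ?_
    rw [← pad_packTo (hp n).ge]
    congr 1
    exact Equiv.ofBijective_apply_symm_apply _ (packTo_bijective (hp n)) b

end

/-! ## Positivity and linearity -/

section

variable {X A Y B : ℕ → Type}
variable [∀ n, BitRep (X n)] [∀ n, BitRep (A n)] [∀ n, BitRep (Y n)] [∀ n, BitRep (B n)]
variable [∀ n, Fintype (X n)] [∀ n, Fintype (A n)] [∀ n, Fintype (Y n)] [∀ n, Fintype (B n)]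
variable [PTLen X] [PTLen A] [PTLen Y] [PTLen B]

theorem QPT.map_sum {Φ : ∀ n, Instr (X n) (A n) (Y n) (B n)} (h : QPT Φ) (n : ℕ) (x : X n) (y : Y n)
    {ι : Type*} (s : Finset ι) (c : ι → ℂ) (ρ : ι → Op (A n)) :
    Φ n x y (∑ i ∈ s, c i • ρ i) = ∑ i ∈ s, c i • Φ n x y (ρ i) := by
  obtain ⟨w, V, hV, hD⟩ := h.exists_dilation
  ext b b'
  simp only [Matrix.sum_apply, Matrix.smul_apply, smul_eq_mul, (hD n).eq_sum, Finset.mul_sum,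
    Finset.sum_mul]
  symm
  rw [Finset.sum_comm]
  refine Finset.sum_congr rfl fun g _ => ?_
  rw [Finset.sum_comm]
  refine Finset.sum_congr rfl fun a _ => ?_
  rw [Finset.sum_comm]
  refine Finset.sum_congr rfl fun a' _ => Finset.sum_congr rfl fun i _ => ?_
  ring

theorem QPT.map_smul {Φ : ∀ n, Instr (X n) (A n) (Y n) (B n)} (h : QPT Φ) (n : ℕ) (x : X n)
    (y : Y n) (c : ℂ) (ρ : Op (A n)) : Φ n x y (c • ρ) = c • Φ n x y ρ := by
  simpa using h.map_sum n x y (Finset.univ : Finset Unit) (fun _ => c) fun _ => ρ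

/-- By the dilation, each probability is a sum of squared moduli of amplitudes. -/
theorem QPTKernel.nonneg {K : ∀ n, Kernel (X n) (Y n)} (h : QPTKernel K) (n : ℕ) (x : X n)
    (y : Y n) : 0 ≤ K n x y := by
  obtain ⟨w, V, hV, hD⟩ := QPT.exists_dilation h
  have h1 := hD n x y 1 () ()
  simp only [Matrix.one_apply_eq, one_mul, Matrix.smul_apply, smul_eq_mul, mul_one,
    Finset.univ_unique, Finset.sum_singleton] at h1
  have h2 : (K n x y : ℂ) = ((∑ g, Complex.normSq (V n ((y, ()), g) (x, ())) : ℝ) : ℂ) := by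
    rw [h1]
    push_cast
    refine Finset.sum_congr rfl fun g _ => ?_
    rw [← Complex.mul_conj]
    rfl
  rw [Complex.ofReal_inj] at h2
  rw [h2]
  exact Finset.sum_nonneg fun g _ => Complex.normSq_nonneg _

theorem QPTKernel.sum_eq {K : ∀ n, Kernel (X n) (Y n)} (h : QPTKernel K) (n : ℕ) (x : X n) :
    ∑ y, K n x y = 1 := by
  have h1 := QPTPrep.sum_trace h n x
  simp only [Matrix.trace_smul, Matrix.trace_one, Fintype.card_unit, Nat.cast_one, smul_eq_mul,
    mul_one] at h1
  exact_mod_cast h1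

theorem QPTKernel.le_one {K : ∀ n, Kernel (X n) (Y n)} (h : QPTKernel K) (n : ℕ) (x : X n)
    (y : Y n) : K n x y ≤ 1 := by
  rw [← h.sum_eq n x]
  exact Finset.single_le_sum (fun y _ => h.nonneg n x y) (Finset.mem_univ y)

end

/-! ## Effects -/

/-- The effect that depends on a stored classical value. -/
def blockEff {Y B : Type} [DecidableEq Y] (E : Y → Op B) : Op (Y × B) :=
  Matrix.of fun p q => if p.1 = q.1 then E p.1 p.2 q.2 else 0

section

variable {Y B : Type} [DecidableEq Y] [Fintype Y] [Fintype B] [DecidableEq B]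

theorem blockEff_posSemidef {E : Y → Op B} (h : ∀ y, (E y).PosSemidef) :
    (blockEff E).PosSemidef := by
  refine .of_dotProduct_mulVec_nonneg ?_ fun x => ?_
  · ext p q
    simp only [Matrix.conjTranspose_apply, blockEff, Matrix.of_apply]
    by_cases hpq : p.1 = q.1
    · rw [if_pos hpq, if_pos hpq.symm, ← hpq]
      exact congrFun (congrFun (h p.1).isHermitian p.2) q.2
    · rw [if_neg hpq, if_neg (Ne.symm hpq), star_zero]
  · have e : star x ⬝ᵥ (blockEff E).mulVec x =
        ∑ y, star (fun b => x (y, b)) ⬝ᵥ (E y).mulVec fun b => x (y, b) := by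
      simp only [dotProduct, Matrix.mulVec, blockEff, Matrix.of_apply, Fintype.sum_prod_type,
        Pi.star_apply]
      refine Finset.sum_congr rfl fun y _ => Finset.sum_congr rfl fun b _ => ?_
      congr 1
      rw [Finset.sum_eq_single y (by
        intro y' _ hy
        simp [Ne.symm hy]) (by simp)]
      simp
    rw [e]
    exact Finset.sum_nonneg fun y _ => (h y).dotProduct_mulVec_nonneg _

theorem blockEff_isEffect {E : Y → Op B} (h : ∀ y, IsEffect (E y)) : IsEffect (blockEff E) := by
  refine ⟨blockEff_posSemidef fun y => (h y).1, ?_⟩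
  have e : 1 - blockEff E = blockEff fun y => 1 - E y := by
    ext ⟨y, b⟩ ⟨y', b'⟩
    simp only [blockEff, Matrix.sub_apply, Matrix.of_apply, Matrix.one_apply, Prod.mk.injEq]
    split_ifs <;> simp_all
  rw [e]
  exact blockEff_posSemidef fun y => (h y).2

/-- An additional test that succeeds with probability `c` can be absorbed into the last adversary.
The verifications which a reduction does not delegate to its challenger are handled like this. -/
theorem IsEffect.smul {E : Op B} (h : IsEffect E) {c : ℝ} (h0 : 0 ≤ c) (h1 : c ≤ 1) :
    IsEffect ((c : ℂ) • E) := by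
  have hc : (0 : ℂ) ≤ c := by exact_mod_cast h0
  have hc' : (0 : ℂ) ≤ (1 - c : ℝ) := by exact_mod_cast sub_nonneg.2 h1
  refine ⟨h.1.smul hc, ?_⟩
  have e : 1 - (c : ℂ) • E = (c : ℂ) • (1 - E) + ((1 - c : ℝ) : ℂ) • 1 := by
    rw [smul_sub]
    push_cast
    rw [sub_smul, one_smul]
    abel
  rw [e]
  exact (h.2.smul hc).add (Matrix.PosSemidef.one.smul hc')

/-- A final effect that depends on the stored history turns the acceptance probability into a sum
over histories compatible with the public output. This brings the games of the reductions into the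
form of `hyb`. -/
theorem trace_blockEff_store {X A Z : Type} (E : Y → Op B) (Φ : Instr X A Y B) (g : X × Y → Z)
    (x : X) (z : Z) (ρ : Op A) : (blockEff E * Φ.store g x z ρ).trace =
      ∑ y, open Classical in if g (x, y) = z then (E y * Φ x y ρ).trace else 0 := by
  classical
  simp only [Matrix.trace, Matrix.diag_apply, Matrix.mul_apply, blockEff, Instr.store,
    Matrix.of_apply, Fintype.sum_prod_type]
  refine Finset.sum_congr rfl fun y _ => ?_
  have e : ∀ b, (∑ y', ∑ b', (if y = y' then E y b b' else 0) *
      if y' = y ∧ g (x, y') = z then Φ x y' ρ b' b else 0) =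
      if g (x, y) = z then ∑ b', E y b b' * Φ x y ρ b' b else 0 := by
    intro b
    rw [Finset.sum_eq_single y (by
      intro y' _ hy
      simp [Ne.symm hy]) (by simp)]
    split_ifs <;> simp_all
  simp only [e]
  split_ifs <;> simp

theorem IsEffect.submatrix {B' : Type} [Fintype B'] [DecidableEq B'] {E : Op B} (h : IsEffect E)
    (e : B' ≃ B) : IsEffect (E.submatrix e e) := by
  refine ⟨h.1.submatrix e, ?_⟩
  have h1 : 1 - E.submatrix e e = (1 - E).submatrix e e := by
    rw [Matrix.submatrix_sub, Pi.sub_apply, Pi.sub_apply, Matrix.submatrix_one_equiv]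
  rw [h1]
  exact h.2.submatrix e

theorem trace_submatrix_mul {B' : Type} [Fintype B'] (M N : Op B) (e : B' ≃ B) :
    (M.submatrix e e * N.submatrix e e).trace = (M * N).trace := by
  rw [Matrix.submatrix_mul_equiv]
  simp only [Matrix.trace, Matrix.diag_apply, Matrix.submatrix_apply]
  exact e.sum_comp fun b => (M * N) b b

end

/-! ## Adversaries with other registers -/

instance {ι : ℕ → Type} [∀ n, BitRep (ι n)] [PTLen ι] (N l : Polynomial ℕ) :
    PTLen fun n => BCircuit (ι n) (N.eval n) (l.eval n) :=
  ⟨PTLen.pt (X := fun n => (Fin (N.eval n) → Bool → Bool → Bool) ×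
    (Fin (N.eval n) → Src (ι n) (N.eval n)) × (Fin (N.eval n) → Src (ι n) (N.eval n)) ×
    (Fin (l.eval n) → Src (ι n) (N.eval n)))⟩

theorem EIf.prod_right {A B R : ℕ → Type} [∀ n, BitRep (A n)] [∀ n, BitRep (B n)]
    [∀ n, BitRep (R n)] [∀ n, Fintype (A n)] [∀ n, Fintype (B n)]
    [∀ n, Fintype (R n)] [PTLen A] [PTLen B] [PTLen R] {e : ∀ n, A n ≃ B n}
    (h : Wire fun n a => e n a) (h' : Wire fun n b => (e n).symm b) :
    EIf fun n => ((e n).prodCongr (Equiv.refl (R n)) : A n × R n ≃ B n × R n) :=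
  .of_wire_equiv (.pair (h.comp Wire.id.fst) Wire.id.snd) (.pair (h'.comp Wire.id.fst) Wire.id.snd)

theorem kronecker_submatrix_prodCongr {A B R : Type} (e : A ≃ B) (M : Op B) (N : Op R) :
    (M.submatrix e e ⊗ₖ N).submatrix (e.prodCongr (Equiv.refl R)).symm
      (e.prodCongr (Equiv.refl R)).symm = M ⊗ₖ N := by
  ext p q
  simp [Matrix.kroneckerMap_apply]

section

variable {T₁ T₂ : ℕ → Type} [∀ n, BitRep (T₁ n)] [∀ n, BitRep (T₂ n)]
  [∀ n, Fintype (T₁ n)] [∀ n, Fintype (T₂ n)] [∀ n, DecidableEq (T₂ n)]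
  [PTLen T₁] [PTLen T₂] [PolyLen T₁] [PolyLen T₂] [∀ n, FullRep (T₁ n)] [∀ n, FullRep (T₂ n)]

/-- The certified everlasting IND-CPA experiment, for adversaries with arbitrary registers. -/
def PKE.game {μ : Polynomial ℕ} (P : PKE μ)
    (choose : ∀ n, Instr (BV (P.pkLen.eval n)) Unit (BV (μ.eval n) × BV (μ.eval n)) (T₁ n))
    (delete : ∀ n, Instr Unit (T₁ n × BV (P.ctLen.eval n)) (BV (P.certLen.eval n)) (T₂ n))
    (E : ∀ n, BV (P.skLen.eval n) → Op (T₂ n)) (b : Bool) (n : ℕ) : ℝ :=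
  ∑ pk, ∑ sk, ∑ m₀, ∑ m₁, ∑ vk, ∑ cert,
    P.keyGen n () (pk, sk) * P.vrfy n (vk, cert) true *
      (E n sk * delete n () cert
        (choose n pk (m₀, m₁) 1 ⊗ₖ P.enc n (pk, if b then m₁ else m₀) vk)).trace.re

/-- The registers are renamed to bit strings before the first stage hands them on, renamed back for
the second, and the effect is conjugated accordingly; all traces stay the same. -/
theorem PKE.game_negligible {μ : Polynomial ℕ} {P : PKE μ} (hP : P.CertEverINDCPA)
    {choose : ∀ n, Instr (BV (P.pkLen.eval n)) Unit (BV (μ.eval n) × BV (μ.eval n)) (T₁ n)}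
    {delete : ∀ n, Instr Unit (T₁ n × BV (P.ctLen.eval n)) (BV (P.certLen.eval n)) (T₂ n)}
    (hc : QPT choose) (hd : QPT delete) {E : ∀ n, BV (P.skLen.eval n) → Op (T₂ n)}
    (hE : ∀ n sk, IsEffect (E n sk)) :
    Negligible fun n => |P.game choose delete E false n - P.game choose delete E true n| := by
  obtain ⟨p, e, he, he'⟩ := FullRep.exists_equiv (X := T₁)
  obtain ⟨q, f, hf, hf'⟩ := FullRep.exists_equiv (X := T₂)
  have := hP ⟨p, q, _, _, hc.post e (.of_wire_equiv he he'),
    (hd.pre (fun n => (e n).symm.prodCongr (Equiv.refl (BV (P.ctLen.eval n))))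
      (.prod_right he' he)).post f (.of_wire_equiv hf hf')⟩
    (fun n sk => (E n sk).submatrix (f n).symm (f n).symm) fun n sk => (hE n sk).submatrix _
  simpa only [PKE.exp, PKE.game, kronecker_submatrix_prodCongr, trace_submatrix_mul] using this

/-- The selective certified everlasting security experiment, for adversaries with arbitrary
registers. -/
def Garbling.game {s N l : Polynomial ℕ} (G : Garbling s N l)
    (choose : ∀ n, Instr Unit Unit
      (BCircuit (Fin (s.eval n)) (N.eval n) (l.eval n) × BV (s.eval n)) (T₁ n))
    (delete : ∀ n, Instr (Fin (s.eval n) → BV (G.labLen.eval n))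
      (T₁ n × BV (G.gcLen.eval n)) (BV (G.certLen.eval n)) (T₂ n))
    (E : ∀ n, Op (T₂ n))
    (G' : ∀ n, BCircuit (Fin (s.eval n)) (N.eval n) (l.eval n) → BV (s.eval n) →
      (Fin (s.eval n) → Bool → BV (G.labLen.eval n)) → BV (G.vkLen.eval n) →
      Op (BV (G.gcLen.eval n))) (n : ℕ) : ℝ :=
  ∑ C, ∑ x, ∑ L, ∑ vk, ∑ cert,
    G.setup n () L * G.vrfy n (vk, cert) true *
      (E n * delete n (fun i => L i (x i)) cert
        (choose n () (C, x) 1 ⊗ₖ G' n C x L vk)).trace.re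

theorem Garbling.game_negligible {s N l : Polynomial ℕ} {G : Garbling s N l} {S : G.Simulator}
    (hS : ∀ (A : G.Adversary) (E : ∀ n, Op (BV (A.r₂.eval n))), (∀ n, IsEffect (E n)) →
      Negligible fun n => |G.expReal A E n - G.expSim S A E n|)
    {choose : ∀ n, Instr Unit Unit
      (BCircuit (Fin (s.eval n)) (N.eval n) (l.eval n) × BV (s.eval n)) (T₁ n)}
    {delete : ∀ n, Instr (Fin (s.eval n) → BV (G.labLen.eval n))
      (T₁ n × BV (G.gcLen.eval n)) (BV (G.certLen.eval n)) (T₂ n)}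
    (hc : QPT choose) (hd : QPT delete) {E : ∀ n, Op (T₂ n)} (hE : ∀ n, IsEffect (E n)) :
    Negligible fun n => |G.game choose delete E (fun n C _ L vk => G.garble n (C, L) vk) n -
      G.game choose delete E (fun n C x L vk => S n (C.eval x, fun i => L i (x i)) vk) n| := by
  obtain ⟨p, e, he, he'⟩ := FullRep.exists_equiv (X := T₁)
  obtain ⟨q, f, hf, hf'⟩ := FullRep.exists_equiv (X := T₂)
  have := hS ⟨p, q, _, _, hc.post e (.of_wire_equiv he he'),
    (hd.pre (fun n => (e n).symm.prodCongr (Equiv.refl (BV (G.gcLen.eval n))))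
      (.prod_right he' he)).post f (.of_wire_equiv hf hf')⟩
    (fun n => (E n).submatrix (f n).symm (f n).symm) fun n => (hE n).submatrix _
  simpa only [Garbling.expReal, Garbling.expSim, Garbling.exp, Garbling.game,
    kronecker_submatrix_prodCongr, trace_submatrix_mul] using this

end

/-! ## Classical computations -/

section

variable {R S T X : ℕ → Type} [∀ n, BitRep (R n)] [∀ n, BitRep (S n)] [∀ n, BitRep (T n)]
  [∀ n, BitRep (X n)] [PTLen R] [PTLen S] [PTLen T] [PTLen X]
  [∀ n, Fintype (R n)] [∀ n, Fintype (S n)] [∀ n, Fintype (T n)] [∀ n, Fintype (X n)]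

theorem pad_slot {p : Polynomial ℕ} {n : ℕ} (f : Fin (p.eval n) → Bool → X n) (K m : ℕ)
    (h : K / 2 < p.eval n) (hm : m < ln X n) : pad f (K * ln X n + m) =
      pad (f ⟨K / 2, h⟩ (decide (K % 2 = 1))) m := by
  have h1 : (K * BitRep.len (X n) + m) / BitRep.len (X n) = K := by
    change m < BitRep.len (X n) at hm
    rw [mul_comm, Nat.mul_add_div (by omega), Nat.div_eq_of_lt hm, add_zero]
  have h2 : (K * BitRep.len (X n) + m) % BitRep.len (X n) = m := by
    change m < BitRep.len (X n) at hm
    rw [mul_comm, Nat.mul_add_mod, Nat.mod_eq_of_lt hm]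
  change pad f (K * BitRep.len (X n) + m) = _
  rw [pad_pi_bool]
  simp only [h1, h2]
  rw [dif_pos h]

theorem pad_pi_bool' {p : Polynomial ℕ} {n : ℕ} (f : Fin (p.eval n) → Bool → X n) (i : ℕ) :
    pad f i = if h : i / ln X n / 2 < p.eval n then
      pad (f ⟨i / ln X n / 2, h⟩ (decide (i / ln X n % 2 = 1))) (i % ln X n) else false :=
  pad_pi_bool f i

/-- Output bit `i` lies in slot `i / ln T`. Its polynomial is that of bit `i % ln T`, with all wire
numbers moved by as many input encodings as slots precede. Behind the last slot all terms are
switched off. -/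
theorem Quad.map {u : ∀ n, S n → T n} (hu : Quad u) (p : Polynomial ℕ) :
    Quad (S := fun n => Fin (p.eval n) → Bool → S n) (T := fun n => Fin (p.eval n) → Bool → T n)
      fun n s i α => u n (s i α) := by
  obtain ⟨q, qa, qb, hq⟩ := hu
  have hlen : ∀ n, ln (fun n => Fin (p.eval n) → Bool → S n) n = p.eval n * (ln S n + ln S n) :=
    fun n => rfl
  have hlt : ∀ n K a, K / 2 < p.eval n → a < ln S n →
      K * ln S n + a < ln (fun n => Fin (p.eval n) → Bool → S n) n := by
    intro n K a hK ha
    rw [hlen]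
    have : (K + 1) * ln S n ≤ (p.eval n * 2) * ln S n := Nat.mul_le_mul_right _ (by omega)
    nlinarith
  refine BQ.intro q.T.ev
    (fun n j => if j / q.T.ev n / ln T n / 2 < p.eval n then
      q.k.ev n (j / q.T.ev n % ln T n * q.T.ev n + j % q.T.ev n) else 0)
    (fun n j => j / q.T.ev n / ln T n * ln S n +
      q.a.ev n (j / q.T.ev n % ln T n * q.T.ev n + j % q.T.ev n))
    (fun n j => j / q.T.ev n / ln T n * ln S n +
      q.b.ev n (j / q.T.ev n % ln T n * q.T.ev n + j % q.T.ev n))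
    (by fun_prop) (by fun_prop) (by fun_prop) (by fun_prop) (fun n j h => ?_) (fun n j h => ?_)
    fun n i s => ?_
  · beta_reduce at h
    split_ifs at h with h1
    · exact hlt _ _ _ h1 (qa _ _ h)
    · omega
  · beta_reduce at h
    split_ifs at h with h1
    · exact hlt _ _ _ h1 (qb _ _ h)
    · omega
  · rw [pad_pi_bool']
    have h2 : ∀ t, t < q.T.ev n → (i * q.T.ev n + t) / q.T.ev n = i := fun t ht => by
      rw [mul_comm, Nat.mul_add_div (by omega), Nat.div_eq_of_lt ht, add_zero]
    have h3 : ∀ t, t < q.T.ev n → (i * q.T.ev n + t) % q.T.ev n = t := fun t ht => by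
      rw [mul_comm, Nat.mul_add_mod, Nat.mod_eq_of_lt ht]
    by_cases h1 : i / ln T n / 2 < p.eval n
    · rw [dif_pos h1]
      refine (hq _ _ _).trans (bigXor_congr fun t ht => ?_)
      simp only [h2 t ht, h3 t ht, h1, if_true]
      have e := fun a ha => (pad_slot s (i / ln T n) a h1 ha).symm
      rcases lt_or_ge (q.k.ev n (i % ln T n * q.T.ev n + t)) 2 with hk | hk
      · unfold termVal
        split_ifs <;> first | rfl | omega
      · rcases lt_or_ge (q.k.ev n (i % ln T n * q.T.ev n + t)) 3 with hk' | hk'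
        · unfold termVal
          rw [e _ (qa _ _ hk)]
          split_ifs <;> first | rfl | omega
        · unfold termVal
          rw [e _ (qa _ _ hk), e _ (qb _ _ hk')]
    · rw [dif_neg h1]
      rw [bigXor_congr (g := fun _ => false)]
      · exact (bigXor_false _).symm
      · intro t ht
        simp only [h2 t ht, h1, if_false]
        rfl

/-- The same value in every slot. -/
theorem Wire.bcast {v : ∀ n, S n → X n} (hv : Wire v) (p : Polynomial ℕ) :
    Wire (T := fun n => Fin (p.eval n) → Bool → X n) fun n s _ _ => v n s := by
  obtain ⟨σ, hσ⟩ := hv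
  refine .intro (fun n i => if i / ln X n / 2 < p.eval n then σ.ev n (i % ln X n) else ln S n)
    (by fun_prop) fun n i s => ?_
  rw [pad_pi_bool']
  split_ifs
  · rw [hσ]
  · exact (pad_of_le s le_rfl).symm

theorem Quad.maskSlot {k : Polynomial ℕ} : Quad fun n (x : Bool × BV (k.eval n)) =>
    if x.1 then x.2 else fun _ => false :=
  (BQ.bit_and Wire.id.fst Wire.id.snd).congr fun n i s => by
    obtain ⟨c, x⟩ := s
    cases c <;> simp [pad_bv, getBit]

/-- Setting some slots to zero. -/
def slotMask {s k : ℕ} (o : Fin s → Bool → Bool) (L : Fin s → Bool → BV k) :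
    Fin s → Bool → BV k := fun i α => if o i α then L i α else fun _ => false

theorem Quad.slotMask {s k : Polynomial ℕ} {o : ∀ n, S n → Fin (s.eval n) → Bool → Bool}
    {L : ∀ n, S n → Fin (s.eval n) → Bool → BV (k.eval n)} (ho : Wire o) (hL : Wire L) :
    Quad fun n x => CertFE.slotMask (o n x) (L n x) :=
  (Quad.maskSlot.map s).comp_wire (ho.zip hL)

/-- Choosing between two families of slots. -/
def slotMux {s : ℕ} {X : Type} (c : Fin s → Bool → Bool) (L L' : Fin s → Bool → X) :
    Fin s → Bool → X := fun i α => if c i α then L i α else L' i α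

theorem Quad.slotMux {s : Polynomial ℕ} {c : ∀ n, S n → Fin (s.eval n) → Bool → Bool}
    {L L' : ∀ n, S n → Fin (s.eval n) → Bool → X n} (hc : Wire c) (hL : Wire L) (hL' : Wire L') :
    Quad fun n x => CertFE.slotMux (c n x) (L n x) (L' n x) :=
  ((Quad.mux (S := fun n => Bool × X n × X n) Wire.id.fst Wire.id.snd.fst Wire.id.snd.snd).map
    s).comp_wire (hc.zip (hL.zip hL'))

/-- The labels of an input. -/
def sel {s : ℕ} {X : Type} (L : Fin s → Bool → X) (x : BV s) : Fin s → X := fun i => L i (x i)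

/-- The selected label is `L i 0 + x i · L i 0 + x i · L i 1` over the field with two elements,
hence quadratic in the bits of `L` and `x` together. -/
theorem Quad.sel {s : Polynomial ℕ} {L : ∀ n, S n → Fin (s.eval n) → Bool → X n}
    {x : ∀ n, S n → BV (s.eval n)} (hL : Wire L) (hx : Wire x) :
    Quad fun n y => CertFE.sel (L n y) (x n y) := by
  obtain ⟨σ, hσ⟩ := hL
  obtain ⟨τ, hτ⟩ := hx
  have hc : PTd fun z : ℕ × ℕ => z.2 / ln X z.1 < s.eval z.1 := by fun_prop
  have h1 : BQ (S := S) fun n i y => pad y (σ.ev n (i / ln X n * 2 * ln X n + i % ln X n)) :=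
    .wire (σ := fun n i => σ.ev n (i / ln X n * 2 * ln X n + i % ln X n)) (by fun_prop)
  have h2 : BQ (S := S) fun n i y => pad y (τ.ev n (i / ln X n)) &&
      pad y (σ.ev n (i / ln X n * 2 * ln X n + i % ln X n)) :=
    .and_wire (σ := fun n i => τ.ev n (i / ln X n))
      (τ := fun n i => σ.ev n (i / ln X n * 2 * ln X n + i % ln X n)) (by fun_prop) (by fun_prop)
  have h3 : BQ (S := S) fun n i y => pad y (τ.ev n (i / ln X n)) &&
      pad y (σ.ev n ((i / ln X n * 2 + 1) * ln X n + i % ln X n)) :=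
    .and_wire (σ := fun n i => τ.ev n (i / ln X n))
      (τ := fun n i => σ.ev n ((i / ln X n * 2 + 1) * ln X n + i % ln X n)) (by fun_prop)
      (by fun_prop)
  refine (BQ.mask (c := fun n i => i / ln X n < s.eval n) hc (h1.xor (h2.xor h3))).congr
    fun n i y => ?_
  rw [pad_pi]
  change (if h : i / ln X n < s.eval n then _ else _) = _
  split_ifs with h
  · rcases Nat.eq_zero_or_pos (ln X n) with h0 | h0
    · have hz : ∀ i, pad y (σ.ev n i) = false := by
        intro i
        rw [← hσ]
        rw [pad_pi_bool']
        split_ifs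
        · exact pad_of_le _ (by
            change ln X n ≤ _
            omega)
        · rfl
      simp only [hz, Bool.and_false, Bool.xor_false]
      exact pad_of_le _ (by
        change ln X n ≤ _
        omega)
    · have hm := Nat.mod_lt i h0
      have e0 : (i / ln X n * 2) / 2 < s.eval n := by omega
      have e1 : (i / ln X n * 2 + 1) / 2 < s.eval n := by omega
      rw [← hσ, ← hσ, ← hτ, pad_slot _ _ _ e0 hm, pad_slot _ _ _ e1 hm]
      have f0 : (⟨i / ln X n * 2 / 2, e0⟩ : Fin (s.eval n)) = ⟨i / ln X n, h⟩ := Fin.ext (by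
        simp only
        omega)
      have f1 : (⟨(i / ln X n * 2 + 1) / 2, e1⟩ : Fin (s.eval n)) = ⟨i / ln X n, h⟩ :=
        Fin.ext (by
        simp only
        omega)
      have g0 : decide (i / ln X n * 2 % 2 = 1) = false := by simp
      have g1 : decide ((i / ln X n * 2 + 1) % 2 = 1) = true := by simp
      rw [f0, f1, g0, g1]
      have e2 : pad (x n y) (i / ln X n) = x n y ⟨i / ln X n, h⟩ := by
        rw [pad_bv, getBit, dif_pos h]
      rw [e2]
      change pad (L n y ⟨i / ln X n, h⟩ (x n y ⟨i / ln X n, h⟩)) (i % ln X n) = _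
      rw [decide_eq_true h, Bool.true_and]
      cases x n y ⟨i / ln X n, h⟩ <;> simp only [Bool.false_and, Bool.true_and, Bool.xor_false]
      cases pad (L n y ⟨i / ln X n, h⟩ true) (i % ln X n) <;>
        cases pad (L n y ⟨i / ln X n, h⟩ false) (i % ln X n) <;> rfl
  · simp [h]

/-- A value that is present if the bit is set. -/
def optIf {X : Type} (q : Bool) (x : X) : Option X := if q then some x else none

theorem Quad.optIf {q : ∀ n, S n → Bool} {x : ∀ n, S n → X n} (hq : Wire q) (hx : Wire x) :
    Quad fun n s => CertFE.optIf (q n s) (x n s) := by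
  have h1 := BQ.bit_and hq hx
  refine (BQ.ite (c := fun _ i => i = 0) (by fun_prop) (BQ.bit hq) (h1.reindex
    (σ := fun _ i => i - 1) (by fun_prop))).congr fun n i s => ?_
  have hl : ln (fun n => Option (X n)) n = 1 + ln X n := rfl
  simp only [CertFE.optIf, pad]
  change (if i < 1 + BitRep.len (X n) then _ else _) = _
  cases q n s
  · simp [BitRep.code]
  · rcases Nat.eq_zero_or_pos i with h0 | h0
    · subst h0
      simp [BitRep.code]
    · have : i < 1 + BitRep.len (X n) ↔ i - 1 < BitRep.len (X n) := by omega
      simp [BitRep.code, this, h0.ne']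

theorem Wire.isSome : Wire fun n (v : Option (X n)) => v.isSome := by
  refine .intro (fun n i => if i < 1 then 0 else 1 + ln X n) (by fun_prop) fun n i v => ?_
  have hl : BitRep.len (Option (X n)) = 1 + ln X n := rfl
  rw [pad_bool]
  dsimp only
  split_ifs
  · rw [pad, if_pos (by omega)]
    cases v <;> rfl
  · exact (pad_of_le v hl.le).symm

/-- An absent value is encoded by zeros, which by assumption also encode the default. Reading the
bits behind the presence bit is therefore correct in both cases. -/
theorem Wire.getD {z : ∀ n, X n} (hz : ∀ n i, pad (z n) i = false) :
    Wire fun n (v : Option (X n)) => v.getD (z n) := by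
  refine .intro (fun n i => 1 + i) (by fun_prop) fun n i v => ?_
  have hl : BitRep.len (Option (X n)) = 1 + BitRep.len (X n) := rfl
  cases v with
  | none =>
    rw [Option.getD_none, hz, pad]
    split_ifs <;> rfl
  | some x =>
    rw [Option.getD_some, pad, pad, hl]
    simp only [Nat.add_lt_add_iff_left]
    split_ifs
    · simp [BitRep.code]
    · rfl

/-- The slots that are opened by a key. -/
def opened {s : ℕ} (q : Bool) (f : BV s) : Fin s → Bool → Bool := fun i α => q && (f i == α)

/-- In slot `(i, α)` the bit is `q · f i` for `α = 1` and `q · f i + q` for `α = 0`. -/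
theorem Quad.opened {s : Polynomial ℕ} {q : ∀ n, S n → Bool} {f : ∀ n, S n → BV (s.eval n)}
    (hq : Wire q) (hf : Wire f) : Quad fun n x => CertFE.opened (q n x) (f n x) := by
  have h1 : BQ fun n i x => pad (f n x) (i / 2) :=
    BQ.reindex hf.quad (σ := fun _ i => i / 2) (by fun_prop)
  have h2 : BQ fun n i x => q n x && pad (f n x) (i / 2) :=
    (BQ.bit_and hq hf).reindex (σ := fun _ i => i / 2) (by fun_prop)
  refine (BQ.mask (c := fun n i => i / 2 < s.eval n) (by fun_prop) (h2.xor
    ((BQ.bit hq).mask (c := fun _ i => i % 2 = 0) (by fun_prop)))).congr fun n i x => ?_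
  rw [pad_pi_bool]
  have hl : BitRep.len Bool = 1 := rfl
  simp only [hl, Nat.div_one, Nat.mod_one]
  split_ifs with h
  · rw [pad_bv, getBit, dif_pos h]
    simp only [pad_bool, CertFE.opened, h, decide_true, Bool.true_and]
    rcases Nat.mod_two_eq_zero_or_one i with h2 | h2 <;> cases q n x <;>
      cases f n x ⟨i / 2, h⟩ <;> simp [h2]
  · simp [h]

end

/-! ## Operations on slots -/

/-- The set that contains one slot. -/
def oneHot {s : ℕ} (i : Fin s) (α : Bool) : Fin s → Bool → Bool := fun i' α' =>
  decide (i' = i ∧ α' = α)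

/-- The number of a slot. -/
def slotNum {s : ℕ} (i : Fin s) (α : Bool) : ℕ := 2 * i + α.toNat

theorem slotNum_lt {s : ℕ} (i : Fin s) (α : Bool) : slotNum i α < s * 2 := by
  have := i.isLt
  cases α <;> simp [slotNum] <;> omega

theorem slotNum_div {s : ℕ} (i : Fin s) (α : Bool) : slotNum i α / 2 = i := by
  cases α <;> simp [slotNum]
  omega

theorem slotNum_mod {s : ℕ} (i : Fin s) (α : Bool) : decide (slotNum i α % 2 = 1) = α := by
  cases α <;> simp [slotNum]

theorem exists_slotNum {s t : ℕ} (h : t < s * 2) : ∃ (i : Fin s) (α : Bool), slotNum i α = t := by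
  refine ⟨⟨t / 2, by omega⟩, decide (t % 2 = 1), ?_⟩
  rcases Nat.mod_two_eq_zero_or_one t with h | h <;> simp [slotNum, h] <;> omega

theorem slotNum_injective {s : ℕ} {i i' : Fin s} {α α' : Bool}
    (h : slotNum i α = slotNum i' α') : i = i' ∧ α = α' := by
  refine ⟨Fin.ext ?_, ?_⟩
  · rw [← slotNum_div i α, h, slotNum_div]
  · rw [← slotNum_mod i α, h, slotNum_mod]

theorem pad_bits_slotNum {s : ℕ} (e : Fin s → Bool → Bool) (i : Fin s) (α : Bool) :
    pad e (slotNum i α) = e i α := by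
  rw [pad_pi_bool]
  have hl : BitRep.len Bool = 1 := rfl
  simp only [hl, Nat.div_one, Nat.mod_one, slotNum_div, slotNum_mod, i.isLt, dite_true]
  rfl

theorem pad_bits_of_le {s : ℕ} (e : Fin s → Bool → Bool) {t : ℕ} (h : s * 2 ≤ t) :
    pad e t = false := by
  refine pad_of_le e ?_
  rwa [show BitRep.len (Fin s → Bool → Bool) = s * 2 from rfl]

theorem pad_oneHot {s : ℕ} (i : Fin s) (α : Bool) (t : ℕ) :
    pad (oneHot i α) t = decide (t = slotNum i α) := by
  rcases lt_or_ge t (s * 2) with h | h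
  · obtain ⟨i', α', rfl⟩ := exists_slotNum h
    rw [pad_bits_slotNum, oneHot]
    exact decide_eq_decide.2 ⟨fun h => by rw [h.1, h.2], slotNum_injective⟩
  · rw [pad_bits_of_le _ h]
    have := slotNum_lt i α
    simp only [false_eq_decide_iff]
    omega

theorem pad_slotNum {s k : ℕ} (v : Fin s → Bool → BV k) (i : Fin s) (α : Bool) (q : Fin k) :
    pad v (slotNum i α * k + q) = v i α q := by
  have hq := q.isLt
  rw [pad_pi_bool]
  have h1 : (slotNum i α * k + q) / k = slotNum i α := by
    rw [mul_comm, Nat.mul_add_div (by omega), Nat.div_eq_of_lt hq, add_zero]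
  have h2 : (slotNum i α * k + q) % k = q := by
    rw [mul_comm, Nat.mul_add_mod, Nat.mod_eq_of_lt hq]
  simp only [ln_bv, h1, h2, slotNum_div, slotNum_mod, i.isLt, dite_true, pad_bv, getBit, hq]

/-- The sum of the values in a set of slots. -/
def selSum {s k : ℕ} (e : Fin s → Bool → Bool) (v : Fin s → Bool → BV k) : BV k := fun q =>
  bigXor (s * 2) fun t => pad e t && pad v (t * k + q)

theorem selSum_oneHot {s k : ℕ} (i : Fin s) (α : Bool) (v : Fin s → Bool → BV k) :
    selSum (oneHot i α) v = v i α := by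
  funext q
  rw [selSum, bigXor_eq_single (slotNum i α) (slotNum_lt i α)]
  · rw [pad_oneHot, pad_slotNum]
    simp
  · intro t _ ht
    rw [pad_oneHot]
    simp [ht]

/-- The slots before the slots of a set, counted with multiplicity modulo two. -/
def below {s : ℕ} (e : Fin s → Bool → Bool) : Fin s → Bool → Bool := fun i α =>
  bigXor (s * 2) fun t => decide (slotNum i α < t) && pad e t

theorem below_oneHot {s : ℕ} (i : Fin s) (α : Bool) :
    below (oneHot i α) = fun i' α' => decide (slotNum i' α' < slotNum i α) := by
  funext i' α'
  rw [below, bigXor_eq_single (slotNum i α) (slotNum_lt i α)]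
  · rw [pad_oneHot]
    simp
  · intro t _ ht
    rw [pad_oneHot]
    simp [ht]

/-- Adding a value to a set of slots. -/
def xorAll {s k : ℕ} (e : Fin s → Bool → Bool) (c : BV k) (v : Fin s → Bool → BV k) :
    Fin s → Bool → BV k := fun i α q => xor (v i α q) (e i α && c q)

/-- Adding the sum of the values in a set of slots. -/
def xorSel {s k : ℕ} (e : Fin s → Bool → Bool) (v : Fin s → Bool → BV k) (c : BV k) : BV k :=
  fun q => xor (c q) (selSum e v q)

theorem xorAll_xorAll {s k : ℕ} (e : Fin s → Bool → Bool) (c : BV k) (v : Fin s → Bool → BV k) :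
    xorAll e c (xorAll e c v) = v := by
  funext i α q
  simp [xorAll]

theorem xorSel_xorSel {s k : ℕ} (e : Fin s → Bool → Bool) (v : Fin s → Bool → BV k) (c : BV k) :
    xorSel e v (xorSel e v c) = c := by
  funext q
  simp [xorSel]

/-- For a set with one slot, this exchanges the value in the slot with a separate value. -/
def slotSwap {s k : ℕ} (e : Fin s → Bool → Bool) (p : (Fin s → Bool → BV k) × BV k) :
    (Fin s → Bool → BV k) × BV k :=
  (xorAll e (xorSel e p.1 p.2) p.1,
    xorSel e (xorAll e (xorSel e p.1 p.2) p.1) (xorSel e p.1 p.2))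

/-- The exchange is made of three additions, of the form `A ∘ B ∘ A` with involutions `A` and `B`.
It is thus reversible for every set `e`, so the reduction remains a legitimate circuit even if its
guess is not a single slot. -/
theorem slotSwap_slotSwap {s k : ℕ} (e : Fin s → Bool → Bool)
    (p : (Fin s → Bool → BV k) × BV k) : slotSwap e (slotSwap e p) = p := by
  simp only [slotSwap, xorSel_xorSel, xorAll_xorAll]

/-- Replacing the value in a slot. -/
def slotUpd {s : ℕ} {X : Type} (i : Fin s) (α : Bool) (x : X) (v : Fin s → Bool → X) :
    Fin s → Bool → X := fun i' α' => if i' = i ∧ α' = α then x else v i' α'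

theorem slotSwap_oneHot {s k : ℕ} (i : Fin s) (α : Bool) (v : Fin s → Bool → BV k) (c : BV k) :
    slotSwap (oneHot i α) (v, c) = (slotUpd i α c v, v i α) := by
  have h1 : xorAll (oneHot i α) (xorSel (oneHot i α) v c) v = slotUpd i α c v := by
    funext i' α' q
    simp only [xorAll, xorSel, selSum_oneHot, slotUpd, oneHot]
    split_ifs with h
    · obtain ⟨rfl, rfl⟩ := h
      cases v i' α' q <;> cases c q <;> simp
    · simp [h]
  simp only [slotSwap, h1, Prod.mk.injEq, true_and]
  funext q
  simp only [xorSel, selSum_oneHot, slotUpd, and_self, if_true]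
  cases v i α q <;> cases c q <;> rfl

section

variable {S X : ℕ → Type} [∀ n, BitRep (S n)] [∀ n, BitRep (X n)] [PTLen S] [PTLen X]
  [∀ n, Fintype (S n)] [∀ n, Fintype (X n)] {s k : Polynomial ℕ}

theorem Quad.selSum {e : ∀ n, S n → Fin (s.eval n) → Bool → Bool}
    {v : ∀ n, S n → Fin (s.eval n) → Bool → BV (k.eval n)} (he : Wire e) (hv : Wire v) :
    Quad fun n x => CertFE.selSum (e n x) (v n x) := by
  obtain ⟨σ, hσ⟩ := he
  obtain ⟨τ, hτ⟩ := hv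
  have h1 : BQ (S := S) fun n i x => pad x (σ.ev n (i % (s.eval n * 2))) &&
      pad x (τ.ev n (i % (s.eval n * 2) * k.eval n + i / (s.eval n * 2))) :=
    .and_wire (σ := fun n i => σ.ev n (i % (s.eval n * 2)))
      (τ := fun n i => τ.ev n (i % (s.eval n * 2) * k.eval n + i / (s.eval n * 2)))
      (by fun_prop) (by fun_prop)
  refine ((h1.sum (M := fun n => s.eval n * 2) (by fun_prop)).mask
    (c := fun n i => i < k.eval n) (by fun_prop)).congr fun n i x => ?_
  rw [pad_bv, getBit]
  split_ifs with h
  · simp only [CertFE.selSum, h, decide_true, Bool.true_and]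
    refine bigXor_congr fun t ht => ?_
    have e1 : (i * (s.eval n * 2) + t) % (s.eval n * 2) = t := by
      rw [mul_comm, Nat.mul_add_mod, Nat.mod_eq_of_lt ht]
    have e2 : (i * (s.eval n * 2) + t) / (s.eval n * 2) = i := by
      rw [mul_comm, Nat.mul_add_div (by omega), Nat.div_eq_of_lt ht, add_zero]
    rw [e1, e2, ← hσ, ← hτ]
  · simp [h]

theorem Quad.below {e : ∀ n, S n → Fin (s.eval n) → Bool → Bool} (he : Wire e) :
    Quad fun n x => CertFE.below (e n x) := by
  obtain ⟨σ, hσ⟩ := he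
  have h1 : BQ (S := S) fun n i x => decide (i / (s.eval n * 2) < i % (s.eval n * 2)) &&
      pad x (σ.ev n (i % (s.eval n * 2))) :=
    (BQ.wire (σ := fun n i => σ.ev n (i % (s.eval n * 2))) (by fun_prop)).mask
      (c := fun n i => i / (s.eval n * 2) < i % (s.eval n * 2)) (by fun_prop)
  refine ((h1.sum (M := fun n => s.eval n * 2) (by fun_prop)).mask
    (c := fun n i => i < s.eval n * 2) (by fun_prop)).congr fun n i x => ?_
  by_cases h : i < s.eval n * 2
  · obtain ⟨j, α, rfl⟩ := exists_slotNum h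
    rw [pad_bits_slotNum]
    simp only [CertFE.below, h, decide_true, Bool.true_and]
    refine bigXor_congr fun t ht => ?_
    have e1 : (slotNum j α * (s.eval n * 2) + t) % (s.eval n * 2) = t := by
      rw [mul_comm, Nat.mul_add_mod, Nat.mod_eq_of_lt ht]
    have e2 : (slotNum j α * (s.eval n * 2) + t) / (s.eval n * 2) = slotNum j α := by
      rw [mul_comm, Nat.mul_add_div (by omega), Nat.div_eq_of_lt ht, add_zero]
    rw [e1, e2, ← hσ]
  · rw [pad_bits_of_le _ (not_lt.1 h)]
    simp [h]

theorem Quad.xorAll {e : ∀ n, S n → Fin (s.eval n) → Bool → Bool} {c : ∀ n, S n → BV (k.eval n)}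
    {v : ∀ n, S n → Fin (s.eval n) → Bool → BV (k.eval n)} (he : Wire e) (hc : Wire c)
    (hv : Wire v) : Quad fun n x => CertFE.xorAll (e n x) (c n x) (v n x) := by
  have h1 : Quad fun n (x : (Bool × BV (k.eval n)) × BV (k.eval n)) (q : Fin (k.eval n)) =>
      xor (x.2 q) (x.1.1 && x.1.2 q) := by
    refine (Wire.id.snd.quad.xor (BQ.bit_and Wire.id.fst.fst Wire.id.fst.snd)).congr
      fun n i x => ?_
    simp only [pad_bv, getBit]
    split_ifs <;> simp
  exact (h1.map s).comp_wire ((he.zip (hc.bcast s)).zip hv)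

theorem Quad.xorSel {e : ∀ n, S n → Fin (s.eval n) → Bool → Bool} {c : ∀ n, S n → BV (k.eval n)}
    {v : ∀ n, S n → Fin (s.eval n) → Bool → BV (k.eval n)} (he : Wire e) (hc : Wire c)
    (hv : Wire v) : Quad fun n x => CertFE.xorSel (e n x) (v n x) (c n x) := by
  refine (hc.quad.xor (Quad.selSum he hv)).congr fun n i x => ?_
  simp only [pad_bv, getBit]
  split_ifs
  · rfl
  · simp

/-! ## Guessing a slot -/

/-- Whether the first bits of `r` are the binary representation of `t`, as far as is needed to
distinguish the numbers less than `M`. -/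
def chainVal (M : ℕ) (r : ℕ → Bool) (t : ℕ) : ℕ → Bool
  | 0 => if 2 ^ 0 < M then r 0 == decide (halve t 0 % 2 = 1) else true
  | b + 1 => chainVal M r t b &&
      if 2 ^ (b + 1) < M then r (b + 1) == decide (halve t (b + 1) % 2 = 1) else true

theorem chainVal_eq_true {M : ℕ} {r : ℕ → Bool} {t b : ℕ} : chainVal M r t b = true ↔
    ∀ c, c ≤ b → 2 ^ c < M → r c = decide (halve t c % 2 = 1) := by
  induction b with
  | zero =>
    simp only [chainVal, Nat.le_zero, forall_eq]
    split_ifs with h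
    · simp only [beq_iff_eq, h, forall_const]
    · simp only [h, false_imp_iff]
  | succ b ih =>
    rw [chainVal, Bool.and_eq_true, ih]
    constructor
    · rintro ⟨h1, h2⟩ c hc hM
      rcases Nat.lt_or_ge c (b + 1) with h | h
      · exact h1 c (by omega) hM
      · obtain rfl : c = b + 1 := by omega
        simpa [hM] using h2
    · intro h
      refine ⟨fun c hc => h c (by omega), ?_⟩
      split_ifs with hM
      · simpa using h (b + 1) le_rfl hM
      · rfl

/-- A form of the condition that can be tested without computing the power. -/
theorem pow_lt_iff_halve (M b : ℕ) : 2 ^ b < M ↔ 1 ≤ halve (M - 1) b := by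
  have := Nat.two_pow_pos b
  rw [halve, Nat.le_div_iff_mul_le this, one_mul]
  omega

/-- Comparing `r` with a slot number is a long conjunction and not quadratic. Recording all partial
conjunctions makes each bit a quadratic function of `r` and the preceding bit, as
`EIf.append_of_slp` allows. -/
theorem easy_chain : Easy (S := fun n => Fin (s.eval n) → Bool → Bool)
    (T := fun n => Fin (s.eval n) → Bool → Fin (s.eval n) → Bool → Bool)
    fun n r i α i' α' => chainVal (s.eval n * 2) (pad r) (slotNum i α) (slotNum i' α') := by
  have hS : ∀ n, ln (fun n => Fin (s.eval n) → Bool → Bool) n = s.eval n * 2 := fun n => rfl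
  have hT : ∀ n, ln (fun n => Fin (s.eval n) → Bool → Fin (s.eval n) → Bool → Bool) n =
      s.eval n * 2 * (s.eval n * 2) := fun n => by
    change s.eval n * (s.eval n * 2 + s.eval n * 2) = _
    ring
  -- Bit `o = t * 2s + b` is a sum of two terms. With `c` the preceding bit (the constant one if `b
  -- = 0`), it is `c·r_b` if bit `b` of `t` is one, `c + c·r_b` if it is zero, and `c` alone if `2 ^
  -- b ≥ 2s`. The preceding bit sits at `s * 2 + o - 1`, behind the `2s` bits of `r`.
  let q : QData := ⟨⟨fun _ => 2, by fun_prop⟩,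
    ⟨fun n j => if j % 2 = 0 then
      if 1 ≤ halve (s.eval n * 2 - 1) (j / 2 % (s.eval n * 2)) ∧
        halve (j / 2 / (s.eval n * 2)) (j / 2 % (s.eval n * 2)) % 2 = 1 then 0
      else if j / 2 % (s.eval n * 2) = 0 then 1 else 2
      else if 1 ≤ halve (s.eval n * 2 - 1) (j / 2 % (s.eval n * 2)) then
        if j / 2 % (s.eval n * 2) = 0 then 2 else 3 else 0, by fun_prop⟩,
    ⟨fun n j => if j % 2 = 0 then s.eval n * 2 + j / 2 - 1 else j / 2 % (s.eval n * 2),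
      by fun_prop⟩,
    ⟨fun n j => s.eval n * 2 + j / 2 - 1, by fun_prop⟩⟩
  have key : ∀ n (r : Fin (s.eval n) → Bool → Bool) t b, t < s.eval n * 2 → b < s.eval n * 2 →
      pad (X := Fin (s.eval n) → Bool → Fin (s.eval n) → Bool → Bool) (fun i α i' α' =>
        chainVal (s.eval n * 2) (pad r) (slotNum i α) (slotNum i' α')) (t * (s.eval n * 2) + b) =
        chainVal (s.eval n * 2) (pad r) t b := by
    intro n r t b ht hb
    obtain ⟨i, α, rfl⟩ := exists_slotNum ht
    obtain ⟨i', α', rfl⟩ := exists_slotNum hb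
    have h1 : slotNum i α / 2 < s.eval n := by rw [slotNum_div]; exact i.isLt
    refine (pad_slot (X := fun n => Fin (s.eval n) → Bool → Bool) _ _ _ h1 hb).trans ?_
    simp only [pad_bits_slotNum, slotNum_div, slotNum_mod]
  have hdm : ∀ n o, o < s.eval n * 2 * (s.eval n * 2) → o / (s.eval n * 2) < s.eval n * 2 ∧
      o % (s.eval n * 2) < s.eval n * 2 := by
    intro n o ho
    have h0 : 0 < s.eval n * 2 := by
      rcases Nat.eq_zero_or_pos (s.eval n * 2) with h | h
      · simp [h] at ho
      · exact h
    exact ⟨(Nat.div_lt_iff_lt_mul h0).2 ho, Nat.mod_lt _ h0⟩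
  have hz : ∀ o M : ℕ, o % M ≠ 0 → 1 ≤ o := by
    intro o M h
    rcases Nat.eq_zero_or_pos o with h0 | h0
    · simp [h0] at h
    · exact h0
  refine Easy.intro (EIf.append_of_slp q (fun n o t ho ht hk => ?_) (fun n o t ho ht hk => ?_)
    fun n o r ho => ?_)
  · have ht : t < 2 := ht
    rw [hT] at ho
    have h1 : (o * 2 + t) / 2 = o := by omega
    have h2 : (o * 2 + t) % 2 = t := by omega
    simp only [q, PF.ev_mk, PF1.ev_mk, h1, h2, hS] at hk ⊢
    have := (hdm n o ho).2
    have := hz o (s.eval n * 2)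
    split_ifs at hk ⊢ <;> omega
  · have ht : t < 2 := ht
    rw [hT] at ho
    have h1 : (o * 2 + t) / 2 = o := by omega
    have h2 : (o * 2 + t) % 2 = t := by omega
    simp only [q, PF.ev_mk, PF1.ev_mk, h1, h2, hS] at hk ⊢
    have := (hdm n o ho).2
    have := hz o (s.eval n * 2)
    split_ifs at hk ⊢ <;> omega
  · rw [hT] at ho
    obtain ⟨h1, h2⟩ := hdm n o ho
    have e0 : o * 2 / 2 = o := by omega
    have e1 : (o * 2 + 1) / 2 = o := by omega
    have e2 : o * 2 % 2 = 0 := by omega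
    have e3 : (o * 2 + 1) % 2 = 1 := by omega
    have f1 : ∀ (c : Fin (s.eval n) → Bool → Fin (s.eval n) → Bool → Bool),
        pad (r, c) (o % (s.eval n * 2)) = pad r (o % (s.eval n * 2)) := by
      intro c
      rw [pad_prod]
      exact if_pos h2
    have f2 : ∀ (c : Fin (s.eval n) → Bool → Fin (s.eval n) → Bool → Bool), 1 ≤ o →
        pad (r, c) (s.eval n * 2 + o - 1) = pad c (o - 1) := by
      intro c hc
      rw [pad_prod]
      have h3 : BitRep.len (Fin (s.eval n) → Bool → Bool) = s.eval n * 2 := rfl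
      rw [h3, if_neg (by omega)]
      congr 1
      omega
    have b2 : ∀ F : ℕ → Bool, bigXor 2 F = xor (F 0) (F 1) := by
      intro F
      change xor (xor false (F 0)) (F 1) = _
      rw [Bool.false_xor]
    simp only [QData.val, q, PF.ev_mk, PF1.ev_mk, b2, add_zero, e0, e1, e2, e3,
      one_ne_zero, if_true, if_false, ← pow_lt_iff_halve]
    have ho' : o / (s.eval n * 2) * (s.eval n * 2) + o % (s.eval n * 2) = o := by
      rw [mul_comm]
      exact Nat.div_add_mod _ _
    conv_lhs => rw [← ho', key _ _ _ _ h1 h2]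
    have f3 : o % (s.eval n * 2) ≠ 0 → ∀ c : Fin (s.eval n) → Bool → Fin (s.eval n) → Bool → Bool,
        (c = fun i α i' α' =>
        chainVal (s.eval n * 2) (pad r) (slotNum i α) (slotNum i' α')) →
        pad (r, c) (s.eval n * 2 + o - 1) =
        chainVal (s.eval n * 2) (pad r) (o / (s.eval n * 2)) (o % (s.eval n * 2) - 1) := by
      rintro h c rfl
      rw [f2 _ (hz _ _ h), ← key _ _ _ _ h1 (by omega)]
      congr 1
      omega
    simp only [termVal, f1]
    generalize o / (s.eval n * 2) = t at *
    generalize o % (s.eval n * 2) = b at *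
    cases b with
    | zero =>
      simp only [chainVal, if_true]
      by_cases ha : 2 ^ 0 < s.eval n * 2
      · by_cases hb : halve t 0 % 2 = 1 <;> simp only [ha, hb] <;> cases pad r 0 <;> simp
      · exact absurd (by omega) ha
    | succ b =>
      rw [f3 (Nat.succ_ne_zero b) _ rfl]
      simp only [chainVal, Nat.succ_ne_zero, if_false, Nat.add_sub_cancel]
      by_cases ha : 2 ^ (b + 1) < s.eval n * 2
      · by_cases hb : halve t (b + 1) % 2 = 1 <;> simp only [ha, hb] <;>
          cases chainVal (s.eval n * 2) (pad r) t b <;> cases pad r (b + 1) <;> simp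
      · simp [ha]

/-- The slot whose number has the binary representation given by the first bits of `r`. -/
def guessSlot {s : ℕ} (r : Fin s → Bool → Bool) : Fin s → Bool → Bool := fun i α =>
  chainVal (s * 2) (pad r) (slotNum i α) (s * 2 - 1)

/-- Only the last entry of each chain is kept, namely the one at slot number `2s - 1`, where the
whole conjunction has been formed. -/
theorem easy_guessSlot : Easy (S := fun n => Fin (s.eval n) → Bool → Bool)
    fun _ r => guessSlot r := by
  have h : Wire (S := fun n => Fin (s.eval n) → Bool → Fin (s.eval n) → Bool → Bool)
      (T := fun n => Fin (s.eval n) → Bool → Bool) fun n c i α =>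
      c i α ⟨s.eval n - 1, by have := i.isLt; omega⟩ true := by
    refine .intro (fun n t => if t < s.eval n * 2 then t * (s.eval n * 2) + (s.eval n * 2 - 1)
      else s.eval n * 2 * (s.eval n * 2)) (by fun_prop) fun n t c => ?_
    split_ifs with h
    · obtain ⟨i, α, rfl⟩ := exists_slotNum h
      have := i.isLt
      have h1 : slotNum i α / 2 < s.eval n := by rw [slotNum_div]; exact i.isLt
      have h2 : s.eval n * 2 - 1 = slotNum (⟨s.eval n - 1, by omega⟩ : Fin (s.eval n)) true := by
        simp [slotNum]
        omega
      rw [pad_bits_slotNum]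
      refine Eq.trans ?_ (pad_slot (X := fun n => Fin (s.eval n) → Bool → Bool) c _ _ h1
        (show s.eval n * 2 - 1 < s.eval n * 2 by omega)).symm
      simp only [h2, pad_bits_slotNum, slotNum_div, slotNum_mod]
    · rw [pad_bits_of_le _ (not_lt.1 h)]
      refine (pad_of_le c (le_of_eq ?_)).symm
      change s.eval n * (s.eval n * 2 + s.eval n * 2) = _
      ring
  have e := h.easy.comp (easy_chain (s := s))
  have e' : (fun n (r : Fin (s.eval n) → Bool → Bool) => guessSlot r) = fun n r i α =>
      chainVal (s.eval n * 2) (pad r) (slotNum i α)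
        (slotNum (⟨s.eval n - 1, by have := i.isLt; omega⟩ : Fin (s.eval n)) true) := by
    funext n r i α
    have := i.isLt
    simp only [guessSlot, slotNum]
    congr 1
    simp
    omega
  rw [e']
  exact e

/-- Numbers below `M` are determined by their bits at positions `b` with `2 ^ b < M`; all higher
bits vanish. -/
theorem chainVal_unique {M : ℕ} {r : ℕ → Bool} {t t' : ℕ} (ht : t < M) (ht' : t' < M)
    (h : chainVal M r t (M - 1) = true) (h' : chainVal M r t' (M - 1) = true) : t = t' := by
  rw [chainVal_eq_true] at h h'
  refine Nat.eq_of_testBit_eq fun b => ?_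
  by_cases hb : 2 ^ b < M
  · have hbM : b ≤ M - 1 := by
      have := Nat.lt_two_pow_self (n := b)
      omega
    have e := (h b hbM hb).symm.trans (h' b hbM hb)
    rw [Nat.testBit_eq_decide_div_mod_eq, Nat.testBit_eq_decide_div_mod_eq]
    exact decide_eq_decide.2 (decide_eq_decide.1 e)
  · rw [Nat.testBit_lt_two_pow (by omega), Nat.testBit_lt_two_pow (by omega)]

/-- At most one slot number matches `r`, so the guess is a given single slot as soon as `r` matches
that slot. This describes the event by independent conditions on the coins. -/
theorem guessSlot_eq_oneHot {s : ℕ} {r : Fin s → Bool → Bool} {i : Fin s} {α : Bool} :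
    guessSlot r = oneHot i α ↔
      ∀ i' α', 2 ^ slotNum i' α' < s * 2 → r i' α' =
        decide (halve (slotNum i α) (slotNum i' α') % 2 = 1) := by
  have key : guessSlot r i α = true ↔ ∀ i' α', 2 ^ slotNum i' α' < s * 2 → r i' α' =
        decide (halve (slotNum i α) (slotNum i' α') % 2 = 1) := by
    rw [guessSlot, chainVal_eq_true]
    constructor
    · intro h i' α' hM
      rw [← pad_bits_slotNum r]
      exact h _ (by have := slotNum_lt i' α'; omega) hM
    · intro h c hc hM
      have := slotNum_lt i α
      obtain ⟨i', α', rfl⟩ := exists_slotNum (show c < s * 2 by omega)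
      rw [pad_bits_slotNum]
      exact h i' α' hM
  rw [← key]
  constructor
  · intro h
    rw [h]
    simp [oneHot]
  · intro h
    funext i' α'
    by_cases hi : i' = i ∧ α' = α
    · rw [hi.1, hi.2, h]
      simp [oneHot]
    · rw [oneHot, decide_eq_false hi]
      cases h' : guessSlot r i' α'
      · rfl
      · exact absurd (slotNum_injective (chainVal_unique (slotNum_lt i' α') (slotNum_lt i α) h' h))
          hi

/-- The product is `(1/2) ^ c`, where `c` counts the `b < K` with `2 ^ b < M`. Such `b` form an
initial segment, whence `2 ^ c < 2 * M`. -/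
theorem prod_half_ge (M K : ℕ) (hM : 0 < M) :
    (1 / (2 * M) : ℝ) ≤ ∏ b ∈ Finset.range K, if 2 ^ b < M then (1 / 2 : ℝ) else 1 := by
  have key : ∃ c ≤ K, (∏ b ∈ Finset.range K, if 2 ^ b < M then (1 / 2 : ℝ) else 1) = (1 / 2) ^ c ∧
      2 ^ c < 2 * M ∧ (c = K ∨ M ≤ 2 ^ c) := by
    induction K with
    | zero => exact ⟨0, le_rfl, by simp, by omega, .inl rfl⟩
    | succ K ih =>
      obtain ⟨c, hc, h1, h2, h3⟩ := ih
      rw [Finset.prod_range_succ, h1]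
      by_cases hK : 2 ^ K < M
      · have : c = K := by
          rcases h3 with h3 | h3
          · exact h3
          · have := Nat.pow_le_pow_right (show 0 < 2 by norm_num) hc
            omega
        subst this
        exact ⟨c + 1, le_rfl, by rw [if_pos hK, pow_succ], by rw [pow_succ]; omega, .inl rfl⟩
      · refine ⟨c, by omega, by rw [if_neg hK, mul_one], h2, .inr ?_⟩
        rcases h3 with rfl | h3
        · exact not_lt.1 hK
        · exact h3
  obtain ⟨c, _, h1, h2, _⟩ := key
  rw [h1, one_div, one_div, inv_pow]
  refine inv_anti₀ (by positivity) ?_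
  exact_mod_cast h2.le

theorem prod_slotNum {M : Type*} [CommMonoid M] {s : ℕ} (F : ℕ → M) :
    ∏ i : Fin s, ∏ α, F (slotNum i α) = ∏ b ∈ Finset.range (s * 2), F b := by
  rw [← prod_pairIdx fun i α => F (slotNum i α), Finset.prod_range]
  refine Finset.prod_congr rfl fun j _ => ?_
  congr 1
  rcases Nat.mod_two_eq_zero_or_one j with h | h <;> simp [pairIdx, slotNum, h] <;> omega

/-- There is an efficient algorithm which guesses every slot with the same probability, which is
not too small. -/
theorem exists_guess (s : Polynomial ℕ) :
    ∃ (K : ∀ n, Kernel Unit (Fin (s.eval n) → Bool → Bool)) (p : ℕ → ℝ), QPTKernel K ∧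
      (∀ n i α, K n () (oneHot i α) = p n) ∧ ∀ n, 0 < s.eval n → 1 / (4 * s.eval n) ≤ p n := by
  classical
  have h1 := (coin_qpt.tensorFam s).marginal (easy_guessSlot.comp Easy.id.snd)
  have h2 : QPTKernel fun n (_ : Unit) (e : Fin (s.eval n) → Bool → Bool) =>
      ∑ r, if guessSlot r = e then ∏ _i : Fin (s.eval n), ∏ _α : Bool, (1 / 2 : ℝ) else 0 := by
    refine QPT.congr (QPT.precomp h1 (g := fun n (_ : Unit) (_ : Fin (s.eval n)) (_ : Bool) => ())
      (Wire.easy (.of_pad_eq fun n u => ?_))) fun n x y ρ => ?_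
    · funext i
      rw [pad_pi_bool]
      split_ifs <;> rfl
    · refine congrArg (fun z : ℝ => ρ () () • ((z : ℂ) • (1 : Op Unit)))
        (Finset.sum_congr rfl fun r _ => ?_)
      congr!
  refine ⟨_, fun n => ∏ b ∈ Finset.range (s.eval n * 2),
    if 2 ^ b < s.eval n * 2 then (1 / 2 : ℝ) else 1, h2, fun n i α => ?_, fun n hn => ?_⟩
  · simp only [guessSlot_eq_oneHot]
    rw [← prod_slotNum]
    -- The coins are independent: each coin that matters contributes `1/2`, and an irrelevant one
    -- contributes `1/2 + 1/2`. The result does not depend on the slot.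
    have e : ∀ r : Fin (s.eval n) → Bool → Bool, (if (∀ i' α', 2 ^ slotNum i' α' < s.eval n * 2 →
        r i' α' = decide (halve (slotNum i α) (slotNum i' α') % 2 = 1)) then
          ∏ _i : Fin (s.eval n), ∏ _α : Bool, (1 / 2 : ℝ) else 0) =
        ∏ i', ∏ α', if 2 ^ slotNum i' α' < s.eval n * 2 → r i' α' =
          decide (halve (slotNum i α) (slotNum i' α') % 2 = 1) then (1 / 2 : ℝ) else 0 := by
      intro r
      by_cases h : ∀ i' α', 2 ^ slotNum i' α' < s.eval n * 2 →
        r i' α' = decide (halve (slotNum i α) (slotNum i' α') % 2 = 1)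
      · rw [if_pos h]
        exact Finset.prod_congr rfl fun i' _ => Finset.prod_congr rfl fun α' _ => by
          rw [if_pos (h i' α')]
      · rw [if_neg h]
        push Not at h
        obtain ⟨i', α', h⟩ := h
        rw [Finset.prod_eq_zero (Finset.mem_univ i')]
        rw [Finset.prod_eq_zero (Finset.mem_univ α')]
        rw [if_neg]
        simpa using h
    simp only [e]
    rw [← prod_prod_sum fun i' α' v => if 2 ^ slotNum i' α' < s.eval n * 2 → v =
          decide (halve (slotNum i α) (slotNum i' α') % 2 = 1) then (1 / 2 : ℝ) else 0]
    refine Finset.prod_congr rfl fun i' _ => Finset.prod_congr rfl fun α' _ => ?_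
    by_cases h : 2 ^ slotNum i' α' < s.eval n * 2
    · simp [h]
    · simp [h]
  · have := prod_half_ge (s.eval n * 2) (s.eval n * 2) (by omega)
    refine le_trans (le_of_eq ?_) this
    push_cast
    ring

end

set_option linter.unusedSimpArgs false

/-! ## Replacing inputs of circuits -/

namespace BCircuit

variable {ι κ : Type} {N l : ℕ}

/-- Attach the inputs indexed by `κ` to other inputs or to constants. -/
def plugSrc (τ : κ → ι ⊕ Bool) : Src (ι ⊕ κ) N → Src ι N
  | Sum.inl (Sum.inl i) => Sum.inl i
  | Sum.inl (Sum.inr j) => match τ j with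
    | Sum.inl i => Sum.inl i
    | Sum.inr b => Sum.inr (Sum.inr b)
  | Sum.inr s => Sum.inr s

theorem of_plugSrc {τ : κ → ι ⊕ Bool} {s : Src (ι ⊕ κ) N} {j : Fin N}
    (h : plugSrc τ s = Sum.inr (Sum.inl j)) : s = Sum.inr (Sum.inl j) := by
  rcases s with (i | i) | s
  · simp [plugSrc] at h
  · simp only [plugSrc] at h
    split at h <;> simp at h
  · simpa [plugSrc] using h

/-- Attach the inputs indexed by `κ` to other inputs or to constants. -/
def plug (U : BCircuit (ι ⊕ κ) N l) (τ : κ → ι ⊕ Bool) : BCircuit ι N l where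
  op := U.op
  lhs k := plugSrc τ (U.lhs k)
  rhs k := plugSrc τ (U.rhs k)
  out o := plugSrc τ (U.out o)
  lhs_lt k j h := U.lhs_lt k j (of_plugSrc h)
  rhs_lt k j h := U.rhs_lt k j (of_plugSrc h)

theorem plugSrc_const (m : κ → Bool) (s : Src (ι ⊕ κ) N) :
    plugSrc (fun j => Sum.inr (m j)) s = hardSrc m s := by
  rcases s with (i | i) | s <;> rfl

theorem plug_const (U : BCircuit (ι ⊕ κ) N l) (m : κ → Bool) :
    U.plug (fun j => Sum.inr (m j)) = U.hardwire m := by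
  ext1 <;> simp only [plug, hardwire, plugSrc_const]

/-- The value on the wire attached to `s`. -/
def srcVal (C : BCircuit ι N l) (x : ι → Bool) : Src ι N → Bool
  | Sum.inl i => x i
  | Sum.inr (Sum.inl j) => C.gateVal x j
  | Sum.inr (Sum.inr b) => b

theorem gateVal_eq (C : BCircuit ι N l) (x : ι → Bool) (k : Fin N) :
    C.gateVal x k = C.op k (C.srcVal x (C.lhs k)) (C.srcVal x (C.rhs k)) := by
  rw [gateVal]
  congr 1 <;> split <;> simp [*, srcVal]

theorem eval_eq (C : BCircuit ι N l) (x : ι → Bool) :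
    C.eval x = fun o => C.srcVal x (C.out o) := by
  funext o
  unfold eval srcVal
  rcases C.out o with i | j | b <;> rfl

/-- The values of the inputs of `U` when `U.plug τ` is evaluated. -/
def plugInput (τ : κ → ι ⊕ Bool) (x : ι → Bool) : ι ⊕ κ → Bool :=
  Sum.elim x fun j => Sum.elim x id (τ j)

theorem srcVal_plug {U : BCircuit (ι ⊕ κ) N l} {τ : κ → ι ⊕ Bool} {x : ι → Bool}
    {s : Src (ι ⊕ κ) N} (h : ∀ j, s = Sum.inr (Sum.inl j) →
      (U.plug τ).gateVal x j = U.gateVal (plugInput τ x) j) :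
    (U.plug τ).srcVal x (plugSrc τ s) = U.srcVal (plugInput τ x) s := by
  rcases s with (i | i) | j | b
  · rfl
  · cases e : τ i <;> simp [plugSrc, srcVal, plugInput, e]
  · exact h j rfl
  · rfl

theorem gateVal_plug (U : BCircuit (ι ⊕ κ) N l) (τ : κ → ι ⊕ Bool) (x : ι → Bool) (k : Fin N) :
    (U.plug τ).gateVal x k = U.gateVal (plugInput τ x) k := by
  induction k using WellFoundedLT.induction with
  | ind k ih =>
    rw [gateVal_eq, gateVal_eq]
    exact congrArg₂ (U.op k) (srcVal_plug fun j hj => ih j (U.lhs_lt k j hj))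
      (srcVal_plug fun j hj => ih j (U.rhs_lt k j hj))

theorem eval_plug (U : BCircuit (ι ⊕ κ) N l) (τ : κ → ι ⊕ Bool) (x : ι → Bool) :
    (U.plug τ).eval x = U.eval (plugInput τ x) := by
  rw [eval_eq, eval_eq]
  funext o
  exact srcVal_plug fun j _ => gateVal_plug U τ x j

theorem eval_hardwire (U : BCircuit (ι ⊕ κ) N l) (m : κ → Bool) (x : ι → Bool) :
    (U.hardwire m).eval x = U.eval (Sum.elim x m) := by
  rw [← plug_const, eval_plug]
  rfl

/-- Attach the second argument of `U` to the bits of `m`, with ones replaced by the first input. -/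
def follow {s : ℕ} (m : κ → Bool) : κ → Fin s ⊕ Bool := fun j =>
  if h : 0 < s then if m j then Sum.inl ⟨0, h⟩ else Sum.inr false else Sum.inr false

/-- On the all-zero input every bit attached to the first input is zero as well, so all trace of `m`
disappears. -/
theorem eval_plug_follow_zero {s : ℕ} (U : BCircuit (Fin s ⊕ κ) N l) (m : κ → Bool) :
    (U.plug (follow m)).eval (fun _ => false) = (U.hardwire fun _ => false).eval fun _ => false := by
  rw [eval_hardwire, eval_plug]
  congr 1
  funext t
  rcases t with i | j
  · rfl
  · simp only [plugInput, follow, Sum.elim_inr]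
    split_ifs <;> rfl

/-- On the all-one input the first input supplies the ones of `m`. Together with the all-zero case,
one circuit connects `U(·,m)` and `U(·,0)`; this needs a first input to exist. -/
theorem eval_plug_follow_one {s : ℕ} (hs : 0 < s) (U : BCircuit (Fin s ⊕ κ) N l) (m : κ → Bool) :
    (U.plug (follow m)).eval (fun _ => true) = (U.hardwire m).eval fun _ => true := by
  rw [eval_hardwire, eval_plug]
  congr 1
  funext t
  rcases t with i | j
  · rfl
  · simp only [plugInput, follow, Sum.elim_inr, dif_pos hs]
    split_ifs with h <;> simp [h]

end BCircuit

/-! ## Computing hard-wired circuits -/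

theorem pad_inl {X Y : Type} [BitRep X] [BitRep Y] (x : X) (i : ℕ) :
    pad (Sum.inl x : X ⊕ Y) i = if i = 0 then false else pad x (i - 1) := by
  simp only [pad, BitRep.len, BitRep.code]
  split_ifs <;> first | rfl | omega

theorem pad_inr {X Y : Type} [BitRep X] [BitRep Y] (y : Y) (i : ℕ) :
    pad (Sum.inr y : X ⊕ Y) i = if i = 0 then true else if i - 1 < BitRep.len X then false else
      pad y (i - 1 - BitRep.len X) := by
  simp only [pad, BitRep.len, BitRep.code]
  split_ifs <;> first | rfl | omega

theorem pad_fin {n : ℕ} (x : Fin n) (i : ℕ) : pad x i = decide (i = x.val) := by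
  have := x.isLt
  simp only [pad, BitRep.len, BitRep.code]
  split_ifs with h
  · rfl
  · symm
    rw [decide_eq_false_iff_not]
    omega

/-- The bits of `plugSrc τ σ`, up to those which depend on `τ`, in terms of the bits of `σ`. -/
def plugBase (s μ N : ℕ) (p : ℕ → Bool) (i : ℕ) : Bool :=
  if i = 0 then xor (p 0) (p 1) else if i < 1 + s then p (i + 1)
  else if i = 1 + s then xor (p (2 + s + μ)) (p 1)
  else if i < 3 + s + N then p (i + μ + 1) else false

theorem decide_xor (P Q : Prop) [Decidable P] [Decidable Q] :
    xor (decide P) (decide Q) = decide ((P ∧ ¬Q) ∨ (¬P ∧ Q)) := by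
  by_cases hP : P <;> by_cases hQ : Q <;> simp [hP, hQ]

theorem false_eq_decide_iff' (P : Prop) [Decidable P] : false = decide P ↔ ¬P := by
  rw [eq_comm, decide_eq_false_iff_not]

theorem true_eq_decide_iff' (P : Prop) [Decidable P] : true = decide P ↔ P := by
  rw [eq_comm, decide_eq_true_iff]

section

variable {ι : Type} [BitRep ι] {N : ℕ} (i : ℕ)

theorem pad_src_gate (k : Fin N) : pad (Sum.inr (Sum.inl k) : Src ι N) i =
    decide (i = 0 ∨ i = 2 + BitRep.len ι + k.val) := by
  simp only [pad_inl, pad_inr, pad_fin]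
  split_ifs <;> (try simp only [decide_xor, Bool.false_xor, false_eq_decide_iff',
        true_eq_decide_iff', decide_eq_decide, decide_eq_false_iff_not, Bool.false_eq_true,
        false_and, true_and, or_false, not_true, eq_self_iff_true,
        false_or, not_false_eq_true, not_true_eq_false, and_false, and_true, or_true, true_or]) <;> omega

theorem pad_src_const (b : Bool) : pad (Sum.inr (Sum.inr b) : Src ι N) i =
    decide (i = 0 ∨ i = 1 + BitRep.len ι ∨ b = true ∧ i = 2 + BitRep.len ι + N) := by
  have hN : BitRep.len (Fin N) = N := rfl
  simp only [pad_inr, pad_bool, hN]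
  cases b <;> split_ifs <;> (try simp only [decide_xor, Bool.false_xor, false_eq_decide_iff',
        true_eq_decide_iff', decide_eq_decide, decide_eq_false_iff_not, Bool.false_eq_true,
        false_and, true_and, or_false, not_true, eq_self_iff_true,
        false_or, not_false_eq_true, not_true_eq_false, and_false, and_true, or_true, true_or]) <;> omega

end

theorem pad_src_fin {s N : ℕ} (k : Fin s) (i : ℕ) :
    pad (Sum.inl k : Src (Fin s) N) i = decide (i = k.val + 1) := by
  simp only [pad_inl, pad_fin]
  split_ifs <;> (try simp only [false_eq_decide_iff', decide_eq_decide]) <;> omega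

theorem pad_src_left {s μ N : ℕ} (k : Fin s) (i : ℕ) :
    pad (Sum.inl (Sum.inl k) : Src (Fin s ⊕ Fin μ) N) i = decide (i = k.val + 2) := by
  simp only [pad_inl, pad_fin]
  split_ifs <;> (try simp only [decide_xor, Bool.false_xor, false_eq_decide_iff',
        true_eq_decide_iff', decide_eq_decide, decide_eq_false_iff_not, Bool.false_eq_true,
        false_and, true_and, or_false, not_true, eq_self_iff_true,
        false_or, not_false_eq_true, not_true_eq_false, and_false, and_true, or_true, true_or]) <;> omega

theorem pad_src_right {s μ N : ℕ} (k : Fin μ) (i : ℕ) :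
    pad (Sum.inl (Sum.inr k) : Src (Fin s ⊕ Fin μ) N) i = decide (i = 1 ∨ i = 2 + s + k.val) := by
  have hs : BitRep.len (Fin s) = s := rfl
  simp only [pad_inl, pad_inr, pad_fin, hs]
  split_ifs <;> (try simp only [decide_xor, Bool.false_xor, false_eq_decide_iff',
        true_eq_decide_iff', decide_eq_decide, decide_eq_false_iff_not, Bool.false_eq_true,
        false_and, true_and, or_false, not_true, eq_self_iff_true,
        false_or, not_false_eq_true, not_true_eq_false, and_false, and_true, or_true, true_or]) <;> omega

/-- Indices are encoded one-hot, so the scalar product with `m` picks out the bit `m j` if the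
source is input `j` of the second argument, and is zero otherwise. -/
theorem bigXor_src {s μ N : ℕ} (σ : Src (Fin s ⊕ Fin μ) N) (m : BV μ) :
    (bigXor μ fun j => pad σ (2 + s + j) && pad m j) = match σ with
      | Sum.inl (Sum.inr j) => m j
      | _ => false := by
  have hl : BitRep.len (Fin s ⊕ Fin μ) = 1 + s + μ := rfl
  rcases σ with (i | j) | j | b
  · refine (bigXor_congr fun t ht => ?_).trans (bigXor_false μ)
    have := i.isLt
    rw [pad_src_left, decide_eq_false (by omega)]
    rfl
  · have hj := j.isLt
    refine (bigXor_eq_single j.val hj fun t ht hne => ?_).trans ?_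
    · rw [pad_src_right, decide_eq_false (by omega)]
      rfl
    · simp only [pad_bv, getBit]
      rw [pad_src_right, decide_eq_true (by omega), dif_pos hj]
      rfl
  · refine (bigXor_congr fun t ht => ?_).trans (bigXor_false μ)
    rw [pad_src_gate, decide_eq_false (by omega)]
    rfl
  · refine (bigXor_congr fun t ht => ?_).trans (bigXor_false μ)
    rw [pad_src_const, decide_eq_false (by omega)]
    rfl

/-- Hard-wiring turns an input of the second argument into a constant. Only the value bit of that
constant, at position `2 + s + N`, depends on `m`, and it is the scalar product of the one-hot index
with `m`; all other bits are moved or adjusted independently of `m`. -/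
theorem pad_hardSrc {s μ N : ℕ} (σ : Src (Fin s ⊕ Fin μ) N) (m : BV μ) (i : ℕ) :
    pad (BCircuit.hardSrc m σ) i = xor (plugBase s μ N (pad σ) i) (decide (i = 2 + s + N) &&
      bigXor μ fun j => pad σ (2 + s + j) && pad m j) := by
  have hl : BitRep.len (Fin s ⊕ Fin μ) = 1 + s + μ := rfl
  have hs : BitRep.len (Fin s) = s := rfl
  rw [bigXor_src]
  rcases σ with (k | k) | k | b
  · have := k.isLt
    simp only [BCircuit.hardSrc, plugBase, pad_src_left, pad_src_fin, decide_xor,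
      Bool.and_false, Bool.xor_false]
    split_ifs <;> (try simp only [decide_xor, Bool.false_xor, false_eq_decide_iff',
        true_eq_decide_iff', decide_eq_decide, decide_eq_false_iff_not, Bool.false_eq_true,
        false_and, true_and, or_false, not_true, eq_self_iff_true,
        false_or, not_false_eq_true, not_true_eq_false, and_false, and_true, or_true, true_or]) <;> omega
  · have := k.isLt
    cases h : m k <;>
      simp only [BCircuit.hardSrc, plugBase, pad_src_right, pad_src_const, decide_xor, hs, h,
        Bool.and_false, Bool.xor_false, Bool.and_true] <;>
      split_ifs <;> (try simp only [decide_xor, Bool.false_xor, false_eq_decide_iff',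
        true_eq_decide_iff', decide_eq_decide, decide_eq_false_iff_not, Bool.false_eq_true,
        false_and, true_and, or_false, not_true, eq_self_iff_true,
        false_or, not_false_eq_true, not_true_eq_false, and_false, and_true, or_true, true_or]) <;> omega
  · have := k.isLt
    simp only [BCircuit.hardSrc, plugBase, pad_src_gate, decide_xor, hs, hl,
      Bool.and_false, Bool.xor_false]
    split_ifs <;> (try simp only [decide_xor, Bool.false_xor, false_eq_decide_iff',
        true_eq_decide_iff', decide_eq_decide, decide_eq_false_iff_not, Bool.false_eq_true,
        false_and, true_and, or_false, not_true, eq_self_iff_true,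
        false_or, not_false_eq_true, not_true_eq_false, and_false, and_true, or_true, true_or]) <;> omega
  · cases b <;>
      simp only [BCircuit.hardSrc, plugBase, pad_src_const, decide_xor, hs, hl,
        Bool.and_false, Bool.xor_false] <;>
      split_ifs <;> (try simp only [decide_xor, Bool.false_xor, false_eq_decide_iff',
        true_eq_decide_iff', decide_eq_decide, decide_eq_false_iff_not, Bool.false_eq_true,
        false_and, true_and, or_false, not_true, eq_self_iff_true,
        false_or, not_false_eq_true, not_true_eq_false, and_false, and_true, or_true, true_or]) <;> omega

/-- Compared with the constant zero, an attachment to the first input differs in exactly three bits: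
the outer tag at 0, the one-hot bit at 1 and the inner tag at `1 + s`. These are flipped when the
relevant bit of `m` is one. -/
theorem pad_plugSrc_follow {s μ N : ℕ} (σ : Src (Fin s ⊕ Fin μ) N) (m : BV μ) (i : ℕ) :
    pad (BCircuit.plugSrc (BCircuit.follow (s := s) m) σ) i = xor (plugBase s μ N (pad σ) i)
      (decide (0 < s ∧ (i = 0 ∨ i = 1 ∨ i = 1 + s)) &&
      bigXor μ fun j => pad σ (2 + s + j) && pad m j) := by
  have hl : BitRep.len (Fin s ⊕ Fin μ) = 1 + s + μ := rfl
  have hs : BitRep.len (Fin s) = s := rfl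
  by_cases h : ∃ j, σ = Sum.inl (Sum.inr j)
  · obtain ⟨k, rfl⟩ := h
    have := k.isLt
    rw [bigXor_src]
    simp only [BCircuit.plugSrc, BCircuit.follow, plugBase, pad_src_right, decide_xor]
    by_cases h0 : 0 < s
    · cases h : m k
      · simp only [dif_pos h0, Bool.false_eq_true, if_false, pad_src_const, hs, Bool.and_false,
          Bool.xor_false]
        split_ifs <;> (try simp only [decide_xor, Bool.false_xor, false_eq_decide_iff',
        true_eq_decide_iff', decide_eq_decide, decide_eq_false_iff_not, Bool.false_eq_true,
        false_and, true_and, or_false, not_true, eq_self_iff_true,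
        false_or, not_false_eq_true, not_true_eq_false, and_false, and_true, or_true, true_or]) <;> omega
      · simp only [dif_pos h0, if_true, pad_src_fin, Bool.and_true]
        split_ifs <;> (try simp only [decide_xor, Bool.false_xor, false_eq_decide_iff',
        true_eq_decide_iff', decide_eq_decide, decide_eq_false_iff_not, Bool.false_eq_true,
        false_and, true_and, or_false, not_true, eq_self_iff_true,
        false_or, not_false_eq_true, not_true_eq_false, and_false, and_true, or_true, true_or]) <;> omega
    · simp only [dif_neg h0]
      simp only [pad_src_const, hs, h0, false_and, decide_false, Bool.false_and, Bool.xor_false]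
      split_ifs <;> (try simp only [decide_xor, Bool.false_xor, false_eq_decide_iff',
        true_eq_decide_iff', decide_eq_decide, decide_eq_false_iff_not, Bool.false_eq_true,
        false_and, true_and, or_false, not_true, eq_self_iff_true,
        false_or, not_false_eq_true, not_true_eq_false, and_false, and_true, or_true, true_or]) <;> omega
  · have e : BCircuit.plugSrc (BCircuit.follow (s := s) m) σ =
        BCircuit.hardSrc (fun _ => false) σ := by
      rcases σ with (k | k) | k | b
      · rfl
      · exact absurd ⟨k, rfl⟩ h
      · rfl
      · rfl
    have e' : ∀ m : BV μ, (bigXor μ fun j => pad σ (2 + s + j) && pad m j) = false := by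
      intro m
      rw [bigXor_src]
      split
      · exact absurd ⟨_, rfl⟩ h
      · rfl
    rw [e, pad_hardSrc, e', e', Bool.and_false, Bool.and_false]


/-- The bits of the objects `x n` can be computed in polynomial time. -/
def ConstBits {X : ℕ → Type} [∀ n, BitRep (X n)] (x : ∀ n, X n) : Prop :=
  PTd fun z => pad (x z.1) z.2 = true

section ConstBits

variable {R S T : ℕ → Type} [∀ n, BitRep (R n)] [∀ n, BitRep (S n)] [∀ n, BitRep (T n)]

/-- The program is specified only below the length of the encoding and may output anything beyond.
Hence the guard on the position, and the cut-off at 1 to keep values bounded. -/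
theorem UniformSeq.constBits [PTLen S] {x : ∀ n, S n} (h : UniformSeq x) : ConstBits x := by
  obtain ⟨P, hP, hx⟩ := h
  have h1 : PT fun z : ℕ × ℕ => min (P.eval ![z.1, z.2]) 1 := .of_min_polyTime hP (by fun_prop)
  have h2 : PTd fun z : ℕ × ℕ => z.2 < ln S z.1 ∧ min (P.eval ![z.1, z.2]) 1 = 1 := by fun_prop
  refine (congrArg PTd (funext fun z => propext ?_)).mp h2
  by_cases h : z.2 < ln S z.1
  · have h' : z.2 < BitRep.len (S z.1) := h
    rw [hx _ _ h', pad, if_pos h']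
    cases BitRep.code (x z.1) z.2 <;> simp [h]
  · rw [pad_of_le _ (not_lt.1 h)]
    simp [h]

theorem ConstBits.wire {x : ∀ n, S n} (h : ConstBits x) {v : ∀ n, S n → T n} (hv : Wire v) :
    ConstBits fun n => v n (x n) := by
  obtain ⟨σ, hσ⟩ := hv
  have h1 : PTd fun z => pad (x z.1) (σ.ev z.1 z.2) = true :=
    PTd.comp (c := fun z => pad (x z.1) z.2 = true) (f := fun z => z.1)
      (g := fun z => σ.ev z.1 z.2) h (by fun_prop) (by fun_prop)
  refine (congrArg PTd (funext fun z => ?_)).mp h1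
  rw [hσ]

theorem ConstBits.bq {x : ∀ n, T n} (h : ConstBits x) {τ : ℕ → ℕ → ℕ}
    (hτ : PT fun z => τ z.1 z.2) : BQ (S := S) fun n i _ => pad (x n) (τ n i) :=
  (BQ.cond (c := fun n i => pad (x n) (τ n i) = true) (PTd.comp (c := fun z => pad (x z.1) z.2 = true)
    (f := fun z => z.1) (g := fun z => τ z.1 z.2) h (by fun_prop) hτ)).congr fun n i _ => by simp

theorem ConstBits.quad {x : ∀ n, T n} (h : ConstBits x) : Quad fun n (_ : S n) => x n :=
  h.bq (τ := fun _ i => i) (by fun_prop)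

end ConstBits

section

variable {s μ N l : Polynomial ℕ}
  {U : ∀ n, BCircuit (Fin (s.eval n) ⊕ Fin (μ.eval n)) (N.eval n) (l.eval n)}

/-- The bits of `σ` are constants that can be computed uniformly. They decide which terms are
present, so each bit of the result is an affine function of `m`. -/
theorem Quad.of_plugBase (K : Polynomial ℕ)
    {σ : ∀ n, Fin (K.eval n) → Src (Fin (s.eval n) ⊕ Fin (μ.eval n)) (N.eval n)}
    (hσ : ConstBits σ) {w : ℕ → ℕ → Prop} [∀ n i, Decidable (w n i)] (hw : PTd fun z => w z.1 z.2)
    {v : ∀ n, BV (μ.eval n) → Fin (K.eval n) → Src (Fin (s.eval n)) (N.eval n)}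
    (hv : ∀ n m k i, pad (v n m k) i =
      xor (plugBase (s.eval n) (μ.eval n) (N.eval n) (pad (σ n k)) i) (decide (w n i) &&
        bigXor (μ.eval n) fun j => pad (σ n k) (2 + s.eval n + j) && pad m j)) : Quad v := by
  obtain ⟨L', el'⟩ : ∃ L' : PF1, ∀ n, L'.ev n = 3 + s.eval n + N.eval n :=
    ⟨⟨fun n => 3 + s.eval n + N.eval n, by fun_prop⟩, fun _ => rfl⟩
  obtain ⟨L, el⟩ : ∃ L : PF1, ∀ n, L.ev n = 4 + s.eval n + μ.eval n + N.eval n :=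
    ⟨⟨fun n => 4 + s.eval n + μ.eval n + N.eval n, by fun_prop⟩, fun _ => rfl⟩
  have e' : ∀ n, BitRep.len (Src (Fin (s.eval n)) (N.eval n)) = L'.ev n := fun n => by
    rw [el']
    change 1 + s.eval n + (1 + N.eval n + 1) = 3 + s.eval n + N.eval n
    omega
  have e : ∀ n, BitRep.len (Src (Fin (s.eval n) ⊕ Fin (μ.eval n)) (N.eval n)) = L.ev n := fun n => by
    rw [el]
    change 1 + (1 + s.eval n + μ.eval n) + (1 + N.eval n + 1) = 4 + s.eval n + μ.eval n + N.eval n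
    omega
  have hbit : ∀ n (k : Fin (K.eval n)) t, t < L.ev n → pad (σ n k) t = pad (σ n) (k.val * L.ev n + t) := by
    intro n k t ht
    have h0 : 0 < L.ev n := by omega
    have h1 : (k.val * L.ev n + t) / L.ev n = k.val := by
      rw [mul_comm, Nat.mul_add_div h0, Nat.div_eq_of_lt ht, add_zero]
    have h2 : (k.val * L.ev n + t) % L.ev n = t := by
      rw [mul_comm, Nat.mul_add_mod, Nat.mod_eq_of_lt ht]
    rw [pad_pi]
    simp only [e, h1, h2]
    rw [dif_pos k.isLt]
  have hb : ∀ {τ : ℕ → ℕ → ℕ}, (PT fun z => τ z.1 z.2) →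
      BQ (S := fun n => BV (μ.eval n)) fun n i _ => pad (σ n) (i / L'.ev n * L.ev n + τ n i) := by
    intro τ hτ
    let τ' : PF := ⟨τ, hτ⟩
    exact hσ.bq (τ := fun n i => i / L'.ev n * L.ev n + τ'.ev n i) (by fun_prop)
  have hbase := BQ.ite (c := fun n i => i % L'.ev n = 0) (by fun_prop)
    ((hb (τ := fun n i => 0) (by fun_prop)).xor (hb (τ := fun n i => 1) (by fun_prop)))
    (BQ.ite (c := fun n i => i % L'.ev n < 1 + s.eval n) (by fun_prop)
      (hb (τ := fun n i => i % L'.ev n + 1) (by fun_prop))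
      (BQ.ite (c := fun n i => i % L'.ev n = 1 + s.eval n) (by fun_prop)
        ((hb (τ := fun n i => 2 + s.eval n + μ.eval n) (by fun_prop)).xor
          (hb (τ := fun n i => 1) (by fun_prop)))
        (BQ.ite (c := fun n i => i % L'.ev n < 3 + s.eval n + N.eval n) (by fun_prop)
          (hb (τ := fun n i => i % L'.ev n + μ.eval n + 1) (by fun_prop)) .zero)))
  have hterm : BQ (S := fun n => BV (μ.eval n)) fun n i m =>
      pad (σ n) (i / μ.eval n / L'.ev n * L.ev n + (2 + s.eval n + i % μ.eval n)) &&
        pad m (i % μ.eval n) := by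
    have h1 : PT fun z : ℕ × ℕ => z.2 / μ.eval z.1 / L'.ev z.1 * L.ev z.1 +
        (2 + s.eval z.1 + z.2 % μ.eval z.1) := by fun_prop
    refine (BQ.mask (c := fun n i => pad (σ n) (i / μ.eval n / L'.ev n * L.ev n +
      (2 + s.eval n + i % μ.eval n)) = true) (PTd.comp (c := fun z => pad (σ z.1) z.2 = true)
      (f := fun z => z.1) hσ (by fun_prop) h1) (BQ.wire (σ := fun n i => i % μ.eval n)
        (by fun_prop))).congr fun n i m => by simp
  have hsum := hterm.sum (M := fun n => μ.eval n) (by fun_prop)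
  have hw' : PTd fun z => w z.1 (z.2 % L'.ev z.1) := PTd.comp (c := fun z => w z.1 z.2)
    (f := fun z => z.1) (g := fun z => z.2 % L'.ev z.1) hw (by fun_prop) (by fun_prop)
  refine (BQ.mask (c := fun n i => i / L'.ev n < K.eval n) (by fun_prop)
    (hbase.xor (hsum.mask (c := fun n i => w n (i % L'.ev n)) hw'))).congr fun n i m => ?_
  have hi : i % L'.ev n < L'.ev n := Nat.mod_lt _ (by rw [el']; omega)
  have hi' := el' n
  have hi'' := el n
  rw [pad_pi]
  simp only [e']
  by_cases h : i / L'.ev n < K.eval n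
  · rw [dif_pos h, hv]
    have hk : ∀ t, t < L.ev n → pad (σ n ⟨i / L'.ev n, h⟩) t = pad (σ n) (i / L'.ev n * L.ev n + t) :=
      hbit n ⟨i / L'.ev n, h⟩
    rw [decide_eq_true h, Bool.true_and]
    congr 1
    · simp only [plugBase]
      rw [hk 0 (by omega), hk 1 (by omega),
        hk _ (show 2 + s.eval n + μ.eval n < L.ev n by omega)]
      split_ifs
      · rfl
      · rw [hk _ (by omega)]
      · rfl
      · rw [hk _ (by omega)]
      · rfl
    · congr 1
      refine bigXor_congr fun t ht => ?_
      have h1 : (i * μ.eval n + t) / μ.eval n = i := by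
        rw [mul_comm, Nat.mul_add_div (by omega), Nat.div_eq_of_lt ht, add_zero]
      have h2 : (i * μ.eval n + t) % μ.eval n = t := by
        rw [mul_comm, Nat.mul_add_mod, Nat.mod_eq_of_lt ht]
      rw [h1, h2, hk _ (by omega)]
  · rw [dif_neg h, decide_eq_false h, Bool.false_and]

theorem Quad.circuit (hU : UniformSeq U) {u : ∀ n, BV (μ.eval n) → Fin (μ.eval n) →
      Fin (s.eval n) ⊕ Bool} {w : ℕ → ℕ → Prop} [∀ n i, Decidable (w n i)]
    (hw : PTd fun z => w z.1 z.2)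
    (hu : ∀ n (σ : Src (Fin (s.eval n) ⊕ Fin (μ.eval n)) (N.eval n)) m i,
      pad (BCircuit.plugSrc (u n m) σ) i =
      xor (plugBase (s.eval n) (μ.eval n) (N.eval n) (pad σ) i) (decide (w n i) &&
        bigXor (μ.eval n) fun j => pad σ (2 + s.eval n + j) && pad m j)) :
    Quad fun n m => (U n).plug (u n m) := by
  have h : ConstBits fun n => (U n).toTuple := hU.constBits
  have h1 : Quad fun n (m : BV (μ.eval n)) => (U n).op := (h.wire Wire.id.fst).quad
  have h2 := Quad.of_plugBase N (h.wire Wire.id.snd.fst) hw fun n m k i => hu n ((U n).lhs k) m i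
  have h3 := Quad.of_plugBase N (h.wire Wire.id.snd.snd.fst) hw
    fun n m k i => hu n ((U n).rhs k) m i
  have h4 := Quad.of_plugBase l (h.wire Wire.id.snd.snd.snd) hw
    fun n m k i => hu n ((U n).out k) m i
  exact h1.pair (h2.pair (h3.pair h4))

theorem Quad.hardwire (hU : UniformSeq U) : Quad fun n m => (U n).hardwire m := by
  have h := Quad.circuit hU (u := fun n m j => Sum.inr (m j))
    (w := fun n i => i = 2 + s.eval n + N.eval n) (by fun_prop) fun n σ m i => by
      rw [BCircuit.plugSrc_const, pad_hardSrc]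
  simpa only [BCircuit.plug_const] using h

theorem Quad.plug_follow (hU : UniformSeq U) :
    Quad fun n m => (U n).plug (BCircuit.follow (s := s.eval n) m) :=
  Quad.circuit hU (w := fun n i => 0 < s.eval n ∧ (i = 0 ∨ i = 1 ∨ i = 1 + s.eval n))
    (by fun_prop) fun n σ m i => pad_plugSrc_follow σ m i

end

/-! ## Easy functions on slots -/

section

variable {R X Y : ℕ → Type} [∀ n, BitRep (R n)] [∀ n, BitRep (X n)] [∀ n, BitRep (Y n)]
  [PTLen R] [PTLen X] [PTLen Y] [∀ n, Fintype (R n)] [∀ n, Fintype (X n)] [∀ n, Fintype (Y n)]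
  {s k : Polynomial ℕ}

theorem Easy.slotMask {o : ∀ n, R n → Fin (s.eval n) → Bool → Bool}
    {L : ∀ n, R n → Fin (s.eval n) → Bool → BV (k.eval n)} (ho : Easy o) (hL : Easy L) :
    Easy fun n x => CertFE.slotMask (o n x) (L n x) :=
  (Quad.slotMask Wire.id.fst Wire.id.snd).easy.comp (ho.pair hL)

theorem Easy.slotMux {c : ∀ n, R n → Fin (s.eval n) → Bool → Bool}
    {L L' : ∀ n, R n → Fin (s.eval n) → Bool → X n} (hc : Easy c) (hL : Easy L) (hL' : Easy L') :
    Easy fun n x => CertFE.slotMux (c n x) (L n x) (L' n x) :=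
  (Quad.slotMux Wire.id.fst Wire.id.snd.fst Wire.id.snd.snd).easy.comp (hc.pair (hL.pair hL'))

theorem Easy.sel {L : ∀ n, R n → Fin (s.eval n) → Bool → X n} {x : ∀ n, R n → BV (s.eval n)}
    (hL : Easy L) (hx : Easy x) : Easy fun n y => CertFE.sel (L n y) (x n y) :=
  (Quad.sel Wire.id.fst Wire.id.snd).easy.comp (hL.pair hx)

theorem Easy.optIf {q : ∀ n, R n → Bool} {x : ∀ n, R n → X n} (hq : Easy q) (hx : Easy x) :
    Easy fun n y => CertFE.optIf (q n y) (x n y) :=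
  (Quad.optIf Wire.id.fst Wire.id.snd).easy.comp (hq.pair hx)

theorem Easy.mux {q : ∀ n, R n → Bool} {x y : ∀ n, R n → X n} (hq : Easy q) (hx : Easy x)
    (hy : Easy y) : Easy fun n r => if q n r then x n r else y n r :=
  (Quad.mux (S := fun n => Bool × X n × X n) Wire.id.fst Wire.id.snd.fst Wire.id.snd.snd).easy.comp
    (hq.pair (hx.pair hy))

theorem Easy.opened {q : ∀ n, R n → Bool} {f : ∀ n, R n → BV (s.eval n)} (hq : Easy q)
    (hf : Easy f) : Easy fun n x => CertFE.opened (q n x) (f n x) :=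
  (Quad.opened (S := fun n => Bool × BV (s.eval n)) (q := fun _ x => x.1) (f := fun _ x => x.2)
    Wire.id.fst Wire.id.snd).easy.comp (hq.pair hf)

theorem Easy.below {e : ∀ n, R n → Fin (s.eval n) → Bool → Bool} (he : Easy e) :
    Easy fun n x => CertFE.below (e n x) :=
  (Quad.below (S := fun n => Fin (s.eval n) → Bool → Bool) (e := fun _ x => x)
    Wire.id).easy.comp he

theorem Easy.selSum {e : ∀ n, R n → Fin (s.eval n) → Bool → Bool}
    {v : ∀ n, R n → Fin (s.eval n) → Bool → BV (k.eval n)} (he : Easy e) (hv : Easy v) :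
    Easy fun n x => CertFE.selSum (e n x) (v n x) := by
  have h : Easy (S := fun n => (Fin (s.eval n) → Bool → Bool) × (Fin (s.eval n) → Bool →
      BV (k.eval n))) fun n x => CertFE.selSum x.1 x.2 :=
    Quad.easy (Quad.selSum (s := s) (k := k) Wire.id.fst Wire.id.snd)
  have h' := h.comp (he.pair hv)
  exact h'

theorem Easy.bcast {v : ∀ n, R n → X n} (hv : Easy v) (p : Polynomial ℕ) :
    Easy (T := fun n => Fin (p.eval n) → Bool → X n) fun n r _ _ => v n r :=
  (Wire.id.bcast p).easy.comp hv

theorem Easy.fsts {v : ∀ n, R n → Fin (s.eval n) → Bool → X n × Y n} (hv : Easy v) :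
    Easy fun n r i α => (v n r i α).1 :=
  (Quad.map Wire.id.fst.quad s).easy.comp hv

theorem Easy.snds {v : ∀ n, R n → Fin (s.eval n) → Bool → X n × Y n} (hv : Easy v) :
    Easy fun n r i α => (v n r i α).2 :=
  (Quad.map Wire.id.snd.quad s).easy.comp hv

theorem Easy.zip {v : ∀ n, R n → Fin (s.eval n) → Bool → X n}
    {u : ∀ n, R n → Fin (s.eval n) → Bool → Y n} (hv : Easy v) (hu : Easy u) :
    Easy fun n r i α => (v n r i α, u n r i α) :=
  (Wire.id.fst.zip Wire.id.snd).easy.comp (hv.pair hu)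

/-- The label of an input for both values of the slot. -/
theorem Easy.both {v : ∀ n, R n → Fin (s.eval n) → X n} (hv : Easy v) :
    Easy (T := fun n => Fin (s.eval n) → Bool → X n) fun n r i _ => v n r i := by
  have h : Wire (S := fun n => Fin (s.eval n) → X n) (T := fun n => Fin (s.eval n) → Bool → X n)
      fun n v i _ => v i := by
    refine .intro (fun n i => if i / ln X n / 2 < s.eval n then
      i / ln X n / 2 * ln X n + i % ln X n else s.eval n * ln X n) (by fun_prop) fun n i v => ?_
    have hl : ∀ t, pad v t = if h : t / ln X n < s.eval n then
      pad (v ⟨t / ln X n, h⟩) (t % ln X n) else false := pad_pi v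
    rw [pad_pi_bool']
    split_ifs with h
    · rcases Nat.eq_zero_or_pos (ln X n) with h0 | h0
      · rw [pad_of_le (v _) (h0.le.trans (Nat.zero_le _)), hl]
        split_ifs
        · rw [pad_of_le (v _) (h0.le.trans (Nat.zero_le _))]
        · rfl
      · have hm := Nat.mod_lt i h0
        have h1 : (i / ln X n / 2 * ln X n + i % ln X n) / ln X n = i / ln X n / 2 := by
          rw [mul_comm, Nat.mul_add_div h0, Nat.div_eq_of_lt hm, add_zero]
        have h2 : (i / ln X n / 2 * ln X n + i % ln X n) % ln X n = i % ln X n := by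
          rw [mul_comm, Nat.mul_add_mod, Nat.mod_eq_of_lt hm]
        rw [hl]
        simp only [h1, h2]
        rw [dif_pos h]
    · exact (pad_of_le v le_rfl).symm
  exact h.easy.comp hv

end

/-! ## The stages of the experiment -/

/-- Reading back a stored history `y` recovers the state for `y`, provided that the public output
`z` is the one determined by `y`, and gives zero otherwise. -/
theorem store_load {X A Y B Z D : Type} (Φ : Instr X A Y B) (g : X × Y → Z) (x : X) (z : Z)
    (ρ : Op A) (T : Op D) (y : Y) [Decidable (g (x, y) = z)] :
    (Matrix.of fun b b' : B × D => ∑ _u : Unit, (Φ.store g x z ρ ⊗ₖ T) ((y, b.1), b.2)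
      ((y, b'.1), b'.2)) = (if g (x, y) = z then (1 : ℂ) else 0) • (Φ x y ρ ⊗ₖ T) := by
  ext b b'
  by_cases h : g (x, y) = z <;> simp [Instr.store, Matrix.kroneckerMap_apply, h]

/-- The messages exchanged with the challenger are functions of the stored history. Summing over all
messages and all histories compatible with them is the same as summing over histories. -/
theorem sum_collapse {Z I V C Y M : Type*} [Fintype Z] [Fintype I] [Fintype V] [Fintype C]
    [Fintype Y] [DecidableEq Z] [DecidableEq C] [AddCommMonoid M]
    (g : Y → Z) (k : Y → C) (F : Y → Z → I → V → M) :
    (∑ z, ∑ i, ∑ v, ∑ c, ∑ y, if k y = c then if g y = z then F y z i v else 0 else 0) =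
      ∑ y, ∑ i, ∑ v, F y (g y) i v := by
  have h1 : ∀ (z : Z) (i : I) (v : V), (∑ c, ∑ y, if k y = c then if g y = z then F y z i v else 0
      else 0) =
      ∑ y, if g y = z then F y z i v else 0 := by
    intro z i v
    rw [Finset.sum_comm]
    simp
  simp only [h1]
  have h2 : ∀ z : Z, (∑ i, ∑ v, ∑ y, if g y = z then F y z i v else 0) =
      ∑ y, if g y = z then ∑ i, ∑ v, F y z i v else 0 := by
    intro z
    rw [Finset.sum_congr rfl fun (i : I) _ => Finset.sum_comm (s := (Finset.univ : Finset V))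
      (t := (Finset.univ : Finset Y)) (f := fun v y => if g y = z then F y z i v else 0)]
    rw [Finset.sum_comm]
    refine Finset.sum_congr rfl fun y _ => ?_
    split_ifs <;> simp
  simp only [h2]
  rw [Finset.sum_comm]
  simp

/-! ## Hybrid experiments -/

/-- What the adversary decides on: whether a key is requested, for which function, and the
plaintext. -/
abbrev Choice (s μ : Polynomial ℕ) (n : ℕ) := (Bool × BV (s.eval n)) × BV (μ.eval n)

/-- Pairs of keys for all slots. -/
abbrev PKE.Keys {μ : Polynomial ℕ} (P : PKE μ) (s : Polynomial ℕ) (n : ℕ) :=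
  Fin (s.eval n) → Bool → BV (P.pkLen.eval n) × BV (P.skLen.eval n)

/-- The probability of a family of keys. -/
def PKE.keys {μ : Polynomial ℕ} (P : PKE μ) (s : Polynomial ℕ) (n : ℕ) (kk : P.Keys s n) : ℝ :=
  ∏ i, ∏ α, P.keyGen n () (kk i α)

theorem PKE.keys_qpt {μ : Polynomial ℕ} (P : PKE μ) (s : Polynomial ℕ) :
    QPTKernel fun n (_ : Unit) => P.keys s n := by
  have h := QPT.precomp (P.keyGen_qpt.tensorFam s)
    (g := fun n (_ : Unit) (_ : Fin (s.eval n)) (_ : Bool) => ()) (Easy.bcast Easy.id s)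
  exact h

section

variable {s μ N l r₂ r₃ : Polynomial ℕ} (G : Garbling s N l) (P : PKE G.labLen)

/-- The ciphertexts of a family of labels. -/
def encs (n : ℕ) (kk : P.Keys s n) (L : Fin (s.eval n) → Bool → BV (G.labLen.eval n))
    (vk : Fin (s.eval n) → Bool → BV (P.vkLen.eval n)) :
    Op (Fin (s.eval n) → Bool → BV (P.ctLen.eval n)) :=
  tensorFam fun i α => P.enc n ((kk i α).1, L i α) (vk i α)

/-- The probability that the verification of the ciphertexts succeeds. -/
def vrfys (n : ℕ) (vk : Fin (s.eval n) → Bool → BV (P.vkLen.eval n))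
    (cert : Fin (s.eval n) → Bool → BV (P.certLen.eval n)) : ℝ :=
  ∏ i, ∏ α, P.vrfy n (vk i α, cert i α) true

theorem vrfys_nonneg (n : ℕ) (vk : Fin (s.eval n) → Bool → BV (P.vkLen.eval n))
    (cert : Fin (s.eval n) → Bool → BV (P.certLen.eval n)) : 0 ≤ vrfys G P n vk cert :=
  Finset.prod_nonneg fun _ _ => Finset.prod_nonneg fun _ _ => P.vrfy_qpt.nonneg _ _ _

theorem vrfys_le_one (n : ℕ) (vk : Fin (s.eval n) → Bool → BV (P.vkLen.eval n))
    (cert : Fin (s.eval n) → Bool → BV (P.certLen.eval n)) : vrfys G P n vk cert ≤ 1 :=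
  Finset.prod_le_one (fun _ _ => Finset.prod_nonneg fun _ _ => P.vrfy_qpt.nonneg _ _ _)
    fun _ _ => Finset.prod_le_one (fun _ _ => P.vrfy_qpt.nonneg _ _ _)
      fun _ _ => P.vrfy_qpt.le_one _ _ _

theorem encs_qpt : QPTPrep (X := fun n => P.Keys s n × (Fin (s.eval n) → Bool →
      BV (G.labLen.eval n))) (Y := fun n => Fin (s.eval n) → Bool → BV (P.vkLen.eval n))
    (B := fun n => Fin (s.eval n) → Bool → BV (P.ctLen.eval n))
    fun n p vk => encs G P n p.1 p.2 vk := by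
  have hg : Easy (S := fun n => P.Keys s n × (Fin (s.eval n) → Bool → BV (G.labLen.eval n)))
      fun n p i α => ((p.1 i α).1, p.2 i α) := Easy.zip (Easy.fsts Easy.id.fst) Easy.id.snd
  have h := (P.enc_qpt.tensorFam s).precomp hg
  exact h

variable (front : ∀ n, Instr (P.Keys s n) Unit (Choice s μ n) (BV (r₂.eval n)))
  (delete : ∀ n, Instr Unit
    (BV (r₂.eval n) × BV (G.gcLen.eval n) × (Fin (s.eval n) → Bool → BV (P.ctLen.eval n)))
    (BV (G.certLen.eval n) × (Fin (s.eval n) → Bool → BV (P.certLen.eval n))) (BV (r₃.eval n)))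
  (E : ∀ n, (Fin (s.eval n) → Bool → BV (P.skLen.eval n)) → Op (BV (r₃.eval n)))

/-- The probability that the last adversary accepts, for given keys, choices, labels, verification
keys and certificates. -/
def final (n : ℕ) (kk : P.Keys s n) (w : Choice s μ n)
    (cert : BV (G.certLen.eval n) × (Fin (s.eval n) → Bool → BV (P.certLen.eval n)))
    (σ : Op (BV (G.gcLen.eval n)))
    (τ : Op (Fin (s.eval n) → Bool → BV (P.ctLen.eval n))) : ℝ :=
  (E n (fun i α => (kk i α).2) * delete n () cert (front n kk w 1 ⊗ₖ (σ ⊗ₖ τ))).trace.re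

/-- The experiment in which the garbled circuit is prepared by `T`, the encrypted labels are given
by `Λ`, and outcomes are weighted by `c`. -/
def hyb (c : ∀ n, Choice s μ n → ℝ)
    (T : ∀ n, Choice s μ n → (Fin (s.eval n) → Bool → BV (G.labLen.eval n)) →
      BV (G.vkLen.eval n) → Op (BV (G.gcLen.eval n)))
    (Λ : ∀ n, Choice s μ n → (Fin (s.eval n) → Bool → BV (G.labLen.eval n)) →
      Fin (s.eval n) → Bool → BV (G.labLen.eval n)) (n : ℕ) : ℝ :=
  ∑ y : ((P.Keys s n × Choice s μ n) × (Fin (s.eval n) → Bool → BV (P.vkLen.eval n))) ×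
      (BV (G.certLen.eval n) × (Fin (s.eval n) → Bool → BV (P.certLen.eval n))),
    ∑ L, ∑ vk, (G.setup n () L * G.vrfy n (vk, y.2.1) true) *
      (P.keys s n y.1.1.1 * c n y.1.1.2 * vrfys G P n y.1.2 y.2.2 *
        final G P front delete E n y.1.1.1 y.1.1.2 y.2 (T n y.1.1.2 L vk)
          (encs G P n y.1.1.1 (Λ n y.1.1.2 L) y.1.2))

/-- The labels that can be decrypted. -/
abbrev hide {s : ℕ} {μ k : ℕ} (w : (Bool × BV s) × BV μ) (L : Fin s → Bool → BV k) :
    Fin s → Bool → BV k := slotMask (opened w.1.1 w.1.2) L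

/-! ## Reduction to the garbling scheme -/

section

variable (C : ∀ n, Choice s μ n → BCircuit (Fin (s.eval n)) (N.eval n) (l.eval n))
  (x : ∀ n, Choice s μ n → BV (s.eval n))

/-- The first stage of the reduction. -/
def gcChoose (n : ℕ) : Instr Unit Unit
    (BCircuit (Fin (s.eval n)) (N.eval n) (l.eval n) × BV (s.eval n))
    ((P.Keys s n × Choice s μ n) × BV (r₂.eval n)) :=
  Instr.store (fun _ p ρ => front n p.1 p.2 (ρ () () • ((P.keys s n p.1 : ℂ) • (1 : Op Unit))))
    fun p => (C n p.2.2, x n p.2.2)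

/-- The second stage of the reduction, before the results are stored. -/
def gcRun (n : ℕ) : Instr (Fin (s.eval n) → BV (G.labLen.eval n))
    (((P.Keys s n × Choice s μ n) × BV (r₂.eval n)) × BV (G.gcLen.eval n))
    (((P.Keys s n × Choice s μ n) × (Fin (s.eval n) → Bool → BV (P.vkLen.eval n))) ×
      (BV (G.certLen.eval n) × (Fin (s.eval n) → Bool → BV (P.certLen.eval n))))
    (BV (r₃.eval n)) := fun ℓ p ρ =>
  delete n () p.2 (((Matrix.of fun b b' : BV (r₂.eval n) × BV (G.gcLen.eval n) => ∑ _u : Unit,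
    ρ ((p.1.1, b.1), b.2) ((p.1.1, b'.1), b'.2)) ⊗ₖ
      encs G P n p.1.1.1 (hide p.1.1.2 fun i _ => ℓ i) p.1.2).submatrix
        (Equiv.prodAssoc _ _ _).symm (Equiv.prodAssoc _ _ _).symm)

variable {G P front delete E C x}

theorem gcChoose_qpt (hf : QPT front) (hC : Easy C) (hx : Easy x) :
    QPT (gcChoose G P front C x) := by
  have h1 := QPT.andThen (P.keys_qpt s) hf (g := fun n p => p.2) Easy.id.snd
  have h2 : Easy (S := fun n => Unit × (P.Keys s n × Choice s μ n))
      fun n p => (C n p.2.2, x n p.2.2) := (hC.comp Easy.id.snd.snd).pair (hx.comp Easy.id.snd.snd)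
  exact h1.store h2

theorem gcRun_qpt (hd : QPT delete) : QPT (gcRun G P delete (μ := μ)) := by
  let e : ∀ n, (Fin (s.eval n) → BV (G.labLen.eval n)) →
      ((P.Keys s n × Choice s μ n) × BV (r₂.eval n)) × BV (G.gcLen.eval n) ≃
      ((P.Keys s n × Choice s μ n) × (BV (r₂.eval n) × BV (G.gcLen.eval n))) × Unit := fun n _ =>
    ⟨fun a => ((a.1.1, (a.1.2, a.2)), ()), fun a => ((a.1.1, a.1.2.1), a.1.2.2), fun _ => rfl,
      fun _ => rfl⟩
  have h1 := QPT.of_equiv e (.of_wire (u := fun n p => (p.1, (e n p.1).symm p.2))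
    (.pair Wire.id.fst (.pair (.pair Wire.id.snd.fst.fst (.pair Wire.id.snd.fst.snd
      Wire.id.snd.snd)) Wire.unit))
    (.pair Wire.id.fst (.pair (.pair Wire.id.snd.fst.fst Wire.id.snd.fst.snd.fst)
      Wire.id.snd.fst.snd.snd)) fun _ _ => rfl)
  have hg : Easy (S := fun n => (Fin (s.eval n) → BV (G.labLen.eval n)) ×
      (P.Keys s n × Choice s μ n)) fun n p => (p.2.1, hide p.2.2 fun i _ => p.1 i) :=
    Easy.id.snd.fst.pair (Easy.slotMask (Easy.opened Easy.id.snd.snd.fst.fst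
      Easy.id.snd.snd.fst.snd) (Easy.both Easy.id.fst))
  have h2 := h1.andPrep (encs_qpt G P) hg
  have h3 := h2.post (fun n => Equiv.prodAssoc _ _ _) (.of_wire_equiv
    (.pair Wire.id.fst.fst (.pair Wire.id.fst.snd Wire.id.snd))
    (.pair (.pair Wire.id.fst Wire.id.snd.fst) Wire.id.snd.snd))
  have h4 := h3.andThen hd (g := fun _ _ => ()) (Wire.unit.easy)
  exact h4

end

end

/-! ### Hybrids as games of the garbling scheme -/

section

variable {s μ N l r₂ r₃ : Polynomial ℕ} {G : Garbling s N l} {P : PKE G.labLen}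
  {front : ∀ n, Instr (P.Keys s n) Unit (Choice s μ n) (BV (r₂.eval n))}
  {delete : ∀ n, Instr Unit
    (BV (r₂.eval n) × BV (G.gcLen.eval n) × (Fin (s.eval n) → Bool → BV (P.ctLen.eval n)))
    (BV (G.certLen.eval n) × (Fin (s.eval n) → Bool → BV (P.certLen.eval n))) (BV (r₃.eval n))}
  {E : ∀ n, (Fin (s.eval n) → Bool → BV (P.skLen.eval n)) → Op (BV (r₃.eval n))}
  {C : ∀ n, Choice s μ n → BCircuit (Fin (s.eval n)) (N.eval n) (l.eval n)}
  {x : ∀ n, Choice s μ n → BV (s.eval n)} {c : ∀ n, Choice s μ n → ℝ}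

theorem gcRun_gcChoose (hf : QPT front) (hd : QPT delete) (n : ℕ)
    (z : BCircuit (Fin (s.eval n)) (N.eval n) (l.eval n) × BV (s.eval n))
    (ℓ : Fin (s.eval n) → BV (G.labLen.eval n)) (σ : Op (BV (G.gcLen.eval n)))
    (y : ((P.Keys s n × Choice s μ n) × (Fin (s.eval n) → Bool → BV (P.vkLen.eval n))) ×
      (BV (G.certLen.eval n) × (Fin (s.eval n) → Bool → BV (P.certLen.eval n))))
    [Decidable ((C n y.1.1.2, x n y.1.1.2) = z)] :
    gcRun G P delete n ℓ y (gcChoose G P front C x n () z 1 ⊗ₖ σ) =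
      (if (C n y.1.1.2, x n y.1.1.2) = z then (P.keys s n y.1.1.1 : ℂ) else 0) •
        delete n () y.2 (front n y.1.1.1 y.1.1.2 1 ⊗ₖ
          (σ ⊗ₖ encs G P n y.1.1.1 (hide y.1.1.2 fun i _ => ℓ i) y.1.2)) := by
  simp only [gcRun, gcChoose]
  rw [store_load, Matrix.one_apply_eq, one_smul, hf.map_smul, Matrix.smul_kronecker,
    Matrix.smul_kronecker, Matrix.smul_kronecker, smul_smul, Matrix.submatrix_smul, Pi.smul_apply, Pi.smul_apply, hd.map_smul]
  congr 1
  · split_ifs <;> simp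
  · congr 1
    ext p q
    simp [Matrix.kroneckerMap_apply, mul_assoc]

/-- The reduction samples all keys, runs the first stages of the adversary, submits `C` and `x`, and
encrypts labels itself. It receives only the labels of `x`, which suffices because every opened slot
has `α = x i`. The weight `c` and the verification of the ciphertexts go into the final effect. -/
theorem game_eq_hyb (hf : QPT front) (hd : QPT delete)
    (hx : ∀ n w i α, opened w.1.1 w.1.2 i α = true → α = x n w i)
    (G' : ∀ n, BCircuit (Fin (s.eval n)) (N.eval n) (l.eval n) → BV (s.eval n) →
      (Fin (s.eval n) → Bool → BV (G.labLen.eval n)) → BV (G.vkLen.eval n) →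
      Op (BV (G.gcLen.eval n))) (n : ℕ) :
    G.game (gcChoose G P front C x) (fun n => (gcRun G P delete n).store fun p => p.2.2.1)
      (fun n => blockEff fun y => ((c n y.1.1.2 * vrfys G P n y.1.2 y.2.2 : ℝ) : ℂ) •
        E n fun i α => (y.1.1.1 i α).2) G' n =
    hyb G P front delete E c (fun n w L vk => G' n (C n w) (x n w) L vk) (fun _ w L => hide w L)
      n := by
  classical
  -- Writing the received label into both slots of each index does no harm: closed slots are set to
  -- zero, and an opened slot gets the right label.
  have hh : ∀ (w : Choice s μ n) (L : Fin (s.eval n) → Bool → BV (G.labLen.eval n)),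
      (hide w fun i _ => L i (x n w i)) = hide w L := by
    intro w L
    funext i α
    simp only [hide, slotMask]
    split_ifs with h
    · rw [hx n w i α h]
    · rfl
  have key : ∀ (z : BCircuit (Fin (s.eval n)) (N.eval n) (l.eval n) × BV (s.eval n))
      (L : Fin (s.eval n) → Bool → BV (G.labLen.eval n)) (vk : BV (G.vkLen.eval n))
      (cert : BV (G.certLen.eval n)),
      G.setup n () L * G.vrfy n (vk, cert) true *
      ((blockEff fun y : ((P.Keys s n × Choice s μ n) × (Fin (s.eval n) → Bool →
          BV (P.vkLen.eval n))) × (BV (G.certLen.eval n) × (Fin (s.eval n) → Bool →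
          BV (P.certLen.eval n))) => ((c n y.1.1.2 * vrfys G P n y.1.2 y.2.2 : ℝ) : ℂ) •
          E n fun i α => (y.1.1.1 i α).2) *
        Instr.store (gcRun G P delete n) (fun p => p.2.2.1) (fun i => L i (z.2 i)) cert
          (gcChoose G P front C x n () z 1 ⊗ₖ G' n z.1 z.2 L vk)).trace.re =
      ∑ y : ((P.Keys s n × Choice s μ n) × (Fin (s.eval n) → Bool →
          BV (P.vkLen.eval n))) × (BV (G.certLen.eval n) × (Fin (s.eval n) → Bool →
          BV (P.certLen.eval n))), if y.2.1 = cert then if (C n y.1.1.2, x n y.1.1.2) = z then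
        (G.setup n () L * G.vrfy n (vk, y.2.1) true) *
        (P.keys s n y.1.1.1 * c n y.1.1.2 * vrfys G P n y.1.2 y.2.2 *
        final G P front delete E n y.1.1.1 y.1.1.2 y.2 (G' n z.1 z.2 L vk)
          (encs G P n y.1.1.1 (hide y.1.1.2 L) y.1.2)) else 0 else 0 := by
    intro z L vk cert
    rw [trace_blockEff_store, Complex.re_sum, Finset.mul_sum]
    refine Finset.sum_congr rfl fun y _ => ?_
    by_cases h1 : y.2.1 = cert
    · subst h1
      rw [if_pos rfl, if_pos rfl, gcRun_gcChoose hf hd]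
      by_cases h2 : (C n y.1.1.2, x n y.1.1.2) = z
      · subst h2
        rw [if_pos rfl, if_pos rfl, hh, Matrix.smul_mul, Matrix.mul_smul, smul_smul,
          Matrix.trace_smul, ← Complex.ofReal_mul, smul_eq_mul, Complex.re_ofReal_mul]
        simp only [final]
        ring
      · rw [if_neg h2, if_neg h2, zero_smul, mul_zero, Matrix.trace_zero, Complex.zero_re, mul_zero]
    · rw [if_neg h1, if_neg h1, Complex.zero_re, mul_zero]
  have h1 := sum_collapse (fun y : ((P.Keys s n × Choice s μ n) × (Fin (s.eval n) → Bool →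
          BV (P.vkLen.eval n))) × (BV (G.certLen.eval n) × (Fin (s.eval n) → Bool →
          BV (P.certLen.eval n))) => (C n y.1.1.2, x n y.1.1.2)) (fun y => y.2.1)
    (fun y z L vk => (G.setup n () L * G.vrfy n (vk, y.2.1) true) *
        (P.keys s n y.1.1.1 * c n y.1.1.2 * vrfys G P n y.1.2 y.2.2 *
        final G P front delete E n y.1.1.1 y.1.1.2 y.2 (G' n z.1 z.2 L vk)
          (encs G P n y.1.1.1 (hide y.1.1.2 L) y.1.2)))
  refine Eq.trans ?_ h1
  rw [Garbling.game, Fintype.sum_prod_type]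
  exact Finset.sum_congr rfl fun C' _ => Finset.sum_congr rfl fun x' _ => Finset.sum_congr rfl
    fun L _ => Finset.sum_congr rfl fun vk _ => Finset.sum_congr rfl fun cert _ =>
      key (C', x') L vk cert

/-- Garbled circuits may be replaced by simulated ones. -/
theorem Garbling.hyb_negligible {S : G.Simulator}
    (hS : ∀ (A : G.Adversary) (E : ∀ n, Op (BV (A.r₂.eval n))), (∀ n, IsEffect (E n)) →
      Negligible fun n => |G.expReal A E n - G.expSim S A E n|)
    (hf : QPT front) (hd : QPT delete) (hE : ∀ n sk, IsEffect (E n sk))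
    (hC : Easy C) (hx : Easy x)
    (hx' : ∀ n w i α, opened w.1.1 w.1.2 i α = true → α = x n w i)
    (hc : ∀ n w, 0 ≤ c n w ∧ c n w ≤ 1) :
    Negligible fun n =>
      |hyb G P front delete E c (fun n w L vk => G.garble n (C n w, L) vk) (fun _ w L => hide w L) n -
      hyb G P front delete E c (fun n w L vk => S n ((C n w).eval (x n w), sel L (x n w)) vk)
        (fun _ w L => hide w L) n| := by
  have hg : Easy (S := fun n => (Fin (s.eval n) → BV (G.labLen.eval n)) ×
      (((P.Keys s n × Choice s μ n) × (Fin (s.eval n) → Bool → BV (P.vkLen.eval n))) ×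
      (BV (G.certLen.eval n) × (Fin (s.eval n) → Bool → BV (P.certLen.eval n)))))
      fun n p => p.2.2.1 := Easy.id.snd.snd.fst
  have h := Garbling.game_negligible hS (gcChoose_qpt (C := C) (x := x) hf hC hx)
    ((gcRun_qpt hd).store hg)
    (E := fun n => blockEff fun y => ((c n y.1.1.2 * vrfys G P n y.1.2 y.2.2 : ℝ) : ℂ) •
        E n fun i α => (y.1.1.1 i α).2) fun n => blockEff_isEffect fun y => (hE _ _).smul
      (mul_nonneg (hc _ _).1 (vrfys_nonneg G P _ _ _))
      (mul_le_one₀ (hc _ _).2 (vrfys_nonneg G P _ _ _) (vrfys_le_one G P _ _ _))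
  simp only [game_eq_hyb hf hd hx'] at h
  exact h

end

/-! ## Replacing the value in a slot -/

section

variable {S : ℕ → Type} [∀ n, BitRep (S n)] [PTLen S] [∀ n, Fintype (S n)] {s k : Polynomial ℕ}

/-- Each of the additions making up the exchange is quadratic and its own inverse, so each is
implemented without leftover; the exchange itself need not be quadratic. -/
theorem EIf.slotSwap {e : ∀ n, S n → Fin (s.eval n) → Bool → Bool} (he : Wire e) :
    EIf fun n (p : S n × ((Fin (s.eval n) → Bool → BV (k.eval n)) × BV (k.eval n))) =>
      (p.1, CertFE.slotSwap (e n p.1) p.2) := by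
  have he' : Wire fun n (p : S n × ((Fin (s.eval n) → Bool → BV (k.eval n)) × BV (k.eval n))) =>
      e n p.1 := he.comp Wire.id.fst
  have qA : Quad fun n (p : S n × ((Fin (s.eval n) → Bool → BV (k.eval n)) × BV (k.eval n))) =>
      (p.1, (p.2.1, xorSel (e n p.1) p.2.1 p.2.2)) :=
    .pair Wire.id.fst.quad (.pair Wire.id.snd.fst.quad (.xorSel he' Wire.id.snd.snd Wire.id.snd.fst))
  have qB : Quad fun n (p : S n × ((Fin (s.eval n) → Bool → BV (k.eval n)) × BV (k.eval n))) =>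
      (p.1, (xorAll (e n p.1) p.2.2 p.2.1, p.2.2)) :=
    .pair Wire.id.fst.quad (.pair (.xorAll he' Wire.id.snd.snd Wire.id.snd.fst) Wire.id.snd.snd.quad)
  have hA := EIf.of_leftInverse qA qA fun n p => by simp only [xorSel_xorSel]
  have hB := EIf.of_leftInverse qB qB fun n p => by simp only [xorAll_xorAll]
  exact hA.comp (hB.comp hA)

end

section

variable {s : ℕ} {X M : Type*} {i : Fin s} {α : Bool}

/-- Replacing a slot only trades the factor of the old value for that of the new one. Applied to key
probabilities, it lets the challenge key take the place of a key sampled by the reduction. -/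
theorem prod_slotUpd {X : Type} {M : Type*} [CommMonoid M] (F : Fin s → Bool → X → M) (x : X)
    (v : Fin s → Bool → X) :
    F i α (v i α) * ∏ i', ∏ α', F i' α' (slotUpd i α x v i' α') =
      F i α x * ∏ i', ∏ α', F i' α' (v i' α') := by
  have h1 : ∀ w : Fin s → Bool → X, ∏ i', ∏ α', F i' α' (w i' α') =
      F i α (w i α) * ∏ p ∈ (Finset.univ : Finset (Fin s × Bool)).erase (i, α), F p.1 p.2
        (w p.1 p.2) := by
    intro w
    rw [← Fintype.prod_prod_type' fun i' α' => F i' α' (w i' α'),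
      ← Finset.mul_prod_erase _ _ (Finset.mem_univ (i, α))]
  have h2 : ∏ p ∈ (Finset.univ : Finset (Fin s × Bool)).erase (i, α), F p.1 p.2
        (slotUpd i α x v p.1 p.2) =
      ∏ p ∈ (Finset.univ : Finset (Fin s × Bool)).erase (i, α), F p.1 p.2 (v p.1 p.2) := by
    refine Finset.prod_congr rfl fun p hp => ?_
    rw [slotUpd, if_neg]
    rintro ⟨h, h'⟩
    exact Finset.ne_of_mem_erase hp (Prod.ext h h')
  rw [h1 (slotUpd i α x v), h1 v, h2, slotUpd, if_pos ⟨rfl, rfl⟩]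
  exact mul_left_comm _ _ _

theorem prod_oneHot {M : Type*} [CommMonoid M] (F : Fin s → Bool → M) :
    F i α * ∏ i', ∏ α', (if oneHot i α i' α' then 1 else F i' α') = ∏ i', ∏ α', F i' α' := by
  classical
  rw [← Fintype.prod_prod_type' F, ← Fintype.prod_prod_type' fun i' α' =>
    if oneHot i α i' α' then 1 else F i' α', ← Finset.mul_prod_erase _ _ (Finset.mem_univ (i, α)),
    ← Finset.mul_prod_erase _ (fun p : Fin s × Bool => F p.1 p.2) (Finset.mem_univ (i, α))]
  rw [if_pos (by simp [oneHot]), one_mul]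
  congr 1
  refine Finset.prod_congr rfl fun p hp => ?_
  rw [if_neg]
  intro h
  simp only [oneHot, decide_eq_true_eq] at h
  exact Finset.ne_of_mem_erase hp (Prod.ext h.1 h.2)

theorem oneHot_injective {i' : Fin s} {α' : Bool} (h : oneHot i α = oneHot i' α') :
    i = i' ∧ α = α' := by
  have := congrFun (congrFun h i) α
  simpa [oneHot] using this.symm

theorem sum_oneHot {M : Type*} [AddCommMonoid M] (F : (Fin s → Bool → Bool) → M)
    (h : ∀ e, (¬∃ i α, e = oneHot i α) → F e = 0) : ∑ e, F e = ∑ i, ∑ α, F (oneHot i α) := by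
  rw [← Fintype.sum_prod_type' fun i α => F (oneHot i α)]
  symm
  refine Finset.sum_of_injOn (fun p : Fin s × Bool => oneHot p.1 p.2) (fun p _ q _ h => ?_)
    (fun p _ => Finset.mem_coe.2 (Finset.mem_univ _)) (fun e _ he => h e ?_) fun p _ => rfl
  · exact Prod.ext (oneHot_injective h).1 (oneHot_injective h).2
  · rintro ⟨i, α, rfl⟩
    exact he ⟨(i, α), Finset.mem_coe.2 (Finset.mem_univ _), rfl⟩

theorem slotUpd_self {X : Type} (x : X) (v : Fin s → Bool → X) : slotUpd i α x v i α = x :=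
  if_pos ⟨rfl, rfl⟩

theorem slotUpd_slotUpd {X : Type} (x : X) (v : Fin s → Bool → X) :
    slotUpd i α (v i α) (slotUpd i α x v) = v := by
  funext i' α'
  simp only [slotUpd]
  split_ifs with h
  · rw [h.1, h.2]
  · rfl

/-- Resampling the value in a slot. -/
theorem sum_slotUpd {X R : Type} [Fintype X] [DecidableEq X] [CommSemiring R] (τ : X → R)
    (g : (Fin s → Bool → X) → R) :
    ∑ v, ∑ x, τ (v i α) * g (slotUpd i α x v) = (∑ x, τ x) * ∑ v, g v := by
  rw [Finset.sum_mul_sum, Finset.sum_comm (s := (Finset.univ : Finset X)),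
    ← Fintype.sum_prod_type' fun (v : Fin s → Bool → X) x => τ (v i α) * g (slotUpd i α x v),
    ← Fintype.sum_prod_type' fun (v : Fin s → Bool → X) x => τ x * g v]
  refine Fintype.sum_equiv ⟨fun p => (slotUpd i α p.2 p.1, p.1 i α),
    fun p => (slotUpd i α p.2 p.1, p.1 i α), fun p => ?_, fun p => ?_⟩ _ _ fun p => rfl <;>
  exact Prod.ext (slotUpd_slotUpd _ _) (slotUpd_self _ _)

/-- The state originally in the slot ends up in the register that is summed over and contributes
only its trace; the other tensor factors do not see the slot. -/
theorem tensorFam_slotUpd {B : Type} [Fintype B] (τ : Fin s → Bool → Op B) (σ : Op B)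
    (v v' : Fin s → Bool → B) :
    ∑ b, tensorFam τ (slotUpd i α b v) (slotUpd i α b v') * σ (v i α) (v' i α) =
      (τ i α).trace * tensorFam (slotUpd i α σ τ) v v' := by
  classical
  have h : ∀ (x : Op B) w w', tensorFam (slotUpd i α x τ) w w' = x (w i α) (w' i α) *
      ∏ p ∈ (Finset.univ : Finset (Fin s × Bool)).erase (i, α), τ p.1 p.2 (w p.1 p.2)
        (w' p.1 p.2) := by
    intro x w w'
    simp only [tensorFam, Matrix.of_apply]
    rw [← Fintype.prod_prod_type' fun i' α' => slotUpd i α x τ i' α' (w i' α') (w' i' α'),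
      ← Finset.mul_prod_erase _ _ (Finset.mem_univ (i, α))]
    simp only [slotUpd_self]
    congr 1
    refine Finset.prod_congr rfl fun p hp => ?_
    have hp' : ¬(p.1 = i ∧ p.2 = α) := fun hh => Finset.ne_of_mem_erase hp (Prod.ext hh.1 hh.2)
    simp only [slotUpd, if_neg hp']
  have h1 : slotUpd i α (τ i α) τ = τ := by
    funext i' α'
    simp only [slotUpd]
    split_ifs with hh
    · rw [hh.1, hh.2]
    · rfl
  have h2 : ∀ b, (∏ p ∈ (Finset.univ : Finset (Fin s × Bool)).erase (i, α), τ p.1 p.2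
      (slotUpd i α b v p.1 p.2) (slotUpd i α b v' p.1 p.2)) =
      ∏ p ∈ (Finset.univ : Finset (Fin s × Bool)).erase (i, α), τ p.1 p.2 (v p.1 p.2)
        (v' p.1 p.2) := by
    intro b
    refine Finset.prod_congr rfl fun p hp => ?_
    have hp' : ¬(p.1 = i ∧ p.2 = α) := fun hh => Finset.ne_of_mem_erase hp (Prod.ext hh.1 hh.2)
    simp only [slotUpd, if_neg hp']
  rw [h, Matrix.trace, Finset.sum_mul]
  refine Finset.sum_congr rfl fun b _ => ?_
  conv_lhs => rw [← h1, h, slotUpd_self, slotUpd_self, h2]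
  rw [Matrix.diag_apply]
  ring

end

/-! ## Reduction to the encryption scheme -/

section

/-- The keys, with the public key in a slot replaced. -/
def mixKeys {s : ℕ} {X Y : Type} (e : Fin s → Bool → Bool) (pk : X) (kk : Fin s → Bool → X × Y) :
    Fin s → Bool → X × Y := fun i α => (slotMux e (fun _ _ => pk) (fun i α => (kk i α).1) i α,
      (kk i α).2)

/-- The labels that are encrypted when the slots below a given one have been treated. -/
abbrev mixLabels {s μ k : ℕ} (e : Fin s → Bool → Bool) (w : (Bool × BV s) × BV μ)
    (L : Fin s → Bool → BV k) : Fin s → Bool → BV k := slotMux (below e) (hide w L) L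

variable {s μ N l r₂ r₃ : Polynomial ℕ} (G : Garbling s N l) (P : PKE G.labLen)

/-- What the reduction remembers. -/
abbrev Hist (μ : Polynomial ℕ) (n : ℕ) :=
  ((((Fin (s.eval n) → Bool → Bool) × P.Keys s n) × Choice s μ n) ×
    (Fin (s.eval n) → Bool → BV (G.labLen.eval n))) ×
  (BV (G.vkLen.eval n) × (Fin (s.eval n) → Bool → BV (P.vkLen.eval n)))

variable (K : ∀ n, Kernel Unit (Fin (s.eval n) → Bool → Bool))
  (front : ∀ n, Instr (P.Keys s n) Unit (Choice s μ n) (BV (r₂.eval n)))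
  (delete : ∀ n, Instr Unit
    (BV (r₂.eval n) × BV (G.gcLen.eval n) × (Fin (s.eval n) → Bool → BV (P.ctLen.eval n)))
    (BV (G.certLen.eval n) × (Fin (s.eval n) → Bool → BV (P.certLen.eval n))) (BV (r₃.eval n)))
  (T : ∀ n, Choice s μ n → (Fin (s.eval n) → Bool → BV (G.labLen.eval n)) →
      BV (G.vkLen.eval n) → Op (BV (G.gcLen.eval n)))

/-- The first stage of the reduction. -/
def pkeChoose (n : ℕ) : Instr (BV (P.pkLen.eval n)) Unit
    (BV (G.labLen.eval n) × BV (G.labLen.eval n))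
    (Hist G P μ n × (BV (r₂.eval n) × BV (G.gcLen.eval n) ×
      (Fin (s.eval n) → Bool → BV (P.ctLen.eval n)))) :=
  Instr.store (fun pk h ρ => ((G.setup n () h.1.2 : ℂ) •
      front n (mixKeys h.1.1.1.1 pk h.1.1.1.2) h.1.1.2 ((P.keys s n h.1.1.1.2 : ℂ) •
        ρ () () • (K n () h.1.1.1.1 : ℂ) • (1 : Op Unit))) ⊗ₖ
      (T n h.1.1.2 h.1.2 h.2.1 ⊗ₖ encs G P n (mixKeys h.1.1.1.1 pk h.1.1.1.2)
        (mixLabels h.1.1.1.1 h.1.1.2 h.1.2) h.2.2))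
    fun p => (selSum p.2.1.1.1.1 p.2.1.2, selSum p.2.1.1.1.1 (hide p.2.1.1.2 p.2.1.2))

/-- The second stage of the reduction, before the results are stored. -/
def pkeRun (n : ℕ) : Instr Unit
    ((Hist G P μ n × (BV (r₂.eval n) × BV (G.gcLen.eval n) ×
      (Fin (s.eval n) → Bool → BV (P.ctLen.eval n)))) × BV (P.ctLen.eval n))
    (Hist G P μ n × (BV (G.certLen.eval n) × (Fin (s.eval n) → Bool → BV (P.certLen.eval n))))
    (BV (r₃.eval n)) := fun _ y ρ =>
  delete n () y.2 (Matrix.of fun b b' => ∑ c,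
    ρ ((y.1, (b.1, (b.2.1, (slotSwap y.1.1.1.1.1 (b.2.2, c)).1))), (slotSwap y.1.1.1.1.1 (b.2.2, c)).2)
      ((y.1, (b'.1, (b'.2.1, (slotSwap y.1.1.1.1.1 (b'.2.2, c)).1))),
        (slotSwap y.1.1.1.1.1 (b'.2.2, c)).2))

variable {G P K front delete T}

theorem Easy.mixKeys {R X Y : ℕ → Type} [∀ n, BitRep (R n)] [∀ n, BitRep (X n)]
    [∀ n, BitRep (Y n)] [PTLen R] [PTLen X] [PTLen Y] [∀ n, Fintype (R n)] [∀ n, Fintype (X n)]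
    [∀ n, Fintype (Y n)] {e : ∀ n, R n → Fin (s.eval n) → Bool → Bool} {pk : ∀ n, R n → X n}
    {kk : ∀ n, R n → Fin (s.eval n) → Bool → X n × Y n} (he : Easy e) (hp : Easy pk)
    (hk : Easy kk) : Easy fun n r => CertFE.mixKeys (e n r) (pk n r) (kk n r) := by
  have h := (Easy.slotMux he (hp.bcast s) hk.fsts).zip hk.snds
  exact h

theorem pkeChoose_qpt (hK : QPTKernel K) (hf : QPT front)
    (hT : QPTPrep (X := fun n => Choice s μ n × (Fin (s.eval n) → Bool → BV (G.labLen.eval n)))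
      fun n p vk => T n p.1 p.2 vk) : QPT (pkeChoose G P K front T) := by
  have h1 := QPT.precomp hK (Z := fun n => BV (P.pkLen.eval n)) (g := fun _ _ => ())
    Wire.unit.easy
  have h2 := h1.andKernel (P.keys_qpt s) (g := fun _ _ => ()) Wire.unit.easy
  have g3 : Easy (S := fun n => BV (P.pkLen.eval n) × ((Fin (s.eval n) → Bool → Bool) ×
      P.Keys s n)) fun n p => CertFE.mixKeys p.2.1 p.1 p.2.2 :=
    Easy.mixKeys Easy.id.snd.fst Easy.id.fst Easy.id.snd.snd
  have h3 := h2.andThen hf g3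
  have h4 := h3.andKernel G.setup_qpt (g := fun _ _ => ()) Wire.unit.easy
  have g5 : Easy (S := fun n => (BV (P.pkLen.eval n) × ((((Fin (s.eval n) → Bool → Bool) ×
      P.Keys s n) × Choice s μ n) × (Fin (s.eval n) → Bool → BV (G.labLen.eval n)))) ×
      BV (G.vkLen.eval n)) fun n p => (CertFE.mixKeys p.1.2.1.1.1 p.1.1 p.1.2.1.1.2,
        mixLabels p.1.2.1.1.1 p.1.2.1.2 p.1.2.2) :=
    (Easy.mixKeys Easy.id.fst.snd.fst.fst.fst Easy.id.fst.fst Easy.id.fst.snd.fst.fst.snd).pair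
      (Easy.slotMux (Easy.below Easy.id.fst.snd.fst.fst.fst)
        (Easy.slotMask (Easy.opened Easy.id.fst.snd.fst.snd.fst.fst Easy.id.fst.snd.fst.snd.fst.snd)
          Easy.id.fst.snd.snd) Easy.id.fst.snd.snd)
  have h5 := (hT.precomp (Z := fun n => BV (P.pkLen.eval n) × ((((Fin (s.eval n) → Bool → Bool) ×
      P.Keys s n) × Choice s μ n) × (Fin (s.eval n) → Bool → BV (G.labLen.eval n))))
      (g := fun n p => (p.2.1.2, p.2.2)) (Easy.id.snd.fst.snd.pair Easy.id.snd.snd)).andPrep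
      (encs_qpt G P) g5
  have h6 := h4.andPrep h5 (g := fun n p => p) Easy.id
  have g7 : Easy (S := fun n => BV (P.pkLen.eval n) × Hist G P μ n)
      fun n p => (selSum p.2.1.1.1.1 p.2.1.2, selSum p.2.1.1.1.1 (hide p.2.1.1.2 p.2.1.2)) :=
    (Easy.selSum Easy.id.snd.fst.fst.fst.fst Easy.id.snd.fst.snd).pair
      (Easy.selSum Easy.id.snd.fst.fst.fst.fst (Easy.slotMask (Easy.opened
        Easy.id.snd.fst.fst.snd.fst.fst Easy.id.snd.fst.fst.snd.fst.snd) Easy.id.snd.fst.snd))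
  have h7 := h6.store g7
  exact h7

theorem pkeRun_qpt (hd : QPT delete) : QPT (pkeRun G P delete (μ := μ)) := by
  let e : ∀ n, Unit → (Hist G P μ n × (BV (r₂.eval n) × BV (G.gcLen.eval n) ×
      (Fin (s.eval n) → Bool → BV (P.ctLen.eval n)))) × BV (P.ctLen.eval n) ≃
      (Hist G P μ n × (BV (r₂.eval n) × BV (G.gcLen.eval n) ×
      (Fin (s.eval n) → Bool → BV (P.ctLen.eval n)))) × BV (P.ctLen.eval n) := fun n _ =>
    ⟨fun a => ((a.1.1, (a.1.2.1, (a.1.2.2.1, (slotSwap a.1.1.1.1.1.1 (a.1.2.2.2, a.2)).1))),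
      (slotSwap a.1.1.1.1.1.1 (a.1.2.2.2, a.2)).2),
     fun a => ((a.1.1, (a.1.2.1, (a.1.2.2.1, (slotSwap a.1.1.1.1.1.1 (a.1.2.2.2, a.2)).1))),
      (slotSwap a.1.1.1.1.1.1 (a.1.2.2.2, a.2)).2), fun a => by
        simp only [Prod.mk.eta, slotSwap_slotSwap], fun a => by
        simp only [Prod.mk.eta, slotSwap_slotSwap]⟩
  have he : EIf fun n (p : Unit × _) => (p.1, e n p.1 p.2) := by
    have h1 : EIf fun n (p : Unit × (Hist G P μ n × (BV (r₂.eval n) × BV (G.gcLen.eval n) ×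
      (Fin (s.eval n) → Bool → BV (P.ctLen.eval n)))) × BV (P.ctLen.eval n)) =>
      ((p.1, (p.2.1.1, (p.2.1.2.1, p.2.1.2.2.1))), (p.2.1.2.2.2, p.2.2)) :=
      .of_wire (u := fun n p => (p.1.1, ((p.1.2.1, (p.1.2.2.1, (p.1.2.2.2, p.2.1))), p.2.2)))
        (.pair (.pair Wire.id.fst (.pair Wire.id.snd.fst.fst (.pair Wire.id.snd.fst.snd.fst
          Wire.id.snd.fst.snd.snd.fst))) (.pair Wire.id.snd.fst.snd.snd.snd Wire.id.snd.snd))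
        (.pair Wire.id.fst.fst (.pair (.pair Wire.id.fst.snd.fst (.pair Wire.id.fst.snd.snd.fst
          (.pair Wire.id.fst.snd.snd.snd Wire.id.snd.fst))) Wire.id.snd.snd)) fun _ _ => rfl
    have h2 := EIf.slotSwap (s := s) (k := P.ctLen) (S := fun n => Unit × Hist G P μ n ×
      BV (r₂.eval n) × BV (G.gcLen.eval n)) (e := fun n p => p.2.1.1.1.1.1)
      Wire.id.snd.fst.fst.fst.fst.fst
    have h3 : EIf fun n (p : (Unit × Hist G P μ n ×
      BV (r₂.eval n) × BV (G.gcLen.eval n)) × ((Fin (s.eval n) → Bool → BV (P.ctLen.eval n)) ×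
        BV (P.ctLen.eval n))) =>
        (p.1.1, ((p.1.2.1, (p.1.2.2.1, (p.1.2.2.2, p.2.1))), p.2.2)) :=
      .of_wire (u := fun n p => ((p.1, (p.2.1.1, (p.2.1.2.1, p.2.1.2.2.1))), (p.2.1.2.2.2, p.2.2)))
        (.pair Wire.id.fst.fst (.pair (.pair Wire.id.fst.snd.fst (.pair Wire.id.fst.snd.snd.fst
          (.pair Wire.id.fst.snd.snd.snd Wire.id.snd.fst))) Wire.id.snd.snd))
        (.pair (.pair Wire.id.fst (.pair Wire.id.snd.fst.fst (.pair Wire.id.snd.fst.snd.fst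
          Wire.id.snd.fst.snd.snd.fst))) (.pair Wire.id.snd.fst.snd.snd.snd Wire.id.snd.snd))
        fun _ _ => rfl
    have h4 := h3.comp (h2.comp h1)
    exact h4
  have h1 := QPT.of_equiv e he
  have h2 := h1.andThen hd (g := fun _ _ => ()) Wire.unit.easy
  exact h2

end

/-! ### The experiment of the encryption reduction -/

section

/-- Exchanging a slot with a separate register, which is then discarded. -/
def swapIn {s k : ℕ} (e : Fin s → Bool → Bool) (τ : Op (Fin s → Bool → BV k)) (σ : Op (BV k)) :
    Op (Fin s → Bool → BV k) := Matrix.of fun v v' => ∑ c,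
  τ (slotSwap e (v, c)).1 (slotSwap e (v', c)).1 * σ (slotSwap e (v, c)).2 (slotSwap e (v', c)).2

/-- For a correct guess the challenge ciphertext simply replaces the ciphertext that the reduction
had prepared there. The trace of the latter remains as a factor and later sums to one over its
verification keys. -/
theorem swapIn_oneHot {s k : ℕ} (i : Fin s) (α : Bool) (τ : Fin s → Bool → Op (BV k))
    (σ : Op (BV k)) : swapIn (oneHot i α) (tensorFam τ) σ =
      (τ i α).trace • tensorFam (slotUpd i α σ τ) := by
  ext v v'
  simp only [swapIn, Matrix.of_apply, slotSwap_oneHot, Matrix.smul_apply, smul_eq_mul]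
  exact tensorFam_slotUpd τ σ v v'

variable {s μ N l r₂ r₃ : Polynomial ℕ} {G : Garbling s N l} {P : PKE G.labLen}
  {K : ∀ n, Kernel Unit (Fin (s.eval n) → Bool → Bool)}
  {front : ∀ n, Instr (P.Keys s n) Unit (Choice s μ n) (BV (r₂.eval n))}
  {delete : ∀ n, Instr Unit
    (BV (r₂.eval n) × BV (G.gcLen.eval n) × (Fin (s.eval n) → Bool → BV (P.ctLen.eval n)))
    (BV (G.certLen.eval n) × (Fin (s.eval n) → Bool → BV (P.certLen.eval n))) (BV (r₃.eval n))}
  {E : ∀ n, (Fin (s.eval n) → Bool → BV (P.skLen.eval n)) → Op (BV (r₃.eval n))}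
  {T : ∀ n, Choice s μ n → (Fin (s.eval n) → Bool → BV (G.labLen.eval n)) →
      BV (G.vkLen.eval n) → Op (BV (G.gcLen.eval n))}

/-- Both stages together, with the stored history read back. No property of the guess is used:
useless guesses are discarded only by `pkeWeight` in the final effect. -/
theorem pkeRun_pkeChoose (hf : QPT front) (hd : QPT delete) (n : ℕ) (pk : BV (P.pkLen.eval n))
    (z : BV (G.labLen.eval n) × BV (G.labLen.eval n)) (σ : Op (BV (P.ctLen.eval n)))
    (y : Hist G P μ n × (BV (G.certLen.eval n) × (Fin (s.eval n) → Bool → BV (P.certLen.eval n))))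
    [Decidable ((selSum y.1.1.1.1.1 y.1.1.2, selSum y.1.1.1.1.1 (hide y.1.1.1.2 y.1.1.2)) = z)] :
    pkeRun G P delete n () y (pkeChoose G P K front T n pk z 1 ⊗ₖ σ) =
      (if (selSum y.1.1.1.1.1 y.1.1.2, selSum y.1.1.1.1.1 (hide y.1.1.1.2 y.1.1.2)) = z then
        ((G.setup n () y.1.1.2 * (P.keys s n y.1.1.1.1.2 * K n () y.1.1.1.1.1) : ℝ) : ℂ) else 0) •
      delete n () y.2 (front n (mixKeys y.1.1.1.1.1 pk y.1.1.1.1.2) y.1.1.1.2 1 ⊗ₖ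
        (T n y.1.1.1.2 y.1.1.2 y.1.2.1 ⊗ₖ swapIn y.1.1.1.1.1
          (encs G P n (mixKeys y.1.1.1.1.1 pk y.1.1.1.1.2)
            (mixLabels y.1.1.1.1.1 y.1.1.1.2 y.1.1.2) y.1.2.2) σ)) := by
  simp only [pkeRun]
  rw [← hd.map_smul]
  congr 1
  ext b b'
  simp only [pkeChoose, Instr.store, Matrix.of_apply, Matrix.kroneckerMap_apply, Matrix.smul_apply,
    hf.map_smul, smul_eq_mul, true_and, Matrix.one_apply_eq, one_smul, swapIn, Finset.mul_sum]
  refine Finset.sum_congr rfl fun c _ => ?_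
  split_ifs with h
  · push_cast
    ring
  · ring

/-- Whether the reduction's guess is usable, together with the verification in the other slots. -/
def pkeWeight (n : ℕ) (y : Hist G P μ n ×
    (BV (G.certLen.eval n) × (Fin (s.eval n) → Bool → BV (P.certLen.eval n)))) : ℝ :=
  open Classical in
  if ∃ i α, y.1.1.1.1.1 = oneHot i α then
    (if ∃ i α, y.1.1.1.1.1 i α = true ∧ opened y.1.1.1.2.1.1 y.1.1.1.2.1.2 i α = true then 0 else 1) *
      (G.vrfy n (y.1.2.1, y.2.1) true * ∏ i, ∏ α, if y.1.1.1.1.1 i α then 1 else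
        P.vrfy n (y.1.2.2 i α, y.2.2 i α) true)
  else 0

theorem pkeWeight_nonneg (n : ℕ) (y : Hist G P μ n ×
    (BV (G.certLen.eval n) × (Fin (s.eval n) → Bool → BV (P.certLen.eval n)))) :
    0 ≤ pkeWeight n y := by
  have h1 := G.vrfy_qpt.nonneg n (y.1.2.1, y.2.1) true
  have h2 : 0 ≤ ∏ i, ∏ α, if y.1.1.1.1.1 i α then 1 else P.vrfy n (y.1.2.2 i α, y.2.2 i α) true :=
    Finset.prod_nonneg fun i _ => Finset.prod_nonneg fun α _ => by
      split_ifs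
      · exact zero_le_one
      · exact P.vrfy_qpt.nonneg _ _ _
  have h3 := mul_nonneg h1 h2
  unfold pkeWeight
  split_ifs
  · rw [zero_mul]
  · rwa [one_mul]
  · exact le_rfl

theorem pkeWeight_le_one (n : ℕ) (y : Hist G P μ n ×
    (BV (G.certLen.eval n) × (Fin (s.eval n) → Bool → BV (P.certLen.eval n)))) :
    pkeWeight n y ≤ 1 := by
  have h2 : 0 ≤ ∏ i, ∏ α, if y.1.1.1.1.1 i α then 1 else P.vrfy n (y.1.2.2 i α, y.2.2 i α) true :=
    Finset.prod_nonneg fun i _ => Finset.prod_nonneg fun α _ => by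
      split_ifs
      · exact zero_le_one
      · exact P.vrfy_qpt.nonneg _ _ _
  have h4 : (∏ i, ∏ α, if y.1.1.1.1.1 i α then 1 else P.vrfy n (y.1.2.2 i α, y.2.2 i α) true) ≤ 1 := by
    refine Finset.prod_le_one (fun i _ => Finset.prod_nonneg fun α _ => ?_) fun i _ =>
      Finset.prod_le_one (fun α _ => ?_) fun α _ => ?_
    · split_ifs
      · exact zero_le_one
      · exact P.vrfy_qpt.nonneg _ _ _
    · split_ifs
      · exact zero_le_one
      · exact P.vrfy_qpt.nonneg _ _ _
    · split_ifs
      · exact le_rfl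
      · exact P.vrfy_qpt.le_one _ _ _
  have h3 := mul_le_one₀ (G.vrfy_qpt.le_one n (y.1.2.1, y.2.1) true) h2 h4
  unfold pkeWeight
  split_ifs
  · rw [zero_mul]
    exact zero_le_one
  · rwa [one_mul]
  · exact zero_le_one

/-- The effect of the reduction. -/
def pkeEff (E : ∀ n, (Fin (s.eval n) → Bool → BV (P.skLen.eval n)) → Op (BV (r₃.eval n))) (n : ℕ)
    (sk : BV (P.skLen.eval n)) :
    Op ((Hist G P μ n × (BV (G.certLen.eval n) × (Fin (s.eval n) → Bool →
      BV (P.certLen.eval n)))) × BV (r₃.eval n)) :=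
  blockEff fun y => (pkeWeight n y : ℂ) • E n
    (slotMux y.1.1.1.1.1 (fun _ _ => sk) fun i α => (y.1.1.1.1.2 i α).2)

theorem pkeEff_isEffect (hE : ∀ n sk, IsEffect (E n sk)) (n : ℕ) (sk : BV (P.skLen.eval n)) :
    IsEffect (pkeEff (G := G) (μ := μ) E n sk) :=
  blockEff_isEffect fun y => (hE _ _).smul (pkeWeight_nonneg n y) (pkeWeight_le_one n y)

theorem pkeGame_negligible (hP : P.CertEverINDCPA) (hK : QPTKernel K) (hf : QPT front)
    (hd : QPT delete) (hE : ∀ n sk, IsEffect (E n sk))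
    (hT : QPTPrep (X := fun n => Choice s μ n × (Fin (s.eval n) → Bool → BV (G.labLen.eval n)))
      fun n p vk => T n p.1 p.2 vk) :
    Negligible fun n => |P.game (pkeChoose G P K front T)
        (fun n => (pkeRun G P delete n).store fun p => selSum p.2.1.1.1.1.1 p.2.2.2) (pkeEff E) false n -
      P.game (pkeChoose G P K front T)
        (fun n => (pkeRun G P delete n).store fun p => selSum p.2.1.1.1.1.1 p.2.2.2) (pkeEff E) true n| := by
  have hg : Easy (S := fun n => Unit × Hist G P μ n × (BV (G.certLen.eval n) ×
      (Fin (s.eval n) → Bool → BV (P.certLen.eval n)))) fun n p =>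
        selSum p.2.1.1.1.1.1 p.2.2.2 :=
    Easy.selSum Easy.id.snd.fst.fst.fst.fst.fst Easy.id.snd.snd.snd
  exact P.game_negligible hP (pkeChoose_qpt hK hf hT) ((pkeRun_qpt hd).store hg)
    fun n sk => pkeEff_isEffect hE n sk

/-- The value of the experiment of the reduction, for given keys, verification key and results. -/
def pkeTerm (K : ∀ n, Kernel Unit (Fin (s.eval n) → Bool → Bool))
    (front : ∀ n, Instr (P.Keys s n) Unit (Choice s μ n) (BV (r₂.eval n)))
    (delete : ∀ n, Instr Unit
    (BV (r₂.eval n) × BV (G.gcLen.eval n) × (Fin (s.eval n) → Bool → BV (P.ctLen.eval n)))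
    (BV (G.certLen.eval n) × (Fin (s.eval n) → Bool → BV (P.certLen.eval n))) (BV (r₃.eval n)))
    (E : ∀ n, (Fin (s.eval n) → Bool → BV (P.skLen.eval n)) → Op (BV (r₃.eval n)))
    (T : ∀ n, Choice s μ n → (Fin (s.eval n) → Bool → BV (G.labLen.eval n)) →
      BV (G.vkLen.eval n) → Op (BV (G.gcLen.eval n))) (b : Bool) (n : ℕ)
    (pk : BV (P.pkLen.eval n)) (sk : BV (P.skLen.eval n)) (vk : BV (P.vkLen.eval n))
    (y : Hist G P μ n × (BV (G.certLen.eval n) × (Fin (s.eval n) → Bool → BV (P.certLen.eval n)))) :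
    ℝ :=
  P.keyGen n () (pk, sk) * P.vrfy n (vk, selSum y.1.1.1.1.1 y.2.2) true *
    (pkeWeight n y * (G.setup n () y.1.1.2 * (P.keys s n y.1.1.1.1.2 * K n () y.1.1.1.1.1)) *
      (E n (slotMux y.1.1.1.1.1 (fun _ _ => sk) fun i α => (y.1.1.1.1.2 i α).2) *
        delete n () y.2 (front n (mixKeys y.1.1.1.1.1 pk y.1.1.1.1.2) y.1.1.1.2 1 ⊗ₖ
        (T n y.1.1.1.2 y.1.1.2 y.1.2.1 ⊗ₖ swapIn y.1.1.1.1.1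
          (encs G P n (mixKeys y.1.1.1.1.1 pk y.1.1.1.1.2)
            (mixLabels y.1.1.1.1.1 y.1.1.1.2 y.1.1.2) y.1.2.2)
          (P.enc n (pk, if b then selSum y.1.1.1.1.1 (hide y.1.1.1.2 y.1.1.2) else
            selSum y.1.1.1.1.1 y.1.1.2) vk)))).trace.re)

/-- The two challenge plaintexts and the certificate of the guessed slot are functions of the stored
history, so the sums over them collapse. -/
theorem pkeGame_eq (hf : QPT front) (hd : QPT delete) (b : Bool) (n : ℕ) :
    P.game (pkeChoose G P K front T)
        (fun n => (pkeRun G P delete n).store fun p => selSum p.2.1.1.1.1.1 p.2.2.2) (pkeEff E) b n =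
      ∑ pk, ∑ sk, ∑ y, ∑ vk, pkeTerm K front delete E T b n pk sk vk y := by
  classical
  rw [PKE.game]
  refine Finset.sum_congr rfl fun pk _ => Finset.sum_congr rfl fun sk _ => ?_
  have h1 := sum_collapse (I := Unit) (fun y : Hist G P μ n × (BV (G.certLen.eval n) ×
      (Fin (s.eval n) → Bool → BV (P.certLen.eval n))) =>
      (selSum y.1.1.1.1.1 y.1.1.2, selSum y.1.1.1.1.1 (hide y.1.1.1.2 y.1.1.2)))
    (fun y => selSum y.1.1.1.1.1 y.2.2)
    fun y z _ vk => P.keyGen n () (pk, sk) * P.vrfy n (vk, selSum y.1.1.1.1.1 y.2.2) true *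
    (pkeWeight n y * (G.setup n () y.1.1.2 * (P.keys s n y.1.1.1.1.2 * K n () y.1.1.1.1.1)) *
      (E n (slotMux y.1.1.1.1.1 (fun _ _ => sk) fun i α => (y.1.1.1.1.2 i α).2) *
        delete n () y.2 (front n (mixKeys y.1.1.1.1.1 pk y.1.1.1.1.2) y.1.1.1.2 1 ⊗ₖ
        (T n y.1.1.1.2 y.1.1.2 y.1.2.1 ⊗ₖ swapIn y.1.1.1.1.1
          (encs G P n (mixKeys y.1.1.1.1.1 pk y.1.1.1.1.2)
            (mixLabels y.1.1.1.1.1 y.1.1.1.2 y.1.1.2) y.1.2.2)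
          (P.enc n (pk, if b then z.2 else z.1) vk)))).trace.re)
  simp only [Finset.univ_unique, Finset.sum_singleton] at h1
  refine Eq.trans ?_ h1
  rw [Fintype.sum_prod_type]
  refine Finset.sum_congr rfl fun m₀ _ => Finset.sum_congr rfl fun m₁ _ =>
    Finset.sum_congr rfl fun vk _ => Finset.sum_congr rfl fun cert _ => ?_
  rw [pkeEff, trace_blockEff_store, Complex.re_sum, Finset.mul_sum]
  refine Finset.sum_congr rfl fun y _ => ?_
  by_cases h2 : selSum y.1.1.1.1.1 y.2.2 = cert
  · subst h2
    rw [if_pos rfl, if_pos rfl, pkeRun_pkeChoose hf hd]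
    by_cases h3 : (selSum y.1.1.1.1.1 y.1.1.2, selSum y.1.1.1.1.1 (hide y.1.1.1.2 y.1.1.2)) = (m₀, m₁)
    · rw [if_pos h3, if_pos h3, Matrix.smul_mul, Matrix.mul_smul, smul_smul, Matrix.trace_smul,
        ← Complex.ofReal_mul, smul_eq_mul, Complex.re_ofReal_mul]
    · rw [if_neg h3, if_neg h3, zero_smul, mul_zero, Matrix.trace_zero, Complex.zero_re, mul_zero]
  · rw [if_neg h2, if_neg h2, Complex.zero_re, mul_zero]

end

/-! ### The reduction as a sum of neighbouring hybrids -/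

section

theorem sum_reorder₁ {E K W L VG VP C PK SK V : Type} [Fintype E] [Fintype K] [Fintype W]
    [Fintype L] [Fintype VG] [Fintype VP] [Fintype C] [Fintype PK] [Fintype SK] [Fintype V]
    (F : PK → SK → (((((E × K) × W) × L) × (VG × VP)) × C) → V → ℝ) :
    ∑ pk, ∑ sk, ∑ y, ∑ v, F pk sk y v = ∑ e, ∑ q : W × L × VG × C, ∑ kk, ∑ k : PK × SK, ∑ vP, ∑ v,
      F k.1 k.2 (((((e, kk), q.1), q.2.1), (q.2.2.1, vP)), q.2.2.2) v := by
  simp only [← Fintype.sum_prod_type']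
  exact Fintype.sum_equiv ⟨fun p => (p.2.2.1.1.1.1.1.1, (p.2.2.1.1.1.1.2, p.2.2.1.1.1.2,
      p.2.2.1.1.2.1, p.2.2.1.2), p.2.2.1.1.1.1.1.2, (p.1, p.2.1), p.2.2.1.1.2.2, p.2.2.2),
    fun p => (p.2.2.2.1.1, p.2.2.2.1.2, (((((p.1, p.2.2.1), p.2.1.1), p.2.1.2.1),
      (p.2.1.2.2.1, p.2.2.2.2.1)), p.2.1.2.2.2), p.2.2.2.2.2), fun _ => rfl, fun _ => rfl⟩ _ _
      fun _ => rfl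

theorem sum_reorder₂ {K W L VG VP C : Type} [Fintype K] [Fintype W]
    [Fintype L] [Fintype VG] [Fintype VP] [Fintype C] (F : (((K × W) × VP) × C) → L → VG → ℝ) :
    ∑ y, ∑ L, ∑ v, F y L v = ∑ q : W × L × VG × C, ∑ kk, ∑ vP,
      F (((kk, q.1), vP), q.2.2.2) q.2.1 q.2.2.1 := by
  simp only [← Fintype.sum_prod_type']
  exact Fintype.sum_equiv ⟨fun p => ((p.1.1.1.2, p.2.1, p.2.2, p.1.2), p.1.1.1.1, p.1.1.2),
    fun p => ((((p.2.1, p.1.1), p.2.2), p.1.2.2.2), p.1.2.1, p.1.2.2.1), fun _ => rfl,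
      fun _ => rfl⟩ _ _ fun _ => rfl

variable {s μ N l r₂ r₃ : Polynomial ℕ} {G : Garbling s N l} {P : PKE G.labLen}
  {K : ∀ n, Kernel Unit (Fin (s.eval n) → Bool → Bool)}
  {front : ∀ n, Instr (P.Keys s n) Unit (Choice s μ n) (BV (r₂.eval n))}
  {delete : ∀ n, Instr Unit
    (BV (r₂.eval n) × BV (G.gcLen.eval n) × (Fin (s.eval n) → Bool → BV (P.ctLen.eval n)))
    (BV (G.certLen.eval n) × (Fin (s.eval n) → Bool → BV (P.certLen.eval n))) (BV (r₃.eval n))}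
  {E : ∀ n, (Fin (s.eval n) → Bool → BV (P.skLen.eval n)) → Op (BV (r₃.eval n))}
  {T : ∀ n, Choice s μ n → (Fin (s.eval n) → Bool → BV (G.labLen.eval n)) →
      BV (G.vkLen.eval n) → Op (BV (G.gcLen.eval n))}

/-- The complex weight with which the last adversary accepts, including the probability of the
keys and of the verification of the ciphertexts. -/
def hterm (front : ∀ n, Instr (P.Keys s n) Unit (Choice s μ n) (BV (r₂.eval n)))
    (delete : ∀ n, Instr Unit
    (BV (r₂.eval n) × BV (G.gcLen.eval n) × (Fin (s.eval n) → Bool → BV (P.ctLen.eval n)))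
    (BV (G.certLen.eval n) × (Fin (s.eval n) → Bool → BV (P.certLen.eval n))) (BV (r₃.eval n)))
    (E : ∀ n, (Fin (s.eval n) → Bool → BV (P.skLen.eval n)) → Op (BV (r₃.eval n)))
    (T : ∀ n, Choice s μ n → (Fin (s.eval n) → Bool → BV (G.labLen.eval n)) →
      BV (G.vkLen.eval n) → Op (BV (G.gcLen.eval n))) (n : ℕ)
    (Λ : Choice s μ n → (Fin (s.eval n) → Bool → BV (G.labLen.eval n)) →
      Fin (s.eval n) → Bool → BV (G.labLen.eval n))
    (q : Choice s μ n × (Fin (s.eval n) → Bool → BV (G.labLen.eval n)) × BV (G.vkLen.eval n) ×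
      (BV (G.certLen.eval n) × (Fin (s.eval n) → Bool → BV (P.certLen.eval n))))
    (kk : P.Keys s n) (vP : Fin (s.eval n) → Bool → BV (P.vkLen.eval n)) : ℂ :=
  ((P.keys s n kk * vrfys G P n vP q.2.2.2.2 : ℝ) : ℂ) *
    (E n (fun i α => (kk i α).2) * delete n () q.2.2.2 (front n kk q.1 1 ⊗ₖ
      (T n q.1 q.2.1 q.2.2.1 ⊗ₖ encs G P n kk (Λ q.1 q.2.1) vP))).trace

theorem hyb_eq_hterm (c : ∀ n, Choice s μ n → ℝ)
    (Λ : ∀ n, Choice s μ n → (Fin (s.eval n) → Bool → BV (G.labLen.eval n)) →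
      Fin (s.eval n) → Bool → BV (G.labLen.eval n)) (n : ℕ) :
    hyb G P front delete E c T Λ n = ∑ q, G.setup n () q.2.1 * G.vrfy n (q.2.2.1, q.2.2.2.1) true *
      c n q.1 * ∑ kk, ∑ vP, (hterm front delete E T n (Λ n) q kk vP).re := by
  rw [hyb, sum_reorder₂]
  refine Finset.sum_congr rfl fun q _ => ?_
  rw [Finset.mul_sum]
  refine Finset.sum_congr rfl fun kk _ => ?_
  rw [Finset.mul_sum]
  refine Finset.sum_congr rfl fun vP _ => ?_
  rw [hterm, Complex.re_ofReal_mul, final]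
  ring

/-- The labels that are encrypted when the first slots have been treated. -/
def partLabels (t : ℕ) {s μ k : ℕ} (w : (Bool × BV s) × BV μ) (L : Fin s → Bool → BV k) :
    Fin s → Bool → BV k := slotMux (fun i α => decide (slotNum i α < t)) (hide w L) L

/-- All slots before the guessed one are treated already. The challenge bit decides about the
guessed slot itself, so the two sides of the challenge are the hybrids `slotNum` and `slotNum + 1`.
-/
theorem slotUpd_mixLabels {s μ k : ℕ} (i : Fin s) (α : Bool) (w : (Bool × BV s) × BV μ)
    (L : Fin s → Bool → BV k) (b : Bool) :
    slotUpd i α (if b then selSum (oneHot i α) (hide w L) else selSum (oneHot i α) L)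
      (mixLabels (oneHot i α) w L) = partLabels (slotNum i α + b.toNat) w L := by
  rw [selSum_oneHot, selSum_oneHot, mixLabels, below_oneHot]
  funext i' α'
  simp only [slotUpd, partLabels, slotMux]
  by_cases h : i' = i ∧ α' = α
  · obtain ⟨rfl, rfl⟩ := h
    cases b <;> simp
  · rw [if_neg h]
    have h1 : slotNum i' α' ≠ slotNum i α := fun hh => h (slotNum_injective hh)
    have h2 : slotNum i' α' < slotNum i α ↔ slotNum i' α' < slotNum i α + b.toNat := by
      cases b
      · simp
      · simp only [Bool.toNat_true]
        omega
    simp only [h2]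

/-- The heart of the reduction. If the guessed slot is not opened, the adversary's first stages do
not depend on its secret key (`hloc`), so the pair with the challenge public key and the reduction's
useless secret key behaves like the genuine challenge pair. What results is the hybrid with the
slot's key pair and verification key resampled, times the weights of the discarded ones. -/
theorem pkeTerm_oneHot (hd : QPT delete)
    (hloc : ∀ n kk kk' w, (∀ i α, (kk i α).1 = (kk' i α).1) →
      (∀ i α, opened w.1.1 w.1.2 i α = true → kk i α = kk' i α) →
      front n kk w 1 = front n kk' w 1) (b : Bool) (n : ℕ) (i : Fin (s.eval n)) (α : Bool)
    (pk : BV (P.pkLen.eval n)) (sk : BV (P.skLen.eval n)) (vk : BV (P.vkLen.eval n))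
    (q : Choice s μ n × (Fin (s.eval n) → Bool → BV (G.labLen.eval n)) × BV (G.vkLen.eval n) ×
      (BV (G.certLen.eval n) × (Fin (s.eval n) → Bool → BV (P.certLen.eval n))))
    (kk : P.Keys s n) (vP : Fin (s.eval n) → Bool → BV (P.vkLen.eval n)) :
    pkeTerm K front delete E T b n pk sk vk
      (((((oneHot i α, kk), q.1), q.2.1), (q.2.2.1, vP)), q.2.2.2) =
    K n () (oneHot i α) * (G.setup n () q.2.1 * G.vrfy n (q.2.2.1, q.2.2.2.1) true *
      (if opened q.1.1.1 q.1.1.2 i α = true then 0 else 1)) *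
      (P.keyGen n () (kk i α) * ((P.enc n (pk, mixLabels (oneHot i α) q.1 q.2.1 i α) (vP i α)).trace *
        hterm front delete E T n (fun w L => partLabels (slotNum i α + b.toNat) w L) q
          (slotUpd i α (pk, sk) kk) (slotUpd i α vk vP)).re) := by
  have hex : ∃ i' α', oneHot i α = oneHot i' α' := ⟨i, α, rfl⟩
  have hop : (∃ i' α', oneHot i α i' α' = true ∧ opened q.1.1.1 q.1.1.2 i' α' = true) ↔
      opened q.1.1.1 q.1.1.2 i α = true := by
    constructor
    · rintro ⟨i', α', h, h'⟩
      simp only [oneHot, decide_eq_true_eq] at h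
      rwa [h.1, h.2] at h'
    · intro h
      exact ⟨i, α, by simp [oneHot], h⟩
  simp only [pkeTerm, pkeWeight, if_pos hex, hop]
  by_cases ho : opened q.1.1.1 q.1.1.2 i α = true
  · simp only [if_pos ho, zero_mul, mul_zero]
  simp only [if_neg ho]
  -- The challenge pair and the pair sampled for the slot exchange their roles; the joint
  -- probability is symmetric in them.
  have k1 : P.keyGen n () (pk, sk) * P.keys s n kk =
      P.keyGen n () (kk i α) * P.keys s n (slotUpd i α (pk, sk) kk) :=
    (prod_slotUpd (i := i) (α := α) (fun _ _ x => P.keyGen n () x) (pk, sk) kk).symm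
  -- The challenger verifies the guessed slot and the effect of the reduction verifies all the
  -- others; together this is the full verification.
  have k2 : P.vrfy n (vk, q.2.2.2.2 i α) true * (∏ i', ∏ α', if oneHot i α i' α' then 1 else
      P.vrfy n (vP i' α', q.2.2.2.2 i' α') true) = vrfys G P n (slotUpd i α vk vP) q.2.2.2.2 := by
    rw [vrfys, ← prod_oneHot (i := i) (α := α) fun i' α' => P.vrfy n (slotUpd i α vk vP i' α',
      q.2.2.2.2 i' α') true, slotUpd_self]
    congr 1
    refine Finset.prod_congr rfl fun i' _ => Finset.prod_congr rfl fun α' _ => ?_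
    by_cases h : oneHot i α i' α'
    · rw [if_pos h, if_pos h]
    · rw [if_neg h, if_neg h, slotUpd, if_neg]
      simpa [oneHot] using h
  have k3 : (slotMux (oneHot i α) (fun _ _ => sk) fun i α => (kk i α).2) =
      fun i' α' => (slotUpd i α (pk, sk) kk i' α').2 := by
    funext i' α'
    simp only [slotMux, oneHot, slotUpd, decide_eq_true_eq]
    split_ifs <;> rfl
  have k4 : ∀ i' α', (mixKeys (oneHot i α) pk kk i' α').1 = (slotUpd i α (pk, sk) kk i' α').1 := by
    intro i' α'
    simp only [mixKeys, slotMux, oneHot, slotUpd, decide_eq_true_eq]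
    split_ifs <;> rfl
  -- The two families of keys differ only in the secret key of the guessed slot, which is not
  -- opened.
  have k5 : front n (mixKeys (oneHot i α) pk kk) q.1 1 = front n (slotUpd i α (pk, sk) kk) q.1 1 := by
    refine hloc n _ _ _ k4 fun i' α' h => ?_
    have hn : ¬(i' = i ∧ α' = α) := by
      rintro ⟨rfl, rfl⟩
      exact ho h
    simp only [mixKeys, slotMux, oneHot, slotUpd, decide_eq_true_eq, if_neg hn]
  have k6 : swapIn (oneHot i α) (encs G P n (mixKeys (oneHot i α) pk kk)
      (mixLabels (oneHot i α) q.1 q.2.1) vP) (P.enc n (pk, if b then selSum (oneHot i α)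
        (hide q.1 q.2.1) else selSum (oneHot i α) q.2.1) vk) =
      (P.enc n (pk, mixLabels (oneHot i α) q.1 q.2.1 i α) (vP i α)).trace •
        encs G P n (slotUpd i α (pk, sk) kk) (partLabels (slotNum i α + b.toNat) q.1 q.2.1)
          (slotUpd i α vk vP) := by
    rw [encs, swapIn_oneHot, ← slotUpd_mixLabels, encs]
    congr 2
    · rw [k4, slotUpd_self]
    · funext i' α'
      by_cases h : i' = i ∧ α' = α
      · simp only [slotUpd, if_pos h]
      · have := k4 i' α'
        simp only [slotUpd, if_neg h] at this ⊢
        rw [this]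
  rw [k3, k5, k6, Matrix.kronecker_smul, Matrix.kronecker_smul, hd.map_smul, Matrix.mul_smul,
    Matrix.trace_smul, selSum_oneHot, hterm, smul_eq_mul]
  generalize (P.enc n (pk, mixLabels (oneHot i α) q.1 q.2.1 i α) (vP i α)).trace = Z
  generalize (E n _ * delete n () _ _).trace = R
  rw [mul_left_comm Z, Complex.re_ofReal_mul, ← k2]
  generalize (∏ i', ∏ α', if oneHot i α i' α' then 1 else
      P.vrfy n (vP i' α', q.2.2.2.2 i' α') true) = Q
  linear_combination (K n () (oneHot i α) * G.setup n () q.2.1 * G.vrfy n (q.2.2.1, q.2.2.2.1) true *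
    Q * P.vrfy n (vk, q.2.2.2.2 i α) true * (Z * R).re) * k1

theorem pkeTerm_eq_zero (b : Bool) (n : ℕ)
    (pk : BV (P.pkLen.eval n)) (sk : BV (P.skLen.eval n)) (vk : BV (P.vkLen.eval n))
    (y : Hist G P μ n × (BV (G.certLen.eval n) × (Fin (s.eval n) → Bool → BV (P.certLen.eval n))))
    (h : ¬∃ i α, y.1.1.1.1.1 = oneHot i α) : pkeTerm K front delete E T b n pk sk vk y = 0 := by
  simp only [pkeTerm, pkeWeight, if_neg h, zero_mul, mul_zero]

/-- The discarded key pair and the discarded verification key occur only through their own total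
probabilities, which are one. Resampling one slot of a product distribution leaves the distribution
unchanged. -/
theorem sum_pkeTerm (hd : QPT delete)
    (hloc : ∀ n kk kk' w, (∀ i α, (kk i α).1 = (kk' i α).1) →
      (∀ i α, opened w.1.1 w.1.2 i α = true → kk i α = kk' i α) →
      front n kk w 1 = front n kk' w 1) (b : Bool) (n : ℕ) :
    (∑ pk, ∑ sk, ∑ y, ∑ vk, pkeTerm K front delete E T b n pk sk vk y) =
      ∑ i, ∑ α, K n () (oneHot i α) * ∑ q, G.setup n () q.2.1 *
        G.vrfy n (q.2.2.1, q.2.2.2.1) true * (if opened q.1.1.1 q.1.1.2 i α = true then 0 else 1) *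
        ∑ kk, ∑ vP, (hterm front delete E T n
          (fun w L => partLabels (slotNum i α + b.toNat) w L) q kk vP).re := by
  classical
  rw [sum_reorder₁ fun pk sk y vk => pkeTerm K front delete E T b n pk sk vk y]
  -- Guesses that are not single slots carry weight zero.
  rw [sum_oneHot _ fun e he => Finset.sum_eq_zero fun q _ => Finset.sum_eq_zero fun kk _ =>
    Finset.sum_eq_zero fun k _ => Finset.sum_eq_zero fun vP _ => Finset.sum_eq_zero fun v _ =>
      pkeTerm_eq_zero b n _ _ _ _ he]
  refine Finset.sum_congr rfl fun i _ => Finset.sum_congr rfl fun α _ => ?_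
  rw [Finset.mul_sum]
  refine Finset.sum_congr rfl fun q _ => ?_
  -- The verification key that the reduction generated for the slot is summed out; the traces of its
  -- ciphertext states add up to one.
  have h1 : ∀ (kk : P.Keys s n) (pk : BV (P.pkLen.eval n)),
      ∑ vP, ∑ v, ((P.enc n (pk, mixLabels (oneHot i α) q.1 q.2.1 i α) (vP i α)).trace *
        hterm front delete E T n (fun w L => partLabels (slotNum i α + b.toNat) w L) q kk
          (slotUpd i α v vP)).re =
      ∑ vP, (hterm front delete E T n (fun w L => partLabels (slotNum i α + b.toNat) w L) q kk
        vP).re := by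
    intro kk pk
    simp only [← Complex.re_sum]
    rw [sum_slotUpd (i := i) (α := α) (fun v => (P.enc n (pk, mixLabels (oneHot i α) q.1 q.2.1 i α)
      v).trace) (hterm front delete E T n (fun w L => partLabels (slotNum i α + b.toNat) w L) q kk),
      P.enc_qpt.sum_trace, one_mul]
  -- In the same way the key pair sampled by the reduction for the guessed slot is summed out.
  have h2 := sum_slotUpd (i := i) (α := α) (P.keyGen n ()) fun kk => ∑ vP, (hterm front delete E T n
    (fun w L => partLabels (slotNum i α + b.toNat) w L) q kk vP).re
  rw [P.keyGen_qpt.sum_eq, one_mul] at h2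
  simp only [pkeTerm_oneHot hd hloc, ← Finset.mul_sum, h1]
  rw [← h2, mul_assoc]
  simp only [← Finset.mul_sum]

end

/-! ## Negligible functions -/

/-- For `n ≥ 1` the value is at most `q(1) * n ^ deg q`, and `n > q(1)` absorbs the constant into
one more power. -/
theorem Polynomial.eval_le_pow (q : Polynomial ℕ) : ∃ k n₀ : ℕ, ∀ n, n₀ < n → q.eval n ≤ n ^ k := by
  refine ⟨q.natDegree + 1, q.eval 1, fun n hn => ?_⟩
  have h1 : q.eval n ≤ q.eval 1 * n ^ q.natDegree := by
    rw [Polynomial.eval_eq_sum_range, Polynomial.eval_eq_sum_range, Finset.sum_mul]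
    refine Finset.sum_le_sum fun i hi => ?_
    rw [one_pow, mul_one]
    exact Nat.mul_le_mul_left _ (Nat.pow_le_pow_right (by omega)
      (Nat.lt_succ_iff.1 (Finset.mem_range.1 hi)))
  refine h1.trans ?_
  rw [pow_succ']
  exact Nat.mul_le_mul_right _ hn.le

theorem Polynomial.eval_pos_of_ne_zero {s : Polynomial ℕ} (hs : s ≠ 0) {n : ℕ} (hn : 0 < n) :
    0 < s.eval n := by
  rw [Polynomial.eval_eq_sum_range]
  refine (Nat.mul_pos (Nat.pos_of_ne_zero (Polynomial.leadingCoeff_ne_zero.2 hs))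
    (pow_pos hn s.natDegree)).trans_le ?_
  exact Finset.single_le_sum (f := fun i => s.coeff i * n ^ i) (fun _ _ => Nat.zero_le _)
    (Finset.mem_range.2 (Nat.lt_succ_self _))

/-- A polynomial factor is absorbed by asking for a correspondingly higher inverse power; this pays
for the guess of a slot. -/
theorem Negligible.of_le {f g : ℕ → ℝ} (hg : Negligible g) (q : Polynomial ℕ) (n₁ : ℕ)
    (h : ∀ n, n₁ < n → |f n| ≤ q.eval n * |g n|) : Negligible f := by
  intro c
  obtain ⟨k, n₀, hk⟩ := Polynomial.eval_le_pow q
  obtain ⟨n₂, h₂⟩ := hg (c + k)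
  refine ⟨max n₁ (max n₀ n₂), fun n hn => ?_⟩
  simp only [max_lt_iff] at hn
  have hpos : (0 : ℝ) < n := by exact_mod_cast (Nat.zero_le _).trans_lt hn.1
  have h3 : ((q.eval n : ℕ) : ℝ) ≤ (n : ℝ) ^ k := by exact_mod_cast hk n hn.2.1
  calc |f n| ≤ (q.eval n : ℕ) * |g n| := h n hn.1
    _ ≤ (n : ℝ) ^ k * |g n| := mul_le_mul_of_nonneg_right h3 (abs_nonneg _)
    _ < (n : ℝ) ^ k * ((n : ℝ) ^ (c + k))⁻¹ := mul_lt_mul_of_pos_left (h₂ n hn.2.2) (pow_pos hpos k)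
    _ = ((n : ℝ) ^ c)⁻¹ := by
      rw [pow_add]
      field_simp

theorem Negligible.add {f g : ℕ → ℝ} (hf : Negligible f) (hg : Negligible g) :
    Negligible fun n => f n + g n := by
  intro c
  obtain ⟨n₁, h₁⟩ := hf (c + 1)
  obtain ⟨n₂, h₂⟩ := hg (c + 1)
  refine ⟨max 2 (max n₁ n₂), fun n hn => ?_⟩
  simp only [max_lt_iff] at hn
  have hpos : (2 : ℝ) < n := by exact_mod_cast hn.1
  calc |f n + g n| ≤ |f n| + |g n| := abs_add_le _ _
    _ ≤ ((n : ℝ) ^ (c + 1))⁻¹ + ((n : ℝ) ^ (c + 1))⁻¹ := add_le_add (h₁ n hn.2.1).le (h₂ n hn.2.2).le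
    _ = 2 / n * ((n : ℝ) ^ c)⁻¹ := by
      rw [pow_succ]
      field_simp
      norm_num
    _ < 1 * ((n : ℝ) ^ c)⁻¹ := by
      refine mul_lt_mul_of_pos_right ?_ (inv_pos.2 (pow_pos (by linarith) c))
      rw [div_lt_one (by linarith)]
      exact hpos
    _ = _ := one_mul _

/-- Negligible differences can be composed. -/
theorem Negligible.trans {f g h : ℕ → ℝ} (hf : Negligible fun n => |f n - g n|)
    (hg : Negligible fun n => |g n - h n|) : Negligible fun n => |f n - h n| := by
  refine (hf.add hg).of_le 1 0 fun n _ => ?_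
  rw [Polynomial.eval_one, Nat.cast_one, one_mul, abs_abs,
    abs_of_nonneg (add_nonneg (abs_nonneg (f n - g n)) (abs_nonneg (g n - h n)))]
  exact abs_sub_le _ _ _

theorem Negligible.symm {f g : ℕ → ℝ} (hf : Negligible fun n => |f n - g n|) :
    Negligible fun n => |g n - f n| := by
  simpa only [abs_sub_comm] using hf

/-! ## Hiding labels -/

section

variable {s μ N l r₂ r₃ : Polynomial ℕ} {G : Garbling s N l} {P : PKE G.labLen}
  {front : ∀ n, Instr (P.Keys s n) Unit (Choice s μ n) (BV (r₂.eval n))}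
  {delete : ∀ n, Instr Unit
    (BV (r₂.eval n) × BV (G.gcLen.eval n) × (Fin (s.eval n) → Bool → BV (P.ctLen.eval n)))
    (BV (G.certLen.eval n) × (Fin (s.eval n) → Bool → BV (P.certLen.eval n))) (BV (r₃.eval n))}
  {E : ∀ n, (Fin (s.eval n) → Bool → BV (P.skLen.eval n)) → Op (BV (r₃.eval n))}
  {T : ∀ n, Choice s μ n → (Fin (s.eval n) → Bool → BV (G.labLen.eval n)) →
      BV (G.vkLen.eval n) → Op (BV (G.gcLen.eval n))}

theorem partLabels_zero {s μ k : ℕ} (w : (Bool × BV s) × BV μ) (L : Fin s → Bool → BV k) :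
    partLabels 0 w L = L := by
  funext i α
  simp [partLabels, slotMux]

theorem partLabels_all {s μ k : ℕ} (w : (Bool × BV s) × BV μ) (L : Fin s → Bool → BV k) :
    partLabels (2 * s) w L = hide w L := by
  funext i α
  simp only [partLabels, slotMux]
  rw [if_pos]
  have := slotNum_lt i α
  exact decide_eq_true (by omega)

/-- An opened slot keeps its label in either hybrid. This is why the reduction may give up on opened
slots: the differences that it ignores are zero. -/
theorem partLabels_succ {s μ k : ℕ} {w : (Bool × BV s) × BV μ} {i : Fin s} {α : Bool}
    (h : opened w.1.1 w.1.2 i α = true) (L : Fin s → Bool → BV k) :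
    partLabels (slotNum i α + 1) w L = partLabels (slotNum i α) w L := by
  funext i' α'
  simp only [partLabels, slotMux]
  by_cases hh : i' = i ∧ α' = α
  · obtain ⟨rfl, rfl⟩ := hh
    simp [hide, slotMask, h]
  · have h1 : slotNum i' α' ≠ slotNum i α := fun h => hh (slotNum_injective h)
    have h2 : slotNum i' α' < slotNum i α + 1 ↔ slotNum i' α' < slotNum i α := by omega
    simp only [h2]

/-- Labels that cannot be decrypted need not be encrypted. -/
theorem PKE.hyb_negligible (hs : s ≠ 0) (hP : P.CertEverINDCPA) (hf : QPT front)
    (hd : QPT delete) (hE : ∀ n sk, IsEffect (E n sk))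
    (hT : QPTPrep (X := fun n => Choice s μ n × (Fin (s.eval n) → Bool → BV (G.labLen.eval n)))
      fun n p vk => T n p.1 p.2 vk)
    (hloc : ∀ n kk kk' w, (∀ i α, (kk i α).1 = (kk' i α).1) →
      (∀ i α, opened w.1.1 w.1.2 i α = true → kk i α = kk' i α) →
      front n kk w 1 = front n kk' w 1) :
    Negligible fun n => |hyb G P front delete E (fun _ _ => 1) T (fun _ _ L => L) n -
      hyb G P front delete E (fun _ _ => 1) T (fun _ w L => hide w L) n| := by
  obtain ⟨K, p, hK, hp, hp'⟩ := exists_guess s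
  -- The factor `4 * s` makes up for the guessing probability, which is at least `1/(4s)`. Positive
  -- `n` ensures that `s` has a positive value there.
  refine (pkeGame_negligible (T := T) hP hK hf hd hE hT).of_le (4 * s) 0 fun n hn => ?_
  have hpos := Polynomial.eval_pos_of_ne_zero hs hn
  let f : ℕ → ℝ := fun t => hyb G P front delete E (fun _ _ => 1) T
    (fun _ w L => partLabels t w L) n
  have h1 : ∀ b, P.game (pkeChoose G P K front T)
      (fun n => (pkeRun G P delete n).store fun p => selSum p.2.1.1.1.1.1 p.2.2.2) (pkeEff E) b n =
      _ := fun b => (pkeGame_eq hf hd b n).trans (sum_pkeTerm hd hloc b n)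
  have h2 : P.game (pkeChoose G P K front T)
      (fun n => (pkeRun G P delete n).store fun p => selSum p.2.1.1.1.1.1 p.2.2.2) (pkeEff E) false n -
      P.game (pkeChoose G P K front T)
      (fun n => (pkeRun G P delete n).store fun p => selSum p.2.1.1.1.1.1 p.2.2.2) (pkeEff E) true n =
      p n * (f 0 - f (2 * s.eval n)) := by
    rw [h1, h1]
    simp only [hp, ← Finset.mul_sum, ← mul_sub, ← Finset.sum_sub_distrib]
    congr 1
    -- All slots are guessed with the same probability, which has been factored out, so the
    -- remaining sum telescopes: first over the two values of `α`, then over `i`.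
    trans ∑ i : Fin (s.eval n), ∑ α, (f (slotNum i α) - f (slotNum i α + 1))
    · refine Finset.sum_congr rfl fun i _ => Finset.sum_congr rfl fun α _ => ?_
      simp only [f, hyb_eq_hterm, ← Finset.sum_sub_distrib, ← mul_sub]
      refine Finset.sum_congr rfl fun q _ => ?_
      -- For an opened slot the reduction contributes nothing, and the hybrids agree.
      by_cases ho : opened q.1.1.1 q.1.1.2 i α = true
      · rw [if_pos ho, mul_zero, zero_mul, eq_comm, mul_eq_zero]
        right
        refine Finset.sum_eq_zero fun kk _ => Finset.sum_eq_zero fun vP _ => ?_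
        simp only [hterm, partLabels_succ ho, sub_self]
      · rw [if_neg ho]
        simp only [Bool.toNat_false, Bool.toNat_true, add_zero]
    · have h3 : ∀ i : Fin (s.eval n), (∑ α, (f (slotNum i α) - f (slotNum i α + 1))) =
          f (2 * i) - f (2 * (i + 1)) := by
        intro i
        simp only [slotNum, Fintype.sum_bool, Bool.toNat_true, Bool.toNat_false, add_zero]
        rw [mul_add, mul_one]
        ring
      simp only [h3]
      rw [Fin.sum_univ_eq_sum_range fun i => f (2 * i) - f (2 * (i + 1)),
        Finset.sum_range_sub' fun i => f (2 * i)]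
  have e0 : f 0 = hyb G P front delete E (fun _ _ => 1) T (fun _ _ L => L) n := by
    simp only [f, hyb, partLabels_zero]
  have e1 : f (2 * s.eval n) = hyb G P front delete E (fun _ _ => 1) T (fun _ w L => hide w L) n := by
    simp only [f, hyb, partLabels_all]
  rw [← e0, ← e1, h2, abs_abs, abs_abs, abs_mul, ← mul_assoc]
  refine le_mul_of_one_le_left (abs_nonneg _) ?_
  have h4 := hp' n hpos
  have h5 : (0 : ℝ) < s.eval n := by exact_mod_cast hpos
  rw [div_le_iff₀ (by positivity)] at h4
  rw [abs_of_nonneg (by nlinarith), Polynomial.eval_mul, Polynomial.eval_ofNat]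
  push_cast
  linarith

end

theorem Easy.constBV {S : ℕ → Type} [∀ n, BitRep (S n)] [PTLen S] [∀ n, Fintype (S n)]
    (p : Polynomial ℕ) (b : Bool) : Easy fun n (_ : S n) => (fun _ => b : BV (p.eval n)) := by
  have h : Quad fun n (_ : S n) => (fun _ => b : BV (p.eval n)) := by
    refine (BQ.cond (c := fun n i => i < p.eval n ∧ b = true)
      (.and (by fun_prop) (.const _))).congr fun n i _ => ?_
    rw [pad_bv, getBit]
    split_ifs with h <;> simp [h]
  exact h.easy

/-! ## Replacing the garbled circuit -/

section

variable {s μ N l r₂ r₃ : Polynomial ℕ} {G : Garbling s N l} {P : PKE G.labLen}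
  {front : ∀ n, Instr (P.Keys s n) Unit (Choice s μ n) (BV (r₂.eval n))}
  {delete : ∀ n, Instr Unit
    (BV (r₂.eval n) × BV (G.gcLen.eval n) × (Fin (s.eval n) → Bool → BV (P.ctLen.eval n)))
    (BV (G.certLen.eval n) × (Fin (s.eval n) → Bool → BV (P.certLen.eval n))) (BV (r₃.eval n))}
  {E : ∀ n, (Fin (s.eval n) → Bool → BV (P.skLen.eval n)) → Op (BV (r₃.eval n))}

theorem hyb_congr {c : ∀ n, Choice s μ n → ℝ}
    {T T' : ∀ n, Choice s μ n → (Fin (s.eval n) → Bool → BV (G.labLen.eval n)) →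
      BV (G.vkLen.eval n) → Op (BV (G.gcLen.eval n))}
    {Λ : ∀ n, Choice s μ n → (Fin (s.eval n) → Bool → BV (G.labLen.eval n)) →
      Fin (s.eval n) → Bool → BV (G.labLen.eval n)} {n : ℕ}
    (h : ∀ w L vk, c n w ≠ 0 → T n w L vk = T' n w L vk) :
    hyb G P front delete E c T Λ n = hyb G P front delete E c T' Λ n := by
  refine Finset.sum_congr rfl fun y _ => Finset.sum_congr rfl fun L _ => Finset.sum_congr rfl
    fun vk _ => ?_
  by_cases hc : c n y.1.1.2 = 0
  · rw [hc]
    ring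
  · rw [h _ _ _ hc]

theorem hyb_split (c c' : ∀ n, Choice s μ n → ℝ) {c₁ : ∀ n, Choice s μ n → ℝ}
    (T : ∀ n, Choice s μ n → (Fin (s.eval n) → Bool → BV (G.labLen.eval n)) →
      BV (G.vkLen.eval n) → Op (BV (G.gcLen.eval n)))
    (Λ : ∀ n, Choice s μ n → (Fin (s.eval n) → Bool → BV (G.labLen.eval n)) →
      Fin (s.eval n) → Bool → BV (G.labLen.eval n)) (n : ℕ) (h : ∀ w, c₁ n w = c n w + c' n w) :
    hyb G P front delete E c₁ T Λ n =
      hyb G P front delete E c T Λ n + hyb G P front delete E c' T Λ n := by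
  simp only [hyb, ← Finset.sum_add_distrib]
  refine Finset.sum_congr rfl fun y _ => Finset.sum_congr rfl fun L _ => Finset.sum_congr rfl
    fun vk _ => ?_
  rw [h]
  ring

/-- The garbled circuits of the simulator: simulated if a key has been requested, and otherwise for
a fixed plaintext. -/
def simGarble (U : ∀ n, BCircuit (Fin (s.eval n) ⊕ Fin (μ.eval n)) (N.eval n) (l.eval n))
    (S : G.Simulator) (n : ℕ) (w : Choice s μ n)
    (L : Fin (s.eval n) → Bool → BV (G.labLen.eval n)) (vk : BV (G.vkLen.eval n)) :
    Op (BV (G.gcLen.eval n)) :=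
  if w.1.1 then S n ((U n).eval (Sum.elim w.1.2 w.2), sel L w.1.2) vk
  else G.garble n ((U n).hardwire fun _ => false, L) vk

/-- If a key was requested, one application of garbling security with input `f` suffices. If not,
every slot is hidden and the input is free: the chain is real `U(·,m)`, simulated at the all-one
input, real following circuit, simulated at the all-zero input, real `U(·,0)`. -/
theorem hyb_simGarble_negligible (hs : s ≠ 0)
    {U : ∀ n, BCircuit (Fin (s.eval n) ⊕ Fin (μ.eval n)) (N.eval n) (l.eval n)}
    (hU : UniformSeq U) {S : G.Simulator}
    (hS : ∀ (A : G.Adversary) (E : ∀ n, Op (BV (A.r₂.eval n))), (∀ n, IsEffect (E n)) →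
      Negligible fun n => |G.expReal A E n - G.expSim S A E n|)
    (hf : QPT front) (hd : QPT delete) (hE : ∀ n sk, IsEffect (E n sk)) :
    Negligible fun n =>
      |hyb G P front delete E (fun _ _ => 1) (fun n w L vk => G.garble n ((U n).hardwire w.2, L) vk)
        (fun _ w L => hide w L) n -
      hyb G P front delete E (fun _ _ => 1) (simGarble U S) (fun _ w L => hide w L) n| := by
  -- The weights `cq` separate the runs with and without a key request, so that the two cases can be
  -- treated by different games.
  let cq : Bool → ∀ n, Choice s μ n → ℝ := fun b n w => if w.1.1 = b then 1 else 0
  -- The queried function if there is one, as required by the labels to be encrypted; otherwise a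
  -- constant string that is free to choose.
  let x : Bool → ∀ n, Choice s μ n → BV (s.eval n) := fun b n w =>
    if w.1.1 then w.1.2 else fun _ => b
  have hc : ∀ b n w, 0 ≤ cq b n w ∧ cq b n w ≤ 1 := by
    intro b n w
    simp only [cq]
    split_ifs <;> simp
  have hx : ∀ b, Easy (x b) := fun b => by
    have h := Easy.mux (R := Choice s μ) (X := fun n => BV (s.eval n)) Easy.id.fst.fst
      Easy.id.fst.snd (Easy.constBV s b)
    exact h
  have hx' : ∀ b n w i α, opened w.1.1 w.1.2 i α = true → α = x b n w i := by
    intro b n w i α h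
    simp only [opened, Bool.and_eq_true, beq_iff_eq] at h
    simp only [x, h.1, if_true, h.2]
  have hCm : Easy (S := Choice s μ) fun n w => (U n).hardwire w.2 :=
    (Quad.hardwire hU).easy.comp Easy.id.snd
  have hCf : Easy (S := Choice s μ) fun n w => (U n).plug (BCircuit.follow (s := s.eval n) w.2) :=
    (Quad.plug_follow hU).easy.comp Easy.id.snd
  have hC0 : Easy (S := Choice s μ) fun n _ => (U n).hardwire fun _ => false :=
    (Quad.hardwire hU).easy.comp (Easy.constBV μ false)
  have d1 := Garbling.hyb_negligible (P := P) (front := front) (delete := delete) hS hf hd hE hCm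
    (hx true) (hx' true) (c := fun _ _ => 1) fun _ _ => ⟨zero_le_one, le_rfl⟩
  -- The middle steps need only the runs without a key, hence the weight `cq false`.
  have d2 := (Garbling.hyb_negligible (P := P) (front := front) (delete := delete) hS hf hd hE hCf
    (hx true) (hx' true) (hc false)).symm
  have d3 := Garbling.hyb_negligible (P := P) (front := front) (delete := delete) hS hf hd hE hCf
    (hx false) (hx' false) (hc false)
  have d4 := (Garbling.hyb_negligible (P := P) (front := front) (delete := delete) hS hf hd hE hC0
    (hx false) (hx' false) (hc false)).symm
  refine (((d1.add d2).add d3).add d4).of_le 1 0 fun n hn => ?_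
  have hsn := Polynomial.eval_pos_of_ne_zero hs hn
  rw [Polynomial.eval_one, Nat.cast_one, one_mul, abs_abs]
  refine le_trans ?_ (le_abs_self _)
  have hsplit : ∀ w : Choice s μ n, (1 : ℝ) = cq true n w + cq false n w := by
    intro w
    cases h : w.1.1 <;> simp [cq, h]
  have hq : ∀ {b n} {w : Choice s μ n}, cq b n w ≠ 0 → w.1.1 = b := by
    intro b n w h
    by_contra hh
    exact h (if_neg hh)
  have e1 : hyb G P front delete E (cq true) (fun n w L vk => S n (((U n).hardwire w.2).eval
      (x true n w), sel L (x true n w)) vk) (fun _ w L => hide w L) n =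
      hyb G P front delete E (cq true) (simGarble U S) (fun _ w L => hide w L) n := by
    refine hyb_congr fun w L vk h => ?_
    simp only [simGarble, x, hq h, if_true, BCircuit.eval_hardwire]
  -- The garbling simulator sees the circuit only through its value at the chosen input, so circuits
  -- that agree there have identical simulations. The next identity uses this at the all-zero input.
  have e2 : hyb G P front delete E (cq false) (fun n w L vk => S n (((U n).hardwire w.2).eval
      (x true n w), sel L (x true n w)) vk) (fun _ w L => hide w L) n =
      hyb G P front delete E (cq false) (fun n w L vk => S n (((U n).plug
      (BCircuit.follow w.2)).eval (x true n w), sel L (x true n w)) vk) (fun _ w L => hide w L) n := by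
    refine hyb_congr fun w L vk h => ?_
    simp only [x, hq h, Bool.false_eq_true, if_false, BCircuit.eval_plug_follow_one hsn]
  have e3 : hyb G P front delete E (cq false) (fun n w L vk => S n (((U n).plug
      (BCircuit.follow w.2)).eval (x false n w), sel L (x false n w)) vk) (fun _ w L => hide w L) n =
      hyb G P front delete E (cq false) (fun n w L vk => S n (((U n).hardwire fun _ => false).eval
      (x false n w), sel L (x false n w)) vk) (fun _ w L => hide w L) n := by
    refine hyb_congr fun w L vk h => ?_
    simp only [x, hq h, Bool.false_eq_true, if_false, BCircuit.eval_plug_follow_zero]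
  have e4 : hyb G P front delete E (cq false) (simGarble U S) (fun _ w L => hide w L) n =
      hyb G P front delete E (cq false) (fun n _ L vk => G.garble n ((U n).hardwire fun _ => false, L)
        vk) (fun _ w L => hide w L) n := by
    refine hyb_congr fun w L vk h => ?_
    simp only [simGarble, hq h, Bool.false_eq_true, if_false]
  have f1 := hyb_split (P := P) (front := front) (delete := delete) (E := E) (cq true) (cq false)
    (c₁ := fun _ _ => 1) (fun n w L vk => S n (((U n).hardwire w.2).eval
      (x true n w), sel L (x true n w)) vk) (fun _ w L => hide w L) n hsplit
  have f2 := hyb_split (P := P) (front := front) (delete := delete) (E := E) (cq true) (cq false)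
    (c₁ := fun _ _ => 1) (simGarble U S) (fun _ w L => hide w L) n hsplit
  rw [e1, e2] at f1
  rw [e4] at f2
  rw [f1, f2, ← e3]
  have key : ∀ a b c d : ℝ, |a + b + c + d| ≤ |a| + |b| + |c| + |d| := fun a b c d =>
    (abs_add_le _ _).trans (add_le_add_left ((abs_add_le _ _).trans
      (add_le_add_left (abs_add_le _ _) _)) _)
  refine le_trans (le_of_eq ?_) (key _ _ _ _)
  congr 1
  ring

end

/-! ## The functional encryption scheme -/

section

theorem sum_reorder₃ {ι X Y F M VG VP C L : Type} [Fintype ι] [DecidableEq ι] [Fintype X] [Fintype Y]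
    [Fintype F] [Fintype M] [Fintype VG] [Fintype VP] [Fintype C] [Fintype L]
    (R : (ι → Bool → X × Y) → (Bool × F) × M → VG → VP → C → L → ℝ) :
    ∑ a : ι → Bool → X, ∑ b : ι → Bool → Y, ∑ q, ∑ f, ∑ m, ∑ vk : VG × VP, ∑ c, ∑ ℓ,
      R (fun i α => (a i α, b i α)) ((q, f), m) vk.1 vk.2 c ℓ =
    ∑ y : (((ι → Bool → X × Y) × ((Bool × F) × M)) × VP) × C, ∑ ℓ, ∑ v,
      R y.1.1.1 y.1.1.2 v y.1.2 y.2 ℓ := by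
  simp only [← Fintype.sum_prod_type']
  exact Fintype.sum_equiv ⟨fun p => ((((fun i α => (p.1 i α, p.2.1 i α),
      ((p.2.2.1, p.2.2.2.1), p.2.2.2.2.1)), p.2.2.2.2.2.1.2), p.2.2.2.2.2.2.1), p.2.2.2.2.2.2.2,
      p.2.2.2.2.2.1.1),
    fun p => (fun i α => (p.1.1.1.1 i α).1, fun i α => (p.1.1.1.1 i α).2, p.1.1.1.2.1.1,
      p.1.1.1.2.1.2, p.1.1.1.2.2, (p.2.2, p.1.1.2), p.1.2, p.2.1), fun _ => rfl, fun _ => rfl⟩ _ _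
      fun _ => rfl

variable {s μ N l : Polynomial ℕ} {G : Garbling s N l} {P : PKE G.labLen}
  {U : ∀ n, BCircuit (Fin (s.eval n) ⊕ Fin (μ.eval n)) (N.eval n) (l.eval n)}

/-- The first stages of an adversary, given all keys. -/
def adversaryFront (A : (cefe G P U).Adversary) (n : ℕ) :
    Instr (P.Keys s n) Unit (Choice s μ n) (BV (A.r₂.eval n)) := fun kk w ρ =>
  A.choose n (optIf w.1.1 (w.1.2, sel (fun i α => (kk i α).2) w.1.2)) w.2
    (A.query n (fun i α => (kk i α).1) w.1 ρ)

theorem adversaryFront_qpt (A : (cefe G P U).Adversary) : QPT (adversaryFront A) := by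
  have h1 := A.query_qpt.precomp (Z := P.Keys s) (g := fun n kk i α => (kk i α).1)
    (Easy.fsts Easy.id)
  have hg : Easy (S := fun n => P.Keys s n × (Bool × BV (s.eval n))) fun n p =>
      optIf p.2.1 (p.2.2, sel (fun i α => (p.1 i α).2) p.2.2) := by
    have h := Easy.optIf (R := fun n => P.Keys s n × (Bool × BV (s.eval n))) Easy.id.snd.fst
      (Easy.id.snd.snd.pair (Easy.sel (Easy.snds Easy.id.fst) Easy.id.snd.snd))
    exact h
  have h2 := h1.andThen A.choose_qpt hg
  exact h2

/-- The key for `f` consists of `f` and the secret keys of the opened slots; nothing else about the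
secret keys reaches the adversary before deletion. This is the locality hypothesis `hloc` of the
encryption reduction. -/
theorem adversaryFront_congr (A : (cefe G P U).Adversary) (n : ℕ) (kk kk' : P.Keys s n)
    (w : Choice s μ n) (h₁ : ∀ i α, (kk i α).1 = (kk' i α).1)
    (h₂ : ∀ i α, opened w.1.1 w.1.2 i α = true → kk i α = kk' i α) :
    adversaryFront A n kk w 1 = adversaryFront A n kk' w 1 := by
  have e₁ : (fun i α => (kk i α).1) = fun i α => (kk' i α).1 := by
    funext i α
    exact h₁ i α
  have e₂ : optIf w.1.1 (w.1.2, sel (fun i α => (kk i α).2) w.1.2) =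
      optIf w.1.1 (w.1.2, sel (fun i α => (kk' i α).2) w.1.2) := by
    cases hq : w.1.1
    · rfl
    · congr 2
      funext i
      simp only [sel]
      rw [h₂ i (w.1.2 i) (by simp [opened, hq])]
  rw [adversaryFront, adversaryFront, e₁, e₂]

/-- Key generation is deterministic, so both with and without a query there is exactly one possible
answer. -/
theorem cefe_answer (n : ℕ) (msk : Fin (s.eval n) → Bool → BV (P.skLen.eval n)) (q : Bool)
    (f : BV (s.eval n)) (a : Option (BV (s.eval n) × (Fin (s.eval n) → BV (P.skLen.eval n)))) :
    (cefe G P U).answer n msk q f a = if a = optIf q (f, sel msk f) then 1 else 0 := by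
  rcases q with _ | _ <;> rcases a with _ | a
  · simp [FE.answer, optIf]
  · simp [FE.answer, optIf]
  · simp [FE.answer, optIf]
  · simp only [FE.answer, optIf, cefe, if_true, Option.some.injEq]
    rfl

/-- An encryption procedure that samples labels, prepares a garbled circuit and encrypts labels
slotwise may be expanded inside the experiment. The hypothesis is asked only for the answers that
can occur, so the real scheme and the simulator are both covered. -/
theorem cefe_exp_eq_hyb (A : (cefe G P U).Adversary)
    (E : ∀ n, (Fin (s.eval n) → Bool → BV (P.skLen.eval n)) → Op (BV (A.r₃.eval n)))
    (enc' : ∀ n, (Fin (s.eval n) → Bool → BV (P.pkLen.eval n)) → BV (s.eval n) →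
      Option (BV (s.eval n) × (Fin (s.eval n) → BV (P.skLen.eval n))) → BV (μ.eval n) →
      BV (G.vkLen.eval n) × (Fin (s.eval n) → Bool → BV (P.vkLen.eval n)) →
      Op (BV (G.gcLen.eval n) × (Fin (s.eval n) → Bool → BV (P.ctLen.eval n))))
    (T : ∀ n, Choice s μ n → (Fin (s.eval n) → Bool → BV (G.labLen.eval n)) →
      BV (G.vkLen.eval n) → Op (BV (G.gcLen.eval n)))
    (Λ : ∀ n, Choice s μ n → (Fin (s.eval n) → Bool → BV (G.labLen.eval n)) →
      Fin (s.eval n) → Bool → BV (G.labLen.eval n))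
    (h : ∀ n mpk (msk : Fin (s.eval n) → Bool → BV (P.skLen.eval n)) q f m vk,
      enc' n mpk f (optIf q (f, sel msk f)) m vk = ∑ L, (G.setup n () L : ℂ) •
        (T n ((q, f), m) L vk.1 ⊗ₖ tensorFam fun i α =>
          P.enc n (mpk i α, Λ n ((q, f), m) L i α) (vk.2 i α))) (n : ℕ) :
    (cefe G P U).exp A E enc' n =
      hyb G P (adversaryFront A) A.delete E (fun _ _ => 1) T Λ n := by
  rw [hyb, ← sum_reorder₃ fun kk w v vP c L => (G.setup n () L * G.vrfy n (v, c.1) true) *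
      (P.keys s n kk * 1 * vrfys G P n vP c.2 *
        final G P (adversaryFront A) A.delete E n kk w c (T n w L v)
          (encs G P n kk (Λ n w L) vP)), FE.exp]
  refine Finset.sum_congr rfl fun mpk _ => Finset.sum_congr rfl fun msk _ =>
    Finset.sum_congr rfl fun q _ => Finset.sum_congr rfl fun f _ => ?_
  rw [Finset.sum_eq_single (optIf q (f, sel msk f)) (fun a _ ha => by
    simp only [cefe_answer, if_neg ha, mul_zero, zero_mul, Finset.sum_const_zero]) (by simp)]
  refine Finset.sum_congr rfl fun m _ => Finset.sum_congr rfl fun vk _ =>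
    Finset.sum_congr rfl fun cert _ => ?_
  have e : A.choose n (optIf q (f, sel msk f)) m (A.query n mpk (q, f) 1) ⊗ₖ
      enc' n mpk f (optIf q (f, sel msk f)) m vk = ∑ L, (G.setup n () L : ℂ) •
      (A.choose n (optIf q (f, sel msk f)) m (A.query n mpk (q, f) 1) ⊗ₖ
        (T n ((q, f), m) L vk.1 ⊗ₖ tensorFam fun i α =>
          P.enc n (mpk i α, Λ n ((q, f), m) L i α) (vk.2 i α))) := by
    rw [h]
    ext a b
    simp only [Matrix.kroneckerMap_apply, Matrix.sum_apply, Matrix.smul_apply, smul_eq_mul,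
      Finset.mul_sum]
    exact Finset.sum_congr rfl fun L _ => by ring
  -- The ciphertext is a mixture over the labels; linearity of the deletion stage moves the sum over
  -- labels outside.
  rw [e, A.delete_qpt.map_sum, Finset.mul_sum, Matrix.trace_sum, Complex.re_sum, Finset.mul_sum]
  refine Finset.sum_congr rfl fun L _ => ?_
  rw [cefe_answer, if_pos rfl, Matrix.mul_smul, Matrix.trace_smul, smul_eq_mul,
    Complex.re_ofReal_mul]
  simp only [cefe, if_true, final, adversaryFront, PKE.keys, vrfys, encs]
  ring

theorem cefe_expReal_eq_hyb (A : (cefe G P U).Adversary)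
    (E : ∀ n, (Fin (s.eval n) → Bool → BV (P.skLen.eval n)) → Op (BV (A.r₃.eval n))) (n : ℕ) :
    (cefe G P U).expReal A E n = hyb G P (adversaryFront A) A.delete E (fun _ _ => 1)
      (fun n w L vk => G.garble n ((U n).hardwire w.2, L) vk) (fun _ _ L => L) n :=
  cefe_exp_eq_hyb A E _ _ _ (fun _ _ _ _ _ _ _ => rfl) n

/-! ## The simulator -/

/-- What the simulator is given about the function and its value, with default values. -/
def simView (n : ℕ) (V : Option (BV (l.eval n) × BV (s.eval n) ×
    (BV (s.eval n) × (Fin (s.eval n) → BV (P.skLen.eval n))))) : BV (l.eval n) × BV (s.eval n) ×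
    (BV (s.eval n) × (Fin (s.eval n) → BV (P.skLen.eval n))) :=
  V.getD (fun _ => false, fun _ => false, fun _ => false, fun _ _ => false)

/-- The simulator. -/
def cefeSim (U : ∀ n, BCircuit (Fin (s.eval n) ⊕ Fin (μ.eval n)) (N.eval n) (l.eval n))
    (P : PKE G.labLen) (S : G.Simulator) : (cefe G P U).Simulator := fun n x vk =>
  ∑ L, (G.setup n () L : ℂ) •
    ((if x.2.isSome then S n ((simView n x.2).1, sel L (simView n x.2).2.1) vk.1
      else G.garble n ((U n).hardwire fun _ => false, L) vk.1) ⊗ₖ tensorFam fun i α =>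
        P.enc n (x.1 i α, slotMask (opened x.2.isSome (simView n x.2).2.1) L i α) (vk.2 i α))

theorem cefe_expSim_eq_hyb (S : G.Simulator) (A : (cefe G P U).Adversary)
    (E : ∀ n, (Fin (s.eval n) → Bool → BV (P.skLen.eval n)) → Op (BV (A.r₃.eval n))) (n : ℕ) :
    (cefe G P U).expSim (cefeSim U P S) A E n = hyb G P (adversaryFront A) A.delete E (fun _ _ => 1)
      (simGarble U S) (fun _ w L => hide w L) n := by
  refine cefe_exp_eq_hyb A E _ _ _ (fun n mpk msk q f m vk => ?_) n
  cases q
  -- Without a key no slot is opened, whatever function serves as the default.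
  · have ho : ∀ g : BV (s.eval n), opened false g = opened false f := fun g => by
      funext i α
      simp [opened]
    simp only [cefeSim, optIf, simGarble, hide, Bool.false_eq_true, if_false, Option.map_none,
      Option.isSome_none, ho (simView n _).2.1]
  · simp only [cefeSim, optIf, simGarble, hide, if_true, Option.map_some, Option.isSome_some,
      simView, Option.getD_some]
    rfl

/-- The default consists of zero strings, so its encoding is the one that an absent value leaves
behind its presence bit. -/
theorem wire_simView : Wire fun n V => simView (P := P) (s := s) (l := l) n V := by
  have hb : ∀ k i, pad (fun _ => false : BV k) i = false := fun k i => by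
    rw [pad_bv, getBit]
    split_ifs <;> rfl
  refine Wire.getD fun n i => ?_
  rw [pad_prod, pad_prod, pad_prod, hb, hb, hb, pad_pi]
  split_ifs <;> simp [hb]

/-- The labels are sampled as a classical output, so that the garbled circuit and the encryptions
can both depend on them, and are summed out at the end. Whether a key was requested decides between
two efficient preparations. -/
theorem cefeSim_qpt (hU : UniformSeq U) {S : G.Simulator} (hS : QPTPrep S) :
    QPTPrep (cefeSim U P S) := by
  classical
  let X : ℕ → Type := fun n => (Fin (s.eval n) → Bool → BV (P.pkLen.eval n)) ×
    Option (BV (l.eval n) × BV (s.eval n) × (BV (s.eval n) × (Fin (s.eval n) → BV (P.skLen.eval n))))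
  let XL : ℕ → Type := fun n => X n × (Fin (s.eval n) → Bool → BV (G.labLen.eval n))
  have hv : Easy (S := XL) fun n p => simView n p.1.2 := wire_simView.easy.comp Easy.id.fst.snd
  have hsome : Easy (S := XL) fun n p => p.1.2.isSome := Wire.isSome.easy.comp Easy.id.fst.snd
  have hC0 : Easy (S := XL) fun n p => ((U n).hardwire fun _ => false, p.2) :=
    ((Quad.hardwire hU).easy.comp (Easy.constBV μ false)).pair Easy.id.snd
  have hL : Easy (S := XL) fun n p => ((simView n p.1.2).1, sel p.2 (simView n p.1.2).2.1) :=
    hv.fst.pair (Easy.sel Easy.id.snd hv.snd.fst)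
  have hg : Easy (S := XL) fun n p i α => (p.1.1 i α, slotMask (opened p.1.2.isSome
      (simView n p.1.2).2.1) p.2 i α) :=
    Easy.zip Easy.id.fst.fst (Easy.slotMask (Easy.opened hsome hv.snd.fst) Easy.id.snd)
  have h1 := QPTPrep.cond (G.garble_qpt.precomp hC0) (hS.precomp hL) hsome
  have h2 := h1.andPrep (P.enc_qpt.tensorFam s) (g := fun n p i α => (p.1.1.1 i α,
    slotMask (opened p.1.1.2.isSome (simView n p.1.1.2).2.1) p.1.2 i α)) (by
      have h := hg.comp (R := fun n => XL n × BV (G.vkLen.eval n)) Easy.id.fst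
      exact h)
  have h0 : QPTKernel fun n (_ : X n) => G.setup n () := QPT.precomp G.setup_qpt Wire.unit.easy
  have h3 := h0.andPrep h2 (g := fun n p => p) Easy.id
  have h4 := h3.marginal (g := fun n p => p.2.2) Easy.id.snd.snd
  refine h4.congr fun n x vk => ?_
  rw [cefeSim, Fintype.sum_prod_type]
  refine Finset.sum_congr rfl fun L _ => ?_
  simp only [Finset.sum_ite_eq', Finset.mem_univ, if_true]

end

end CertFE

end

/-! ### The security theorem -/

theorem mainTheorem7 {s μ N l : Polynomial ℕ} (hs : s ≠ 0)
    (U : ∀ n, CertFE.BCircuit (Fin (s.eval n) ⊕ Fin (μ.eval n)) (N.eval n) (l.eval n))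
    (hU : CertFE.UniformSeq U)
    (G : CertFE.Garbling s N l) (P : CertFE.PKE G.labLen)
    (hG : G.SelCertEver) (hP : P.CertEverINDCPA) :
    (CertFE.cefe G P U).NonAdaptiveCertEverSim := by
  obtain ⟨S, hS, hG⟩ := hG
  refine ⟨CertFE.cefeSim U P S, CertFE.cefeSim_qpt hU hS, fun A E hE => ?_⟩
  have hT : CertFE.QPTPrep (X := fun n => CertFE.Choice s μ n ×
      (Fin (s.eval n) → Bool → CertFE.BV (G.labLen.eval n))) fun n p vk =>
      G.garble n ((U n).hardwire p.1.2, p.2) vk :=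
    G.garble_qpt.precomp (((CertFE.Quad.hardwire hU).easy.comp CertFE.Easy.id.fst.snd).pair
      CertFE.Easy.id.snd)
  -- The labels are hidden while the circuit is still garbled honestly; only afterwards does the
  -- garbling game apply, since it reveals just one label per input bit.
  have h1 := CertFE.PKE.hyb_negligible (T := fun n w L vk => G.garble n ((U n).hardwire w.2, L) vk)
    hs hP (CertFE.adversaryFront_qpt A) A.delete_qpt hE hT (CertFE.adversaryFront_congr A)
  have h2 := CertFE.hyb_simGarble_negligible (P := P) hs hU hG (CertFE.adversaryFront_qpt A)
    A.delete_qpt hE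
  simp only [CertFE.cefe_expReal_eq_hyb, CertFE.cefe_expSim_eq_hyb]
  exact h1.trans h2
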